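/- **Theorem 4.2 (A priori estimate).** *Setting.* Let $d\in\{2,3\}$ and let $\mathcal T_h$ be a matching simplicial mesh of a polytopal domain $\Omega\subset\mathbb R^d$ whose boundary is partitioned into $\Gamma_{\rm D},\Gamma_{\rm N},\Gamma_{\rm R}$, each covered by mesh faces. Let $\mu>0$ and $\boldsymbol A$ (real, symmetric positive definite) be constant on each $K\in\mathcal T_h$, let $\gamma>0$ be constant on each $F\in\mathcal F_h^{\rm R}$, the set of faces in $\overline{\Gamma_{\rm R}}$, and let $\omega>0$. All functions are complex valued, and $(\cdot,\cdot)$, $\|\cdot\|$ denote $L^2$ inner products (linear in the first argument) and norms, a subscript $\mu,\boldsymbol A,\gamma,\boldsymbol A^{-1}$ indicating a weight. Let $h_K,h_F$ be diameters, $\alpha_K$ the smallest eigenvalue of $\boldsymbol A|_K$, $\alpha_F:=\alpha_K$ for $F\in\mathcal F_h^{\rm R}$ a face of $K$, $\vartheta_K:=\sqrt{\alpha_K/\mu_K}$ and $\vartheta_F:=\alpha_F/\gamma_F$. Let $H^1_{\Gamma_{\rm D}}(\Omega)$ be the functions in $H^1(\Omega)$ with zero trace on $\Gamma_{\rm D}$,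 $H^1(\mathcal T_h)$ the broken Sobolev space, and $\boldsymbol X_{\Gamma_{\rm N}}$ the fields $\boldsymbol w\in\boldsymbol H({\rm div},\Omega)$ with $\boldsymbol w\cdot\boldsymbol n=0$ on $\Gamma_{\rm N}$ and $\boldsymbol w\cdot\boldsymbol n|_{\Gamma_{\rm R}}\in L^2(\Gamma_{\rm R})$. On $H^1_{\Gamma_{\rm D}}(\Omega)$ let $$b(\phi,v):=-\omega^2(\mu\phi,v)_\Omega-i\omega(\gamma\phi,v)_{\Gamma_{\rm R}}+(\boldsymbol A\nabla\phi,\nabla v)_\Omega,\qquad |||v|||_{\omega,\Omega}^2:=\omega^2\|v\|_{\mu,\Omega}^2+\omega\|v\|^2_{\gamma,\Gamma_{\rm R}}+\|\nabla v\|^2_{\boldsymbol A,\Omega},$$ and assume well-posedness: for some $\gamma_{\rm st}>0$, every $\phi\in H^1_{\Gamma_{\rm D}}(\Omega)$ with $|||\phi|||_{\omega,\Omega}=1$ admits $v\in H^1_{\Gamma_{\rm D}}(\Omega)$ with $|||v|||_{\omega,\Omega}=1$ and $\operatorname{Re}b(\phi,v)\ge 1/\gamma_{\rm st}$. Fix $f\in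 L^2(\Omega)$ and let $u\in H^1_{\Gamma_{\rm D}}(\Omega)$ solve $b(u,v)=(f,v)_\Omega$ for all $v\in H^1_{\Gamma_{\rm D}}(\Omega)$. *Discretization.* Let $p\ge1$, and let $\mathcal P_p(\mathcal T_h)$ be the piecewise polynomials of total degree at most $p$. Each face $F$ carries a fixed unit normal $\boldsymbol n_F$, outward if $F\subset\partial\Omega$. The jump is $[\![\phi]\!]_F:=\phi_+\,\boldsymbol n_+\cdot\boldsymbol n_F+\phi_-\,\boldsymbol n_-\cdot\boldsymbol n_F$ on interior faces, $\phi$ on faces in $\overline{\Gamma_{\rm D}}$, and $0$ on the other boundary faces. The average $\{\!\{\boldsymbol w\}\!\}_F$ is the mean of the two sides on interior faces and $\boldsymbol w|_F$ on boundary faces. For $\phi\in H^1(\mathcal T_h)$, the lifting $\mathfrak L(\phi)\in\mathcal P_p(\mathcal T_h)^d$ is defined by $(\mathfrak L(\phi),\boldsymbol w_h)_\Omega=\sum_F([\![\phi]\!]_F,\{\!\{\boldsymbol w_h\}\!\}_F\cdot\boldsymbol n_F)_F$ for all $\boldsymbol w_h\in\mathcal P_p(\mathcal T_h)^d$, and $\mathfrak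 G(\phi):=\nabla\phi-\mathfrak L(\phi)$, with $\nabla$ the element-wise gradient. Let $s_h$ be a sesquilinear form on $H^1(\mathcal T_h)$ with $s_h(\phi,v)=0$ whenever $\phi$ or $v$ lies in $H^1_{\Gamma_{\rm D}}(\Omega)$, and set $$b_h(\phi,v):=-\omega^2(\mu\phi,v)_\Omega-i\omega(\gamma\phi,v)_{\Gamma_{\rm R}}+(\boldsymbol A\mathfrak G(\phi),\mathfrak G(v))_\Omega+s_h(\phi,v).$$ The IPDG problem is to find $u_h\in\mathcal P_p(\mathcal T_h)$ with $b_h(u_h,v_h)=(f,v_h)_\Omega$ for all $v_h\in\mathcal P_p(\mathcal T_h)$. Define $$|||v|||^2_{\omega,\mathcal T_h}:=\omega^2\|v\|_{\mu,\Omega}^2+\omega\|v\|^2_{\gamma,\Gamma_{\rm R}}+\|\mathfrak G(v)\|^2_{\boldsymbol A,\Omega},$$ $$\|v\|^2_{\dagger,1}:=\sum_{K\in\mathcal T_h}\Big\{\max\Big(1,\tfrac{\omega^2h_K^2}{\vartheta_K^2}\Big)\tfrac{\alpha_K}{h_K^2}\|v\|_K^2+\|\mathfrak G(v)\|^2_{\boldsymbol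 A,K}\Big\}+\sum_{F\in\mathcal F_h^{\rm R}}\max\Big(1,\tfrac{\omega h_F}{\vartheta_F}\Big)\tfrac{\alpha_F}{h_F}\|v\|_F^2,$$ $$\|\boldsymbol w\|^2_{\dagger,{\rm div}}:=\sum_{K\in\mathcal T_h}\Big\{\|\boldsymbol w\|^2_{\boldsymbol A^{-1},K}+\tfrac{h_K^2}{\alpha_K}\|\operatorname{div}\boldsymbol w\|_K^2\Big\}+\sum_{F\in\mathcal F_h^{\rm R}}\tfrac{h_F}{\alpha_F}\|\boldsymbol w\cdot\boldsymbol n\|_F^2 .$$ Let $V_h:=\mathcal P_p(\mathcal T_h)\cap H^1_{\Gamma_{\rm D}}(\Omega)$ (Lagrange) and $\boldsymbol W_h:=\mathcal P_p(\mathcal T_h)^d\cap\boldsymbol X_{\Gamma_{\rm N}}$ (BDM). Let $\pi^{\rm g}_h$, $\pi^{\rm g}$ be the best approximations in $V_h$, $H^1_{\Gamma_{\rm D}}(\Omega)$ for $\|\cdot\|_{\dagger,1}$, and $\pi^{\rm d}_h$ the best approximation in $\boldsymbol W_h$ for $\|\cdot\|_{\dagger,{\rm div}}$. *Approximation factors.*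 For $\psi\in L^2(\Omega)$ and $\Psi\in L^2(\Gamma_{\rm R})$ let $u^\star_\psi,U^\star_\Psi\in H^1_{\Gamma_{\rm D}}(\Omega)$ solve $b(w,u^\star_\psi)=\omega(\mu w,\psi)_\Omega$ and $b(w,U^\star_\Psi)=\omega^{1/2}(\gamma w,\Psi)_{\Gamma_{\rm R}}$ for all $w\in H^1_{\Gamma_{\rm D}}(\Omega)$. With $e_{\rm g}(\xi):=\|\xi-\pi_h^{\rm g}\xi\|_{\dagger,1}$ and $e_{\rm d}(\xi):=\|\boldsymbol A\nabla\xi-\pi_h^{\rm d}(\boldsymbol A\nabla\xi)\|_{\dagger,{\rm div}}$, set for $\bullet\in\{{\rm g},{\rm d}\}$ $$\gamma_{{\rm ba},\bullet}^2:=4\Big(\sup_{\|\psi\|_{\mu,\Omega}=1}e_\bullet(u^\star_\psi)\Big)^2+2\Big(\sup_{\|\Psi\|_{\gamma,\Gamma_{\rm R}}=1}e_\bullet(U^\star_\Psi)\Big)^2,$$ the second supremum being $0$ if $\Gamma_{\rm R}=\emptyset$. *Claim.* Assume that there is $\rho>0$ with $\operatorname{Re}s_h(v_h,v_h)\ge\rho^2\|v_h-\pi^{\rm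 g}v_h\|_{\dagger,1}^2$ for all $v_h\in\mathcal P_p(\mathcal T_h)$, that $\gamma_{{\rm ba},{\rm g}}<1$ and that $\sqrt2\,\gamma_{{\rm ba},{\rm d}}\le\rho$. Then the IPDG problem has a unique solution $u_h\in\mathcal P_p(\mathcal T_h)$, and $$|||u-u_h|||_{\omega,\mathcal T_h}\le\frac1{1-\gamma_{{\rm ba},{\rm g}}^2}\Big(\min_{v_h\in V_h}|||u-v_h|||_{\omega,\Omega}^2+\frac1{\rho^2}\min_{\boldsymbol\sigma_h\in\boldsymbol W_h}\|\boldsymbol A\nabla u-\boldsymbol\sigma_h\|^2_{\dagger,{\rm div}}\Big)^{1/2}.$$ If moreover $\sqrt2\,\gamma_{{\rm ba},{\rm d}}<\rho$, then $$\|u_h-\pi^{\rm g}u_h\|_{\dagger,1}\le\Big(\frac1{(1-\gamma_{{\rm ba},{\rm g}}^2)(\rho^2-2\gamma_{{\rm ba},{\rm d}}^2)}\Big)^{1/2}\Big(\min_{v_h\in V_h}|||u-v_h|||_{\omega,\Omega}^2+\frac1{\rho^2}\min_{\boldsymbol\sigma_h\in\boldsymbol W_h}\|\boldsymbol A\nabla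 u-\boldsymbol\sigma_h\|^2_{\dagger,{\rm div}}\Big)^{1/2}.$$ -/

import Mathlib

open MeasureTheory Filter Topology
open scoped ContDiff ENNReal ComplexConjugate

noncomputable section

namespace IPDG

/-! ## Ambient spaces -/

/-- The Euclidean space `ℝ^d`. -/
abbrev E (d : ℕ) : Type := EuclideanSpace ℝ (Fin d)

/-- Values of vector fields: `ℂ^d` with its Hermitian norm. -/
abbrev V (d : ℕ) : Type := EuclideanSpace ℂ (Fin d)

/-- The partial derivative `∂_i φ`. -/
def pderiv {d : ℕ} {G : Type*} [NormedAddCommGroup G] [NormedSpace ℝ G]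
    (i : Fin d) (φ : E d → G) (x : E d) : G :=
  fderiv ℝ φ x (EuclideanSpace.single i 1)

/-- The classical gradient of a complex-valued function. -/
def cgrad {d : ℕ} (φ : E d → ℂ) (x : E d) : V d := WithLp.toLp 2 fun i => pderiv i φ x

/-- `φ` is a test function: smooth with compact support in `D`. -/
def IsTest {d : ℕ} (D : Set (E d)) (φ : E d → ℝ) : Prop :=
  ContDiff ℝ ∞ φ ∧ HasCompactSupport φ ∧ tsupport φ ⊆ D

/-- `g` is the gradient of `v` on `D` in the sense of distributions. -/
def IsWeakGrad {d : ℕ} (D : Set (E d)) (v : E d → ℂ) (g : E d → V d) : Prop :=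
  ∀ φ : E d → ℝ, IsTest D φ → ∀ i : Fin d,
    ∫ x in D, v x * ((pderiv i φ x : ℝ) : ℂ) = - ∫ x in D, g x i * (φ x : ℂ)

/-- `q` is the divergence of `w` on `D` in the sense of distributions. -/
def IsWeakDiv {d : ℕ} (D : Set (E d)) (w : E d → V d) (q : E d → ℂ) : Prop :=
  ∀ φ : E d → ℝ, IsTest D φ →
    ∫ x in D, ∑ i, w x i * ((pderiv i φ x : ℝ) : ℂ) = - ∫ x in D, q x * (φ x : ℂ)

/-- The value at `x ∈ ℝ^d` of a polynomial with complex coefficients. -/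
def peval {d : ℕ} (x : E d) (P : MvPolynomial (Fin d) ℂ) : ℂ :=
  MvPolynomial.eval (fun i => ((x i : ℝ) : ℂ)) P

/-- The closed simplex with vertex set `K`. -/
def hull {d : ℕ} (K : Finset (E d)) : Set (E d) := convexHull ℝ (K : Set (E d))

/-- The open simplex with vertex set `K` (for `d + 1` vertices). -/
def cell {d : ℕ} (K : Finset (E d)) : Set (E d) := interior (hull K)

/-- Surface measure on the `(d-1)`-dimensional simplex with vertex set `F`. -/
def faceMeasure {d : ℕ} (F : Finset (E d)) : Measure (E d) :=
  (Measure.euclideanHausdorffMeasure (d - 1)).restrict (hull F)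

/-- Families of square-integrable functions, one on each face. -/
abbrev FaceData (d : ℕ) : Type := (F : Finset (E d)) → Lp ℂ 2 (faceMeasure F)

/-- `n` is the unit vector normal to the face `F` of `K` that points outside `K`. -/
def IsOutwardNormal {d : ℕ} (K F : Finset (E d)) (n : E d) : Prop :=
  ‖n‖ = 1 ∧ (∀ x ∈ F, ∀ y ∈ F, inner ℝ (y - x) n = 0) ∧
    ∀ x ∈ F, ∀ y ∈ K, inner ℝ (y - x) n ≤ 0

/-- The unit outward normal `n_K` on the face `F` of `K`. -/
def outNormal {d : ℕ} (K F : Finset (E d)) : E d := Classical.epsilon (IsOutwardNormal K F)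

/-- `argminOn S N v` is an element `s` of `S` that minimizes `N (v - s)`. -/
def argminOn {α : Type*} [AddGroup α] (S : Set α) (N : α → ℝ) (v : α) : α :=
  Classical.epsilon fun s => s ∈ S ∧ ∀ t ∈ S, N (v - s) ≤ N (v - t)

/-! ## Matching simplicial meshes -/

/-- A matching simplicial mesh. Each element is given by its set of `d + 1` vertices; the
intersection of two elements is the (possibly empty) simplex spanned by their common vertices. -/
structure Mesh (d : ℕ) where
  elems : Finset (Finset (E d))
  nonempty : elems.Nonempty
  card_eq : ∀ K ∈ elems, K.card = d + 1
  indep : ∀ K ∈ elems, AffineIndependent ℝ (fun a : K => (a : E d))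
  matching : ∀ K ∈ elems, ∀ L ∈ elems,
    hull K ∩ hull L ⊆ convexHull ℝ ((K : Set (E d)) ∩ (L : Set (E d)))

namespace Mesh

variable {d : ℕ}

/-- The open set covered by the mesh. -/
def dom (M : Mesh d) : Set (E d) := interior (⋃ K ∈ M.elems, hull K)

open Classical in
/-- The faces of the mesh (vertex sets of cardinality `d`). -/
def faces (M : Mesh d) : Finset (Finset (E d)) := M.elems.biUnion fun K => K.powersetCard d

open Classical in
/-- The elements having `F` as a face. -/
def elemsAt (M : Mesh d) (F : Finset (E d)) : Finset (Finset (E d)) :=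
  M.elems.filter fun K => F ⊆ K

/-- For a face `F` on the boundary: the only element having `F` as a face. -/
def owner (M : Mesh d) (F : Finset (E d)) : Finset (E d) :=
  Classical.epsilon fun K => K ∈ M.elems ∧ F ⊆ K

/-- `L²(Ω)`. -/
abbrev L2 (M : Mesh d) : Type := Lp ℂ 2 ((volume : Measure (E d)).restrict M.dom)

/-- `L²(Ω)^d`. -/
abbrev L2V (M : Mesh d) : Type := Lp (V d) 2 ((volume : Measure (E d)).restrict M.dom)

theorem cell_subset_dom (M : Mesh d) {K : Finset (E d)} (hK : K ∈ M.elems) :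
    cell K ⊆ M.dom :=
  interior_mono (Set.subset_biUnion_of_mem (u := fun K => hull K) hK)

/-- A function in `L²(Ω)` times a bounded continuous function is integrable on subsets of `Ω`. -/
theorem integrable_mul_aux {H : Type*} [NormedAddCommGroup H] (M : Mesh d) {D : Set (E d)}
    (hD : D ⊆ M.dom) (v : Lp H 2 ((volume : Measure (E d)).restrict M.dom))
    (L : H → ℂ) (hL : Continuous L) (hn : ∀ x, ‖L x‖ ≤ ‖x‖)
    {φ : E d → ℝ} (hφ : Continuous φ) (hc : HasCompactSupport φ) :
    Integrable (fun x => L (v x) * (φ x : ℂ)) ((volume : Measure (E d)).restrict D) := by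
  have h1 : MemLp (fun x => L (v x)) 2 ((volume : Measure (E d)).restrict D) := by
    have hv : MemLp v 2 ((volume : Measure (E d)).restrict D) :=
      (Lp.memLp v).mono_measure (Measure.restrict_mono hD le_rfl)
    exact hv.mono (hL.comp_aestronglyMeasurable hv.1) (ae_of_all _ fun x => hn _)
  have h2 : MemLp (fun x => (φ x : ℂ)) 2 ((volume : Measure (E d)).restrict D) :=
    ((Complex.continuous_ofReal.comp hφ).memLp_of_hasCompactSupport
      (hc.comp_left (g := fun t : ℝ => (t : ℂ)) (by simp))).restrict _
  exact h1.integrable_mul h2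

theorem pderiv_continuous {φ : E d → ℝ} {D : Set (E d)} (h : IsTest D φ) (i : Fin d) :
    Continuous (pderiv i φ) := by
  have := h.1.continuous_fderiv (by simp)
  exact this.clm_apply continuous_const

theorem pderiv_hasCompactSupport {φ : E d → ℝ} {D : Set (E d)} (h : IsTest D φ) (i : Fin d) :
    HasCompactSupport (pderiv i φ) := by
  have := h.2.1.fderiv (𝕜 := ℝ)
  exact this.comp_left (g := fun l : E d →L[ℝ] ℝ => l (EuclideanSpace.single i 1)) rfl

/-- The broken Sobolev space `H¹(T_h)`: functions in `L²(Ω)` for which there is a vector field in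
`L²(Ω)^d` that is their weak gradient on each element. -/
def H1 (M : Mesh d) : Submodule ℂ M.L2 where
  carrier := {v | ∃ g : M.L2V, ∀ K ∈ M.elems, IsWeakGrad (cell K) v g}
  zero_mem' := by
    refine ⟨0, fun K hK φ hφ i => ?_⟩
    have hle : ((volume : Measure (E d)).restrict (cell K)) ≤ volume.restrict M.dom :=
      Measure.restrict_mono (M.cell_subset_dom hK) le_rfl
    have e1 := (Lp.coeFn_zero ℂ 2 ((volume : Measure (E d)).restrict M.dom)).filter_mono
      (ae_mono hle)
    have e2 := (Lp.coeFn_zero (V d) 2 ((volume : Measure (E d)).restrict M.dom)).filter_mono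
      (ae_mono hle)
    have i1 : ∫ x in cell K, (0 : M.L2) x * ((pderiv i φ x : ℝ) : ℂ) = 0 := by
      apply integral_eq_zero_of_ae
      filter_upwards [e1] with x hx
      rw [hx]; simp
    have i2 : ∫ x in cell K, (0 : M.L2V) x i * (φ x : ℂ) = 0 := by
      apply integral_eq_zero_of_ae
      filter_upwards [e2] with x hx
      rw [hx]; simp
    rw [i1, i2, neg_zero]
  add_mem' := by
    rintro v w ⟨g, hg⟩ ⟨k, hk⟩
    refine ⟨g + k, fun K hK φ hφ i => ?_⟩
    have hD := M.cell_subset_dom hK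
    have hle : ((volume : Measure (E d)).restrict (cell K)) ≤ volume.restrict M.dom :=
      Measure.restrict_mono hD le_rfl
    have e1 := (Lp.coeFn_add v w).filter_mono (ae_mono hle)
    have e2 := (Lp.coeFn_add g k).filter_mono (ae_mono hle)
    have c1 := pderiv_continuous hφ i
    have c2 := pderiv_hasCompactSupport hφ i
    have hn : ∀ y : V d, ‖y i‖ ≤ ‖y‖ := fun y => PiLp.norm_apply_le y i
    have hci : Continuous fun y : V d => y i := by fun_prop
    calc ∫ x in cell K, (v + w : M.L2) x * ((pderiv i φ x : ℝ) : ℂ)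
        = ∫ x in cell K, (v x * ((pderiv i φ x : ℝ) : ℂ) + w x * ((pderiv i φ x : ℝ) : ℂ)) := by
          apply integral_congr_ae
          filter_upwards [e1] with x hx
          rw [hx, Pi.add_apply, add_mul]
      _ = - ∫ x in cell K, (g x i * (φ x : ℂ) + k x i * (φ x : ℂ)) := by
          rw [integral_add (M.integrable_mul_aux hD v (fun y => y) continuous_id (fun _ => le_rfl) c1 c2)
              (M.integrable_mul_aux hD w (fun y => y) continuous_id (fun _ => le_rfl) c1 c2),
            integral_add
              (M.integrable_mul_aux hD g (fun y => y i) hci hn hφ.1.continuous hφ.2.1)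
              (M.integrable_mul_aux hD k (fun y => y i) hci hn hφ.1.continuous hφ.2.1),
            hg K hK φ hφ i, hk K hK φ hφ i, neg_add]
      _ = - ∫ x in cell K, (g + k : M.L2V) x i * (φ x : ℂ) := by
          congr 1
          apply integral_congr_ae
          filter_upwards [e2] with x hx
          rw [hx, Pi.add_apply, PiLp.add_apply, add_mul]
  smul_mem' := by
    rintro c v ⟨g, hg⟩
    refine ⟨c • g, fun K hK φ hφ i => ?_⟩
    have hle : ((volume : Measure (E d)).restrict (cell K)) ≤ volume.restrict M.dom :=
      Measure.restrict_mono (M.cell_subset_dom hK) le_rfl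
    have e1 := (Lp.coeFn_smul c v).filter_mono (ae_mono hle)
    have e2 := (Lp.coeFn_smul c g).filter_mono (ae_mono hle)
    calc ∫ x in cell K, (c • v : M.L2) x * ((pderiv i φ x : ℝ) : ℂ)
        = ∫ x in cell K, c * (v x * ((pderiv i φ x : ℝ) : ℂ)) := by
          apply integral_congr_ae
          filter_upwards [e1] with x hx
          rw [hx, Pi.smul_apply, smul_eq_mul, mul_assoc]
      _ = - ∫ x in cell K, c * (g x i * (φ x : ℂ)) := by
          rw [integral_const_mul, integral_const_mul, hg K hK φ hφ i, mul_neg]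
      _ = - ∫ x in cell K, (c • g : M.L2V) x i * (φ x : ℂ) := by
          congr 1
          apply integral_congr_ae
          filter_upwards [e2] with x hx
          rw [hx, Pi.smul_apply, PiLp.smul_apply, smul_eq_mul, mul_assoc]

/-- The element-wise weak gradient `∇v` of `v ∈ H¹(T_h)`. On `H¹(Ω)` it is the weak gradient. -/
def grad (M : Mesh d) (v : M.H1) : M.L2V := Classical.choose v.2

/-- `g` is the trace of `v|_K` on the face `F` of `K`: the limit in `L²(F)` of the restrictions to
`F` of smooth functions that converge to `v` in `H¹(K)`. -/
def IsTrace (M : Mesh d) (K F : Finset (E d)) (v : M.H1) (g : Lp ℂ 2 (faceMeasure F)) : Prop :=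
  ∃ φ : ℕ → E d → ℂ, (∀ n, ContDiff ℝ ∞ (φ n)) ∧
    Tendsto (fun n => eLpNorm (fun x => (v : M.L2) x - φ n x) 2 (volume.restrict (cell K)))
      atTop (𝓝 0) ∧
    Tendsto (fun n => eLpNorm (fun x => M.grad v x - cgrad (φ n) x) 2 (volume.restrict (cell K)))
      atTop (𝓝 0) ∧
    Tendsto (fun n => eLpNorm (fun x => g x - φ n x) 2 (faceMeasure F)) atTop (𝓝 0)

/-- The trace of `v|_K` on the face `F` of `K`. -/
def trace (M : Mesh d) (K F : Finset (E d)) (v : M.H1) : Lp ℂ 2 (faceMeasure F) :=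
  Classical.epsilon (M.IsTrace K F v)

/-- The traces of `v` on the faces on the boundary of `Ω`. -/
def bdryTrace (M : Mesh d) (v : M.H1) : FaceData d := fun F => M.trace (M.owner F) F v

/-- The space `P_p(T_h)` of piecewise polynomials of total degree at most `p`. -/
def Poly (M : Mesh d) (p : ℕ) : Set M.H1 :=
  {v | ∀ K ∈ M.elems, ∃ P : MvPolynomial (Fin d) ℂ, P.totalDegree ≤ p ∧
    ∀ᵐ x ∂((volume : Measure (E d)).restrict (cell K)), (v : M.L2) x = peval x P}

/-- `w ∈ L²(Ω)^d` is the piecewise polynomial field whose restriction to `K` has the polynomial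
components `W K i`, of total degree at most `p`. -/
def IsPolyField (M : Mesh d) (p : ℕ) (w : M.L2V)
    (W : Finset (E d) → Fin d → MvPolynomial (Fin d) ℂ) : Prop :=
  ∀ K ∈ M.elems, (∀ i, (W K i).totalDegree ≤ p) ∧
    ∀ᵐ x ∂((volume : Measure (E d)).restrict (cell K)), ∀ i, w x i = peval x (W K i)

/-- The space `P_p(T_h)^d`. -/
def PolyV (M : Mesh d) (p : ℕ) : Set M.L2V := {w | ∃ W, M.IsPolyField p w W}

/-- The weighted inner product `∑_K c_K (φ, v)_K`. -/
def massForm (M : Mesh d) (c : Finset (E d) → ℝ) (φ v : M.L2) : ℂ :=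
  ∑ K ∈ M.elems, (c K : ℂ) * ∫ x in cell K, φ x * conj (v x)

/-- The function that sends `x ∈ K` to `B_K σ(x)`. -/
def mulMatFun (M : Mesh d) (B : Finset (E d) → Matrix (Fin d) (Fin d) ℝ) (σ : M.L2V)
    (x : E d) : V d :=
  ∑ K ∈ M.elems, (cell K).indicator
    (fun y => Matrix.toEuclideanCLM (𝕜 := ℂ) ((B K).map (fun t : ℝ => (t : ℂ))) (σ y)) x

theorem mulMatFun_memLp (M : Mesh d) (B : Finset (E d) → Matrix (Fin d) (Fin d) ℝ) (σ : M.L2V) :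
    MemLp (M.mulMatFun B σ) 2 ((volume : Measure (E d)).restrict M.dom) := by
  unfold mulMatFun
  refine memLp_finsetSum _ fun K _ => MemLp.indicator isOpen_interior.measurableSet ?_
  exact ContinuousLinearMap.comp_memLp' _ (Lp.memLp σ)

/-- Multiplication of a vector field by the piecewise constant real matrix `B`. -/
def mulMat (M : Mesh d) (B : Finset (E d) → Matrix (Fin d) (Fin d) ℝ) (σ : M.L2V) : M.L2V :=
  (M.mulMatFun_memLp B σ).toLp

end Mesh

/-! ## The Helmholtz problem -/

/-- A matching mesh of `Ω`, together with the data of the Helmholtz problem. Since the mesh conforms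
with the partitions of the boundary and of the coefficients, the boundary parts `Γ_D`, `Γ_N`, `Γ_R`
are given by the faces that cover them, the coefficients `μ`, `A` by one value on each element, and
`γ` by one value on each face of `Γ_R`. -/
structure Setting (d : ℕ) extends Mesh d where
  FD : Finset (Finset (E d))
  FN : Finset (Finset (E d))
  FR : Finset (Finset (E d))
  disj_DN : Disjoint FD FN
  disj_DR : Disjoint FD FR
  disj_NR : Disjoint FN FR
  /-- The faces on the boundary are the faces of exactly one element. -/
  mem_bdry : ∀ F, (F ∈ FD ∨ F ∈ FN ∨ F ∈ FR) ↔
    (F ∈ toMesh.faces ∧ (toMesh.elemsAt F).card = 1)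
  /-- The unit normal `n_F`, outward on the boundary and arbitrarily oriented elsewhere. -/
  nF : Finset (E d) → E d
  nF_spec : ∀ F ∈ toMesh.faces, ∃ K ∈ toMesh.elemsAt F, IsOutwardNormal K F (nF F)
  mu : Finset (E d) → ℝ
  mu_pos : ∀ K ∈ elems, 0 < mu K
  A : Finset (E d) → Matrix (Fin d) (Fin d) ℝ
  A_symm : ∀ K ∈ elems, (A K).IsSymm
  A_pos : ∀ K ∈ elems, ∀ ξ : Fin d → ℝ, ξ ≠ 0 → 0 < ξ ⬝ᵥ (A K).mulVec ξ
  gam : Finset (E d) → ℝ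
  gam_pos : ∀ F ∈ FR, 0 < gam F
  omega : ℝ
  omega_pos : 0 < omega

namespace Setting

variable {d : ℕ}

/-- `α_K`, the minimum of `A_K ξ · ξ` over unit vectors `ξ`. -/
def alpha (S : Setting d) (K : Finset (E d)) : ℝ :=
  ⨅ ξ : Metric.sphere (0 : E d) 1, (ξ : E d).ofLp ⬝ᵥ (S.A K).mulVec (ξ : E d).ofLp

/-- `α_F` for a face on the boundary. -/
def alphaF (S : Setting d) (F : Finset (E d)) : ℝ := S.alpha (S.owner F)

/-- `ϑ_K`. -/
def theta (S : Setting d) (K : Finset (E d)) : ℝ := √(S.alpha K / S.mu K)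

/-- `ϑ_F` for `F ⊆ Γ_R`. -/
def thetaF (S : Setting d) (F : Finset (E d)) : ℝ := S.alphaF F / S.gam F

/-- The diameter of an element or of a face. -/
def diam (_S : Setting d) (K : Finset (E d)) : ℝ := Metric.diam (hull K)

/-- The weighted inner product `∑_F c_F (φ, v)_F` over the faces of `Γ_R`. -/
def robinForm (S : Setting d) (c : Finset (E d) → ℝ) (φ v : FaceData d) : ℂ :=
  ∑ F ∈ S.FR, (c F : ℂ) * ∫ x, φ F x * conj (v F x) ∂(faceMeasure F)

/-- The inner product `(A σ, τ)`. -/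
def stiffForm (S : Setting d) (σ τ : S.L2V) : ℂ := inner ℂ τ (S.mulMat S.A σ)

/-- The space `H¹_{Γ_D}(Ω)`. -/
def H1D (S : Setting d) : Set S.H1 :=
  {v | (∃ g : S.L2V, IsWeakGrad S.dom (v : S.L2) g) ∧ ∀ F ∈ S.FD, S.bdryTrace v F = 0}

/-- The energy norm on `H¹_{Γ_D}(Ω)`. -/
def energyNorm (S : Setting d) (v : S.H1) : ℝ :=
  √(S.omega ^ 2 * (S.massForm S.mu v v).re
    + S.omega * (S.robinForm S.gam (S.bdryTrace v) (S.bdryTrace v)).re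
    + (S.stiffForm (S.grad v) (S.grad v)).re)

/-- The sesquilinear form `b` of the Helmholtz problem. -/
def b (S : Setting d) (φ v : S.H1) : ℂ :=
  -(S.omega : ℂ) ^ 2 * S.massForm S.mu φ v
    - Complex.I * (S.omega : ℂ) * S.robinForm S.gam (S.bdryTrace φ) (S.bdryTrace v)
    + S.stiffForm (S.grad φ) (S.grad v)

/-- Well-posedness of the Helmholtz problem, as an inf-sup condition. -/
def WellPosed (S : Setting d) : Prop :=
  ∃ γst : ℝ, 0 < γst ∧ ∀ φ ∈ S.H1D, S.energyNorm φ = 1 →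
    ∃ v ∈ S.H1D, S.energyNorm v = 1 ∧ 1 / γst ≤ (S.b φ v).re

/-- `u ∈ H¹_{Γ_D}(Ω)` is the solution of the Helmholtz problem with right-hand side `f`. -/
def IsSolution (S : Setting d) (f : S.L2) (u : S.H1) : Prop :=
  u ∈ S.H1D ∧ ∀ v ∈ S.H1D, S.b u v = inner ℂ (v : S.L2) f

/-! ### Vector fields with divergence and normal trace -/

/-- Given `q = div w`: `w · n = 0` on `Γ_N` and `w · n = g` on `Γ_R`, in the weak sense. -/
def IsNormalTrace (S : Setting d) (w : S.L2V) (q : S.L2) (g : FaceData d) : Prop :=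
  ∀ v ∈ S.H1D, inner ℂ w (S.grad v) + inner ℂ q (v : S.L2) =
    S.robinForm (fun _ => 1) (S.bdryTrace v) g

/-- The space `X_{Γ_N}(div, Ω)`. -/
def XN (S : Setting d) : Set S.L2V :=
  {w | ∃ (q : S.L2) (g : FaceData d), IsWeakDiv S.dom w q ∧ S.IsNormalTrace w q g}

/-- The weak divergence. -/
def wdiv (S : Setting d) (w : S.L2V) : S.L2 := Classical.epsilon fun q => IsWeakDiv S.dom w q

/-- The normal trace on the faces of `Γ_R` of an element of `X_{Γ_N}(div, Ω)`. -/
def ntrace (S : Setting d) (w : S.L2V) : FaceData d :=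
  Classical.epsilon fun g => S.IsNormalTrace w (S.wdiv w) g

/-- The norm `‖·‖_{†,div}` on `X_{Γ_N}(div, Ω)`. -/
def divNorm (S : Setting d) (w : S.L2V) : ℝ :=
  √((inner ℂ w (S.mulMat (fun K => (S.A K)⁻¹) w)).re
    + (S.massForm (fun K => S.diam K ^ 2 / S.alpha K) (S.wdiv w) (S.wdiv w)).re
    + (S.robinForm (fun F => S.diam F / S.alphaF F) (S.ntrace w) (S.ntrace w)).re)

/-! ### Jumps, averages, lifting, discrete gradient -/

open Classical in
/-- The jump of `v` through `F`. On an interior face `F` the sum has the two terms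
`v_± n_± · n_F`; on a face of `Γ_D` it has the only term `v`. -/
def jump (S : Setting d) (v : S.H1) (F : Finset (E d)) : Lp ℂ 2 (faceMeasure F) :=
  if F ∈ S.FN ∨ F ∈ S.FR then 0
  else ∑ K ∈ S.elemsAt F, ((inner ℝ (outNormal K F) (S.nF F) : ℝ) : ℂ) • S.trace K F v

/-- The normal component on `F` of the average of a piecewise polynomial field. -/
def avgNormal (S : Setting d) (W : Finset (E d) → Fin d → MvPolynomial (Fin d) ℂ)
    (F : Finset (E d)) (x : E d) : ℂ :=
  (1 / ((S.elemsAt F).card : ℂ)) *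
    ∑ K ∈ S.elemsAt F, ∑ i, peval x (W K i) * ((S.nF F i : ℝ) : ℂ)

/-- `ℓ` is the lifting of `v` in `P_p(T_h)^d`. -/
def IsLift (S : Setting d) (p : ℕ) (v : S.H1) (l : S.L2V) : Prop :=
  l ∈ S.PolyV p ∧ ∀ w W, S.IsPolyField p w W →
    inner ℂ w l = ∑ F ∈ S.faces, ∫ x, S.jump v F x * conj (S.avgNormal W F x) ∂(faceMeasure F)

/-- The lifting operator. -/
def lift (S : Setting d) (p : ℕ) (v : S.H1) : S.L2V := Classical.epsilon (S.IsLift p v)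

/-- The discrete gradient. -/
def dgrad (S : Setting d) (p : ℕ) (v : S.H1) : S.L2V := S.grad v - S.lift p v

/-- The broken energy norm on `H¹(T_h)`. -/
def brokenNorm (S : Setting d) (p : ℕ) (v : S.H1) : ℝ :=
  √(S.omega ^ 2 * (S.massForm S.mu v v).re
    + S.omega * (S.robinForm S.gam (S.bdryTrace v) (S.bdryTrace v)).re
    + (S.stiffForm (S.dgrad p v) (S.dgrad p v)).re)

/-- The norm `‖·‖_{†,1}` on `H¹(T_h)`. -/
def dagNorm (S : Setting d) (p : ℕ) (v : S.H1) : ℝ :=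
  √((S.massForm (fun K => max 1 (S.omega ^ 2 * S.diam K ^ 2 / S.theta K ^ 2)
        * (S.alpha K / S.diam K ^ 2)) v v).re
    + (S.stiffForm (S.dgrad p v) (S.dgrad p v)).re
    + (S.robinForm (fun F => max 1 (S.omega * S.diam F / S.thetaF F)
        * (S.alphaF F / S.diam F)) (S.bdryTrace v) (S.bdryTrace v)).re)

/-! ### The IPDG form and the discrete problem -/

/-- Sesquilinear forms on `H¹(T_h)`, linear in the first and antilinear in the second variable. -/
abbrev SesqForm (S : Setting d) : Type := S.H1 →ₗ[ℂ] S.H1 →ₗ⋆[ℂ] ℂ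

/-- The stabilization vanishes as soon as one argument belongs to `H¹_{Γ_D}(Ω)`. -/
def IsStabilization (S : Setting d) (s : S.SesqForm) : Prop :=
  ∀ φ v : S.H1, φ ∈ S.H1D ∨ v ∈ S.H1D → s φ v = 0

/-- The IPDG form `a_h`. -/
def ah (S : Setting d) (p : ℕ) (s : S.SesqForm) (φ v : S.H1) : ℂ :=
  S.stiffForm (S.dgrad p φ) (S.dgrad p v) + s φ v

/-- The discrete Helmholtz form `b_h`. -/
def bh (S : Setting d) (p : ℕ) (s : S.SesqForm) (φ v : S.H1) : ℂ :=
  -(S.omega : ℂ) ^ 2 * S.massForm S.mu φ v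
    - Complex.I * (S.omega : ℂ) * S.robinForm S.gam (S.bdryTrace φ) (S.bdryTrace v)
    + S.ah p s φ v

/-- `u_h ∈ P_p(T_h)` solves the discrete Helmholtz problem with right-hand side `f`. -/
def IsDiscreteSolution (S : Setting d) (p : ℕ) (s : S.SesqForm) (f : S.L2) (uh : S.H1) : Prop :=
  uh ∈ S.Poly p ∧ ∀ vh ∈ S.Poly p, S.bh p s uh vh = inner ℂ (vh : S.L2) f

/-! ### Conforming subspaces, projections, approximation factors -/

/-- The Lagrange space `P_p(T_h) ∩ H¹_{Γ_D}(Ω)`. -/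
def Lagrange (S : Setting d) (p : ℕ) : Set S.H1 := S.Poly p ∩ S.H1D

/-- The BDM space `P_p(T_h)^d ∩ X_{Γ_N}(div, Ω)`. -/
def BDM (S : Setting d) (p : ℕ) : Set S.L2V := S.PolyV p ∩ S.XN

/-- The projection `π_h^g` onto the Lagrange space. -/
def projhG (S : Setting d) (p : ℕ) (v : S.H1) : S.H1 := argminOn (S.Lagrange p) (S.dagNorm p) v

/-- The projection `π_h^d` onto the BDM space. -/
def projhD (S : Setting d) (p : ℕ) (w : S.L2V) : S.L2V := argminOn (S.BDM p) S.divNorm w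

/-- The conforming projection `π^g` onto `H¹_{Γ_D}(Ω)`. -/
def projG (S : Setting d) (p : ℕ) (v : S.H1) : S.H1 := argminOn S.H1D (S.dagNorm p) v

/-- The flux `A∇v`. -/
def flux (S : Setting d) (v : S.H1) : S.L2V := S.mulMat S.A (S.grad v)

/-- `ξ = u*_ψ` solves the adjoint problem with volume datum `ψ ∈ L²(Ω)`. -/
def IsDualVol (S : Setting d) (ψ : S.L2) (ξ : S.H1) : Prop :=
  ξ ∈ S.H1D ∧ ∀ w ∈ S.H1D, S.b w ξ = (S.omega : ℂ) * S.massForm S.mu w ψ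

/-- `ξ = U*_Ψ` solves the adjoint problem with boundary datum `Ψ ∈ L²(Γ_R)`. -/
def IsDualBdry (S : Setting d) (Ψ : FaceData d) (ξ : S.H1) : Prop :=
  ξ ∈ S.H1D ∧ ∀ w ∈ S.H1D,
    S.b w ξ = ((√S.omega : ℝ) : ℂ) * S.robinForm S.gam (S.bdryTrace w) Ψ

/-- The largest value of `err u*_ψ` over `ψ ∈ L²(Ω)` with `‖ψ‖_μ = 1`. -/
def supVol (S : Setting d) (err : S.H1 → ℝ) : ℝ≥0∞ :=
  ⨆ (ψ : S.L2) (ξ : S.H1) (_ : √(S.massForm S.mu ψ ψ).re = 1) (_ : S.IsDualVol ψ ξ),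
    ENNReal.ofReal (err ξ)

/-- The largest value of `err U*_Ψ` over `Ψ ∈ L²(Γ_R)` with `‖Ψ‖_γ = 1`
(it is `0` if `Γ_R` is empty). -/
def supBdry (S : Setting d) (err : S.H1 → ℝ) : ℝ≥0∞ :=
  ⨆ (Ψ : FaceData d) (ξ : S.H1) (_ : √(S.robinForm S.gam Ψ Ψ).re = 1) (_ : S.IsDualBdry Ψ ξ),
    ENNReal.ofReal (err ξ)

/-- The error of the projection on the Lagrange space. -/
def errG (S : Setting d) (p : ℕ) (ξ : S.H1) : ℝ := S.dagNorm p (ξ - S.projhG p ξ)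

/-- The error of the projection of the flux on the BDM space. -/
def errD (S : Setting d) (p : ℕ) (ξ : S.H1) : ℝ := S.divNorm (S.flux ξ - S.projhD p (S.flux ξ))

/-- The approximation factor `γ_{ba,g}`. -/
def gbaG (S : Setting d) (p : ℕ) : ℝ≥0∞ :=
  (4 * S.supVol (S.errG p) ^ 2 + 2 * S.supBdry (S.errG p) ^ 2) ^ (1 / 2 : ℝ)

/-- The approximation factor `γ_{ba,d}`. -/
def gbaD (S : Setting d) (p : ℕ) : ℝ≥0∞ :=
  (4 * S.supVol (S.errD p) ^ 2 + 2 * S.supBdry (S.errD p) ^ 2) ^ (1 / 2 : ℝ)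

/-- The minimum of the energy error of approximation of `u` in the Lagrange space. -/
def bestG (S : Setting d) (p : ℕ) (u : S.H1) : ℝ :=
  ⨅ vh : S.Lagrange p, S.energyNorm (u - vh)

/-- The minimum of the error of approximation of `A∇u` in the BDM space. -/
def bestD (S : Setting d) (p : ℕ) (u : S.H1) : ℝ :=
  ⨅ σh : S.BDM p, S.divNorm (S.flux u - σh)

end Setting

end IPDG

end

/-! Write e = u - u_h, let X be the broken energy norm of e and Y = ‖u_h - π^g u_h‖_{†,1}. The
Gårding identity `bh_self_re` says that Re b_h(e,e) equals X² + Re s_h(e,e) minus the lower-order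
terms 2ω²‖e‖²_μ + ω‖e‖²_γ. Since s_h vanishes as soon as one argument is conforming, s_h(e,e) =
s_h(u_h,u_h), whose real part is at least ρ²Y². It remains to bound Re b_h(e,e) and the lower-order
terms from above.

Both bounds rest on `ibp`, the defect (w, 𝔊v) + (div w, v) - (w·n, v)_{Γ_R} of the discrete
integration by parts formula. It vanishes for w in X_{Γ_N} and v in H¹_{Γ_D}(Ω), by the definition
of the normal trace. It also vanishes for w in the BDM space and every broken v, because the lifting
inside 𝔊 compensates exactly the jump terms. Hence its value at (w, v) is its value at (w - σ_h, v -
c) for any BDM field σ_h and any conforming c. The two †-norms dominate norms that are dual for this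
pairing, so `norm_ibp_le_dist` bounds the defect by a product of two distances. This is why Y always
appears multiplied by a BDM approximation error.

For b_h(e,e), Galerkin orthogonality on the Lagrange space and the mixed form of the Helmholtz
equation give b_h(e, u - v_h) minus the conjugate of the defect at (A∇u, u_h), hence the bound X|||u
- v_h||| + Y‖A∇u - σ_h‖_{†,div} (`quadratic_estimate`). The lower-order terms are treated by an
Aubin–Nitsche argument. For a dual solution ξ with datum e divided by its norm, `dual_estimate`
writes that norm of e as a form value b(e, ξ - π_h^g ξ) plus the defect at (A∇ξ, u_h). The squares
of these bounds add up to γ_g²X² + γ_d²Y² (`lower_order_le`), where γ_g and γ_d are the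
approximation factors.

Altogether (1 - γ_g²)X² + (ρ² - γ_d²)Y² ≤ Xa + Yb, with a and b the two best approximation errors
(`error_quadratic`), and Young's inequality yields both estimates. With zero data the right-hand
side can be made zero, so X = 0 and u_h = 0. The discrete problem is a square linear system, so
uniqueness implies existence.

Most of the work is to give substance to objects that are picked by choice: traces, lifting, weak
divergence, normal trace, projections. The analytic tools are the divergence theorem on a simplex,
obtained from polar coordinates around a vertex (`IsSimplex.integral_radial`), density of smooth
functions in H¹ of an element by averaged contractions (`exists_smooth_approx`), and the trace
inequality. The matching condition shows that elements sharing a face lie on opposite sides of it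
(`normalAt_eq_neg`). All norms are pulled back from one Hilbert space `EH`, which provides
Cauchy–Schwarz, best approximations, and dual solutions from the inf-sup condition. -/

noncomputable section

namespace IPDG

/-! ## Simplices and barycentric coordinates -/

/-- `K` is the vertex set of a nondegenerate `d`-simplex. -/
def IsSimplex {d : ℕ} (K : Finset (E d)) : Prop :=
  K.card = d + 1 ∧ AffineIndependent ℝ (fun a : K => (a : E d))

theorem Mesh.isSimplex {d : ℕ} (M : Mesh d) {K : Finset (E d)} (hK : K ∈ M.elems) : IsSimplex K :=
  ⟨M.card_eq K hK, M.indep K hK⟩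

section Simplex

variable {d : ℕ} {K : Finset (E d)}

/-- The vertices of a nondegenerate simplex as an affine basis. -/
def IsSimplex.basis (h : IsSimplex K) : AffineBasis K ℝ (E d) where
  toFun := Subtype.val
  ind' := h.2
  tot' := by
    rw [h.2.affineSpan_eq_top_iff_card_eq_finrank_add_one]
    simp [h.1]

open Classical in
/-- The barycentric coordinate of the simplex `K` associated with the vertex `a`. -/
def bary (K : Finset (E d)) (a : E d) : E d →ᵃ[ℝ] ℝ :=
  -- The default 0 makes the coordinate a total function of `K` and `a`, so that sums over vertices
  -- need no subtypes.
  if h : IsSimplex K ∧ a ∈ K then h.1.basis.coord ⟨a, h.2⟩ else 0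

theorem IsSimplex.bary_eq (h : IsSimplex K) (a : K) : bary K a = h.basis.coord a := by
  rw [bary, dif_pos ⟨h, a.2⟩]

theorem IsSimplex.basis_apply (h : IsSimplex K) (a : K) : h.basis a = a := rfl

theorem IsSimplex.range_basis (h : IsSimplex K) : Set.range h.basis = (K : Set (E d)) := by
  ext x
  constructor
  · rintro ⟨a, rfl⟩; exact a.2
  · intro hx; exact ⟨⟨x, hx⟩, rfl⟩

theorem IsSimplex.bary_self (h : IsSimplex K) {a : E d} (ha : a ∈ K) : bary K a a = 1 := by
  have := h.basis.coord_apply_eq ⟨a, ha⟩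
  rwa [h.basis_apply, ← h.bary_eq] at this

theorem IsSimplex.bary_ne (h : IsSimplex K) {a b : E d} (ha : a ∈ K) (hb : b ∈ K) (hab : a ≠ b) :
    bary K a b = 0 := by
  have := h.basis.coord_apply_ne (i := ⟨a, ha⟩) (j := ⟨b, hb⟩) (by simpa using hab)
  rwa [h.basis_apply, ← h.bary_eq] at this

theorem IsSimplex.sum_bary (h : IsSimplex K) (x : E d) : ∑ a ∈ K, bary K a x = 1 := by
  rw [← h.basis.sum_coord_apply_eq_one x, ← Finset.sum_coe_sort]
  exact Finset.sum_congr rfl fun a _ => by rw [h.bary_eq]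

theorem IsSimplex.sum_bary_smul (h : IsSimplex K) (x : E d) : ∑ a ∈ K, bary K a x • a = x := by
  conv_rhs => rw [← h.basis.linear_combination_coord_eq_self x]
  rw [← Finset.sum_coe_sort]
  exact Finset.sum_congr rfl fun a _ => by rw [h.bary_eq]; rfl

theorem IsSimplex.mem_hull (h : IsSimplex K) {x : E d} : x ∈ hull K ↔ ∀ a ∈ K, 0 ≤ bary K a x := by
  rw [hull, ← h.range_basis, h.basis.convexHull_eq_nonneg_coord]
  constructor
  · intro hx a ha
    have := hx ⟨a, ha⟩
    rwa [← h.bary_eq] at this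
  · intro hx a
    rw [← h.bary_eq]
    exact hx a a.2

theorem IsSimplex.mem_cell (h : IsSimplex K) {x : E d} : x ∈ cell K ↔ ∀ a ∈ K, 0 < bary K a x := by
  rw [cell, hull, ← h.range_basis, h.basis.interior_convexHull]
  constructor
  · intro hx a ha
    have := hx ⟨a, ha⟩
    rwa [← h.bary_eq] at this
  · intro hx a
    rw [← h.bary_eq]
    exact hx a a.2

/-- The zero set of a coordinate is convex and contains every vertex but one. Conversely, dropping
the vanishing coordinates leaves a convex combination of the remaining vertices. This is how
subsimplices are handled from here on. -/
theorem IsSimplex.mem_hull_of_subset (h : IsSimplex K) {G : Finset (E d)} (hG : G ⊆ K) {x : E d} :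
    x ∈ hull G ↔ x ∈ hull K ∧ ∀ a ∈ K, a ∉ G → bary K a x = 0 := by
  constructor
  · intro hx
    refine ⟨convexHull_mono (by exact_mod_cast hG) hx, fun a ha haG => ?_⟩
    have hc : Convex ℝ {y : E d | bary K a y = 0} := by
      have := (convex_singleton (0 : ℝ)).affine_preimage (bary K a)
      exact this
    exact convexHull_min (fun b hb => h.bary_ne ha (hG hb) (by rintro rfl; exact haG hb)) hc hx
  · rintro ⟨hx, h0⟩
    have hs := h.sum_bary_smul x
    have h1 := h.sum_bary x
    rw [← Finset.sum_subset hG (fun a ha haG => by rw [h0 a ha haG, zero_smul])] at hs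
    rw [← Finset.sum_subset hG (fun a ha haG => h0 a ha haG)] at h1
    rw [← hs]
    exact (convex_convexHull ℝ _).sum_mem (fun a ha => h.mem_hull.1 hx a (hG ha)) h1
      (fun a ha => subset_convexHull ℝ _ ha)

open Classical in
/-- The vertices of `K` other than `a`: the face opposite to `a`. -/
def opp (K : Finset (E d)) (a : E d) : Finset (E d) := K.erase a

theorem mem_opp {a b : E d} : b ∈ opp K a ↔ b ≠ a ∧ b ∈ K := by
  classical
  rw [opp]; convert Finset.mem_erase

theorem opp_subset (K : Finset (E d)) (a : E d) : opp K a ⊆ K := fun _ hb => (mem_opp.1 hb).2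

theorem IsSimplex.mem_hull_opp (h : IsSimplex K) {a x : E d} (ha : a ∈ K) :
    x ∈ hull (opp K a) ↔ x ∈ hull K ∧ bary K a x = 0 := by
  rw [h.mem_hull_of_subset (opp_subset K a)]
  refine and_congr_right fun _ => ⟨fun H => H a ha (by simp [mem_opp]), fun H b hb hba => ?_⟩
  have : b = a := by by_contra hne; exact hba (mem_opp.2 ⟨hne, hb⟩)
  rw [this, H]

theorem isCompact_hull (K : Finset (E d)) : IsCompact (hull K) := K.finite_toSet.isCompact_convexHull ℝ

theorem convex_hull (K : Finset (E d)) : Convex ℝ (hull K) := convex_convexHull ℝ _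

theorem isOpen_cell (K : Finset (E d)) : IsOpen (cell K) := isOpen_interior

theorem convex_cell (K : Finset (E d)) : Convex ℝ (cell K) := (convex_hull K).interior

theorem cell_subset_hull (K : Finset (E d)) : cell K ⊆ hull K := interior_subset

theorem cell_ae_eq_hull (K : Finset (E d)) : cell K =ᵐ[volume] hull K :=
  interior_ae_eq_of_null_frontier ((convex_hull K).addHaar_frontier volume)

theorem restrict_cell (K : Finset (E d)) :
    (volume : Measure (E d)).restrict (cell K) = volume.restrict (hull K) :=
  Measure.restrict_congr_set (cell_ae_eq_hull K)

theorem IsSimplex.cell_nonempty (h : IsSimplex K) : (cell K).Nonempty := by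
  rw [cell, hull, ← h.range_basis]
  exact ⟨_, h.basis.centroid_mem_interior_convexHull⟩

theorem IsSimplex.closure_cell (h : IsSimplex K) : closure (cell K) = hull K := by
  rw [cell, (convex_hull K).closure_interior_eq_closure_of_nonempty_interior h.cell_nonempty,
    (isCompact_hull K).isClosed.closure_eq]

instance isFiniteMeasure_cell (K : Finset (E d)) :
    IsFiniteMeasure ((volume : Measure (E d)).restrict (cell K)) := by
  rw [restrict_cell]
  exact ⟨by rw [Measure.restrict_apply_univ]; exact (isCompact_hull K).measure_lt_top⟩

/-- The gradient of the barycentric coordinate `bary K a`. -/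
def gvec (K : Finset (E d)) (a : E d) : E d :=
  (InnerProductSpace.toDual ℝ (E d)).symm (LinearMap.toContinuousLinearMap (bary K a).linear)

theorem inner_gvec (K : Finset (E d)) (a e : E d) : inner ℝ (gvec K a) e = (bary K a).linear e := by
  rw [gvec, InnerProductSpace.toDual_symm_apply]; rfl

theorem bary_sub (K : Finset (E d)) (a x y : E d) :
    bary K a y - bary K a x = inner ℝ (gvec K a) (y - x) := by
  rw [inner_gvec]
  exact ((bary K a).linearMap_vsub y x).symm

theorem continuous_bary (K : Finset (E d)) (a : E d) : Continuous (bary K a) :=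
  (bary K a).continuous_of_finiteDimensional

theorem IsSimplex.exists_ne (h : IsSimplex K) (hd : d ≠ 0) (a : E d) : ∃ b ∈ K, b ≠ a := by
  have : 1 < K.card := by rw [h.1]; omega
  exact K.exists_mem_ne this a

theorem IsSimplex.gvec_ne_zero (h : IsSimplex K) (hd : d ≠ 0) {a : E d} (ha : a ∈ K) :
    gvec K a ≠ 0 := by
  obtain ⟨b, hb, hba⟩ := h.exists_ne hd a
  intro h0
  have := bary_sub K a b a
  rw [h.bary_self ha, h.bary_ne ha hb hba.symm, h0, inner_zero_left] at this
  norm_num at this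

theorem IsSimplex.sum_gvec (h : IsSimplex K) (e : E d) : ∑ a ∈ K, inner ℝ (gvec K a) e = 0 := by
  have h1 := h.sum_bary e
  have h2 := h.sum_bary 0
  have : ∑ a ∈ K, (bary K a e - bary K a 0) = 0 := by rw [Finset.sum_sub_distrib, h1, h2, sub_self]
  simpa only [bary_sub, sub_zero] using this

/-- Difference of the reproduction identity `sum_bary_smul` at `e` and at 0. Together with
`sum_gvec` it expands any vector along the edges issued from one vertex. -/
theorem IsSimplex.sum_gvec_smul (h : IsSimplex K) (e : E d) :
    ∑ a ∈ K, inner ℝ (gvec K a) e • a = e := by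
  have h1 := h.sum_bary_smul e
  have h2 := h.sum_bary_smul 0
  have : ∑ a ∈ K, (bary K a e - bary K a 0) • a = e := by
    simp_rw [sub_smul]; rw [Finset.sum_sub_distrib, h1, h2, sub_zero]
  simpa only [bary_sub, sub_zero] using this

/-! ## Outward normals -/

/-- The distance from the vertex `a` of `K` to the opposite face. -/
def height (K : Finset (E d)) (a : E d) : ℝ := ‖gvec K a‖⁻¹

/-- The unit normal to the face opposite to `a`, pointing outside `K`. -/
def normalAt (K : Finset (E d)) (a : E d) : E d := -(height K a • gvec K a)

theorem IsSimplex.height_pos (h : IsSimplex K) (hd : d ≠ 0) {a : E d} (ha : a ∈ K) :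
    0 < height K a := inv_pos.2 (norm_pos_iff.2 (h.gvec_ne_zero hd ha))

theorem IsSimplex.norm_normalAt (h : IsSimplex K) (hd : d ≠ 0) {a : E d} (ha : a ∈ K) :
    ‖normalAt K a‖ = 1 := by
  rw [normalAt, norm_neg, norm_smul, height, norm_inv, norm_norm]
  exact inv_mul_cancel₀ (norm_ne_zero_iff.2 (h.gvec_ne_zero hd ha))

theorem inner_normalAt (K : Finset (E d)) (a x y : E d) :
    inner ℝ (y - x) (normalAt K a) = -(height K a * (bary K a y - bary K a x)) := by
  rw [bary_sub, normalAt, inner_neg_right, inner_smul_right, real_inner_comm]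

/-- A normal kills all edges inside the face, so the expansion along edges leaves one term and makes
it a multiple of `gvec K a`. Unit length and the sign condition fix the multiple. This uniqueness
gives access to the chosen `outNormal`. -/
theorem IsSimplex.isOutwardNormal_iff (h : IsSimplex K) (hd : d ≠ 0) {a : E d} (ha : a ∈ K)
    (n : E d) : IsOutwardNormal K (opp K a) n ↔ n = normalAt K a := by
  have hh := h.height_pos hd ha
  have hb0 : ∀ x ∈ opp K a, bary K a x = 0 := fun x hx =>
    h.bary_ne ha (mem_opp.1 hx).2 (mem_opp.1 hx).1.symm
  constructor
  · rintro ⟨h1, h2, h3⟩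
    obtain ⟨b, hb, hba⟩ := h.exists_ne hd a
    have hbF : b ∈ opp K a := mem_opp.2 ⟨hba, hb⟩
    -- expand an arbitrary vector along the edges issued from `b`
    have key : ∀ e : E d, inner ℝ e n = inner ℝ (gvec K a) e * inner ℝ (a - b) n := by
      intro e
      have he : e = ∑ c ∈ K, inner ℝ (gvec K c) e • (c - b) := by
        simp_rw [smul_sub]
        rw [Finset.sum_sub_distrib, h.sum_gvec_smul, ← Finset.sum_smul, h.sum_gvec, zero_smul,
          sub_zero]
      conv_lhs => rw [he]
      rw [sum_inner, Finset.sum_eq_single_of_mem a ha]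
      · rw [real_inner_smul_left]
      · intro c hc hca
        rw [real_inner_smul_left, h2 b hbF c (mem_opp.2 ⟨hca, hc⟩), mul_zero]
    have hn : n = (inner ℝ (a - b) n : ℝ) • gvec K a := by
      refine ext_inner_left ℝ fun e => ?_
      rw [key e, inner_smul_right, real_inner_comm, mul_comm]
    have hle : inner ℝ (a - b) n ≤ (0 : ℝ) := h3 b hbF a ha
    have hnorm : |(inner ℝ (a - b) n : ℝ)| * ‖gvec K a‖ = 1 := by
      rw [← Real.norm_eq_abs, ← norm_smul, ← hn, h1]
    rw [abs_of_nonpos hle] at hnorm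
    have : (inner ℝ (a - b) n : ℝ) = -height K a := by
      rw [height, ← eq_inv_of_mul_eq_one_left hnorm, neg_neg]
    rw [this] at hn
    rw [hn, normalAt, neg_smul]
  · rintro rfl
    refine ⟨h.norm_normalAt hd ha, fun x hx y hy => ?_, fun x hx y hy => ?_⟩
    · rw [inner_normalAt, hb0 x hx, hb0 y hy]; simp
    · rw [inner_normalAt, hb0 x hx, sub_zero, neg_nonpos]
      by_cases hya : y = a
      · rw [hya, h.bary_self ha]; simpa using hh.le
      · rw [h.bary_ne ha hy (Ne.symm hya), mul_zero]

theorem IsSimplex.outNormal_eq (h : IsSimplex K) (hd : d ≠ 0) {a : E d} (ha : a ∈ K) :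
    outNormal K (opp K a) = normalAt K a := by
  have := Classical.epsilon_spec (p := IsOutwardNormal K (opp K a))
    ⟨_, (h.isOutwardNormal_iff hd ha _).2 rfl⟩
  exact (h.isOutwardNormal_iff hd ha _).1 this

end Simplex

/-! ### Polar coordinates around a vertex and the divergence theorem on a simplex -/

section Cone

variable {d : ℕ} {K : Finset (E d)}

theorem bary_lineMap (K : Finset (E d)) (c a y : E d) (t : ℝ) :
    bary K c (a + t • (y - a)) = bary K c a + t * (bary K c y - bary K c a) := by
  have h1 := bary_sub K c a (a + t • (y - a))
  have h2 := bary_sub K c a y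
  rw [add_sub_cancel_left, inner_smul_right, ← h2] at h1
  linarith

/-- On the hyperplane of the face, the homothety of centre `a` and ratio `t` multiplies the other
coordinates by `t` and turns the coordinate of `a` from 0 into `1 - t`. -/
theorem IsSimplex.cone_mem_hull (h : IsSimplex K) {a y : E d} (ha : a ∈ K) (hy : bary K a y = 0)
    {t : ℝ} (ht0 : 0 < t) (ht1 : t ≤ 1) :
    a + t • (y - a) ∈ hull K ↔ y ∈ hull (opp K a) := by
  rw [h.mem_hull_opp ha, h.mem_hull, h.mem_hull]
  have key : ∀ c ∈ K, c ≠ a → bary K c (a + t • (y - a)) = t * bary K c y := fun c hc hca => by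
    rw [bary_lineMap, h.bary_ne hc ha hca]; ring
  have keya : bary K a (a + t • (y - a)) = 1 - t := by
    rw [bary_lineMap, h.bary_self ha, hy]; ring
  constructor
  · refine fun H => ⟨fun c hc => ?_, hy⟩
    by_cases hca : c = a
    · rw [hca, hy]
    · have := H c hc
      rw [key c hc hca] at this
      exact nonneg_of_mul_nonneg_right this ht0
  · rintro ⟨H, -⟩ c hc
    by_cases hca : c = a
    · rw [hca, keya]; linarith
    · rw [key c hc hca]
      exact mul_nonneg ht0.le (H c hc)

/-- The directions of the face of `K` opposite to `a`. -/
abbrev faceDir (K : Finset (E d)) (a : E d) : Submodule ℝ (E d) := (ℝ ∙ normalAt K a)ᗮ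

/-- Cartesian coordinates along the normal and the directions of a face, with origin at the
opposite vertex `a`. -/
def conePt (K : Finset (E d)) (a : E d) (q : ℝ × faceDir K a) : E d :=
  a + (q.1 • normalAt K a + q.2)

/-- Up to translation, this is the orthogonal splitting of the space into the normal line and its
complement, and both factors are parametrized isometrically. -/
theorem IsSimplex.measurePreserving_conePt (h : IsSimplex K) (hd : d ≠ 0) {a : E d} (ha : a ∈ K) :
    MeasurePreserving (conePt K a) volume volume ∧ MeasurableEmbedding (conePt K a) := by
  let s : Submodule ℝ (E d) := ℝ ∙ normalAt K a
  let e1 : ℝ ≃ₗᵢ[ℝ] s := LinearIsometryEquiv.toSpanUnitSingleton (normalAt K a) (h.norm_normalAt hd ha)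
  let e2 : E d ≃ᵐ s × sᗮ := s.measurableEquivProd a
  have m1 : MeasurePreserving e1 volume volume := e1.measurePreserving
  have m2 : MeasurePreserving e2 volume volume := by
    have := s.measurePreserving_measurableEquivProd a
    rwa [InnerProductSpace.euclideanHausdorffMeasure_eq_volume] at this
  have m3 : MeasurePreserving (Prod.map e1 (id : sᗮ → sᗮ)) (volume.prod volume)
    (volume.prod volume) := m1.prod (MeasurePreserving.id _)
  have heq : conePt K a = e2.symm ∘ (Prod.map e1 (id : sᗮ → sᗮ)) := by
    ext1 q
    simp only [Function.comp, e2, Submodule.measurableEquivProd_symm_apply, conePt]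
    rw [vadd_eq_add, add_comm]
    rfl
  rw [heq]
  refine ⟨m2.symm.comp m3, e2.symm.measurableEmbedding.comp ?_⟩
  exact e1.toHomeomorph.measurableEmbedding.prodMap MeasurableEmbedding.id

theorem inner_normalAt_faceDir (K : Finset (E d)) (a : E d) (z : faceDir K a) :
    inner ℝ (z : E d) (normalAt K a) = 0 := by
  have := (Submodule.mem_orthogonal _ _).1 z.2 (normalAt K a) (Submodule.mem_span_singleton_self _)
  rwa [real_inner_comm]

/-- The first parameter is the distance from `a` to the slice, along the outward normal. It runs
from 0 at the vertex to the height on the opposite face. -/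
theorem IsSimplex.bary_conePt (h : IsSimplex K) (hd : d ≠ 0) {a : E d} (ha : a ∈ K)
    (q : ℝ × faceDir K a) : height K a * bary K a (conePt K a q) = height K a - q.1 := by
  have h1 := inner_normalAt K a a (conePt K a q)
  rw [h.bary_self ha, conePt, add_sub_cancel_left, inner_add_left, inner_smul_left,
    inner_normalAt_faceDir, real_inner_self_eq_norm_sq, h.norm_normalAt hd ha] at h1
  simp only [conj_trivial, one_pow, mul_one, add_zero] at h1
  rw [conePt]
  linarith

theorem IsSimplex.bary_conePt_height (h : IsSimplex K) (hd : d ≠ 0) {a : E d} (ha : a ∈ K)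
    (z : faceDir K a) : bary K a (conePt K a (height K a, z)) = 0 := by
  have h1 := h.bary_conePt hd ha (height K a, z)
  rw [sub_self] at h1
  exact (mul_eq_zero.1 h1).resolve_left (h.height_pos hd ha).ne'

theorem IsSimplex.finrank_faceDir (h : IsSimplex K) (hd : d ≠ 0) {a : E d} (ha : a ∈ K) :
    Module.finrank ℝ (faceDir K a) = d - 1 := by
  apply Submodule.finrank_add_finrank_orthogonal'
  rw [finrank_span_singleton, finrank_euclideanSpace_fin]
  · omega
  · intro h0
    have := h.norm_normalAt hd ha
    rw [h0, norm_zero] at this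
    norm_num at this

theorem isometry_conePt (K : Finset (E d)) (a : E d) (s : ℝ) :
    Isometry fun z : faceDir K a => conePt K a (s, z) := by
  refine Isometry.of_dist_eq fun z w => ?_
  simp [conePt, dist_eq_norm]

/-- The part of the parameter space that describes the face opposite to `a`. -/
def facePre (K : Finset (E d)) (a : E d) : Set (faceDir K a) :=
  (fun z => conePt K a (height K a, z)) ⁻¹' hull (opp K a)

theorem isCompact_facePre (K : Finset (E d)) (a : E d) : IsCompact (facePre K a) :=
  (isometry_conePt K a _).isClosedEmbedding.isCompact_preimage (isCompact_hull _)

/-- Isometries transport Hausdorff measure, and on the `d - 1` dimensional direction space the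
normalized Hausdorff measure is Lebesgue measure. Surface integrals thus become Lebesgue integrals
over `facePre`. -/
theorem IsSimplex.faceMeasure_eq_map (h : IsSimplex K) (hd : d ≠ 0) {a : E d} (ha : a ∈ K) :
    faceMeasure (opp K a) =
      (volume.restrict (facePre K a)).map fun z => conePt K a (height K a, z) := by
  have hi := isometry_conePt K a (height K a)
  have h1 := hi.map_euclideanHausdorffMeasure (d := Module.finrank ℝ (faceDir K a))
  rw [InnerProductSpace.euclideanHausdorffMeasure_eq_volume, h.finrank_faceDir hd ha] at h1
  have hm : MeasurableSet (hull (opp K a)) := (isCompact_hull _).measurableSet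
  rw [facePre, ← Measure.restrict_map hi.continuous.measurable hm, h1, Measure.restrict_restrict hm,
    faceMeasure, Set.inter_eq_left.2]
  intro y hy
  have hy0 := ((h.mem_hull_opp ha).1 hy).2
  have hinner := inner_normalAt K a a y
  rw [hy0, h.bary_self ha] at hinner
  refine ⟨⟨y - a - height K a • normalAt K a, ?_⟩, ?_⟩
  · rw [Submodule.mem_orthogonal_singleton_iff_inner_left, inner_sub_left, hinner, inner_smul_left,
      real_inner_self_eq_norm_sq, h.norm_normalAt hd ha]
    simp
  · simp [conePt]

theorem IsSimplex.integral_face (h : IsSimplex K) (hd : d ≠ 0) {a : E d} (ha : a ∈ K)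
    (f : E d → ℂ) : ∫ y, f y ∂faceMeasure (opp K a) =
      ∫ z in facePre K a, f (conePt K a (height K a, z)) := by
  rw [h.faceMeasure_eq_map hd ha,
    (isometry_conePt K a _).isClosedEmbedding.measurableEmbedding.integral_map]

theorem IsSimplex.isFiniteMeasure_face (h : IsSimplex K) (hd : d ≠ 0) {a : E d} (ha : a ∈ K) :
    IsFiniteMeasure (faceMeasure (opp K a)) := by
  rw [h.faceMeasure_eq_map hd ha]
  have : IsFiniteMeasure (volume.restrict (facePre K a)) :=
    ⟨by rw [Measure.restrict_apply_univ]; exact (isCompact_facePre K a).measure_lt_top⟩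
  infer_instance

theorem conePt_smul (K : Finset (E d)) (a : E d) (t s : ℝ) (z : faceDir K a) :
    conePt K a (t * s, t • z) = a + t • (conePt K a (s, z) - a) := by
  simp [conePt, mul_smul]

/-- Integration over a simplex in polar coordinates around a vertex. -/
theorem IsSimplex.integral_cone (h : IsSimplex K) (hd : d ≠ 0) {a : E d} (ha : a ∈ K)
    {f : E d → ℂ} (hf : Continuous f) :
    ∫ x in cell K, f x = ∫ y, ((height K a : ℂ) * ∫ t in (0 : ℝ)..1,
      (t ^ (d - 1) : ℝ) • f (a + t • (y - a))) ∂faceMeasure (opp K a) := by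
  have hh := h.height_pos hd ha
  set η := height K a
  have hmK : MeasurableSet (hull K) := (isCompact_hull K).measurableSet
  have hmF : MeasurableSet (facePre K a) := (isCompact_facePre K a).measurableSet
  obtain ⟨mp, me⟩ := h.measurePreserving_conePt hd ha
  let g : E d → ℂ := (hull K).indicator f
  have hg : Integrable g := (hf.continuousOn.integrableOn_compact (isCompact_hull K)).integrable_indicator hmK
  have hgc : Integrable (fun q => g (conePt K a q)) (volume.prod volume) := mp.integrable_comp_of_integrable hg
  have hcone : ∫ x in cell K, f x = ∫ s : ℝ, ∫ z : faceDir K a, g (conePt K a (s, z)) := by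
    rw [restrict_cell, ← integral_indicator hmK, ← mp.integral_comp me, Measure.volume_eq_prod,
      integral_prod _ hgc]
  -- Slices outside `[0, η]` miss the simplex, since the coordinate of `a` lies in `[0, 1]` there.
  have hslice : ∫ s : ℝ, ∫ z : faceDir K a, g (conePt K a (s, z))
      = ∫ s in (0 : ℝ)..η, ∫ z : faceDir K a, g (conePt K a (s, z)) := by
    rw [intervalIntegral.integral_of_le hh.le, integral_Ioc_eq_integral_Ioo,
      ← integral_Icc_eq_integral_Ioo, ← integral_indicator measurableSet_Icc]
    congr 1
    ext s
    by_cases hs : s ∈ Set.Icc 0 η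
    · rw [Set.indicator_of_mem hs]
    · rw [Set.indicator_of_notMem hs]
      apply integral_eq_zero_of_ae
      refine ae_of_all _ fun z => ?_
      apply Set.indicator_of_notMem
      intro hz
      apply hs
      have hb := h.bary_conePt hd ha (s, z)
      have h0 := h.mem_hull.1 hz a ha
      have h1 : bary K a (conePt K a (s, z)) ≤ 1 := by
        rw [← h.sum_bary (conePt K a (s, z))]
        exact Finset.single_le_sum (fun c hc => h.mem_hull.1 hz c hc) ha
      constructor
      · have := mul_le_mul_of_nonneg_left h1 hh.le
        simp only at hb
        linarith
      · have := mul_nonneg hh.le h0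
        simp only at hb
        linarith
  have hscale : ∫ s in (0 : ℝ)..η, ∫ z : faceDir K a, g (conePt K a (s, z))
      = (η : ℂ) * ∫ t in (0 : ℝ)..1, ∫ z in facePre K a,
          (t ^ (d - 1) : ℝ) • f (a + t • (conePt K a (η, z) - a)) := by
    have := intervalIntegral.smul_integral_comp_mul_left (a := 0) (b := 1)
      (fun s => ∫ z : faceDir K a, g (conePt K a (s, z))) η
    rw [mul_zero, mul_one] at this
    rw [← this, Complex.real_smul]
    congr 1
    apply intervalIntegral.integral_congr_ae
    refine ae_of_all _ fun t ht => ?_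
    rw [Set.uIoc_of_le zero_le_one] at ht
    have h2 := Measure.integral_comp_smul (volume : Measure (faceDir K a))
      (fun z => g (conePt K a (η * t, z))) t
    have htp : 0 < t ^ (d - 1) := pow_pos ht.1 _
    rw [h.finrank_faceDir hd ha, abs_of_pos (inv_pos.2 htp), eq_inv_smul_iff₀ htp.ne',
      ← integral_smul] at h2
    rw [← h2, ← integral_indicator hmF]
    congr 1
    ext z
    rw [mul_comm η t, conePt_smul]
    change _ • (hull K).indicator f _ = _
    have hiff := h.cone_mem_hull ha (h.bary_conePt_height hd ha z) ht.1 ht.2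
    by_cases hz : z ∈ facePre K a
    · rw [Set.indicator_of_mem hz, Set.indicator_of_mem (s := hull K) (hiff.2 hz)]
    · rw [Set.indicator_of_notMem hz, Set.indicator_of_notMem (s := hull K) (fun H => hz (hiff.1 H)), smul_zero]
  rw [hcone, hslice, hscale, integral_const_mul, h.integral_face hd ha]
  congr 1
  simp_rw [intervalIntegral.integral_of_le zero_le_one]
  apply integral_integral_swap
  rw [Measure.prod_restrict]
  have hc : Continuous (Function.uncurry fun (t : ℝ) (z : faceDir K a) =>
      (t ^ (d - 1) : ℝ) • f (a + t • (conePt K a (η, z) - a))) := by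
    have h1 : Continuous fun p : ℝ × faceDir K a => conePt K a (η, p.2) :=
      (isometry_conePt K a η).continuous.comp continuous_snd
    exact (continuous_fst.pow _).smul
      (hf.comp (continuous_const.add (continuous_fst.smul (h1.sub continuous_const))))
  exact (hc.continuousOn.integrableOn_compact (isCompact_Icc.prod (isCompact_facePre K a))).mono_set
    (Set.prod_mono Set.Ioc_subset_Icc_self subset_rfl)

/-- The divergence theorem on a simplex for the field `ψ(x) (x - a)`. -/
theorem IsSimplex.integral_radial (h : IsSimplex K) (hd : d ≠ 0) {a : E d} (ha : a ∈ K)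
    {ψ : E d → ℂ} (hψ : ContDiff ℝ 1 ψ) :
    ∫ x in cell K, ((d : ℂ) * ψ x + fderiv ℝ ψ x (x - a)) =
      (height K a : ℂ) * ∫ y, ψ y ∂faceMeasure (opp K a) := by
  have hψ' : Continuous (fderiv ℝ ψ) := hψ.continuous_fderiv one_ne_zero
  rw [h.integral_cone hd ha (by have := hψ.continuous; fun_prop), ← integral_const_mul]
  congr 1
  ext y
  congr 1
  -- Along a ray the integrand is an exact derivative, so the radial integral reduces to the
  -- endpoint on the face. The other endpoint contributes 0 because `d ≠ 0`.
  have hder : ∀ t : ℝ, HasDerivAt (fun t : ℝ => (t ^ d : ℝ) • ψ (a + t • (y - a)))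
      ((t ^ (d - 1) : ℝ) • ((d : ℂ) * ψ (a + t • (y - a))
        + fderiv ℝ ψ (a + t • (y - a)) (a + t • (y - a) - a))) t := by
    intro t
    have h1 : HasDerivAt (fun t : ℝ => a + t • (y - a)) (y - a) t := by
      simpa using ((hasDerivAt_id t).smul_const (y - a)).const_add a
    have h2 := ((hψ.differentiable one_ne_zero) (a + t • (y - a))).hasFDerivAt.comp_hasDerivAt t h1
    have h3 := (hasDerivAt_pow d t).smul h2
    convert! h3 using 1
    rw [add_sub_cancel_left, map_smul]
    obtain ⟨m, rfl⟩ := Nat.exists_eq_succ_of_ne_zero hd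
    simp only [Nat.succ_sub_one, Function.comp, smul_add, Complex.real_smul, pow_succ]
    push_cast
    ring
  rw [intervalIntegral.integral_eq_sub_of_hasDerivAt (fun t _ => hder t)]
  · simp [hd]
  · apply Continuous.intervalIntegrable
    have := hψ.continuous
    fun_prop

theorem integrableOn_cell {f : E d → ℂ} (hf : Continuous f) :
    Integrable f ((volume : Measure (E d)).restrict (cell K)) := by
  rw [restrict_cell]
  exact hf.continuousOn.integrableOn_compact (isCompact_hull K)

/-- The divergence theorem on a simplex. -/
theorem IsSimplex.integral_fderiv (h : IsSimplex K) (hd : d ≠ 0) {ψ : E d → ℂ}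
    (hψ : ContDiff ℝ 1 ψ) (e : E d) :
    ∫ x in cell K, fderiv ℝ ψ x e =
      ∑ a ∈ K, ((inner ℝ (normalAt K a) e : ℝ) : ℂ) * ∫ y, ψ y ∂faceMeasure (opp K a) := by
  have hψc := hψ.continuous
  have hψ' : Continuous (fderiv ℝ ψ) := hψ.continuous_fderiv one_ne_zero
  -- Combine the radial identities of all vertices with weights minus `gvec K a · e`. The part
  -- common to all vertices cancels because the gradients sum to zero, and `sum_gvec_smul` leaves
  -- the derivative in direction `e`.
  have hterm : ∀ a ∈ K, ((inner ℝ (normalAt K a) e : ℝ) : ℂ) * ∫ y, ψ y ∂faceMeasure (opp K a)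
      = ∫ x in cell K, -((inner ℝ (gvec K a) e : ℝ) : ℂ) *
          ((d : ℂ) * ψ x + fderiv ℝ ψ x (x - a)) := by
    intro a ha
    rw [integral_const_mul, h.integral_radial hd ha hψ, normalAt, inner_neg_left,
      real_inner_smul_left]
    push_cast
    ring
  rw [Finset.sum_congr rfl hterm, ← integral_finsetSum]
  · congr 1
    ext x
    have h1 : ∀ a ∈ K, -((inner ℝ (gvec K a) e : ℝ) : ℂ) * ((d : ℂ) * ψ x + fderiv ℝ ψ x (x - a))
        = -((inner ℝ (gvec K a) e : ℝ) : ℂ) * ((d : ℂ) * ψ x + fderiv ℝ ψ x x)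
          + fderiv ℝ ψ x ((inner ℝ (gvec K a) e : ℝ) • a) := by
      intro a _
      rw [map_sub, map_smul, Complex.real_smul]
      ring
    rw [Finset.sum_congr rfl h1, Finset.sum_add_distrib, ← Finset.sum_mul, ← map_sum,
      h.sum_gvec_smul, Finset.sum_neg_distrib, ← Complex.ofReal_sum, h.sum_gvec]
    simp
  · intro a _
    apply integrableOn_cell
    fun_prop

end Cone

/-! ### Smooth functions on a simplex: integration by parts and trace inequality -/

section Smooth

variable {d : ℕ} {K : Finset (E d)}

theorem fderiv_eq_sum {φ : E d → ℂ} (x e : E d) :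
    fderiv ℝ φ x e = ∑ i, (e i : ℂ) * pderiv i φ x := by
  conv_lhs => rw [← (EuclideanSpace.basisFun (Fin d) ℝ).sum_repr e]
  rw [map_sum]
  refine Finset.sum_congr rfl fun i _ => ?_
  rw [map_smul, Complex.real_smul]
  simp [pderiv]

theorem norm_fderiv_le {φ : E d → ℂ} (x e : E d) : ‖fderiv ℝ φ x e‖ ≤ ‖e‖ * ‖cgrad φ x‖ := by
  rw [fderiv_eq_sum]
  let e' : V d := WithLp.toLp 2 fun i => (e i : ℂ)
  have h1 : ∑ i, (e i : ℂ) * pderiv i φ x = inner ℂ e' (cgrad φ x) := by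
    rw [PiLp.inner_apply]
    refine Finset.sum_congr rfl fun i _ => ?_
    simp [e', cgrad, mul_comm]
  have h2 : ‖e'‖ = ‖e‖ := by
    simp [EuclideanSpace.norm_eq, e']
  rw [h1, ← h2]
  exact norm_inner_le_norm _ _

theorem continuous_cgrad {φ : E d → ℂ} (hφ : ContDiff ℝ 1 φ) : Continuous (cgrad φ) := by
  have := hφ.continuous_fderiv one_ne_zero
  unfold cgrad pderiv
  fun_prop

theorem continuous_pderiv {φ : E d → ℂ} (hφ : ContDiff ℝ 1 φ) (i : Fin d) :
    Continuous (pderiv i φ) :=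
  (hφ.continuous_fderiv one_ne_zero).clm_apply continuous_const

theorem memLp_cell {G : Type*} [NormedAddCommGroup G] {f : E d → G} (hf : Continuous f) :
    MemLp f 2 ((volume : Measure (E d)).restrict (cell K)) := by
  obtain ⟨B, hB⟩ := (isCompact_hull K).exists_bound_of_continuousOn hf.continuousOn
  refine MemLp.of_bound hf.aestronglyMeasurable B ?_
  filter_upwards [ae_restrict_mem (isOpen_cell K).measurableSet] with x hx
  exact hB x (cell_subset_hull K hx)

theorem contDiff_conj {n : WithTop ℕ∞} {η : E d → ℂ} (hη : ContDiff ℝ n η) :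
    ContDiff ℝ n fun x => conj (η x) :=
  Complex.conjCLE.contDiff.comp hη

theorem fderiv_mul_conj {φ η : E d → ℂ} (hφ : ContDiff ℝ 1 φ) (hη : ContDiff ℝ 1 η) (x e : E d) :
    fderiv ℝ (fun y => φ y * conj (η y)) x e =
      fderiv ℝ φ x e * conj (η x) + φ x * conj (fderiv ℝ η x e) := by
  have h1 := (hφ.differentiable one_ne_zero x).hasFDerivAt
  have h2 : HasFDerivAt (fun y => conj (η y)) ((Complex.conjCLE : ℂ →L[ℝ] ℂ).comp (fderiv ℝ η x)) x :=
    (Complex.conjCLE : ℂ →L[ℝ] ℂ).hasFDerivAt.comp x (hη.differentiable one_ne_zero x).hasFDerivAt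
  have h3 : HasFDerivAt (fun y => φ y * conj (η y)) _ x := h1.mul h2
  rw [h3.fderiv]
  simp
  ring

/-- Integration by parts on a simplex, for smooth functions. -/
theorem IsSimplex.green_smooth (h : IsSimplex K) (hd : d ≠ 0) {φ η : E d → ℂ}
    (hφ : ContDiff ℝ 1 φ) (hη : ContDiff ℝ 1 η) (i : Fin d) :
    ∫ x in cell K, (pderiv i φ x * conj (η x) + φ x * conj (pderiv i η x)) =
      ∑ a ∈ K, (normalAt K a i : ℂ) * ∫ y, φ y * conj (η y) ∂faceMeasure (opp K a) := by
  have := h.integral_fderiv hd (hφ.mul (contDiff_conj hη)) (EuclideanSpace.single i 1)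
  simp only [fderiv_mul_conj hφ hη] at this
  rw [show (∫ x in cell K, (pderiv i φ x * conj (η x) + φ x * conj (pderiv i η x))) = _ from this]
  refine Finset.sum_congr rfl fun a _ => ?_
  rw [EuclideanSpace.inner_single_right]
  simp

theorem eLpNorm_two_eq {α G : Type*} [MeasurableSpace α] [NormedAddCommGroup G] {μ : Measure α}
    {f : α → G} (hf : MemLp f 2 μ) : eLpNorm f 2 μ = ENNReal.ofReal √(∫ x, ‖f x‖ ^ 2 ∂μ) := by
  rw [hf.eLpNorm_eq_integral_rpow_norm two_ne_zero ENNReal.ofNat_ne_top, Real.sqrt_eq_rpow]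
  simp

/-- Continuous functions are square-integrable on faces. -/
theorem IsSimplex.memLp_face (h : IsSimplex K) (hd : d ≠ 0) {a : E d} (ha : a ∈ K)
    {f : E d → ℂ} (hf : Continuous f) : MemLp f 2 (faceMeasure (opp K a)) := by
  have := h.isFiniteMeasure_face hd ha
  obtain ⟨B, hB⟩ := (isCompact_hull (opp K a)).exists_bound_of_continuousOn hf.continuousOn
  refine MemLp.of_bound hf.aestronglyMeasurable B ?_
  rw [faceMeasure]
  filter_upwards [ae_restrict_mem (isCompact_hull (opp K a)).measurableSet] with x hx
  exact hB x hx

/-- The trace inequality for smooth functions. -/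
theorem IsSimplex.trace_inequality (h : IsSimplex K) (hd : d ≠ 0) {a : E d} (ha : a ∈ K) :
    ∃ C : ℝ, 0 ≤ C ∧ ∀ φ : E d → ℂ, ContDiff ℝ 1 φ →
      eLpNorm φ 2 (faceMeasure (opp K a)) ≤ ENNReal.ofReal C *
        (eLpNorm φ 2 (volume.restrict (cell K)) + eLpNorm (cgrad φ) 2 (volume.restrict (cell K))) := by
  have hh := h.height_pos hd ha
  have := h.isFiniteMeasure_face hd ha
  obtain ⟨R, hR⟩ := (isCompact_hull K).isBounded.subset_closedBall a
  -- The truncation at 0 supplies nonnegativity of the radius, which the constant needs.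
  set R' := max R 0
  have hR0 : 0 ≤ R' := le_max_right _ _
  refine ⟨√((d + R') / height K a), Real.sqrt_nonneg _, fun φ hφ => ?_⟩
  have hφc := hφ.continuous
  have hc : Continuous fun x => ‖φ x‖ ^ 2 := by fun_prop
  have hgc : Continuous fun x => ‖cgrad φ x‖ ^ 2 := ((continuous_cgrad hφ).norm).pow 2
  have m1 : MemLp φ 2 (faceMeasure (opp K a)) := h.memLp_face hd ha hφc
  have m2 : MemLp φ 2 (volume.restrict (cell K)) := memLp_cell hφc
  have m3 : MemLp (cgrad φ) 2 (volume.restrict (cell K)) := memLp_cell (continuous_cgrad hφ)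
  have i2 := m2.integrable_norm_pow two_ne_zero
  have i3 := m3.integrable_norm_pow two_ne_zero
  rw [eLpNorm_two_eq m1, eLpNorm_two_eq m2, eLpNorm_two_eq m3,
    ← ENNReal.ofReal_add (Real.sqrt_nonneg _) (Real.sqrt_nonneg _),
    ← ENNReal.ofReal_mul (Real.sqrt_nonneg _)]
  apply ENNReal.ofReal_le_ofReal
  -- This is the radial identity for `|φ|²`. The field `x - a` is tangent to every face through `a`,
  -- so only the opposite face is seen; its derivative term is controlled by `R'` and the gradient.
  have key : height K a * ∫ y, ‖φ y‖ ^ 2 ∂faceMeasure (opp K a) ≤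
      (d + R') * ((∫ x in cell K, ‖φ x‖ ^ 2) + ∫ x in cell K, ‖cgrad φ x‖ ^ 2) := by
    have hrad := h.integral_radial hd ha (hφ.mul (contDiff_conj hφ))
    have hreal : ∫ y, φ y * conj (φ y) ∂faceMeasure (opp K a)
        = ((∫ y, ‖φ y‖ ^ 2 ∂faceMeasure (opp K a) : ℝ) : ℂ) := by
      rw [← integral_complex_ofReal]
      congr 1; ext y
      rw [Complex.mul_conj, Complex.normSq_eq_norm_sq]
    have hn := congrArg norm hrad
    rw [hreal, ← Complex.ofReal_mul, Complex.norm_real, Real.norm_of_nonneg (by positivity)] at hn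
    rw [← hn, ← integral_add i2 i3, ← integral_const_mul]
    refine norm_integral_le_of_norm_le ((i2.add i3).const_mul _) ?_
    filter_upwards [ae_restrict_mem (isOpen_cell K).measurableSet] with x hx
    have hxa : ‖x - a‖ ≤ R' := by
      have := hR (cell_subset_hull K hx)
      rw [Metric.mem_closedBall, dist_eq_norm] at this
      exact this.trans (le_max_left _ _)
    rw [fderiv_mul_conj hφ hφ]
    have hD : ‖fderiv ℝ φ x (x - a)‖ ≤ R' * ‖cgrad φ x‖ :=
      (norm_fderiv_le x _).trans (mul_le_mul_of_nonneg_right hxa (norm_nonneg _))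
    calc ‖(d : ℂ) * (φ x * conj (φ x)) + (fderiv ℝ φ x (x - a) * conj (φ x)
            + φ x * conj (fderiv ℝ φ x (x - a)))‖
        ≤ d * ‖φ x‖ ^ 2 + (‖fderiv ℝ φ x (x - a)‖ * ‖φ x‖ + ‖φ x‖ * ‖fderiv ℝ φ x (x - a)‖) := by
          refine (norm_add_le _ _).trans (add_le_add ?_ ((norm_add_le _ _).trans ?_))
          · simp [pow_two]
          · simp only [norm_mul, RCLike.norm_conj]; rfl
      _ ≤ d * ‖φ x‖ ^ 2 + (R' * ‖cgrad φ x‖ * ‖φ x‖ + ‖φ x‖ * (R' * ‖cgrad φ x‖)) := by gcongr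
      _ ≤ (d + R') * (‖φ x‖ ^ 2 + ‖cgrad φ x‖ ^ 2) := by
          have hd0 : (0 : ℝ) ≤ d := Nat.cast_nonneg d
          nlinarith [mul_nonneg hR0 (sq_nonneg (‖φ x‖ - ‖cgrad φ x‖)),
            mul_nonneg hd0 (sq_nonneg (‖cgrad φ x‖))]
  have hA : 0 ≤ ∫ x in cell K, ‖φ x‖ ^ 2 := integral_nonneg fun x => by positivity
  have hB : 0 ≤ ∫ x in cell K, ‖cgrad φ x‖ ^ 2 := integral_nonneg fun x => by positivity
  calc √(∫ y, ‖φ y‖ ^ 2 ∂faceMeasure (opp K a))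
      ≤ √((d + R') / height K a * ((∫ x in cell K, ‖φ x‖ ^ 2) + ∫ x in cell K, ‖cgrad φ x‖ ^ 2)) := by
        apply Real.sqrt_le_sqrt
        rw [div_mul_eq_mul_div, le_div_iff₀ hh, mul_comm]
        exact key
    _ = √((d + R') / height K a) * √((∫ x in cell K, ‖φ x‖ ^ 2) + ∫ x in cell K, ‖cgrad φ x‖ ^ 2) :=
        Real.sqrt_mul (by positivity) _
    _ ≤ _ := by
        gcongr
        rw [Real.sqrt_le_left (by positivity), add_sq, Real.sq_sqrt hA, Real.sq_sqrt hB]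
        have := mul_nonneg (Real.sqrt_nonneg (∫ x in cell K, ‖φ x‖ ^ 2))
          (Real.sqrt_nonneg (∫ x in cell K, ‖cgrad φ x‖ ^ 2))
        linarith

end Smooth

/-! ### Averages of contractions in L² -/

section Averaging

variable {d : ℕ} {G : Type*} [NormedAddCommGroup G]

theorem eLpNorm_two_sq {α G : Type*} [MeasurableSpace α] [NormedAddCommGroup G] {μ : Measure α}
    (f : α → G) : eLpNorm f 2 μ ^ 2 = ∫⁻ x, ‖f x‖ₑ ^ 2 ∂μ := by
  rw [eLpNorm_eq_lintegral_rpow_enorm_toReal two_ne_zero ENNReal.ofNat_ne_top]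
  simp only [ENNReal.toReal_ofNat, ← ENNReal.rpow_natCast, ← ENNReal.rpow_mul]
  norm_num

/-- The contraction of ratio `1 - ε` towards `y`, evaluated at `x`. -/
def contract (ε : ℝ) (q : E d × E d) : E d := (1 - ε) • q.1 + ε • q.2

theorem continuous_contract (ε : ℝ) : Continuous (contract (d := d) ε) := by
  unfold contract; fun_prop

/-- The Jacobian of the contraction is `(1 - ε) ^ d`, and `ε ≤ 1/2` bounds its inverse by `2 ^ d`.
The bound does not depend on the centre `y`, so it survives averaging over `y`. -/
theorem lintegral_contract_le {ε : ℝ} (h1 : ε ≤ 1 / 2) {f : E d → ℝ≥0∞}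
    (hf : Measurable f) (y : E d) :
    ∫⁻ x, f (contract ε (x, y)) ≤ ENNReal.ofReal (2 ^ d) * ∫⁻ x, f x := by
  have hp : 0 < 1 - ε := by linarith
  have hr : (1 - ε) ≠ 0 := hp.ne'
  have h2 := lintegral_map (μ := (volume : Measure (E d))) (f := fun x => f (x + ε • y))
    (g := fun x : E d => (1 - ε) • x) (by fun_prop) (by fun_prop)
  rw [Measure.map_addHaar_smul _ hr, lintegral_smul_measure,
    lintegral_add_right_eq_self (fun x => f x)] at h2
  unfold contract
  simp only
  rw [← h2, smul_eq_mul]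
  gcongr
  rw [finrank_euclideanSpace_fin, abs_of_pos (by positivity), ← inv_pow]
  gcongr
  rw [inv_le_comm₀ hp two_pos]
  linarith

theorem eLpNorm_comp_contract_le {ε : ℝ} (h1 : ε ≤ 1 / 2) {w : E d → G}
    (hw : StronglyMeasurable w) (ν : Measure (E d)) [IsProbabilityMeasure ν] (D : Set (E d)) :
    eLpNorm (w ∘ contract ε) 2 ((volume.restrict D).prod ν) ≤
      ENNReal.ofReal (2 ^ d) * eLpNorm w 2 volume := by
  have hm : Measurable fun x => ‖w x‖ₑ ^ 2 := hw.enorm.pow_const 2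
  rw [← ENNReal.pow_le_pow_left_iff two_ne_zero, mul_pow, eLpNorm_two_sq, eLpNorm_two_sq,
    lintegral_prod_symm (fun q => ‖(w ∘ contract ε) q‖ₑ ^ 2)
      (hm.comp (continuous_contract ε).measurable).aemeasurable]
  refine (lintegral_mono (g := fun _ => ENNReal.ofReal (2 ^ d) * ∫⁻ x, ‖w x‖ₑ ^ 2) fun y =>
    (setLIntegral_le_lintegral _ _).trans (lintegral_contract_le h1 hm y)).trans ?_
  rw [lintegral_const, measure_univ, mul_one]
  gcongr
  -- The sharp constant would be the square root of `2 ^ d`; the cruder one avoids the root and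
  -- suffices.
  apply le_self_pow₀ _ two_ne_zero
  rw [ENNReal.one_le_ofReal]
  exact one_le_pow₀ one_le_two

/-- Contractions of small ratio towards points of a bounded set converge to the identity
in `L²`. -/
theorem tendsto_eLpNorm_contract [NormedSpace ℝ G] {D : Set (E d)} (hDm : MeasurableSet D)
    (hD : Bornology.IsBounded D) {w : E d → G}
    (hw : StronglyMeasurable w) (hw2 : MemLp w 2 volume)
    (ν : Measure (E d)) [IsProbabilityMeasure ν] (hν : ∀ᵐ y ∂ν, y ∈ D)
    {ε : ℕ → ℝ} (hε0 : ∀ n, 0 ≤ ε n) (hε1 : ∀ n, ε n ≤ 1 / 2) (hε : Tendsto ε atTop (𝓝 0)) :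
    Tendsto (fun n => eLpNorm (fun q => w (contract (ε n) q) - w q.1) 2
      ((volume.restrict D).prod ν)) atTop (𝓝 0) := by
  have hfin : IsFiniteMeasure ((volume : Measure (E d)).restrict D) :=
    ⟨by rw [Measure.restrict_apply_univ]; exact hD.measure_lt_top⟩
  set P := ((volume : Measure (E d)).restrict D).prod ν
  rw [ENNReal.tendsto_atTop_zero]
  intro δ hδ
  wlog hδt : δ ≠ ⊤ generalizing δ
  · exact ⟨0, fun n _ => by rw [not_not.1 hδt]; exact le_top⟩
  -- There will be three errors: the approximation by a compactly supported continuous function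
  -- after contraction, which costs the factor `2 ^ d`, the modulus of continuity of that function,
  -- and the approximation itself.
  obtain ⟨δ₁, hδ₁, hδ₁'⟩ : ∃ δ₁ : ℝ≥0∞, δ₁ ≠ 0 ∧ ENNReal.ofReal (2 ^ d) * δ₁ + δ₁ + δ₁ ≤ δ := by
    refine ⟨δ / (ENNReal.ofReal (2 ^ d) + 1 + 1), (ENNReal.div_pos hδ.ne' (by simp)).ne', ?_⟩
    rw [show ENNReal.ofReal (2 ^ d) * (δ / (ENNReal.ofReal (2 ^ d) + 1 + 1)) +
      δ / (ENNReal.ofReal (2 ^ d) + 1 + 1) + δ / (ENNReal.ofReal (2 ^ d) + 1 + 1)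
      = (ENNReal.ofReal (2 ^ d) + 1 + 1) * (δ / (ENNReal.ofReal (2 ^ d) + 1 + 1)) by ring]
    exact ENNReal.mul_div_le
  obtain ⟨c, hcs, hcle, hcc, hcm⟩ := hw2.exists_hasCompactSupport_eLpNorm_sub_le
    ENNReal.ofNat_ne_top hδ₁
  have huc := hcs.uniformContinuous_of_continuous hcc
  obtain ⟨τ, hτ, hτ'⟩ : ∃ τ : ℝ, 0 < τ ∧ P Set.univ ^ (2 : ℝ≥0∞).toReal⁻¹ * ENNReal.ofReal τ ≤ δ₁ := by
    have hPt : P Set.univ ^ (2 : ℝ≥0∞).toReal⁻¹ ≠ ⊤ :=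
      ENNReal.rpow_ne_top_of_nonneg (by positivity) (measure_ne_top _ _)
    have : Tendsto (fun τ : ℝ => P Set.univ ^ (2 : ℝ≥0∞).toReal⁻¹ * ENNReal.ofReal τ) (𝓝[>] 0)
        (𝓝 0) := by
      have h1 : Tendsto (fun τ : ℝ => ENNReal.ofReal τ) (𝓝[>] 0) (𝓝 0) := by
        have := (ENNReal.continuous_ofReal.tendsto 0).mono_left
          (nhdsWithin_le_nhds (s := Set.Ioi (0 : ℝ)))
        simpa using this
      simpa using ENNReal.Tendsto.const_mul h1 (Or.inr hPt)
    obtain ⟨τ, h1, h2⟩ := ((this.eventually (ge_mem_nhds (pos_iff_ne_zero.2 hδ₁))).and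
      self_mem_nhdsWithin).exists
    exact ⟨τ, h2, h1⟩
  obtain ⟨κ, hκ, hκ'⟩ := Metric.uniformContinuous_iff.1 huc τ hτ
  obtain ⟨R, hR⟩ := hD.exists_norm_le
  have hsmall : ∀ᶠ n in atTop, ε n * (2 * R) < κ := by
    have : Tendsto (fun n => ε n * (2 * R)) atTop (𝓝 0) := by simpa using hε.mul_const (2 * R)
    exact this.eventually (gt_mem_nhds hκ)
  obtain ⟨N, hN⟩ := eventually_atTop.1 hsmall
  refine ⟨N, fun n hn => le_trans ?_ hδ₁'⟩
  have hS := (continuous_contract (d := d) (ε n))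
  have hm1 : AEStronglyMeasurable ((w - c) ∘ contract (ε n)) P :=
    ((hw.sub hcc.stronglyMeasurable).comp_measurable hS.measurable).aestronglyMeasurable
  have hm2 : AEStronglyMeasurable (fun q => c (contract (ε n) q) - c q.1) P :=
    ((hcc.comp hS).sub (hcc.comp continuous_fst)).aestronglyMeasurable
  have hm3 : AEStronglyMeasurable ((c - w) ∘ Prod.fst) P :=
    ((hcc.stronglyMeasurable.sub hw).comp_measurable measurable_fst).aestronglyMeasurable
  have hsplit : (fun q : E d × E d => w (contract (ε n) q) - w q.1) =
      (w - c) ∘ contract (ε n) + (fun q => c (contract (ε n) q) - c q.1) + (c - w) ∘ Prod.fst := by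
    ext q; simp
  rw [hsplit]
  refine (eLpNorm_add_le (hm1.add hm2) hm3 one_le_two).trans (add_le_add
    ((eLpNorm_add_le hm1 hm2 one_le_two).trans (add_le_add ?_ ?_)) ?_)
  · refine (eLpNorm_comp_contract_le (hε1 n) (hw.sub hcc.stronglyMeasurable) ν D).trans ?_
    gcongr
  · refine (eLpNorm_le_of_ae_bound (C := τ) ?_).trans hτ'
    have h1 : ∀ᵐ q ∂P, q.1 ∈ D :=
      Measure.quasiMeasurePreserving_fst.ae (ae_restrict_mem hDm)
    have h2 : ∀ᵐ q ∂P, q.2 ∈ D := Measure.quasiMeasurePreserving_snd.ae hν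
    filter_upwards [h1, h2] with q hq1 hq2
    rw [← dist_eq_norm]
    refine (hκ' (lt_of_le_of_lt ?_ (hN n hn))).le
    rw [dist_eq_norm, contract, show (1 - ε n) • q.1 + ε n • q.2 - q.1 = ε n • (q.2 - q.1) by module,
      norm_smul, Real.norm_of_nonneg (hε0 n)]
    gcongr
    · exact hε0 n
    · calc ‖q.2 - q.1‖ ≤ ‖q.2‖ + ‖q.1‖ := norm_sub_le _ _
        _ ≤ R + R := add_le_add (hR _ hq2) (hR _ hq1)
        _ = 2 * R := by ring
  · rw [eLpNorm_comp_measurePreserving (hcc.stronglyMeasurable.sub hw).aestronglyMeasurable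
      measurePreserving_fst, ← eLpNorm_neg, neg_sub]
    exact (eLpNorm_restrict_le _ _ _ _).trans hcle

/-- Jensen's inequality for the probability measure `ν`, applied at each `x`, followed by Tonelli.
-/
theorem eLpNorm_average_sub_le [NormedSpace ℝ G] [CompleteSpace G] {D : Set (E d)} {w : E d → G}
    (hw : StronglyMeasurable w) (ν : Measure (E d)) [IsProbabilityMeasure ν] (ε : ℝ)
    (hi : ∀ x, Integrable (fun y => w (contract ε (x, y))) ν) :
    eLpNorm (fun x => (∫ y, w (contract ε (x, y)) ∂ν) - w x) 2 (volume.restrict D) ≤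
      eLpNorm (fun q => w (contract ε q) - w q.1) 2 ((volume.restrict D).prod ν) := by
  have hm : StronglyMeasurable fun q : E d × E d => w (contract ε q) - w q.1 :=
    (hw.comp_measurable (continuous_contract ε).measurable).sub (hw.comp_measurable measurable_fst)
  rw [← ENNReal.pow_le_pow_left_iff two_ne_zero, eLpNorm_two_sq, eLpNorm_two_sq,
    lintegral_prod _ (hm.enorm.pow_const 2).aemeasurable]
  gcongr with x
  have h1 : (∫ y, w (contract ε (x, y)) ∂ν) - w x = ∫ y, (w (contract ε (x, y)) - w x) ∂ν := by
    rw [integral_sub (hi x) (integrable_const _)]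
    simp
  have hmx : StronglyMeasurable fun y => w (contract ε (x, y)) - w x :=
    hm.comp_measurable measurable_prodMk_left
  rw [h1, ← eLpNorm_two_sq]
  gcongr
  refine (enorm_integral_le_lintegral_enorm _).trans ?_
  rw [← eLpNorm_one_eq_lintegral_enorm]
  exact eLpNorm_le_eLpNorm_of_exponent_le one_le_two hmx.aestronglyMeasurable

end Averaging

/-! ### Smooth approximation on convex sets -/

section Smoothing

variable {d : ℕ} {c : E d} (β : ContDiffBump c)

/-- The probability measure with density a normalized bump function. -/
def bumpMeasure : Measure (E d) :=
  (volume : Measure (E d)).withDensity fun y => ENNReal.ofReal (β.normed volume y)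

theorem measurable_bump : Measurable fun y => ENNReal.ofReal (β.normed volume y) :=
  (ENNReal.continuous_ofReal.comp β.continuous_normed).measurable

instance isProbabilityMeasure_bumpMeasure : IsProbabilityMeasure (bumpMeasure β) := by
  constructor
  rw [bumpMeasure, withDensity_apply _ MeasurableSet.univ, Measure.restrict_univ,
    ← ofReal_integral_eq_lintegral_ofReal β.integrable_normed (ae_of_all _ β.nonneg_normed),
    β.integral_normed, ENNReal.ofReal_one]

theorem bumpMeasure_ae_mem {D : Set (E d)} (hβ : Metric.closedBall c β.rOut ⊆ D) :
    ∀ᵐ y ∂bumpMeasure β, y ∈ D := by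
  rw [bumpMeasure, ae_withDensity_iff (measurable_bump β)]
  refine ae_of_all _ fun y hy => hβ ?_
  rw [← β.tsupport_normed_eq (μ := volume)]
  apply subset_tsupport
  intro h0
  apply hy
  rw [h0, ENNReal.ofReal_zero]

theorem integral_bumpMeasure {G : Type*} [NormedAddCommGroup G] [NormedSpace ℝ G] (w : E d → G) :
    ∫ y, w y ∂bumpMeasure β = ∫ y, β.normed volume y • w y := by
  rw [bumpMeasure, integral_withDensity_eq_integral_toReal_smul (measurable_bump β)
    (ae_of_all _ fun _ => ENNReal.ofReal_lt_top)]
  simp_rw [ENNReal.toReal_ofReal (β.nonneg_normed _)]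

/-- For `ε ≠ 0` the contraction is an affine bijection in `y`, and the density of the measure is
bounded. -/
theorem integrable_contract {G : Type*} [NormedAddCommGroup G] [NormedSpace ℝ G] {w : E d → G}
    (hw : Integrable w) {ε : ℝ} (hε : ε ≠ 0) (x : E d) :
    Integrable (fun y => w (contract ε (x, y))) (bumpMeasure β) := by
  rw [bumpMeasure, integrable_withDensity_iff_integrable_smul' (measurable_bump β)
    (ae_of_all _ fun _ => ENNReal.ofReal_lt_top)]
  have h1 : Integrable (fun y => w (contract ε (x, y))) := by
    have := (hw.comp_add_left ((1 - ε) • x)).comp_smul hε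
    exact this
  obtain ⟨B, hB⟩ := β.hasCompactSupport_normed (μ := volume) |>.exists_bound_of_continuous
    β.continuous_normed
  refine h1.bdd_smul B (measurable_bump β).ennreal_toReal.aestronglyMeasurable ?_
  refine ae_of_all _ fun y => ?_
  rw [ENNReal.toReal_ofReal (β.nonneg_normed _)]
  exact hB y

/-- The convolution kernel that realizes averages of contractions. -/
def kernelFun (ε : ℝ) (t : E d) : ℝ := (ε ^ d)⁻¹ * β.normed volume (-(ε⁻¹ • t))

theorem contDiff_kernelFun (ε : ℝ) : ContDiff ℝ ∞ (kernelFun β ε) := by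
  have := β.contDiff_normed (μ := volume) (n := ⊤)
  unfold kernelFun
  exact contDiff_const.mul (this.comp (by fun_prop))

theorem tsupport_kernelFun {ε : ℝ} {t : E d} (ht : t ∈ tsupport (kernelFun β ε)) :
    -(ε⁻¹ • t) ∈ Metric.closedBall c β.rOut := by
  have hcl : IsClosed {t : E d | -(ε⁻¹ • t) ∈ Metric.closedBall c β.rOut} :=
    Metric.isClosed_closedBall.preimage (by fun_prop)
  refine closure_minimal ?_ hcl ht
  intro t ht
  rw [Set.mem_ofPred, ← β.tsupport_normed_eq (μ := volume)]
  apply subset_tsupport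
  intro h0
  apply ht
  rw [kernelFun, h0, mul_zero]

theorem hasCompactSupport_kernelFun {ε : ℝ} (hε : ε ≠ 0) : HasCompactSupport (kernelFun β ε) := by
  have hb : Bornology.IsBounded (tsupport (kernelFun β ε)) := by
    rw [isBounded_iff_forall_norm_le]
    refine ⟨|ε| * (‖c‖ + β.rOut), fun t ht => ?_⟩
    have h1 := tsupport_kernelFun β ht
    have h2 := norm_le_of_mem_closedBall h1
    rw [norm_neg, norm_smul, norm_inv, Real.norm_eq_abs] at h2
    rwa [inv_mul_le_iff₀ (abs_pos.2 hε)] at h2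
  exact Metric.isCompact_of_isClosed_isBounded (isClosed_tsupport _) hb

/-- Substituting `t = -ε y` turns the average over centres into a mollification evaluated at `(1 -
ε) x`. Smoothness of the average follows from that of the kernel, while the average itself is what
is estimated in L². -/
theorem integral_contract_eq_convolution {ε : ℝ} (hε : 0 < ε) (w : E d → ℂ) (x : E d) :
    ∫ y, w (contract ε (x, y)) ∂bumpMeasure β =
      convolution (kernelFun β ε) w (ContinuousLinearMap.lsmul ℝ ℝ) volume ((1 - ε) • x) := by
  rw [integral_bumpMeasure, convolution_def]
  simp only [ContinuousLinearMap.lsmul_apply]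
  have h1 := Measure.integral_comp_smul (volume : Measure (E d))
    (fun t => kernelFun β ε t • w ((1 - ε) • x - t)) (-ε)
  have hp : 0 < ε ^ d := pow_pos hε _
  rw [finrank_euclideanSpace_fin, eq_comm, abs_inv, abs_pow, abs_neg, abs_of_pos hε,
    inv_smul_eq_iff₀ hp.ne', ← integral_smul] at h1
  rw [h1]
  congr 1
  ext y
  rw [kernelFun, smul_smul, mul_inv_cancel_left₀ hp.ne', smul_smul, contract,
    show -((ε⁻¹ * -ε) • y) = y by rw [mul_neg, inv_mul_cancel₀ hε.ne']; simp]
  congr 2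
  simp

/-- Inside `D`, the derivative of a mollified function is the mollified weak derivative. -/
theorem pderiv_convolution {D : Set (E d)} (hDm : MeasurableSet D) {f : E d → ℝ}
    (hf : ContDiff ℝ ∞ f) (hfc : HasCompactSupport f) {v : E d → ℂ} {g : E d → V d}
    (hv : IntegrableOn v D) (hvg : IsWeakGrad D v g)
    {X : E d} (hX : ∀ t ∈ tsupport f, X - t ∈ D) (i : Fin d) :
    pderiv i (convolution f (D.indicator v) (ContinuousLinearMap.lsmul ℝ ℝ) volume) X =
      convolution f (D.indicator fun x => g x i) (ContinuousLinearMap.lsmul ℝ ℝ) volume X := by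
  have hvi : LocallyIntegrable (D.indicator v) (volume : Measure (E d)) :=
    (hv.integrable_indicator hDm).locallyIntegrable
  have hf1 : ContDiff ℝ 1 f := hf.of_le (by simp)
  have hder := hfc.hasFDerivAt_convolution_left (ContinuousLinearMap.lsmul ℝ ℝ : ℝ →L[ℝ] ℂ →L[ℝ] ℂ)
    hf1 hvi X
  have hex := (hfc.fderiv (𝕜 := ℝ)).convolutionExists_left
    ((ContinuousLinearMap.lsmul ℝ ℝ : ℝ →L[ℝ] ℂ →L[ℝ] ℂ).precompL (E d))
    (hf1.continuous_fderiv one_ne_zero) hvi X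
  rw [pderiv, hder.fderiv, convolution_def, ContinuousLinearMap.integral_apply hex, convolution_def,
    ← integral_sub_left_eq_self _ volume X]
  conv_rhs => rw [← integral_sub_left_eq_self _ volume X]
  simp only [sub_sub_cancel, ContinuousLinearMap.precompL_apply, ContinuousLinearMap.lsmul_apply]
  -- The reflected and translated kernel is an admissible test function exactly because of `hX`;
  -- reflection produces the sign in the definition of the weak gradient.
  let ψ : E d → ℝ := fun z => f (X - z)
  have hsub : ContDiff ℝ ∞ fun z : E d => X - z := contDiff_const.sub contDiff_id
  have hts : tsupport ψ ⊆ D := by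
    intro z hz
    have : z ∈ (fun z => X - z) ⁻¹' tsupport f := by
      refine closure_minimal (fun y hy => ?_) ((isClosed_tsupport f).preimage hsub.continuous) hz
      exact subset_tsupport f hy
    simpa using hX _ this
  have hψ : IsTest D ψ := by
    refine ⟨hf.comp hsub, ?_, hts⟩
    exact hfc.comp_homeomorph (Homeomorph.subLeft X)
  have hpd : ∀ z, pderiv i ψ z = -(fderiv ℝ f (X - z) (EuclideanSpace.single i 1)) := by
    intro z
    have h1 : HasFDerivAt (fun z : E d => X - z) (-ContinuousLinearMap.id ℝ (E d)) z := by
      simpa using (hasFDerivAt_id z).const_sub X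
    have h2 := ((hf1.differentiable one_ne_zero) (X - z)).hasFDerivAt.comp z h1
    rw [pderiv, show ψ = f ∘ fun z => X - z from rfl, h2.fderiv]
    simp
  have hw := hvg ψ hψ i
  have e1 : ∀ z, fderiv ℝ f (X - z) (EuclideanSpace.single i 1) • D.indicator v z =
      D.indicator (fun z => -(v z * ((pderiv i ψ z : ℝ) : ℂ))) z := by
    intro z
    by_cases hz : z ∈ D
    · rw [Set.indicator_of_mem hz, Set.indicator_of_mem hz, hpd, Complex.real_smul]
      push_cast; ring
    · rw [Set.indicator_of_notMem hz, Set.indicator_of_notMem hz, smul_zero]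
  have e2 : ∀ z, f (X - z) • D.indicator (fun x => g x i) z =
      D.indicator (fun z => g z i * (ψ z : ℂ)) z := by
    intro z
    by_cases hz : z ∈ D
    · rw [Set.indicator_of_mem hz, Set.indicator_of_mem hz, Complex.real_smul, mul_comm]
    · rw [Set.indicator_of_notMem hz, Set.indicator_of_notMem hz, smul_zero]
  simp_rw [e1, e2]
  rw [integral_indicator hDm, integral_indicator hDm, integral_neg, hw, neg_neg]

/-- On a bounded convex open set, functions with a weak gradient are limits of smooth functions. -/
theorem exists_smooth_approx {D : Set (E d)} (hDo : IsOpen D) (hDc : Convex ℝ D)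
    (hDb : Bornology.IsBounded D) (hDn : D.Nonempty) {v : E d → ℂ} {g : E d → V d}
    (hvm : StronglyMeasurable v) (hgm : StronglyMeasurable g)
    (hv : MemLp v 2 (volume.restrict D)) (hg : MemLp g 2 (volume.restrict D))
    (hvg : IsWeakGrad D v g) :
    ∃ φ : ℕ → E d → ℂ, (∀ n, ContDiff ℝ ∞ (φ n)) ∧
      Tendsto (fun n => eLpNorm (fun x => v x - φ n x) 2 (volume.restrict D)) atTop (𝓝 0) ∧
      Tendsto (fun n => eLpNorm (fun x => g x - cgrad (φ n) x) 2 (volume.restrict D))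
        atTop (𝓝 0) := by
  have hDm := hDo.measurableSet
  have hfin : IsFiniteMeasure ((volume : Measure (E d)).restrict D) :=
    ⟨by rw [Measure.restrict_apply_univ]; exact hDb.measure_lt_top⟩
  obtain ⟨c, hc⟩ := hDn
  obtain ⟨r, hr, hrD⟩ := Metric.nhds_basis_closedBall.mem_iff.1 (hDo.mem_nhds hc)
  -- Centres are taken in a ball inside `D`. By convexity the contractions then move points of `D`
  -- to points of `D`, so no extension across the boundary is needed.
  let β : ContDiffBump c := ⟨r / 2, r, by positivity, by linarith⟩
  have hβ : Metric.closedBall c β.rOut ⊆ D := hrD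
  -- The shift by 2 gives `ε n ≤ 1/2` already for `n = 0`.
  let ε : ℕ → ℝ := fun n => 1 / ((n : ℝ) + 2)
  have hε0 : ∀ n, 0 < ε n := fun n => by positivity
  have hε1 : ∀ n, ε n ≤ 1 / 2 := fun n => by
    apply one_div_le_one_div_of_le two_pos; have := Nat.cast_nonneg (α := ℝ) n; linarith
  have hε : Tendsto ε atTop (𝓝 0) := by
    have h1 : Tendsto (fun n : ℕ => (n : ℝ) + 2) atTop atTop :=
      tendsto_atTop_add_const_right _ _ tendsto_natCast_atTop_atTop
    simpa [ε, Function.comp_def] using tendsto_inv_atTop_zero.comp h1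
  let v' := D.indicator v
  let g' := D.indicator g
  have hv'm : StronglyMeasurable v' := hvm.indicator hDm
  have hg'm : StronglyMeasurable g' := hgm.indicator hDm
  have hv'2 : MemLp v' 2 volume := (memLp_indicator_iff_restrict hDm).2 hv
  have hg'2 : MemLp g' 2 volume := (memLp_indicator_iff_restrict hDm).2 hg
  have hvi : IntegrableOn v D := hv.integrable one_le_two
  have hgi : IntegrableOn g D := hg.integrable one_le_two
  have hv'i : Integrable v' := hvi.integrable_indicator hDm
  have hg'i : Integrable g' := hgi.integrable_indicator hDm
  have hν := bumpMeasure_ae_mem β hβ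
  let φ : ℕ → E d → ℂ := fun n x => ∫ y, v' (contract (ε n) (x, y)) ∂bumpMeasure β
  let γ : ℕ → E d → V d := fun n x => ∫ y, g' (contract (ε n) (x, y)) ∂bumpMeasure β
  have hφeq : ∀ n, φ n = fun x => convolution (kernelFun β (ε n)) v'
      (ContinuousLinearMap.lsmul ℝ ℝ) volume ((1 - ε n) • x) := fun n => by
    ext x; exact integral_contract_eq_convolution β (hε0 n) v' x
  have hconv : ∀ n, ContDiff ℝ ∞ (convolution (kernelFun β (ε n)) v'
      (ContinuousLinearMap.lsmul ℝ ℝ : ℝ →L[ℝ] ℂ →L[ℝ] ℂ) volume) := fun n =>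
    (hasCompactSupport_kernelFun β (hε0 n).ne').contDiff_convolution_left (n := ⊤) _
      (contDiff_kernelFun β _) hv'i.locallyIntegrable
  have hsm : ∀ n, ContDiff ℝ ∞ (φ n) := fun n => by
    rw [hφeq]
    exact (hconv n).comp (contDiff_id.const_smul _)
  have hgrad : ∀ n, ∀ x ∈ D, cgrad (φ n) x = (1 - ε n) • γ n x := by
    intro n x hx
    ext i
    -- Such a point is a convex combination of `x` and of a point of the ball, hence stays in `D`.
    have hX : ∀ t ∈ tsupport (kernelFun β (ε n)), (1 - ε n) • x - t ∈ D := by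
      intro t ht
      have h1 := hβ (tsupport_kernelFun β ht)
      have h2 := hDc hx h1 (show 0 ≤ 1 - ε n by linarith [hε1 n]) (hε0 n).le (by ring)
      rwa [smul_neg, smul_smul, mul_inv_cancel₀ (hε0 n).ne', one_smul, ← sub_eq_add_neg] at h2
    have h1 := pderiv_convolution hDm (contDiff_kernelFun β (ε n))
      (hasCompactSupport_kernelFun β (hε0 n).ne') hvi hvg hX i
    have h2 : HasFDerivAt (fun x : E d => (1 - ε n) • x)
        ((1 - ε n) • ContinuousLinearMap.id ℝ (E d)) x := by
      exact (hasFDerivAt_id (𝕜 := ℝ) x).const_smul (1 - ε n)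
    have h3 := (((hconv n).differentiable (by simp)) ((1 - ε n) • x)).hasFDerivAt.comp x h2
    have h4 : pderiv i (φ n) x = (1 - ε n) • pderiv i (convolution (kernelFun β (ε n)) v'
      (ContinuousLinearMap.lsmul ℝ ℝ : ℝ →L[ℝ] ℂ →L[ℝ] ℂ) volume) ((1 - ε n) • x) := by
      rw [pderiv, hφeq]
      have := h3.fderiv
      simp only [Function.comp_def] at this
      rw [this]
      simp [pderiv]
    change pderiv i (φ n) x = ((1 - ε n) • γ n x) i
    rw [h4, h1, ← integral_contract_eq_convolution β (hε0 n), PiLp.smul_apply]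
    congr 1
    have h5 := (EuclideanSpace.proj i : V d →L[ℂ] ℂ).integral_comp_comm
      (integrable_contract β hg'i (hε0 n).ne' x)
    rw [show γ n x i = (EuclideanSpace.proj i : V d →L[ℂ] ℂ) (γ n x) from rfl, ← h5]
    congr 1
    ext y
    by_cases hy : contract (ε n) (x, y) ∈ D
    · simp [g', Set.indicator_of_mem hy]
    · simp [g', Set.indicator_of_notMem hy]
  have limv : Tendsto (fun n => eLpNorm (fun x => φ n x - v' x) 2 (volume.restrict D)) atTop (𝓝 0) :=
    tendsto_of_tendsto_of_tendsto_of_le_of_le tendsto_const_nhds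
      (tendsto_eLpNorm_contract hDm hDb hv'm hv'2 (bumpMeasure β) hν (fun n => (hε0 n).le) hε1 hε)
      (fun _ => zero_le) (fun n => eLpNorm_average_sub_le hv'm (bumpMeasure β) (ε n)
        (integrable_contract β hv'i (hε0 n).ne'))
  have limg : Tendsto (fun n => eLpNorm (fun x => γ n x - g' x) 2 (volume.restrict D)) atTop (𝓝 0) :=
    tendsto_of_tendsto_of_tendsto_of_le_of_le tendsto_const_nhds
      (tendsto_eLpNorm_contract hDm hDb hg'm hg'2 (bumpMeasure β) hν (fun n => (hε0 n).le) hε1 hε)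
      (fun _ => zero_le) (fun n => eLpNorm_average_sub_le hg'm (bumpMeasure β) (ε n)
        (integrable_contract β hg'i (hε0 n).ne'))
  refine ⟨φ, hsm, ?_, ?_⟩
  · refine limv.congr fun n => ?_
    rw [← eLpNorm_neg]
    apply eLpNorm_congr_ae
    filter_upwards [ae_restrict_mem hDm] with x hx
    simp [v', Set.indicator_of_mem hx]
  -- The chain rule puts a factor `1 - ε n` in front of the averaged gradient; the term with `ε n`
  -- accounts for it.
  · have hbound : ∀ n, eLpNorm (fun x => g x - cgrad (φ n) x) 2 (volume.restrict D) ≤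
        eLpNorm (fun x => γ n x - g' x) 2 (volume.restrict D) +
          ENNReal.ofReal (ε n) * eLpNorm g' 2 (volume.restrict D) := by
      intro n
      have hγm : StronglyMeasurable (γ n) := StronglyMeasurable.integral_prod_right
        (f := fun x y => g' (contract (ε n) (x, y)))
        (hg'm.comp_measurable (continuous_contract (ε n)).measurable)
      have heq : (fun x => g x - cgrad (φ n) x) =ᵐ[volume.restrict D]
          (-(1 - ε n)) • (fun x => γ n x - g' x) + (ε n) • g' := by
        filter_upwards [ae_restrict_mem hDm] with x hx
        rw [hgrad n x hx]
        simp only [Pi.add_apply, Pi.smul_apply, g', Set.indicator_of_mem hx]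
        module
      rw [eLpNorm_congr_ae heq]
      refine (eLpNorm_add_le ((hγm.sub hg'm).const_smul _).aestronglyMeasurable
        (hg'm.const_smul _).aestronglyMeasurable one_le_two).trans (add_le_add ?_ ?_)
      · rw [eLpNorm_const_smul]
        refine mul_le_of_le_one_left (zero_le) ?_
        rw [← ofReal_norm, ← ENNReal.ofReal_one]
        apply ENNReal.ofReal_le_ofReal
        rw [norm_neg, Real.norm_eq_abs, abs_of_nonneg] <;> linarith [hε1 n, hε0 n]
      · rw [eLpNorm_const_smul, ← ofReal_norm, Real.norm_of_nonneg (hε0 n).le]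
    refine tendsto_of_tendsto_of_tendsto_of_le_of_le tendsto_const_nhds ?_ (fun _ => zero_le) hbound
    have h1 : Tendsto (fun n => ENNReal.ofReal (ε n)) atTop (𝓝 0) := by
      simpa [Function.comp_def] using (ENNReal.continuous_ofReal.tendsto 0).comp hε
    have h2 := ENNReal.Tendsto.mul_const (b := eLpNorm g' 2 (volume.restrict D)) h1
      (Or.inr ((hg'2.restrict D).eLpNorm_ne_top))
    simpa using limg.add h2

end Smoothing

namespace Mesh

variable {d : ℕ} (M : Mesh d)

/-! ## Decomposition of integrals over the cells -/

open Classical in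
theorem mem_hull_inter {K L : Finset (E d)} (hK : K ∈ M.elems) (hL : L ∈ M.elems) {x : E d}
    (hxK : x ∈ hull K) (hxL : x ∈ hull L) : x ∈ hull (K.filter (· ∈ L)) := by
  have := M.matching K hK L hL ⟨hxK, hxL⟩
  rw [hull]
  convert this using 2
  ext y; simp

/-- The matching condition puts `x` in the simplex spanned by the common vertices. In this form it
is used throughout. -/
theorem bary_eq_zero_of_mem_hull {K L : Finset (E d)} (hK : K ∈ M.elems) (hL : L ∈ M.elems)
    {x : E d} (hxK : x ∈ hull K) (hxL : x ∈ hull L) {a : E d} (ha : a ∈ K) (haL : a ∉ L) :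
    bary K a x = 0 := by
  classical
  have h := M.mem_hull_inter hK hL hxK hxL
  exact (((M.isSimplex hK).mem_hull_of_subset (Finset.filter_subset _ _)).1 h).2 a ha (by simp [haL])

theorem exists_mem_notMem {K L : Finset (E d)} (hK : K ∈ M.elems) (hL : L ∈ M.elems)
    (hne : K ≠ L) : ∃ a ∈ K, a ∉ L := by
  by_contra! hsub
  exact hne (Finset.eq_of_subset_of_card_le hsub (by rw [M.card_eq K hK, M.card_eq L hL]))

/-- A common point would have zero coordinate at a vertex of `K` not shared with `L`, whereas
coordinates are positive in the open simplex. -/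
theorem disjoint_cell {K L : Finset (E d)} (hK : K ∈ M.elems) (hL : L ∈ M.elems)
    (hne : K ≠ L) : Disjoint (cell K) (cell L) := by
  rw [Set.disjoint_left]
  intro x hxK hxL
  obtain ⟨a, ha, haL⟩ := M.exists_mem_notMem hK hL hne
  have h0 := M.bary_eq_zero_of_mem_hull hK hL (cell_subset_hull K hxK) (cell_subset_hull L hxL) ha haL
  exact ((M.isSimplex hK).mem_cell.1 hxK a ha).ne' h0

theorem isOpen_dom : IsOpen M.dom := isOpen_interior

theorem dom_subset : M.dom ⊆ ⋃ K ∈ M.elems, hull K := interior_subset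

/-- Open and closed simplices differ by the boundary of a convex set, which is null. Integrals over
the domain thus split over the cells. -/
theorem dom_ae_eq : M.dom =ᵐ[volume] ⋃ K ∈ M.elems, cell K := by
  refine EventuallyLE.antisymm ?_ (Eventually.of_forall
    (Set.iUnion₂_subset fun K hK => M.cell_subset_dom hK : (⋃ K ∈ M.elems, cell K) ⊆ M.dom))
  · have h1 : (⋃ K ∈ M.elems, hull K) =ᵐ[volume] ⋃ K ∈ M.elems, cell K := by
      have h2 : ∀ᵐ x : E d, ∀ K ∈ M.elems, (x ∈ cell K ↔ x ∈ hull K) := by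
        rw [Finset.eventually_all]
        exact fun K _ => (cell_ae_eq_hull K).mem_iff
      filter_upwards [h2] with x hx
      apply propext
      change (x ∈ ⋃ K ∈ M.elems, hull K) ↔ (x ∈ ⋃ K ∈ M.elems, cell K)
      simp only [Set.mem_iUnion]
      exact exists_congr fun K => exists_congr fun hK => (hx K hK).symm
    exact EventuallyLE.trans (Eventually.of_forall M.dom_subset) h1.le

theorem restrict_dom : (volume : Measure (E d)).restrict M.dom =
    volume.restrict (⋃ K ∈ M.elems, cell K) := Measure.restrict_congr_set M.dom_ae_eq

theorem restrict_cell_le {K : Finset (E d)} (hK : K ∈ M.elems) :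
    (volume : Measure (E d)).restrict (cell K) ≤ volume.restrict M.dom :=
  Measure.restrict_mono (M.cell_subset_dom hK) le_rfl

theorem ae_dom_iff {P : E d → Prop} :
    (∀ᵐ x ∂(volume : Measure (E d)).restrict M.dom, P x) ↔
      ∀ K ∈ M.elems, ∀ᵐ x ∂(volume : Measure (E d)).restrict (cell K), P x := by
  rw [M.restrict_dom, ae_restrict_biUnion_finset_iff]

theorem ae_cell_of_dom {P : E d → Prop} (h : ∀ᵐ x ∂(volume : Measure (E d)).restrict M.dom, P x)
    {K : Finset (E d)} (hK : K ∈ M.elems) : ∀ᵐ x ∂(volume : Measure (E d)).restrict (cell K), P x :=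
  M.ae_dom_iff.1 h K hK

theorem integral_dom {G : Type*} [NormedAddCommGroup G] [NormedSpace ℝ G] {f : E d → G}
    (hf : IntegrableOn f M.dom) : ∫ x in M.dom, f x = ∑ K ∈ M.elems, ∫ x in cell K, f x := by
  rw [M.restrict_dom, integral_biUnion_finset]
  · exact fun K _ => (isOpen_cell K).measurableSet
  · exact fun K hK L hL hne => M.disjoint_cell hK hL hne
  · exact fun K hK => hf.mono_set (M.cell_subset_dom hK)

theorem inner_eq_sum {H : Type*} [NormedAddCommGroup H] [InnerProductSpace ℂ H]
    (f g : Lp H 2 ((volume : Measure (E d)).restrict M.dom)) :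
    inner ℂ f g = ∑ K ∈ M.elems, ∫ x in cell K, inner ℂ (f x) (g x) := by
  rw [L2.inner_def, M.integral_dom]
  exact L2.integrable_inner f g

theorem eq_of_forall_cell {H : Type*} [NormedAddCommGroup H]
    {f g : Lp H 2 ((volume : Measure (E d)).restrict M.dom)}
    (h : ∀ K ∈ M.elems, ∀ᵐ x ∂(volume : Measure (E d)).restrict (cell K), f x = g x) : f = g :=
  Lp.ext (M.ae_dom_iff.2 h)

instance isFiniteMeasure_dom : IsFiniteMeasure ((volume : Measure (E d)).restrict M.dom) := by
  constructor
  rw [Measure.restrict_apply_univ]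
  refine (measure_mono M.dom_subset).trans_lt ?_
  exact measure_biUnion_lt_top M.elems.finite_toSet fun K _ => (isCompact_hull K).measure_lt_top

theorem memLp_cell {H : Type*} [NormedAddCommGroup H]
    (f : Lp H 2 ((volume : Measure (E d)).restrict M.dom)) {K : Finset (E d)} (hK : K ∈ M.elems) :
    MemLp f 2 ((volume : Measure (E d)).restrict (cell K)) :=
  (Lp.memLp f).mono_measure (M.restrict_cell_le hK)

/-! ## Weak derivatives -/

/-- Take the extension of `θ` by zero. Integrals against fixed functions on `D` become continuous
linear functionals on L². -/
theorem exists_inner_eq_integral {H : Type*} [NormedAddCommGroup H] [InnerProductSpace ℂ H]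
    [CompleteSpace H] {D : Set (E d)} (hDm : MeasurableSet D) (hD : D ⊆ M.dom) {θ : E d → H}
    (hθ : MemLp θ 2 ((volume : Measure (E d)).restrict D)) :
    ∃ k : Lp H 2 ((volume : Measure (E d)).restrict M.dom),
      ∀ v : Lp H 2 ((volume : Measure (E d)).restrict M.dom),
        inner ℂ k v = ∫ x in D, inner ℂ (θ x) (v x) := by
  have hm : MemLp (D.indicator θ) 2 ((volume : Measure (E d)).restrict M.dom) := by
    rw [memLp_indicator_iff_restrict hDm, Measure.restrict_restrict hDm, Set.inter_eq_left.2 hD]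
    exact hθ
  refine ⟨hm.toLp, fun v => ?_⟩
  have hr : (volume : Measure (E d)).restrict D = (volume.restrict M.dom).restrict D := by
    rw [Measure.restrict_restrict hDm, Set.inter_eq_left.2 hD]
  rw [L2.inner_def, hr, ← integral_indicator hDm]
  apply integral_congr_ae
  filter_upwards [hm.coeFn_toLp] with x hx
  rw [hx]
  by_cases hxD : x ∈ D
  · simp only [Set.indicator_of_mem hxD]
  · simp only [Set.indicator_of_notMem hxD, inner_zero_left]

theorem memLp_test {θ : E d → ℝ} (hθ : Continuous θ)
    (hc : HasCompactSupport θ) (D' : Set (E d)) :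
    MemLp (fun x => (θ x : ℂ)) 2 ((volume : Measure (E d)).restrict D') :=
  ((Complex.continuous_ofReal.comp hθ).memLp_of_hasCompactSupport
      (hc.comp_left (g := fun t : ℝ => (t : ℂ)) (by simp))).restrict _

/-- The pairs made of a function and its weak gradient on `D`. -/
theorem exists_weakGradGraph {D : Set (E d)} (hDm : MeasurableSet D) (hD : D ⊆ M.dom) :
    ∃ S : Submodule ℂ (M.L2 × M.L2V), IsClosed (S : Set (M.L2 × M.L2V)) ∧
      ∀ v g, (v, g) ∈ S ↔ IsWeakGrad D v g := by
  have h1 : ∀ (φ : E d → ℝ) (hφ : IsTest D φ) (i : Fin d), ∃ l : (M.L2 × M.L2V) →L[ℂ] ℂ,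
      ∀ v g, l (v, g) = (∫ x in D, v x * ((pderiv i φ x : ℝ) : ℂ)) + ∫ x in D, g x i * (φ x : ℂ) := by
    intro φ hφ i
    obtain ⟨k1, hk1⟩ := M.exists_inner_eq_integral hDm hD
      (memLp_test (pderiv_continuous hφ i) (pderiv_hasCompactSupport hφ i) D)
    have hV : MemLp (fun x => (EuclideanSpace.single i (φ x : ℂ) : V d)) 2
        ((volume : Measure (E d)).restrict D) :=
      (memLp_test hφ.1.continuous hφ.2.1 D).of_le
        (by
          have : Continuous fun x => (EuclideanSpace.single i (φ x : ℂ) : V d) := by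
            have := hφ.1.continuous
            have h2 : Continuous fun z : ℂ => (EuclideanSpace.single i z : V d) := by
              have : (fun z : ℂ => (EuclideanSpace.single i z : V d)) =
                fun z => z • EuclideanSpace.single i 1 := by ext z j; simp [PiLp.single_apply]
              rw [this]; fun_prop
            exact h2.comp (Complex.continuous_ofReal.comp this)
          exact this.aestronglyMeasurable)
        (ae_of_all _ fun x => by simp)
    obtain ⟨k2, hk2⟩ := M.exists_inner_eq_integral hDm hD hV
    refine ⟨(innerSL ℂ k1).comp (ContinuousLinearMap.fst ℂ _ _) +
      (innerSL ℂ k2).comp (ContinuousLinearMap.snd ℂ _ _), fun v g => ?_⟩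
    simp only [_root_.add_apply, ContinuousLinearMap.comp_apply,
      ContinuousLinearMap.coe_fst', ContinuousLinearMap.coe_snd', innerSL_apply_apply]
    rw [hk1, hk2]
    simp [EuclideanSpace.inner_single_left, mul_comm]
  choose l hl using h1
  -- An intersection of kernels of continuous functionals, one for each test function and direction,
  -- is at once linear and closed.
  refine ⟨⨅ (φ : E d → ℝ) (hφ : IsTest D φ) (i : Fin d), LinearMap.ker (l φ hφ i).toLinearMap, ?_, ?_⟩
  · simp only [Submodule.coe_iInf]
    exact isClosed_iInter fun φ => isClosed_iInter fun hφ => isClosed_iInter fun i =>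
      (l φ hφ i).isClosed_ker
  · intro v g
    simp only [Submodule.mem_iInf, LinearMap.mem_ker]
    refine forall_congr' fun φ => forall_congr' fun hφ => forall_congr' fun i => ?_
    change l φ hφ i (v, g) = 0 ↔ _
    rw [hl, add_eq_zero_iff_eq_neg]

/-- The pairs made of a vector field and its weak divergence. -/
theorem exists_weakDivGraph :
    ∃ S : Submodule ℂ (M.L2V × M.L2), ∀ w q, (w, q) ∈ S ↔ IsWeakDiv M.dom w q := by
  have hDm := M.isOpen_dom.measurableSet
  have h1 : ∀ (φ : E d → ℝ) (hφ : IsTest M.dom φ), ∃ l : (M.L2V × M.L2) →L[ℂ] ℂ,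
      ∀ w q, l (w, q) = (∫ x in M.dom, ∑ i, w x i * ((pderiv i φ x : ℝ) : ℂ)) +
        ∫ x in M.dom, q x * (φ x : ℂ) := by
    intro φ hφ
    obtain ⟨k1, hk1⟩ := M.exists_inner_eq_integral hDm subset_rfl
      (memLp_test hφ.1.continuous hφ.2.1 M.dom)
    have hV : MemLp (fun x => (WithLp.toLp 2 fun i => ((pderiv i φ x : ℝ) : ℂ) : V d)) 2
        ((volume : Measure (E d)).restrict M.dom) := by
      have hc : Continuous fun x => (WithLp.toLp 2 fun i => ((pderiv i φ x : ℝ) : ℂ) : V d) := by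
        have := fun i => pderiv_continuous hφ i
        fun_prop
      refine (hc.memLp_of_hasCompactSupport ?_).restrict _
      have := hφ.2.1.fderiv (𝕜 := ℝ)
      refine this.comp_left (g := fun l : E d →L[ℝ] ℝ =>
        (WithLp.toLp 2 fun i => ((l (EuclideanSpace.single i 1) : ℝ) : ℂ) : V d)) ?_
      ext i; simp
    obtain ⟨k2, hk2⟩ := M.exists_inner_eq_integral hDm subset_rfl hV
    refine ⟨(innerSL ℂ k2).comp (ContinuousLinearMap.fst ℂ _ _) +
      (innerSL ℂ k1).comp (ContinuousLinearMap.snd ℂ _ _), fun w q => ?_⟩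
    simp only [_root_.add_apply, ContinuousLinearMap.comp_apply,
      ContinuousLinearMap.coe_fst', ContinuousLinearMap.coe_snd', innerSL_apply_apply]
    rw [hk1, hk2]
    simp [PiLp.inner_apply]
  choose l hl using h1
  refine ⟨⨅ (φ : E d → ℝ) (hφ : IsTest M.dom φ), LinearMap.ker (l φ hφ).toLinearMap, ?_⟩
  intro w q
  simp only [Submodule.mem_iInf, LinearMap.mem_ker]
  refine forall_congr' fun φ => forall_congr' fun hφ => ?_
  change l φ hφ (w, q) = 0 ↔ _
  rw [hl, add_eq_zero_iff_eq_neg]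

/-- A function with vanishing integral against all test functions is zero. -/
theorem ae_eq_zero_of_test {D : Set (E d)} (hDo : IsOpen D) {f : E d → ℂ} (hf : IntegrableOn f D)
    (h : ∀ φ, IsTest D φ → ∫ x in D, f x * (φ x : ℂ) = 0) :
    ∀ᵐ x ∂(volume : Measure (E d)).restrict D, f x = 0 := by
  rw [ae_restrict_iff' hDo.measurableSet]
  refine hDo.ae_eq_zero_of_integral_contDiff_smul_eq_zero hf.locallyIntegrableOn ?_
  intro φ h1 h2 h3
  rw [← h φ ⟨h1, h2, h3⟩, ← integral_indicator hDo.measurableSet]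
  congr 1
  ext x
  by_cases hx : x ∈ D
  · rw [Set.indicator_of_mem hx, Complex.real_smul, mul_comm]
  · rw [Set.indicator_of_notMem hx, image_eq_zero_of_notMem_tsupport (fun H => hx (h3 H)), zero_smul]

theorem weakGrad_unique {D : Set (E d)} (hDo : IsOpen D) {v : E d → ℂ} {g k : E d → V d}
    (hgi : IntegrableOn g D) (hki : IntegrableOn k D)
    (hg : IsWeakGrad D v g) (hk : IsWeakGrad D v k) :
    ∀ᵐ x ∂(volume : Measure (E d)).restrict D, g x = k x := by
  have hi : ∀ {g : E d → V d}, IntegrableOn g D → ∀ i, IntegrableOn (fun x => g x i) D :=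
    fun hg i => (EuclideanSpace.proj i : V d →L[ℂ] ℂ).integrable_comp hg
  have : ∀ i, ∀ᵐ x ∂(volume : Measure (E d)).restrict D, g x i - k x i = 0 := by
    intro i
    refine ae_eq_zero_of_test hDo ((hi hgi i).sub (hi hki i)) fun φ hφ => ?_
    have hmul : ∀ {g : E d → V d}, IntegrableOn g D →
        IntegrableOn (fun x => g x i * (φ x : ℂ)) D := by
      intro g hg
      obtain ⟨B, hB⟩ := hφ.2.1.exists_bound_of_continuous hφ.1.continuous
      refine Integrable.mul_bdd (c := B) (hi hg i)
        (Complex.continuous_ofReal.comp hφ.1.continuous).aestronglyMeasurable ?_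
      exact ae_of_all _ fun x => by simpa using hB x
    simp_rw [sub_mul]
    rw [integral_sub (hmul hgi) (hmul hki), sub_eq_zero]
    exact neg_injective ((hg φ hφ i).symm.trans (hk φ hφ i))
  filter_upwards [ae_all_iff.2 this] with x hx
  ext i
  exact sub_eq_zero.1 (hx i)

variable {M}

theorem grad_spec (v : M.H1) {K : Finset (E d)} (hK : K ∈ M.elems) :
    IsWeakGrad (cell K) (v : M.L2) (M.grad v) := Classical.choose_spec v.2 K hK

theorem grad_ae_eq (v : M.H1) {g : E d → V d} {K : Finset (E d)} (hK : K ∈ M.elems)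
    (hgi : IntegrableOn g (cell K)) (hg : IsWeakGrad (cell K) (v : M.L2) g) :
    ∀ᵐ x ∂(volume : Measure (E d)).restrict (cell K), M.grad v x = g x :=
  weakGrad_unique (isOpen_cell K) ((M.memLp_cell _ hK).integrable one_le_two) hgi (grad_spec v hK) hg

/-- The gradient is a choice; uniqueness of weak gradients on each cell makes any candidate equal to
it, from which linearity follows. -/
theorem grad_eq (v : M.H1) {g : M.L2V} (h : ∀ K ∈ M.elems, IsWeakGrad (cell K) (v : M.L2) g) :
    M.grad v = g :=
  M.eq_of_forall_cell fun K hK =>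
    grad_ae_eq v hK ((M.memLp_cell g hK).integrable one_le_two) (h K hK)

theorem grad_add (v w : M.H1) : M.grad (v + w) = M.grad v + M.grad w := by
  refine grad_eq _ fun K hK => ?_
  obtain ⟨S, -, hS⟩ := M.exists_weakGradGraph (isOpen_cell K).measurableSet (M.cell_subset_dom hK)
  exact (hS _ _).1 (S.add_mem ((hS _ _).2 (grad_spec v hK)) ((hS _ _).2 (grad_spec w hK)))

theorem grad_smul (c : ℂ) (v : M.H1) : M.grad (c • v) = c • M.grad v := by
  refine grad_eq _ fun K hK => ?_
  obtain ⟨S, -, hS⟩ := M.exists_weakGradGraph (isOpen_cell K).measurableSet (M.cell_subset_dom hK)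
  exact (hS _ _).1 (S.smul_mem c ((hS _ _).2 (grad_spec v hK)))

end Mesh

/-! ### Smooth approximation of broken H¹ functions on an element -/

theorem tendsto_integral_mul_conj {α : Type*} [MeasurableSpace α] {μ : Measure α} {f h : α → ℂ}
    {fn : ℕ → α → ℂ} (hf : MemLp f 2 μ) (hfn : ∀ n, MemLp (fn n) 2 μ) (hh : MemLp h 2 μ)
    (hlim : Tendsto (fun n => eLpNorm (fun x => f x - fn n x) 2 μ) atTop (𝓝 0)) :
    Tendsto (fun n => ∫ x, fn n x * conj (h x) ∂μ) atTop (𝓝 (∫ x, f x * conj (h x) ∂μ)) := by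
  have key : ∀ {k : α → ℂ} (hk : MemLp k 2 μ),
      ∫ x, k x * conj (h x) ∂μ = inner ℂ hh.toLp hk.toLp := by
    intro k hk
    rw [L2.inner_def]
    apply integral_congr_ae
    filter_upwards [hk.coeFn_toLp, hh.coeFn_toLp] with x h1 h2
    rw [h1, h2]; simp
  have h1 : Tendsto (fun n => (hfn n).toLp) atTop (𝓝 hf.toLp) := by
    rw [Lp.tendsto_Lp_iff_tendsto_eLpNorm'']
    refine hlim.congr fun n => ?_
    rw [← eLpNorm_neg]
    congr 1
    ext x; simp
  simp_rw [fun n => key (hfn n), key hf]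
  exact (continuous_const.inner continuous_id).continuousAt.tendsto.comp h1

theorem cgrad_add {d : ℕ} {φ ψ : E d → ℂ} (hφ : ContDiff ℝ ∞ φ) (hψ : ContDiff ℝ ∞ ψ) (x : E d) :
    cgrad (φ + ψ) x = cgrad φ x + cgrad ψ x := by
  ext i
  simp [cgrad, pderiv, fderiv_add (hφ.differentiable (by simp) x) (hψ.differentiable (by simp) x)]

theorem cgrad_sub {d : ℕ} {φ ψ : E d → ℂ} (hφ : ContDiff ℝ ∞ φ) (hψ : ContDiff ℝ ∞ ψ) (x : E d) :
    cgrad (φ - ψ) x = cgrad φ x - cgrad ψ x := by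
  ext i
  simp [cgrad, pderiv, fderiv_sub (hφ.differentiable (by simp) x) (hψ.differentiable (by simp) x)]

theorem cgrad_smul {d : ℕ} {φ : E d → ℂ} (hφ : ContDiff ℝ ∞ φ) (c : ℂ) (x : E d) :
    cgrad (c • φ) x = c • cgrad φ x := by
  ext i
  simp [cgrad, pderiv, fderiv_const_smul (hφ.differentiable (by simp) x)]

namespace Mesh

variable {d : ℕ} {M : Mesh d} {K : Finset (E d)} {v w : M.H1} {φ ψ : ℕ → E d → ℂ}

variable (M K v φ) in
/-- `φ` is a sequence of smooth functions that converges to `v` in `H¹(K)`. -/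
def SmoothApprox : Prop :=
  (∀ n, ContDiff ℝ ∞ (φ n)) ∧
    Tendsto (fun n => eLpNorm (fun x => (v : M.L2) x - φ n x) 2 (volume.restrict (cell K)))
      atTop (𝓝 0) ∧
    Tendsto (fun n => eLpNorm (fun x => M.grad v x - cgrad (φ n) x) 2 (volume.restrict (cell K)))
      atTop (𝓝 0)

theorem exists_smoothApprox (hK : K ∈ M.elems) (v : M.H1) : ∃ φ, M.SmoothApprox K v φ :=
  exists_smooth_approx (isOpen_cell K) (convex_cell K)
    ((isCompact_hull K).isBounded.subset (cell_subset_hull K)) (M.isSimplex hK).cell_nonempty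
    (Lp.stronglyMeasurable _) (Lp.stronglyMeasurable _) (M.memLp_cell _ hK) (M.memLp_cell _ hK)
    (grad_spec v hK)

theorem contDiff_one {φ : E d → ℂ} (h : ContDiff ℝ ∞ φ) : ContDiff ℝ 1 φ := h.of_le (by simp)

theorem eLpNorm_add_tendsto {α G : Type*} [MeasurableSpace α] [NormedAddCommGroup G] {μ : Measure α}
    {f g : ℕ → α → G} (hfm : ∀ n, AEStronglyMeasurable (f n) μ)
    (hgm : ∀ n, AEStronglyMeasurable (g n) μ) (hf : Tendsto (fun n => eLpNorm (f n) 2 μ) atTop (𝓝 0))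
    (hg : Tendsto (fun n => eLpNorm (g n) 2 μ) atTop (𝓝 0)) :
    Tendsto (fun n => eLpNorm (f n + g n) 2 μ) atTop (𝓝 0) := by
  refine tendsto_of_tendsto_of_tendsto_of_le_of_le tendsto_const_nhds ?_ (fun _ => zero_le)
    (fun n => eLpNorm_add_le (hfm n) (hgm n) one_le_two)
  simpa using hf.add hg

theorem SmoothApprox.aesm (h : M.SmoothApprox K v φ) (hK : K ∈ M.elems) (n : ℕ) :
    AEStronglyMeasurable (fun x => (v : M.L2) x - φ n x) (volume.restrict (cell K)) :=
  (M.memLp_cell _ hK).1.sub (h.1 n).continuous.aestronglyMeasurable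

theorem SmoothApprox.aesm_grad (h : M.SmoothApprox K v φ) (hK : K ∈ M.elems) (n : ℕ) :
    AEStronglyMeasurable (fun x => M.grad v x - cgrad (φ n) x) (volume.restrict (cell K)) :=
  (M.memLp_cell _ hK).1.sub (continuous_cgrad (contDiff_one (h.1 n))).aestronglyMeasurable

theorem SmoothApprox.add (hK : K ∈ M.elems) (hφ : M.SmoothApprox K v φ)
    (hψ : M.SmoothApprox K w ψ) : M.SmoothApprox K (v + w) (fun n => φ n + ψ n) := by
  refine ⟨fun n => (hφ.1 n).add (hψ.1 n), ?_, ?_⟩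
  · refine (eLpNorm_add_tendsto (hφ.aesm hK) (hψ.aesm hK) hφ.2.1 hψ.2.1).congr fun n => ?_
    apply eLpNorm_congr_ae
    filter_upwards [M.ae_cell_of_dom (Lp.coeFn_add (v : M.L2) w) hK] with x hx
    simp only [Submodule.coe_add, hx, Pi.add_apply]; ring
  · refine (eLpNorm_add_tendsto (hφ.aesm_grad hK) (hψ.aesm_grad hK) hφ.2.2 hψ.2.2).congr fun n => ?_
    apply eLpNorm_congr_ae
    filter_upwards [M.ae_cell_of_dom (Lp.coeFn_add (M.grad v) (M.grad w)) hK] with x hx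
    rw [grad_add, hx, cgrad_add (hφ.1 n) (hψ.1 n)]
    simp only [Pi.add_apply]; abel

theorem SmoothApprox.smul (hK : K ∈ M.elems) (hφ : M.SmoothApprox K v φ) (c : ℂ) :
    M.SmoothApprox K (c • v) (fun n => c • φ n) := by
  have key : ∀ {u : ℕ → ℝ≥0∞}, Tendsto u atTop (𝓝 0) → Tendsto (fun n => ‖c‖ₑ * u n) atTop (𝓝 0) := by
    intro u hu
    simpa using ENNReal.Tendsto.const_mul hu (Or.inr enorm_ne_top)
  refine ⟨fun n => (hφ.1 n).const_smul c, ?_, ?_⟩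
  · refine (key hφ.2.1).congr fun n => ?_
    rw [← eLpNorm_const_smul]
    apply eLpNorm_congr_ae
    filter_upwards [M.ae_cell_of_dom (Lp.coeFn_smul c (v : M.L2)) hK] with x hx
    simp only [Submodule.coe_smul, hx, Pi.smul_apply, smul_sub]
  · refine (key hφ.2.2).congr fun n => ?_
    rw [← eLpNorm_const_smul]
    apply eLpNorm_congr_ae
    filter_upwards [M.ae_cell_of_dom (Lp.coeFn_smul c (M.grad v)) hK] with x hx
    rw [grad_smul, hx, cgrad_smul (hφ.1 n)]
    simp only [Pi.smul_apply, smul_sub]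

/-! ## Traces -/

/-- Trace inequality for `φ n - ψ m`, with a triangle inequality through `v` and `w`. The case `v =
w` with one sequence gives existence of traces, with two sequences independence of the sequence, and
`w = 0` gives continuity. -/
theorem SmoothApprox.face_le (hd : d ≠ 0) (hK : K ∈ M.elems) {a : E d} (ha : a ∈ K) :
    ∃ C : ℝ≥0∞, C ≠ ⊤ ∧ ∀ (v w : M.H1) (φ ψ : ℕ → E d → ℂ), M.SmoothApprox K v φ →
      M.SmoothApprox K w ψ → ∀ n m, eLpNorm (φ n - ψ m) 2 (faceMeasure (opp K a)) ≤
        C * (eLpNorm (fun x => (v : M.L2) x - φ n x) 2 (volume.restrict (cell K))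
          + eLpNorm (fun x => M.grad v x - cgrad (φ n) x) 2 (volume.restrict (cell K))
          + (eLpNorm (fun x => (w : M.L2) x - ψ m x) 2 (volume.restrict (cell K))
          + eLpNorm (fun x => M.grad w x - cgrad (ψ m) x) 2 (volume.restrict (cell K)))
          + (eLpNorm (fun x => (v : M.L2) x - (w : M.L2) x) 2 (volume.restrict (cell K))
          + eLpNorm (fun x => M.grad v x - M.grad w x) 2 (volume.restrict (cell K)))) := by
  obtain ⟨C, -, hC⟩ := (M.isSimplex hK).trace_inequality hd ha
  refine ⟨ENNReal.ofReal C, ENNReal.ofReal_ne_top, fun v w φ ψ hφ hψ n m => ?_⟩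
  refine (hC (φ n - ψ m) ((contDiff_one (hφ.1 n)).sub (contDiff_one (hψ.1 m)))).trans ?_
  have tri : ∀ {G : Type} [NormedAddCommGroup G] {f g f' g' : E d → G},
      AEStronglyMeasurable f (volume.restrict (cell K)) →
      AEStronglyMeasurable g (volume.restrict (cell K)) →
      AEStronglyMeasurable f' (volume.restrict (cell K)) →
      AEStronglyMeasurable g' (volume.restrict (cell K)) →
      eLpNorm (fun x => f x - g x) 2 (volume.restrict (cell K)) ≤
        eLpNorm (fun x => f' x - f x) 2 (volume.restrict (cell K))
        + eLpNorm (fun x => g' x - g x) 2 (volume.restrict (cell K))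
        + eLpNorm (fun x => f' x - g' x) 2 (volume.restrict (cell K)) := by
    intro G _ f g f' g' hf hg hf' hg'
    have : (fun x => f x - g x) = -(f' - f) + (g' - g) + (f' - g') := by ext x; simp; abel
    rw [this]
    refine (eLpNorm_add_le ((hf'.sub hf).neg.add (hg'.sub hg)) (hf'.sub hg') one_le_two).trans
      (add_le_add_left ((eLpNorm_add_le (hf'.sub hf).neg (hg'.sub hg) one_le_two).trans ?_) _)
    rw [eLpNorm_neg]
    rfl
  have t1 := tri (hφ.1 n).continuous.aestronglyMeasurable (hψ.1 m).continuous.aestronglyMeasurable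
    (M.memLp_cell (v : M.L2) hK).1 (M.memLp_cell (w : M.L2) hK).1
  have t2 := tri (continuous_cgrad (contDiff_one (hφ.1 n))).aestronglyMeasurable
    (continuous_cgrad (contDiff_one (hψ.1 m))).aestronglyMeasurable
    (M.memLp_cell (M.grad v) hK).1 (M.memLp_cell (M.grad w) hK).1
  have hs : cgrad (φ n - ψ m) = fun x => cgrad (φ n) x - cgrad (ψ m) x :=
    funext fun x => cgrad_sub (hφ.1 n) (hψ.1 m) x
  refine mul_le_mul' le_rfl ?_
  rw [hs]
  refine (add_le_add t1 t2).trans (le_of_eq ?_)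
  ring

/-- By `face_le` the restrictions to the face form a Cauchy sequence, and L² of the face is
complete. -/
theorem exists_isTrace (hd : d ≠ 0) (hK : K ∈ M.elems) {a : E d} (ha : a ∈ K) (v : M.H1) :
    ∃ g, M.IsTrace K (opp K a) v g := by
  obtain ⟨φ, hφ⟩ := exists_smoothApprox hK v
  obtain ⟨C, hCt, hC⟩ := SmoothApprox.face_le hd hK ha
  have hmem : ∀ n, MemLp (φ n) 2 (faceMeasure (opp K a)) := fun n =>
    (M.isSimplex hK).memLp_face hd ha (hφ.1 n).continuous
  let e : ℕ → ℝ≥0∞ := fun n =>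
    eLpNorm (fun x => (v : M.L2) x - φ n x) 2 (volume.restrict (cell K))
      + eLpNorm (fun x => M.grad v x - cgrad (φ n) x) 2 (volume.restrict (cell K))
  have he : Tendsto e atTop (𝓝 0) := by simpa using hφ.2.1.add hφ.2.2
  have hle : ∀ n m, eLpNorm (φ n - φ m) 2 (faceMeasure (opp K a)) ≤ C * (e n + e m) := by
    intro n m
    have := hC v v φ φ hφ hφ n m
    simpa using this
  have hcau : CauchySeq fun n => (hmem n).toLp := by
    rw [EMetric.cauchySeq_iff]
    intro δ hδ
    have h2 : Tendsto (fun n => C * (e n + e n)) atTop (𝓝 0) := by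
      simpa using ENNReal.Tendsto.const_mul (he.add he) (Or.inr hCt)
    have h3 : Tendsto (fun p : ℕ × ℕ => C * (e p.1 + e p.2)) atTop (𝓝 0) := by
      rw [← prod_atTop_atTop_eq]
      simpa using ENNReal.Tendsto.const_mul
        ((he.comp tendsto_fst).add (he.comp tendsto_snd)) (Or.inr hCt)
    obtain ⟨N, hN⟩ := eventually_atTop.1 (h3.eventually (gt_mem_nhds hδ))
    refine ⟨max N.1 N.2, fun m hm n hn => ?_⟩
    rw [Lp.edist_toLp_toLp]
    exact (hle m n).trans_lt (hN (m, n) ⟨(le_max_left _ _).trans hm, (le_max_right _ _).trans hn⟩)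
  obtain ⟨g, hg⟩ := cauchySeq_tendsto_of_complete hcau
  refine ⟨g, φ, hφ.1, hφ.2.1, hφ.2.2, ?_⟩
  have := (tendsto_iff_edist_tendsto_0).1 hg
  refine this.congr fun n => ?_
  rw [edist_comm, Lp.edist_def]
  apply eLpNorm_congr_ae
  filter_upwards [(hmem n).coeFn_toLp] with x hx
  simp [hx]

/-- The chosen trace comes with some approximating sequence; `face_le` shows that any other sequence
has the same limit on the face. -/
theorem SmoothApprox.tendsto_trace (hd : d ≠ 0) (hK : K ∈ M.elems) {a : E d} (ha : a ∈ K)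
    (hφ : M.SmoothApprox K v φ) :
    Tendsto (fun n => eLpNorm (fun x => M.trace K (opp K a) v x - φ n x) 2 (faceMeasure (opp K a)))
      atTop (𝓝 0) := by
  obtain ⟨ψ, h1, h2, h3, h4⟩ := Classical.epsilon_spec (exists_isTrace hd hK ha v)
  have hψ : M.SmoothApprox K v ψ := ⟨h1, h2, h3⟩
  obtain ⟨C, hCt, hC⟩ := SmoothApprox.face_le hd hK ha
  have h5 : Tendsto (fun n => eLpNorm (ψ n - φ n) 2 (faceMeasure (opp K a))) atTop (𝓝 0) := by
    refine tendsto_of_tendsto_of_tendsto_of_le_of_le tendsto_const_nhds ?_ (fun _ => zero_le)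
      (fun n => hC v v ψ φ hψ hφ n n)
    simpa using ENNReal.Tendsto.const_mul ((hψ.2.1.add hψ.2.2).add (hφ.2.1.add hφ.2.2)) (Or.inr hCt)
  refine (eLpNorm_add_tendsto (fun n => (Lp.aestronglyMeasurable _).sub
    (h1 n).continuous.aestronglyMeasurable) (fun n => (h1 n).continuous.aestronglyMeasurable.sub
    (hφ.1 n).continuous.aestronglyMeasurable) h4 h5).congr fun n => ?_
  congr 1
  ext x
  simp [trace]

theorem SmoothApprox.trace_eq (hd : d ≠ 0) (hK : K ∈ M.elems) {a : E d} (ha : a ∈ K)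
    (hφ : M.SmoothApprox K v φ) {g : Lp ℂ 2 (faceMeasure (opp K a))}
    (hg : Tendsto (fun n => eLpNorm (fun x => g x - φ n x) 2 (faceMeasure (opp K a)))
      atTop (𝓝 0)) : M.trace K (opp K a) v = g := by
  have hφm := fun n => (hφ.1 n).continuous.aestronglyMeasurable (μ := faceMeasure (opp K a))
  have h1 := hφ.tendsto_trace hd hK ha
  have h2 : Tendsto (fun n => eLpNorm (fun x => φ n x - g x) 2 (faceMeasure (opp K a)))
      atTop (𝓝 0) := by
    refine hg.congr fun n => ?_
    rw [← eLpNorm_neg]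
    congr 1; ext x; simp
  have h3 := eLpNorm_add_tendsto (fun n => (Lp.aestronglyMeasurable _).sub (hφm n))
    (fun n => (hφm n).sub (Lp.aestronglyMeasurable _)) h1 h2
  rw [← edist_eq_zero, Lp.edist_def]
  refine tendsto_nhds_unique (tendsto_const_nhds.congr fun n => ?_) h3
  congr 1; ext x; simp

theorem trace_add (hd : d ≠ 0) (hK : K ∈ M.elems) {a : E d} (ha : a ∈ K) (v w : M.H1) :
    M.trace K (opp K a) (v + w) = M.trace K (opp K a) v + M.trace K (opp K a) w := by
  obtain ⟨φ, hφ⟩ := exists_smoothApprox hK v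
  obtain ⟨ψ, hψ⟩ := exists_smoothApprox hK w
  refine (hφ.add hK hψ).trace_eq hd hK ha ?_
  refine (eLpNorm_add_tendsto (fun n => (Lp.aestronglyMeasurable _).sub
    (hφ.1 n).continuous.aestronglyMeasurable) (fun n => (Lp.aestronglyMeasurable _).sub
    (hψ.1 n).continuous.aestronglyMeasurable) (hφ.tendsto_trace hd hK ha)
    (hψ.tendsto_trace hd hK ha)).congr fun n => ?_
  apply eLpNorm_congr_ae
  filter_upwards [Lp.coeFn_add (M.trace K (opp K a) v) (M.trace K (opp K a) w)] with x hx
  simp only [hx, Pi.add_apply, Pi.sub_apply]; ring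

theorem trace_smul (hd : d ≠ 0) (hK : K ∈ M.elems) {a : E d} (ha : a ∈ K) (c : ℂ) (v : M.H1) :
    M.trace K (opp K a) (c • v) = c • M.trace K (opp K a) v := by
  obtain ⟨φ, hφ⟩ := exists_smoothApprox hK v
  refine (hφ.smul hK c).trace_eq hd hK ha ?_
  have : Tendsto (fun n => ‖c‖ₑ * eLpNorm (fun x => M.trace K (opp K a) v x - φ n x) 2
      (faceMeasure (opp K a))) atTop (𝓝 0) := by
    simpa using ENNReal.Tendsto.const_mul (hφ.tendsto_trace hd hK ha) (Or.inr enorm_ne_top)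
  refine this.congr fun n => ?_
  rw [← eLpNorm_const_smul]
  apply eLpNorm_congr_ae
  filter_upwards [Lp.coeFn_smul c (M.trace K (opp K a) v)] with x hx
  simp only [hx, Pi.smul_apply, smul_sub]

/-- The trace is continuous for the norm of `H¹`. -/
theorem norm_trace_le (hd : d ≠ 0) (hK : K ∈ M.elems) {a : E d} (ha : a ∈ K) :
    ∃ C : ℝ, ∀ v : M.H1, ‖M.trace K (opp K a) v‖ ≤ C * (‖(v : M.L2)‖ + ‖M.grad v‖) := by
  obtain ⟨C, hCt, hC⟩ := SmoothApprox.face_le hd hK ha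
  refine ⟨C.toReal, fun v => ?_⟩
  -- Multiplying any approximating sequence by 0 shows that the zero sequence approximates 0.
  have h0a : M.SmoothApprox K (0 : M.H1) (fun _ => 0) := by
    obtain ⟨φ, hφ⟩ := exists_smoothApprox hK (0 : M.H1)
    have := hφ.smul hK (0 : ℂ)
    simpa only [zero_smul] using this
  obtain ⟨φ, hφ⟩ := exists_smoothApprox hK v
  have hg0 : M.grad (0 : M.H1) = 0 := by
    have := grad_smul (0 : ℂ) (0 : M.H1)
    simpa only [zero_smul] using this
  have e1 : eLpNorm (fun x => (v : M.L2) x - ((0 : M.H1) : M.L2) x) 2 (volume.restrict (cell K))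
      ≤ ENNReal.ofReal ‖(v : M.L2)‖ := by
    rw [ofReal_norm, Lp.enorm_def]
    refine (eLpNorm_congr_ae ?_).trans_le (eLpNorm_mono_measure _ (M.restrict_cell_le hK))
    filter_upwards [M.ae_cell_of_dom (Lp.coeFn_zero ℂ 2 _) hK] with x hx
    rw [Submodule.coe_zero, hx]; simp
  have e2 : eLpNorm (fun x => M.grad v x - M.grad (0 : M.H1) x) 2 (volume.restrict (cell K))
      ≤ ENNReal.ofReal ‖M.grad v‖ := by
    rw [ofReal_norm, Lp.enorm_def]
    refine (eLpNorm_congr_ae ?_).trans_le (eLpNorm_mono_measure _ (M.restrict_cell_le hK))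
    filter_upwards [M.ae_cell_of_dom (Lp.coeFn_zero (V d) 2 _) hK] with x hx
    rw [hg0, hx]; simp
  have hb : ∀ n, eLpNorm (M.trace K (opp K a) v) 2 (faceMeasure (opp K a)) ≤
      eLpNorm (fun x => M.trace K (opp K a) v x - φ n x) 2 (faceMeasure (opp K a)) +
      C * (eLpNorm (fun x => (v : M.L2) x - φ n x) 2 (volume.restrict (cell K))
          + eLpNorm (fun x => M.grad v x - cgrad (φ n) x) 2 (volume.restrict (cell K))
          + (eLpNorm (fun x => ((0 : M.H1) : M.L2) x - (0 : E d → ℂ) x) 2 (volume.restrict (cell K))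
          + eLpNorm (fun x => M.grad (0 : M.H1) x - cgrad 0 x) 2 (volume.restrict (cell K)))
          + (ENNReal.ofReal ‖(v : M.L2)‖ + ENNReal.ofReal ‖M.grad v‖)) := by
    intro n
    have h1 := hC v 0 φ (fun _ => 0) hφ h0a n n
    have h2 : (M.trace K (opp K a) v : E d → ℂ) =
      (fun x => M.trace K (opp K a) v x - φ n x) + (φ n - 0) := by ext x; simp
    conv_lhs => rw [h2]
    refine (eLpNorm_add_le ((Lp.aestronglyMeasurable _).sub
      (hφ.1 n).continuous.aestronglyMeasurable) ((hφ.1 n).continuous.aestronglyMeasurable.sub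
      aestronglyMeasurable_const) one_le_two).trans ?_
    refine add_le_add le_rfl (h1.trans ?_)
    gcongr
  have hlim : Tendsto (fun n =>
      eLpNorm (fun x => M.trace K (opp K a) v x - φ n x) 2 (faceMeasure (opp K a)) +
      C * (eLpNorm (fun x => (v : M.L2) x - φ n x) 2 (volume.restrict (cell K))
          + eLpNorm (fun x => M.grad v x - cgrad (φ n) x) 2 (volume.restrict (cell K))
          + (eLpNorm (fun x => ((0 : M.H1) : M.L2) x - (0 : E d → ℂ) x) 2 (volume.restrict (cell K))
          + eLpNorm (fun x => M.grad (0 : M.H1) x - cgrad 0 x) 2 (volume.restrict (cell K)))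
          + (ENNReal.ofReal ‖(v : M.L2)‖ + ENNReal.ofReal ‖M.grad v‖))) atTop
      (𝓝 (0 + C * (0 + 0 + (0 + 0) + (ENNReal.ofReal ‖(v : M.L2)‖ + ENNReal.ofReal ‖M.grad v‖)))) :=
    (hφ.tendsto_trace hd hK ha).add (ENNReal.Tendsto.const_mul
      (((hφ.2.1.add hφ.2.2).add (h0a.2.1.add h0a.2.2)).add tendsto_const_nhds) (Or.inr hCt))
  have hfin := ge_of_tendsto' hlim hb
  simp only [zero_add] at hfin
  rw [← ENNReal.ofReal_add (norm_nonneg _) (norm_nonneg _), ← ENNReal.ofReal_toReal hCt,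
    ← ENNReal.ofReal_mul ENNReal.toReal_nonneg, ← Lp.enorm_def, ← ofReal_norm] at hfin
  exact (ENNReal.ofReal_le_ofReal_iff (by positivity)).1 hfin

/-- Integration by parts on an element. -/
theorem green (hd : d ≠ 0) (hK : K ∈ M.elems) (v : M.H1) {η : E d → ℂ} (hη : ContDiff ℝ 1 η)
    (i : Fin d) :
    ∫ x in cell K, (M.grad v x i * conj (η x) + (v : M.L2) x * conj (pderiv i η x)) =
      ∑ a ∈ K, (normalAt K a i : ℂ) *
        ∫ y, M.trace K (opp K a) v y * conj (η y) ∂faceMeasure (opp K a) := by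
  have hS := M.isSimplex hK
  obtain ⟨φ, hφ⟩ := exists_smoothApprox hK v
  have hφ1 := fun n => contDiff_one (hφ.1 n)
  have mη : MemLp η 2 ((volume : Measure (E d)).restrict (cell K)) := IPDG.memLp_cell hη.continuous
  have mη' : MemLp (pderiv i η) 2 ((volume : Measure (E d)).restrict (cell K)) :=
    IPDG.memLp_cell (continuous_pderiv hη i)
  have mg : MemLp (fun x => M.grad v x i) 2 ((volume : Measure (E d)).restrict (cell K)) :=
    (EuclideanSpace.proj i : V d →L[ℂ] ℂ).comp_memLp' (M.memLp_cell (M.grad v) hK)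
  have mv := M.memLp_cell (v : M.L2) hK
  have mφ := fun n => IPDG.memLp_cell (K := K) (hφ1 n).continuous
  have mφ' := fun n => IPDG.memLp_cell (K := K) (continuous_pderiv (hφ1 n) i)
  have mul_int : ∀ {f h : E d → ℂ}, MemLp f 2 ((volume : Measure (E d)).restrict (cell K)) →
      MemLp h 2 ((volume : Measure (E d)).restrict (cell K)) →
      Integrable (fun x => f x * conj (h x)) ((volume : Measure (E d)).restrict (cell K)) :=
    fun hf hh => hf.integrable_mul (Complex.conjLIE.toContinuousLinearEquiv.toContinuousLinearMap.comp_memLp' hh)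
  have hsm := fun n => hS.green_smooth hd (hφ1 n) hη i
  have l1 := tendsto_integral_mul_conj mv mφ mη' hφ.2.1
  have l2 : Tendsto (fun n => ∫ x in cell K, pderiv i (φ n) x * conj (η x)) atTop
      (𝓝 (∫ x in cell K, M.grad v x i * conj (η x))) := by
    refine tendsto_integral_mul_conj mg mφ' mη ?_
    refine tendsto_of_tendsto_of_tendsto_of_le_of_le tendsto_const_nhds hφ.2.2 (fun _ => zero_le) ?_
    intro n
    refine eLpNorm_mono fun x => ?_
    exact PiLp.norm_apply_le (M.grad v x - cgrad (φ n) x) i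
  have l3 : Tendsto (fun n => ∑ a ∈ K, (normalAt K a i : ℂ) *
      ∫ y, φ n y * conj (η y) ∂faceMeasure (opp K a)) atTop (𝓝 (∑ a ∈ K, (normalAt K a i : ℂ) *
        ∫ y, M.trace K (opp K a) v y * conj (η y) ∂faceMeasure (opp K a))) := by
    refine tendsto_finsetSum _ fun a ha => Tendsto.const_mul _ ?_
    exact tendsto_integral_mul_conj (Lp.memLp _) (fun n => hS.memLp_face hd ha (hφ1 n).continuous)
      (hS.memLp_face hd ha hη.continuous) (hφ.tendsto_trace hd hK ha)
  rw [integral_add (mul_int mg mη) (mul_int mv mη')]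
  refine tendsto_nhds_unique (l2.add l1) (l3.congr fun n => ?_)
  rw [← hsm n, integral_add (mul_int (mφ' n) mη) (mul_int (mφ n) mη')]

end Mesh

/-! ### Faces of one simplex -/

section SimplexFaces

variable {d : ℕ} {K : Finset (E d)}

theorem card_opp {a : E d} (ha : a ∈ K) : (opp K a).card + 1 = K.card := by
  classical
  rw [opp]
  convert Finset.card_erase_add_one ha

theorem IsSimplex.eq_opp_iff (h : IsSimplex K) {F : Finset (E d)} :
    F ∈ K.powersetCard d ↔ ∃ a ∈ K, F = opp K a := by
  rw [Finset.mem_powersetCard]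
  constructor
  · rintro ⟨hF, hc⟩
    obtain ⟨a, ha, haF⟩ := Finset.exists_mem_notMem_of_card_lt_card
      (show F.card < K.card by rw [h.1, hc]; omega)
    refine ⟨a, ha, Finset.eq_of_subset_of_card_le (fun b hb => mem_opp.2 ⟨?_, hF hb⟩) ?_⟩
    · rintro rfl; exact haF hb
    · have := card_opp ha
      rw [h.1] at this
      omega
  · rintro ⟨a, ha, rfl⟩
    have := card_opp ha
    rw [h.1] at this
    exact ⟨opp_subset K a, by omega⟩

theorem opp_injOn {a b : E d} (ha : a ∈ K) (h : opp K a = opp K b) : a = b := by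
  by_contra hne
  have : a ∈ opp K b := mem_opp.2 ⟨hne, ha⟩
  rw [← h] at this
  exact (mem_opp.1 this).1 rfl

/-- A normal to a face is a multiple of the gradient of the opposite barycentric coordinate. -/
theorem IsSimplex.eq_smul_gvec (h : IsSimplex K) {a b : E d} (ha : a ∈ K) {n : E d}
    (hn : ∀ c ∈ opp K a, inner ℝ (c - b) n = 0) :
    n = (inner ℝ (a - b) n : ℝ) • gvec K a := by
  refine ext_inner_left ℝ fun e => ?_
  have he : e = ∑ c ∈ K, inner ℝ (gvec K c) e • (c - b) := by
    simp_rw [smul_sub]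
    rw [Finset.sum_sub_distrib, h.sum_gvec_smul, ← Finset.sum_smul, h.sum_gvec, zero_smul, sub_zero]
  conv_lhs => rw [he]
  rw [sum_inner, Finset.sum_eq_single_of_mem a ha]
  · rw [real_inner_smul_left, inner_smul_right, real_inner_comm, mul_comm]
  · intro c hc hca
    rw [real_inner_smul_left, hn c (mem_opp.2 ⟨hca, hc⟩), mul_zero]

theorem IsSimplex.exists_mem_opp (h : IsSimplex K) (hd : d ≠ 0) (a : E d) : ∃ b, b ∈ opp K a := by
  obtain ⟨b, hb, hba⟩ := h.exists_ne hd a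
  exact ⟨b, mem_opp.2 ⟨hba, hb⟩⟩

/-- The points of a face where a further barycentric coordinate vanishes form a null set. -/
theorem IsSimplex.faceMeasure_bary_eq_zero (h : IsSimplex K) (hd : d ≠ 0) {a b : E d} (ha : a ∈ K)
    (hb : b ∈ opp K a) : ∀ᵐ x ∂faceMeasure (opp K a), bary K b x ≠ 0 := by
  obtain ⟨hba, hbK⟩ := mem_opp.1 hb
  have hi := (isometry_conePt K a (height K a)).isClosedEmbedding.measurableEmbedding
  rw [h.faceMeasure_eq_map hd ha, hi.ae_map_iff]
  apply ae_restrict_of_ae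
  let f : faceDir K a →ᵃ[ℝ] ℝ := (bary K b).comp
    ((faceDir K a).subtype.toAffineMap + AffineMap.const ℝ _ (a + height K a • normalAt K a))
  have hf : ∀ z, f z = bary K b (conePt K a (height K a, z)) := by
    intro z
    simp only [f, AffineMap.comp_apply, conePt]
    congr 1
    simp
    abel
  -- The zero set of an affine function is an affine subspace. It is proper, since the coordinate
  -- equals 1 at the vertex `b` of the face.
  let s : AffineSubspace ℝ (faceDir K a) := (AffineSubspace.mk' (0 : ℝ) ⊥).comap f
  have hs : ∀ z, z ∈ s ↔ f z = 0 := by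
    intro z
    simp [s, AffineSubspace.mem_comap, AffineSubspace.mem_mk']
  have hne : s ≠ ⊤ := by
    intro htop
    have hbm := (h.mem_hull_opp ha).2 ⟨subset_convexHull ℝ _ hbK, h.bary_ne ha hbK hba.symm⟩
    have hinner := inner_normalAt K a a b
    rw [h.bary_ne ha hbK hba.symm, h.bary_self ha] at hinner
    have hz : b - a - height K a • normalAt K a ∈ faceDir K a := by
      rw [Submodule.mem_orthogonal_singleton_iff_inner_left, inner_sub_left, hinner, inner_smul_left,
        real_inner_self_eq_norm_sq, h.norm_normalAt hd ha]
      simp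
    have h0 := (hs ⟨_, hz⟩).1 (by rw [htop]; trivial)
    rw [hf] at h0
    simp only [conePt] at h0
    rw [show a + (height K a • normalAt K a + (b - a - height K a • normalAt K a)) = b by abel,
      h.bary_self hbK] at h0
    exact one_ne_zero h0
  have hnull := Measure.addHaar_affineSubspace (volume : Measure (faceDir K a)) s hne
  have : ∀ᵐ z ∂(volume : Measure (faceDir K a)), z ∉ (s : Set (faceDir K a)) :=
    measure_eq_zero_iff_ae_notMem.1 hnull
  filter_upwards [this] with z hz h0
  exact hz ((hs z).2 ((hf z).trans h0))

theorem faceMeasure_ae_mem (F : Finset (E d)) : ∀ᵐ x ∂faceMeasure F, x ∈ hull F :=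
  ae_restrict_mem (isCompact_hull F).measurableSet

end SimplexFaces

namespace Mesh

variable {d : ℕ} {M : Mesh d}

/-! ## Faces of the mesh -/

theorem mem_faces {F : Finset (E d)} : F ∈ M.faces ↔ ∃ K ∈ M.elems, ∃ a ∈ K, F = opp K a := by
  classical
  rw [faces]
  constructor
  · intro h
    obtain ⟨K, hK, hF⟩ := Finset.mem_biUnion.1 h
    exact ⟨K, hK, (M.isSimplex hK).eq_opp_iff.1 hF⟩
  · rintro ⟨K, hK, h⟩
    exact Finset.mem_biUnion.2 ⟨K, hK, (M.isSimplex hK).eq_opp_iff.2 h⟩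

theorem mem_elemsAt {F K : Finset (E d)} : K ∈ M.elemsAt F ↔ K ∈ M.elems ∧ F ⊆ K := by
  classical
  rw [elemsAt, Finset.mem_filter]

theorem card_face {F : Finset (E d)} (hF : F ∈ M.faces) : F.card = d := by
  obtain ⟨K, hK, a, ha, rfl⟩ := mem_faces.1 hF
  have := card_opp ha
  rw [M.card_eq K hK] at this
  omega

theorem exists_eq_opp {F K : Finset (E d)} (hF : F ∈ M.faces) (hK : K ∈ M.elemsAt F) :
    ∃ a ∈ K, F = opp K a := by
  obtain ⟨hK, hFK⟩ := mem_elemsAt.1 hK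
  exact (M.isSimplex hK).eq_opp_iff.1 (Finset.mem_powersetCard.2 ⟨hFK, card_face hF⟩)

/-- Pairs made of an element and one of its vertices correspond to pairs made of a face and an
adjacent element, through the opposite face. This regroups element boundary terms face by face. -/
theorem sum_elems_eq_sum_faces {N : Type*} [AddCommMonoid N]
    (f : Finset (E d) → Finset (E d) → N) :
    ∑ K ∈ M.elems, ∑ a ∈ K, f K (opp K a) = ∑ F ∈ M.faces, ∑ K ∈ M.elemsAt F, f K F := by
  have h1 : ∀ K ∈ M.elems, ∑ a ∈ K, f K (opp K a) = ∑ F ∈ K.powersetCard d, f K F := by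
    intro K hK
    refine Finset.sum_bij (fun a _ => opp K a) ?_ ?_ ?_ ?_
    · exact fun a ha => (M.isSimplex hK).eq_opp_iff.2 ⟨a, ha, rfl⟩
    · exact fun a ha b _ hab => opp_injOn ha hab
    · intro F hF
      obtain ⟨a, ha, h⟩ := (M.isSimplex hK).eq_opp_iff.1 hF
      exact ⟨a, ha, h.symm⟩
    · exact fun _ _ => rfl
  rw [Finset.sum_congr rfl h1]
  refine Finset.sum_comm' fun K F => ?_
  rw [mem_elemsAt, Finset.mem_powersetCard]
  constructor
  · rintro ⟨hK, hFK, hc⟩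
    refine ⟨⟨hK, hFK⟩, mem_faces.2 ⟨K, hK, (M.isSimplex hK).eq_opp_iff.1 ?_⟩⟩
    exact Finset.mem_powersetCard.2 ⟨hFK, hc⟩
  · rintro ⟨⟨hK, hFK⟩, hF⟩
    exact ⟨hK, hFK, card_face hF⟩

-- The matching condition passes to subsimplices: a point common to both has zero coordinate at
-- every vertex of `A` that is not in `B`.
open Classical in
theorem mem_hull_inter_of_subset {K L A B : Finset (E d)} (hK : K ∈ M.elems) (hL : L ∈ M.elems)
    (hA : A ⊆ K) (hB : B ⊆ L) {x : E d} (hxA : x ∈ hull A) (hxB : x ∈ hull B) :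
    x ∈ hull (A.filter (· ∈ B)) := by
  have hSK := M.isSimplex hK
  have hSL := M.isSimplex hL
  obtain ⟨hxK, hxA'⟩ := (hSK.mem_hull_of_subset hA).1 hxA
  obtain ⟨hxL, hxB'⟩ := (hSL.mem_hull_of_subset hB).1 hxB
  have h1 : x ∈ hull (B.filter (· ∈ K)) := by
    refine (hSL.mem_hull_of_subset ((Finset.filter_subset _ _).trans hB)).2 ⟨hxL, fun b hb hn => ?_⟩
    by_cases hbB : b ∈ B
    · exact M.bary_eq_zero_of_mem_hull hL hK hxL hxK hb fun hbK =>
        hn (Finset.mem_filter.2 ⟨hbB, hbK⟩)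
    · exact hxB' b hb hbB
  have h2 := (hSK.mem_hull_of_subset (G := B.filter (· ∈ K))
    fun b hb => (Finset.mem_filter.1 hb).2).1 h1
  refine (hSK.mem_hull_of_subset ((Finset.filter_subset _ _).trans hA)).2 ⟨hxK, fun b hb hn => ?_⟩
  by_cases hbA : b ∈ A
  · refine h2.2 b hb fun hbB => hn (Finset.mem_filter.2 ⟨hbA, (Finset.mem_filter.1 hbB).1⟩)
  · exact hxA' b hb hbA

/-- Distinct faces meet in a null set. -/
theorem faceMeasure_ae_notMem (hd : d ≠ 0) {F F' : Finset (E d)} (hF : F ∈ M.faces)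
    (hF' : F' ∈ M.faces) (hne : F ≠ F') : ∀ᵐ x ∂faceMeasure F, x ∉ hull F' := by
  classical
  obtain ⟨K, hK, a, ha, rfl⟩ := mem_faces.1 hF
  obtain ⟨K', hK', a', ha', rfl⟩ := mem_faces.1 hF'
  obtain ⟨b, hb, hb'⟩ : ∃ b ∈ opp K a, b ∉ opp K' a' := by
    by_contra! hsub
    exact hne (Finset.eq_of_subset_of_card_le hsub (by rw [card_face hF, card_face hF']))
  filter_upwards [faceMeasure_ae_mem (opp K a),
    (M.isSimplex hK).faceMeasure_bary_eq_zero hd ha hb] with x hx hbx hx'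
  have h1 := mem_hull_inter_of_subset hK hK' (opp_subset K a) (opp_subset K' a') hx hx'
  exact hbx ((((M.isSimplex hK).mem_hull_of_subset
    ((Finset.filter_subset _ _).trans (opp_subset K a))).1 h1).2 b (mem_opp.1 hb).2 (by simp [hb']))

variable {F K L : Finset (E d)} {a b : E d}

/-- Barycentric coordinates with respect to the vertices of a common face are positive in both
elements at once. -/
theorem bary_pos_of_face (hK : K ∈ M.elems) (hL : L ∈ M.elems) (hb : b ∈ L)
    (hab : opp K a = opp L b) {x : E d} (hx : x ∈ hull (opp K a))
    (hpos : ∀ c ∈ opp K a, bary K c x ≠ 0) : ∀ c ∈ opp L b, 0 < bary L c x := by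
  classical
  intro c hc
  have hxL : x ∈ hull (opp L b) := hab ▸ hx
  obtain ⟨hxL', hxb⟩ := ((M.isSimplex hL).mem_hull_opp hb).1 hxL
  refine lt_of_le_of_ne ((M.isSimplex hL).mem_hull.1 hxL' c (mem_opp.1 hc).2) fun h0 => ?_
  have h1 : x ∈ hull ((opp L b).filter (· ≠ c)) := by
    refine ((M.isSimplex hL).mem_hull_of_subset ((Finset.filter_subset _ _).trans (opp_subset L b))).2
      ⟨hxL', fun e he hn => ?_⟩
    by_cases hec : e = c
    · rw [hec, h0]
    · by_cases heb : e = b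
      · rw [heb, hxb]
      · exact absurd (Finset.mem_filter.2 ⟨mem_opp.2 ⟨heb, he⟩, hec⟩) hn
  have hcK : c ∈ opp K a := hab ▸ hc
  rw [← hab] at h1
  exact hpos c hcK ((((M.isSimplex hK).mem_hull_of_subset
    ((Finset.filter_subset _ _).trans (opp_subset K a))).1 h1).2 c (mem_opp.1 hcK).2 (by simp))

/-- The radial identity for the constant 1 says that `d` times the volume of the simplex is the
height times the measure of the face, so the face is not null. Each zero set of a further coordinate
is null. -/
theorem exists_relint (hd : d ≠ 0) (hK : K ∈ M.elems) (ha : a ∈ K) :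
    ∃ x ∈ hull (opp K a), ∀ c ∈ opp K a, bary K c x ≠ 0 := by
  have h := M.isSimplex hK
  have hne : (ae (faceMeasure (opp K a))).NeBot := by
    rw [ae_neBot]
    intro h0
    have h1 := h.integral_radial hd ha (ψ := fun _ => 1) contDiff_const
    rw [h0] at h1
    have h2 : (volume : Measure (E d)) (cell K) ≠ 0 :=
      ((isOpen_cell K).measure_pos volume h.cell_nonempty).ne'
    have h3 : (volume : Measure (E d)) (cell K) ≠ ⊤ :=
      ((measure_mono (cell_subset_hull K)).trans_lt (isCompact_hull K).measure_lt_top).ne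
    simp [measureReal_def, ENNReal.toReal_eq_zero_iff, h2, h3] at h1
    exact hd h1
  have hall : ∀ᵐ x ∂faceMeasure (opp K a), ∀ c ∈ opp K a, bary K c x ≠ 0 := by
    rw [Finset.eventually_all]
    exact fun c hc => h.faceMeasure_bary_eq_zero hd ha hc
  obtain ⟨x, hx1, hx2⟩ := ((faceMeasure_ae_mem _).and hall).exists
  exact ⟨x, hx1, hx2⟩

/-- Two distinct elements lie on opposite sides of a common face. -/
theorem normalAt_eq_neg (hd : d ≠ 0) (hK : K ∈ M.elems) (hL : L ∈ M.elems) (hne : K ≠ L)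
    (ha : a ∈ K) (hb : b ∈ L) (hab : opp K a = opp L b) : normalAt L b = -normalAt K a := by
  have hSK := M.isSimplex hK
  have hSL := M.isSimplex hL
  have hhK := hSK.height_pos hd ha
  have hhL := hSL.height_pos hd hb
  obtain ⟨n1, n2, n3⟩ := (hSL.isOutwardNormal_iff hd hb _).2 rfl
  rw [← hab] at n2
  obtain ⟨e, he⟩ := hSK.exists_mem_opp hd a
  have h1 := hSK.eq_smul_gvec ha (n := normalAt L b) fun c hc => n2 e he c hc
  set t : ℝ := inner ℝ (a - e) (normalAt L b)
  have h2 : normalAt L b = (-(t * (height K a)⁻¹)) • normalAt K a := by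
    rw [h1, show normalAt K a = -(height K a • gvec K a) from rfl, smul_neg, neg_smul, neg_neg,
      smul_smul, mul_assoc, inv_mul_cancel₀ hhK.ne', mul_one]
  set τ := -(t * (height K a)⁻¹)
  have h3 : |τ| = 1 := by
    have := congrArg norm h2
    rw [hSL.norm_normalAt hd hb, norm_smul, hSK.norm_normalAt hd ha, mul_one] at this
    exact this.symm
  rcases (abs_eq zero_le_one).1 h3 with h4 | h4
  -- If the outward normals agreed, a small step from a relative interior point of the face against
  -- the normal would enter both cells, which are disjoint.
  · exfalso
    rw [h4, one_smul] at h2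
    obtain ⟨x, hx, hxc⟩ := exists_relint hd hK ha
    have hposK := bary_pos_of_face hK hK ha rfl hx hxc
    have hposL := bary_pos_of_face hK hL hb hab hx hxc
    have hline : Tendsto (fun s : ℝ => x - s • normalAt K a) (𝓝[>] 0) (𝓝 x) := by
      have : Continuous fun s : ℝ => x - s • normalAt K a := by fun_prop
      have := (this.tendsto 0).mono_left (nhdsWithin_le_nhds (s := Set.Ioi (0 : ℝ)))
      simpa using this
    have evK : ∀ᶠ s : ℝ in 𝓝[>] 0, ∀ c ∈ opp K a, 0 < bary K c (x - s • normalAt K a) := by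
      rw [Finset.eventually_all]
      exact fun c hc => (((continuous_bary K c).tendsto x).comp hline).eventually
        (lt_mem_nhds (hposK c hc))
    have evL : ∀ᶠ s : ℝ in 𝓝[>] 0, ∀ c ∈ opp L b, 0 < bary L c (x - s • normalAt K a) := by
      rw [Finset.eventually_all]
      exact fun c hc => (((continuous_bary L c).tendsto x).comp hline).eventually
        (lt_mem_nhds (hposL c hc))
    obtain ⟨s, ⟨hsK, hsL⟩, hs⟩ := ((evK.and evL).and self_mem_nhdsWithin).exists
    have apex : ∀ {N : Finset (E d)} {c : E d}, IsSimplex N → c ∈ N → x ∈ hull (opp N c) →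
        normalAt N c = normalAt K a → 0 < bary N c (x - s • normalAt K a) := by
      intro N c hN hc hxN hn
      have h5 := inner_normalAt N c x (x - s • normalAt K a)
      have hh := hN.height_pos hd hc
      rw [((hN.mem_hull_opp hc).1 hxN).2, sub_sub_cancel_left, inner_neg_left, inner_smul_left,
        hn, real_inner_self_eq_norm_sq, hSK.norm_normalAt hd ha] at h5
      simp only [conj_trivial, one_pow, mul_one, sub_zero, neg_inj] at h5
      have : 0 < height N c * bary N c (x - s • normalAt K a) := by rw [← h5]; exact hs
      exact pos_of_mul_pos_right this hh.le
    refine Set.disjoint_left.1 (M.disjoint_cell hK hL hne)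
      (show x - s • normalAt K a ∈ cell K from ?_) ?_
    · refine hSK.mem_cell.2 fun c hc => ?_
      by_cases hca : c = a
      · rw [hca]; exact apex hSK ha hx rfl
      · exact hsK c (mem_opp.2 ⟨hca, hc⟩)
    · refine hSL.mem_cell.2 fun c hc => ?_
      by_cases hcb : c = b
      · rw [hcb]; exact apex hSL hb (hab ▸ hx) h2
      · exact hsL c (mem_opp.2 ⟨hcb, hc⟩)
  · rw [h2, h4, neg_smul, one_smul]

/-- Interior faces lie in the domain up to a null set. -/
theorem faceMeasure_ae_mem_dom (hd : d ≠ 0) (hK : K ∈ M.elems) (hL : L ∈ M.elems) (hne : K ≠ L)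
    (ha : a ∈ K) (hb : b ∈ L) (hab : opp K a = opp L b) :
    ∀ᵐ x ∂faceMeasure (opp K a), x ∈ M.dom := by
  have hSK := M.isSimplex hK
  have hSL := M.isSimplex hL
  have hall : ∀ᵐ x ∂faceMeasure (opp K a), ∀ c ∈ opp K a, bary K c x ≠ 0 := by
    rw [Finset.eventually_all]
    exact fun c hc => hSK.faceMeasure_bary_eq_zero hd ha hc
  filter_upwards [hall, faceMeasure_ae_mem (opp K a)] with x hxc hx
  have hposK := bary_pos_of_face hK hK ha rfl hx hxc
  have hposL := bary_pos_of_face hK hL hb hab hx hxc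
  have evK : ∀ᶠ y in 𝓝 x, ∀ c ∈ opp K a, 0 < bary K c y := by
    rw [Finset.eventually_all]
    exact fun c hc => ((continuous_bary K c).tendsto x).eventually (lt_mem_nhds (hposK c hc))
  have evL : ∀ᶠ y in 𝓝 x, ∀ c ∈ opp L b, 0 < bary L c y := by
    rw [Finset.eventually_all]
    exact fun c hc => ((continuous_bary L c).tendsto x).eventually (lt_mem_nhds (hposL c hc))
  rw [dom, mem_interior_iff_mem_nhds]
  filter_upwards [evK, evL] with y hyK hyL
  simp only [Set.mem_iUnion]
  -- Near `x` all coordinates at the face vertices are positive in both elements. The sign of the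
  -- remaining one decides in which of the two `y` lies, because the normals are opposite.
  rcases le_or_gt 0 (bary K a y) with h0 | h0
  · refine ⟨K, hK, hSK.mem_hull.2 fun c hc => ?_⟩
    by_cases hca : c = a
    · rwa [hca]
    · exact (hyK c (mem_opp.2 ⟨hca, hc⟩)).le
  · refine ⟨L, hL, hSL.mem_hull.2 fun c hc => ?_⟩
    by_cases hcb : c = b
    · have h1 := inner_normalAt K a x y
      have h2 := inner_normalAt L b x y
      rw [((hSK.mem_hull_opp ha).1 hx).2, sub_zero] at h1
      have hxL : x ∈ hull (opp L b) := hab ▸ hx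
      rw [((hSL.mem_hull_opp hb).1 hxL).2, sub_zero, normalAt_eq_neg hd hK hL hne ha hb hab,
        inner_neg_right, h1, neg_neg] at h2
      have h3 : 0 < height L b * bary L b y := by
        have := mul_pos_of_neg_of_neg (neg_neg_of_pos (hSK.height_pos hd ha)) h0
        linarith
      rw [hcb]
      exact (pos_of_mul_pos_right h3 (hSL.height_pos hd hb).le).le
    · exact (hyL c (mem_opp.2 ⟨hcb, hc⟩)).le

/-- Up to a null set, the faces of only one element do not meet the domain. -/
theorem faceMeasure_ae_notMem_dom (hd : d ≠ 0) (hK : K ∈ M.elems) (ha : a ∈ K)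
    (hone : ∀ L ∈ M.elemsAt (opp K a), L = K) : ∀ᵐ x ∂faceMeasure (opp K a), x ∉ M.dom := by
  have hSK := M.isSimplex hK
  have hall : ∀ᵐ x ∂faceMeasure (opp K a), ∀ c ∈ opp K a, bary K c x ≠ 0 := by
    rw [Finset.eventually_all]
    exact fun c hc => hSK.faceMeasure_bary_eq_zero hd ha hc
  filter_upwards [hall, faceMeasure_ae_mem (opp K a)] with x hxc hx hdom
  have hline : Tendsto (fun s : ℝ => x + s • normalAt K a) (𝓝[>] 0) (𝓝 x) := by
    have : Continuous fun s : ℝ => x + s • normalAt K a := by fun_prop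
    have := (this.tendsto 0).mono_left (nhdsWithin_le_nhds (s := Set.Ioi (0 : ℝ)))
    simpa using this
  have hev : ∀ᶠ s : ℝ in 𝓝[>] 0, ∃ L ∈ M.elems, x + s • normalAt K a ∈ hull L := by
    filter_upwards [hline.eventually (M.isOpen_dom.mem_nhds hdom)] with s hs
    simpa using M.dom_subset hs
  -- If `x` were in the open domain, the points slightly outside `K` along the normal would be
  -- covered by finitely many elements, so one `L` contains them frequently. It contains `x` by
  -- closedness, hence all face vertices, hence is `K`, a contradiction.
  obtain ⟨L, hL, hfreq⟩ : ∃ L ∈ M.elems, ∃ᶠ s : ℝ in 𝓝[>] 0, x + s • normalAt K a ∈ hull L := by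
    by_contra! hcon
    have : ∀ᶠ s : ℝ in 𝓝[>] 0, ∀ L ∈ M.elems, x + s • normalAt K a ∉ hull L := by
      rw [Finset.eventually_all]
      exact hcon
    obtain ⟨s, ⟨L, hL, hs⟩, hs'⟩ := (hev.and this).exists
    exact hs' L hL hs
  have hxL : x ∈ hull L :=
    (isCompact_hull L).isClosed.mem_of_frequently_of_tendsto hfreq hline
  have hxK := ((hSK.mem_hull_opp ha).1 hx).1
  have hLK : L = K := by
    refine hone L (mem_elemsAt.2 ⟨hL, fun c hc => ?_⟩)
    by_contra hcL
    exact hxc c hc (M.bary_eq_zero_of_mem_hull hK hL hxK hxL (mem_opp.1 hc).2 hcL)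
  obtain ⟨s, hs, hs0⟩ := (hfreq.and_eventually self_mem_nhdsWithin).exists
  rw [hLK] at hs
  have h5 := inner_normalAt K a x (x + s • normalAt K a)
  rw [((hSK.mem_hull_opp ha).1 hx).2, add_sub_cancel_left, inner_smul_left,
    real_inner_self_eq_norm_sq, hSK.norm_normalAt hd ha] at h5
  simp only [conj_trivial, one_pow, mul_one, sub_zero] at h5
  have h6 := mul_nonneg (hSK.height_pos hd ha).le (hSK.mem_hull.1 hs a ha)
  have h7 : (0 : ℝ) < s := hs0
  linarith

/-- Among three elements the normals would be pairwise opposite, which forces a unit vector to equal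
its negative. -/
theorem card_elemsAt_le (hd : d ≠ 0) (hF : F ∈ M.faces) : (M.elemsAt F).card ≤ 2 := by
  by_contra! h
  obtain ⟨K1, K2, K3, h1, h2, h3, h12, h13, h23⟩ := Finset.two_lt_card_iff.1 h
  obtain ⟨a1, ha1, e1⟩ := exists_eq_opp hF h1
  obtain ⟨a2, ha2, e2⟩ := exists_eq_opp hF h2
  obtain ⟨a3, ha3, e3⟩ := exists_eq_opp hF h3
  have m1 := (mem_elemsAt.1 h1).1
  have m2 := (mem_elemsAt.1 h2).1
  have m3 := (mem_elemsAt.1 h3).1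
  have n12 := normalAt_eq_neg hd m1 m2 h12 ha1 ha2 (e1.symm.trans e2)
  have n13 := normalAt_eq_neg hd m1 m3 h13 ha1 ha3 (e1.symm.trans e3)
  have n23 := normalAt_eq_neg hd m2 m3 h23 ha2 ha3 (e2.symm.trans e3)
  rw [n13, n12, neg_neg] at n23
  have n0 : (2 : ℝ) • normalAt K1 a1 = 0 := by
    rw [two_smul]
    nth_rewrite 1 [← n23]
    simp
  replace n0 := (smul_eq_zero.1 n0).resolve_left two_ne_zero
  have := (M.isSimplex m1).norm_normalAt hd ha1
  rw [n0, norm_zero] at this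
  exact zero_ne_one this

theorem elemsAt_nonempty (hF : F ∈ M.faces) : (M.elemsAt F).Nonempty := by
  obtain ⟨K, hK, a, -, rfl⟩ := mem_faces.1 hF
  exact ⟨K, mem_elemsAt.2 ⟨hK, opp_subset K a⟩⟩

theorem outNormal_opp (hd : d ≠ 0) (hK : K ∈ M.elems) (ha : a ∈ K) :
    outNormal K (opp K a) = normalAt K a := (M.isSimplex hK).outNormal_eq hd ha

end Mesh

/-! ## Smooth functions on the mesh -/

theorem pderiv_ofReal {d : ℕ} {φ : E d → ℝ} (hφ : ContDiff ℝ 1 φ) (i : Fin d) (x : E d) :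
    pderiv i (fun y => (φ y : ℂ)) x = ((pderiv i φ x : ℝ) : ℂ) := by
  have h := Complex.ofRealCLM.hasFDerivAt.comp x
    (hφ.differentiable one_ne_zero x).hasFDerivAt
  exact congrArg (fun l : E d →L[ℝ] ℂ => l (EuclideanSpace.single i 1)) h.fderiv

theorem contDiff_ofReal {d : ℕ} {n : WithTop ℕ∞} {φ : E d → ℝ} (hφ : ContDiff ℝ n φ) :
    ContDiff ℝ n fun x => (φ x : ℂ) := Complex.ofRealCLM.contDiff.comp hφ

theorem integral_mul_pderiv_test {d : ℕ} {D : Set (E d)} {φ : E d → ℝ} (hφ : IsTest D φ)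
    {ψ : E d → ℂ} (hψ : ContDiff ℝ 1 ψ) (i : Fin d) :
    ∫ x in D, ψ x * ((pderiv i φ x : ℝ) : ℂ) = -∫ x in D, pderiv i ψ x * (φ x : ℂ) := by
  have hφ1 : ContDiff ℝ 1 φ := hφ.1.of_le (by simp)
  have hz : ∀ x ∉ D, φ x = 0 := fun x hx => image_eq_zero_of_notMem_tsupport fun h => hx (hφ.2.2 h)
  have hz' : ∀ x ∉ D, pderiv i φ x = 0 := by
    intro x hx
    have : fderiv ℝ φ x = 0 := by
      by_contra hne
      exact hx (hφ.2.2 (support_fderiv_subset ℝ (Function.mem_support.2 hne)))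
    rw [pderiv, this, _root_.zero_apply]
  rw [setIntegral_eq_integral_of_forall_compl_eq_zero (fun x hx => by rw [hz' x hx]; simp),
    setIntegral_eq_integral_of_forall_compl_eq_zero (fun x hx => by rw [hz x hx]; simp)]
  have hc : HasCompactSupport fun x => (φ x : ℂ) :=
    hφ.2.1.comp_left (g := fun t : ℝ => (t : ℂ)) (by simp)
  have hc' : HasCompactSupport fun x => ((pderiv i φ x : ℝ) : ℂ) :=
    (Mesh.pderiv_hasCompactSupport hφ i).comp_left (g := fun t : ℝ => (t : ℂ)) (by simp)
  have hφc := contDiff_ofReal hφ1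
  have hcont : Continuous fun x => ((pderiv i φ x : ℝ) : ℂ) :=
    Complex.continuous_ofReal.comp (Mesh.pderiv_continuous hφ i)
  have := integral_mul_fderiv_eq_neg_fderiv_mul_of_integrable (μ := (volume : Measure (E d)))
    (f := ψ) (g := fun x => (φ x : ℂ)) (v := EuclideanSpace.single i 1)
    (((continuous_pderiv hψ i).mul hφc.continuous).integrable_of_hasCompactSupport hc.mul_left)
    ?_ ((hψ.continuous.mul hφc.continuous).integrable_of_hasCompactSupport hc.mul_left)
    (fun x _ => hψ.differentiable one_ne_zero x) (fun x _ => hφc.differentiable one_ne_zero x)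
  · rw [← show (∫ x, ψ x * fderiv ℝ (fun x => (φ x : ℂ)) x (EuclideanSpace.single i 1)) =
      ∫ x, ψ x * ((pderiv i φ x : ℝ) : ℂ) from
        integral_congr_ae (ae_of_all _ fun x => congrArg (ψ x * ·) (pderiv_ofReal hφ1 i x))]
    exact this
  · refine ((hψ.continuous.mul hcont).integrable_of_hasCompactSupport hc'.mul_left).congr
      (ae_of_all _ fun x => ?_)
    exact congrArg (ψ x * ·) (pderiv_ofReal hφ1 i x).symm

theorem isWeakGrad_cgrad {d : ℕ} (D : Set (E d)) {ψ : E d → ℂ} (hψ : ContDiff ℝ 1 ψ) :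
    IsWeakGrad D ψ (cgrad ψ) := fun _ hφ i => integral_mul_pderiv_test hφ hψ i

theorem IsTest.mono {d : ℕ} {D D' : Set (E d)} {φ : E d → ℝ} (h : IsTest D φ) (hD : D ⊆ D') :
    IsTest D' φ := ⟨h.1, h.2.1, h.2.2.trans hD⟩

theorem IsTest.setIntegral_eq {d : ℕ} {D D' : Set (E d)} {φ : E d → ℝ} (h : IsTest D φ)
    (hD : D ⊆ D') (f : E d → ℂ) : ∫ x in D, f x * (φ x : ℂ) = ∫ x in D', f x * (φ x : ℂ) := by
  have hz : ∀ x ∉ D, f x * (φ x : ℂ) = 0 := fun x hx => by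
    rw [image_eq_zero_of_notMem_tsupport fun ht => hx (h.2.2 ht), Complex.ofReal_zero, mul_zero]
  rw [setIntegral_eq_integral_of_forall_compl_eq_zero hz,
    setIntegral_eq_integral_of_forall_compl_eq_zero fun x hx => hz x fun hx' => hx (hD hx')]

theorem IsTest.setIntegral_pderiv_eq {d : ℕ} {D D' : Set (E d)} {φ : E d → ℝ} (h : IsTest D φ)
    (hD : D ⊆ D') (i : Fin d) (f : E d → ℂ) :
    ∫ x in D, f x * ((pderiv i φ x : ℝ) : ℂ) = ∫ x in D', f x * ((pderiv i φ x : ℝ) : ℂ) := by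
  have hz : ∀ x ∉ D, f x * ((pderiv i φ x : ℝ) : ℂ) = 0 := fun x hx => by
    have : fderiv ℝ φ x = 0 := by
      by_contra hne
      exact hx (h.2.2 (support_fderiv_subset ℝ (Function.mem_support.2 hne)))
    rw [pderiv, this, _root_.zero_apply, Complex.ofReal_zero, mul_zero]
  rw [setIntegral_eq_integral_of_forall_compl_eq_zero hz,
    setIntegral_eq_integral_of_forall_compl_eq_zero fun x hx => hz x fun hx' => hx (hD hx')]

theorem IsWeakGrad.mono {d : ℕ} {D D' : Set (E d)} {v : E d → ℂ} {g : E d → V d}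
    (h : IsWeakGrad D' v g) (hD : D ⊆ D') : IsWeakGrad D v g := by
  intro φ hφ i
  rw [hφ.setIntegral_eq hD fun x => g x i, hφ.setIntegral_pderiv_eq hD]
  exact h φ (hφ.mono hD) i

theorem IsWeakGrad.congr {d : ℕ} {D : Set (E d)} {v v' : E d → ℂ} {g g' : E d → V d}
    (h : IsWeakGrad D v g) (hv : v' =ᵐ[volume.restrict D] v) (hg : g' =ᵐ[volume.restrict D] g) :
    IsWeakGrad D v' g' := by
  intro φ hφ i
  rw [integral_congr_ae (g := fun x => v x * ((pderiv i φ x : ℝ) : ℂ)) (by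
      filter_upwards [hv] with x hx; rw [hx]),
    integral_congr_ae (f := fun x => g' x i * (φ x : ℂ)) (g := fun x => g x i * (φ x : ℂ)) (by
      filter_upwards [hg] with x hx; rw [hx])]
  exact h φ hφ i

/-! ### Integration by parts over the mesh and single-valued traces -/

namespace Mesh

variable {d : ℕ} {M : Mesh d}

/-- Element-wise integration by parts, with the boundary terms collected face by face. -/
theorem green_field (hd : d ≠ 0) (v : M.H1) {W : Finset (E d) → Fin d → E d → ℂ}
    (hW : ∀ K ∈ M.elems, ∀ i, ContDiff ℝ 1 (W K i)) :
    ∑ K ∈ M.elems, ∫ x in cell K, ((∑ i, M.grad v x i * conj (W K i x)) +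
        (v : M.L2) x * conj (∑ i, pderiv i (W K i) x)) =
      ∑ F ∈ M.faces, ∑ K ∈ M.elemsAt F, ∫ y, M.trace K F v y *
        conj (∑ i, W K i y * ((outNormal K F i : ℝ) : ℂ)) ∂faceMeasure F := by
  rw [← sum_elems_eq_sum_faces (M := M) fun K F => ∫ y, M.trace K F v y *
        conj (∑ i, W K i y * ((outNormal K F i : ℝ) : ℂ)) ∂faceMeasure F]
  refine Finset.sum_congr rfl fun K hK => ?_
  have hS := M.isSimplex hK
  have hint : ∀ i, Integrable (fun x => M.grad v x i * conj (W K i x) +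
      (v : M.L2) x * conj (pderiv i (W K i) x)) (volume.restrict (cell K)) := by
    intro i
    have h1 : MemLp (fun x => M.grad v x i) 2 (volume.restrict (cell K)) :=
      (M.memLp_cell (M.grad v) hK).eval_piLp i
    have h2 : MemLp (fun x => conj (W K i x)) 2 (volume.restrict (cell K)) :=
      IPDG.memLp_cell (contDiff_conj (hW K hK i)).continuous
    have h3 : MemLp (fun x => conj (pderiv i (W K i) x)) 2 (volume.restrict (cell K)) :=
      IPDG.memLp_cell (Complex.continuous_conj.comp (continuous_pderiv (hW K hK i) i))
    exact (h1.integrable_mul h2).add ((M.memLp_cell (v : M.L2) hK).integrable_mul h3)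
  have hface : ∀ a ∈ K, ∀ i, Integrable (fun y => M.trace K (opp K a) v y * conj (W K i y))
      (faceMeasure (opp K a)) := fun a ha i =>
    (Lp.memLp _).integrable_mul (hS.memLp_face hd ha (contDiff_conj (hW K hK i)).continuous)
  calc ∫ x in cell K, ((∑ i, M.grad v x i * conj (W K i x)) +
        (v : M.L2) x * conj (∑ i, pderiv i (W K i) x))
      = ∫ x in cell K, ∑ i, (M.grad v x i * conj (W K i x) +
          (v : M.L2) x * conj (pderiv i (W K i) x)) := by
        congr 1; ext x
        rw [Finset.sum_add_distrib, map_sum, Finset.mul_sum]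
    _ = ∑ i, ∑ a ∈ K, (normalAt K a i : ℂ) *
          ∫ y, M.trace K (opp K a) v y * conj (W K i y) ∂faceMeasure (opp K a) := by
        rw [integral_finsetSum _ fun i _ => hint i]
        exact Finset.sum_congr rfl fun i _ => green hd hK v (hW K hK i) i
    _ = ∑ a ∈ K, ∫ y, M.trace K (opp K a) v y *
          conj (∑ i, W K i y * ((outNormal K (opp K a) i : ℝ) : ℂ)) ∂faceMeasure (opp K a) := by
        rw [Finset.sum_comm]
        refine Finset.sum_congr rfl fun a ha => ?_
        simp_rw [← integral_const_mul]
        rw [← integral_finsetSum _ fun i _ => (hface a ha i).const_mul _]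
        congr 1; ext y
        rw [map_sum, Finset.mul_sum]
        refine Finset.sum_congr rfl fun i _ => ?_
        rw [outNormal_opp hd hK ha, map_mul, Complex.conj_ofReal]
        ring

/-- The constant sequence is an approximating sequence, so traces are restrictions. This supplies
the test functions for all weak identities below. -/
theorem exists_H1_of_smooth (hd : d ≠ 0) {ψ : E d → ℂ} (hψ : ContDiff ℝ ∞ ψ)
    (hc : HasCompactSupport ψ) :
    ∃ v : M.H1, (v : M.L2) =ᵐ[volume.restrict M.dom] ψ ∧
      M.grad v =ᵐ[volume.restrict M.dom] cgrad ψ ∧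
      IsWeakGrad M.dom (v : M.L2) (M.grad v) ∧
      ∀ K ∈ M.elems, ∀ a ∈ K, M.trace K (opp K a) v =ᵐ[faceMeasure (opp K a)] ψ := by
  have hψ1 := contDiff_one hψ
  have hm : MemLp ψ 2 (volume.restrict M.dom) :=
    (hψ.continuous.memLp_of_hasCompactSupport hc).restrict _
  have hgc : HasCompactSupport (cgrad ψ) := by
    refine (hc.fderiv (𝕜 := ℝ)).comp_left
      (g := fun l : E d →L[ℝ] ℂ => (WithLp.toLp 2 fun i => l (EuclideanSpace.single i 1) : V d)) ?_
    ext i; simp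
  have hgm : MemLp (cgrad ψ) 2 (volume.restrict M.dom) :=
    ((continuous_cgrad hψ1).memLp_of_hasCompactSupport hgc).restrict _
  have hw : IsWeakGrad M.dom hm.toLp hgm.toLp :=
    (isWeakGrad_cgrad M.dom hψ1).congr hm.coeFn_toLp hgm.coeFn_toLp
  have hwc : ∀ K ∈ M.elems, IsWeakGrad (cell K) hm.toLp hgm.toLp :=
    fun K hK => hw.mono (M.cell_subset_dom hK)
  let v : M.H1 := ⟨hm.toLp, hgm.toLp, hwc⟩
  have hg : M.grad v = hgm.toLp := grad_eq v hwc
  refine ⟨v, hm.coeFn_toLp, hg ▸ hgm.coeFn_toLp, hg ▸ hw, fun K hK a ha => ?_⟩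
  have hf := (M.isSimplex hK).memLp_face hd ha hψ.continuous
  have hS : M.SmoothApprox K v (fun _ => ψ) := by
    refine ⟨fun _ => hψ, ?_, ?_⟩
    · refine tendsto_const_nhds.congr fun n => ?_
      rw [eLpNorm_congr_ae (g := (0 : E d → ℂ)) ?_, eLpNorm_zero]
      filter_upwards [M.ae_cell_of_dom hm.coeFn_toLp hK] with x hx
      simp [v, hx]
    · refine tendsto_const_nhds.congr fun n => ?_
      rw [eLpNorm_congr_ae (g := (0 : E d → V d)) ?_, eLpNorm_zero]
      filter_upwards [M.ae_cell_of_dom hgm.coeFn_toLp hK] with x hx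
      simp [hg, hx]
  rw [hS.trace_eq hd hK ha (g := hf.toLp)]
  · exact hf.coeFn_toLp
  · refine tendsto_const_nhds.congr fun n => ?_
    rw [eLpNorm_congr_ae (g := (0 : E d → ℂ)) ?_, eLpNorm_zero]
    filter_upwards [hf.coeFn_toLp] with x hx
    simp [hx]

/-- The points that belong to no other face than `F`. -/
def offFaces (M : Mesh d) (F : Finset (E d)) : Set (E d) :=
  {x | ∀ F' ∈ M.faces, F' ≠ F → x ∉ hull F'}

theorem isOpen_offFaces (F : Finset (E d)) : IsOpen (M.offFaces F) := by
  classical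
  have : M.offFaces F = ⋂ F' ∈ M.faces.filter (· ≠ F), (hull F')ᶜ := by
    ext x; simp [offFaces]
  rw [this]
  exact isOpen_biInter_finset fun F' _ => (isCompact_hull F').isClosed.isOpen_compl

theorem isFiniteMeasure_faceMeasure (hd : d ≠ 0) {F : Finset (E d)} (hF : F ∈ M.faces) :
    IsFiniteMeasure (faceMeasure F) := by
  obtain ⟨K, hK, a, ha, rfl⟩ := mem_faces.1 hF
  exact (M.isSimplex hK).isFiniteMeasure_face hd ha

theorem memLp_faceMeasure (hd : d ≠ 0) {F : Finset (E d)} (hF : F ∈ M.faces) {f : E d → ℂ}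
    (hf : Continuous f) : MemLp f 2 (faceMeasure F) := by
  obtain ⟨K, hK, a, ha, rfl⟩ := mem_faces.1 hF
  exact (M.isSimplex hK).memLp_face hd ha hf

/-- Other faces meet `F` in a null set, so test functions that vanish near all of them still detect
every function on `F`. With such tests a sum over faces reduces to one term. -/
theorem face_ae_eq_zero (hd : d ≠ 0) {F : Finset (E d)} (hF : F ∈ M.faces) {U : Set (E d)}
    (hU : IsOpen U) (hFU : ∀ᵐ x ∂faceMeasure F, x ∈ U) {f : E d → ℂ} (hf : MemLp f 2 (faceMeasure F))
    (h : ∀ φ, IsTest (U ∩ M.offFaces F) φ → ∫ x, f x * (φ x : ℂ) ∂faceMeasure F = 0) :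
    f =ᵐ[faceMeasure F] 0 := by
  have := isFiniteMeasure_faceMeasure hd hF
  have h1 := (hU.inter (isOpen_offFaces (M := M) F)).ae_eq_zero_of_integral_contDiff_smul_eq_zero
    (f := f) (μ := faceMeasure F) ((hf.integrable one_le_two).locallyIntegrable.locallyIntegrableOn _)
    (fun g hg hgc hgt => by
      rw [← h g ⟨hg, hgc, hgt⟩]
      refine integral_congr_ae (ae_of_all _ fun x => ?_)
      simp [mul_comm])
  have h2 : ∀ᵐ x ∂faceMeasure F, x ∈ M.offFaces F := by
    have : ∀ᵐ x ∂faceMeasure F, ∀ F' ∈ M.faces, F' ≠ F → x ∉ hull F' := by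
      rw [Finset.eventually_all]
      intro F' hF'
      by_cases hne : F' = F
      · exact ae_of_all _ fun x h => absurd hne h
      · filter_upwards [faceMeasure_ae_notMem hd hF hF' (Ne.symm hne)] with x hx _ using hx
    exact this
  filter_upwards [h1, h2, hFU] with x hx1 hx2 hx3 using hx1 ⟨hx3, hx2⟩

theorem test_eq_zero_on_face {F F' : Finset (E d)} (hF' : F' ∈ M.faces) (hne : F' ≠ F)
    {U : Set (E d)} {φ : E d → ℝ} (hφ : IsTest (U ∩ M.offFaces F) φ) :
    ∀ᵐ x ∂faceMeasure F', φ x = 0 := by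
  filter_upwards [faceMeasure_ae_mem F'] with x hx
  exact image_eq_zero_of_notMem_tsupport fun h => (hφ.2.2 h).2 F' hF' hne hx

/-- Test with `φ` times a coordinate vector, `φ` supported in the domain away from the other faces.
The volume terms cancel because the weak gradient is global, and `green_field` leaves a component of
the normal times the integral of the trace difference. Multiplying by that component and summing
removes the normal, which has unit length. -/
theorem trace_eq_of_weakGrad (hd : d ≠ 0) {v : M.H1} {g : M.L2V}
    (hv : IsWeakGrad M.dom (v : M.L2) g) {F K L : Finset (E d)} (hF : F ∈ M.faces)
    (hKF : K ∈ M.elemsAt F) (hLF : L ∈ M.elemsAt F) (hne : K ≠ L) :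
    M.trace K F v = M.trace L F v := by
  obtain ⟨a, ha, hFa⟩ := exists_eq_opp hF hKF
  obtain ⟨b, hb, hFb⟩ := exists_eq_opp hF hLF
  have hK := (mem_elemsAt.1 hKF).1
  have hL := (mem_elemsAt.1 hLF).1
  have hgrad : M.grad v = g := grad_eq v fun K hK => hv.mono (M.cell_subset_dom hK)
  have hdom : ∀ᵐ x ∂faceMeasure F, x ∈ M.dom := by
    have := faceMeasure_ae_mem_dom hd hK hL hne ha hb (hFa.symm.trans hFb)
    rwa [← hFa] at this
  have hn : outNormal L F = -outNormal K F := by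
    have h1 := outNormal_opp hd hK ha
    have h2 := outNormal_opp hd hL hb
    rw [← hFa] at h1
    rw [← hFb] at h2
    rw [h1, h2]
    exact normalAt_eq_neg hd hK hL hne ha hb (hFa.symm.trans hFb)
  have hpair : M.elemsAt F = {K, L} := by
    refine (Finset.eq_of_subset_of_card_le ?_ ?_).symm
    · intro N hN
      rcases Finset.mem_insert.1 hN with rfl | h
      · exact hKF
      · rwa [Finset.mem_singleton.1 h]
    · rw [Finset.card_pair hne]; exact card_elemsAt_le hd hF
  have hnorm : ∑ i, ((outNormal K F i : ℝ) : ℂ) * ((outNormal K F i : ℝ) : ℂ) = 1 := by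
    have h1 := outNormal_opp hd hK ha
    rw [← hFa] at h1
    have h2 := (M.isSimplex hK).norm_normalAt hd ha
    rw [← h1] at h2
    have h3 : ∑ i, outNormal K F i ^ 2 = 1 := by
      rw [← EuclideanSpace.real_norm_sq_eq, h2, one_pow]
    rw [← Complex.ofReal_one, ← h3]
    push_cast
    exact Finset.sum_congr rfl fun i _ => (sq _).symm
  have hz : (fun x => M.trace K F v x - M.trace L F v x) =ᵐ[faceMeasure F] 0 := by
    refine face_ae_eq_zero hd hF M.isOpen_dom hdom ((Lp.memLp _).sub (Lp.memLp _)) fun φ hφ => ?_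
    have hφd : IsTest M.dom φ := hφ.mono Set.inter_subset_left
    have hφ1 : ContDiff ℝ 1 φ := hφ.1.of_le (by simp)
    have hiK : ∀ N, Integrable (fun x => M.trace N F v x * (φ x : ℂ)) (faceMeasure F) := fun N =>
      (Lp.memLp _).integrable_mul
        (memLp_faceMeasure hd hF (Complex.continuous_ofReal.comp hφ1.continuous))
    have key : ∀ i, ((outNormal K F i : ℝ) : ℂ) *
        ∫ x, (M.trace K F v x - M.trace L F v x) * (φ x : ℂ) ∂faceMeasure F = 0 := by
      intro i
      have hgf := green_field hd v (W := fun _ j x => if j = i then (φ x : ℂ) else 0)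
        (fun _ _ j => by
          by_cases hj : j = i
          · simpa [hj] using contDiff_ofReal hφ1
          · simpa [hj] using contDiff_const)
      have hsumP : ∀ x, ∑ j, pderiv j (fun x => if j = i then (φ x : ℂ) else 0) x =
          ((pderiv i φ x : ℝ) : ℂ) := by
        intro x
        rw [Finset.sum_eq_single i]
        · simpa using pderiv_ofReal hφ1 i x
        · intro j _ hj
          simp [hj, pderiv]
        · simp
      simp only [hsumP, apply_ite (f := (starRingEnd ℂ)), map_zero, mul_ite, mul_zero, ite_mul,
        zero_mul, Finset.sum_ite_eq', Finset.mem_univ, if_true, Complex.conj_ofReal, map_mul] at hgf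
      have hint1 : Integrable (fun x => M.grad v x i * (φ x : ℂ)) (volume.restrict M.dom) :=
        M.integrable_mul_aux le_rfl (M.grad v) (fun y => y i) (by fun_prop)
          (fun y => PiLp.norm_apply_le y i) hφ1.continuous hφ.2.1
      have hint2 : Integrable (fun x => (v : M.L2) x * ((pderiv i φ x : ℝ) : ℂ))
          (volume.restrict M.dom) :=
        M.integrable_mul_aux le_rfl (v : M.L2) (fun y => y) continuous_id (fun _ => le_rfl)
          (pderiv_continuous hφ i) (pderiv_hasCompactSupport hφ i)
      have hl := M.integral_dom (hint1.add hint2)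
      simp only [Pi.add_apply] at hl
      rw [← hl, integral_add hint1 hint2, hv φ hφd i, hgrad, add_neg_cancel] at hgf
      rw [Finset.sum_eq_single_of_mem F hF, hpair, Finset.sum_pair hne, hn] at hgf
      · simp_rw [sub_mul]
        rw [integral_sub (hiK K) (hiK L), mul_sub, ← integral_const_mul, ← integral_const_mul]
        rw [sub_eq_add_neg, ← integral_neg]
        rw [hgf]
        congr 1
        · congr 1; ext x; ring
        · congr 1; ext x; simp; ring
      · intro F' hF' hne'
        refine Finset.sum_eq_zero fun N _ => integral_eq_zero_of_ae ?_
        filter_upwards [test_eq_zero_on_face hF' hne' hφ] with x hx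
        simp [hx]
    have : ∑ i, ((outNormal K F i : ℝ) : ℂ) * (((outNormal K F i : ℝ) : ℂ) *
        ∫ x, (M.trace K F v x - M.trace L F v x) * (φ x : ℂ) ∂faceMeasure F) = 0 :=
      Finset.sum_eq_zero fun i _ => by rw [key i, mul_zero]
    simp_rw [← mul_assoc] at this
    rwa [← Finset.sum_mul, hnorm, one_mul] at this
  refine Lp.ext ?_
  filter_upwards [hz] with x hx
  exact sub_eq_zero.1 hx

end Mesh

/-- The Riesz representation of a functional given on the graph of a linear relation. -/
theorem exists_inner_eq_of_graph {X Y : Type*} [NormedAddCommGroup X] [InnerProductSpace ℂ X]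
    [AddCommGroup Y] [Module ℂ Y] (G : Submodule ℂ (X × Y)) [FiniteDimensional ℂ G]
    (R : Y →ₗ[ℂ] ℂ) (hR : ∀ y, ((0 : X), y) ∈ G → R y = 0) :
    ∃ l ∈ G.map (LinearMap.fst ℂ X Y), ∀ x y, (x, y) ∈ G → inner ℂ l x = R y := by
  -- A linear section of the first projection picks some `y` for each `x`; by `hR` the functional
  -- does not depend on the pick.
  obtain ⟨s, hs⟩ := ((LinearMap.fst ℂ X Y).submoduleMap G).exists_rightInverse_of_surjective
    (LinearMap.range_eq_top.2 (LinearMap.submoduleMap_surjective _ _))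
  have : FiniteDimensional ℂ (G.map (LinearMap.fst ℂ X Y)) := Module.Finite.map _ _
  have := FiniteDimensional.complete ℂ (G.map (LinearMap.fst ℂ X Y))
  let ℓ : G.map (LinearMap.fst ℂ X Y) →ₗ[ℂ] ℂ := R ∘ₗ LinearMap.snd ℂ X Y ∘ₗ G.subtype ∘ₗ s
  let l := (InnerProductSpace.toDual ℂ (G.map (LinearMap.fst ℂ X Y))).symm
    (LinearMap.toContinuousLinearMap ℓ)
  refine ⟨l, l.2, fun x y hxy => ?_⟩
  let w : G.map (LinearMap.fst ℂ X Y) := ⟨x, (x, y), hxy, rfl⟩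
  have h1 : inner ℂ l w = ℓ w := by
    rw [InnerProductSpace.toDual_symm_apply]; rfl
  rw [Submodule.coe_inner] at h1
  refine h1.trans ?_
  have h2 : (s w).1.1 = x := congrArg Subtype.val (LinearMap.congr_fun hs w)
  have h3 : ((0 : X), (s w).1.2 - y) ∈ G := by
    have := G.sub_mem (s w).2 hxy
    rwa [show (s w).1 - (x, y) = (0, (s w).1.2 - y) from Prod.ext (sub_eq_zero.2 h2) rfl] at this
  have h4 := hR _ h3
  rw [map_sub, sub_eq_zero] at h4
  exact h4

/-! ## Piecewise polynomials -/

section PolynomialFunctions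

variable {d : ℕ}

theorem contDiff_peval (P : MvPolynomial (Fin d) ℂ) {n : WithTop ℕ∞} :
    ContDiff ℝ n fun x : E d => peval x P := by
  unfold peval
  induction P using MvPolynomial.induction_on with
  | C a => simpa using contDiff_const
  | add P Q hP hQ => simpa using hP.add hQ
  | mul_X P i hP =>
    simp only [map_mul, MvPolynomial.eval_X]
    exact hP.mul (contDiff_ofReal (EuclideanSpace.proj i : E d →L[ℝ] ℝ).contDiff)

theorem peval_add (x : E d) (P Q : MvPolynomial (Fin d) ℂ) :
    peval x (P + Q) = peval x P + peval x Q := map_add _ _ _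

theorem peval_smul (x : E d) (c : ℂ) (P : MvPolynomial (Fin d) ℂ) :
    peval x (c • P) = c * peval x P := by simp [peval, MvPolynomial.smul_eval]

theorem eqOn_hull_of_ae {K : Finset (E d)} (hK : IsSimplex K) {f g : E d → ℂ}
    (hf : Continuous f) (hg : Continuous g)
    (h : ∀ᵐ x ∂(volume : Measure (E d)).restrict (cell K), f x = g x) : ∀ x ∈ hull K, f x = g x := by
  have h1 : Set.EqOn f g (cell K) :=
    Measure.eqOn_open_of_ae_eq h (isOpen_cell K) hf.continuousOn hg.continuousOn
  have h2 := h1.closure hf hg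
  rw [hK.closure_cell] at h2
  exact h2

end PolynomialFunctions

namespace Mesh

variable {d : ℕ} {M : Mesh d} {p : ℕ}

/-- A family of polynomials on the elements, extended by `0`. -/
def extPoly {G : Type*} [Zero G] (M : Mesh d) (W : M.elems → G) (K : Finset (E d)) : G :=
  open Classical in if h : K ∈ M.elems then W ⟨K, h⟩ else 0

theorem extPoly_of_mem {G : Type*} [Zero G] (W : M.elems → G) {K : Finset (E d)}
    (hK : K ∈ M.elems) : M.extPoly W K = W ⟨K, hK⟩ := dif_pos hK

/-- The functions of `P_p(T_h)` together with the polynomials that define them. -/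
def polyGraph (M : Mesh d) (p : ℕ) :
    Submodule ℂ (M.H1 × (M.elems → MvPolynomial.restrictTotalDegree (Fin d) ℂ p)) where
  carrier := {z | ∀ K : M.elems, ∀ᵐ x ∂(volume : Measure (E d)).restrict (cell K),
    (z.1 : M.L2) x = peval x (z.2 K : MvPolynomial (Fin d) ℂ)}
  zero_mem' := by
    intro K
    filter_upwards [M.ae_cell_of_dom (Lp.coeFn_zero ℂ 2 _) K.2] with x hx
    simpa [peval] using hx
  add_mem' := by
    intro z z' h h' K
    filter_upwards [M.ae_cell_of_dom (Lp.coeFn_add (z.1 : M.L2) (z'.1 : M.L2)) K.2, h K, h' K]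
      with x hx h1 h2
    simpa [peval_add, h1, h2] using hx
  smul_mem' := by
    intro c z h K
    filter_upwards [M.ae_cell_of_dom (Lp.coeFn_smul c (z.1 : M.L2)) K.2, h K] with x hx h1
    simpa [peval_smul, h1] using hx

/-- The fields of `P_p(T_h)^d` together with the polynomials that define them. -/
def polyVGraph (M : Mesh d) (p : ℕ) : Submodule ℂ
    (M.L2V × (M.elems → Fin d → MvPolynomial.restrictTotalDegree (Fin d) ℂ p)) where
  carrier := {z | ∀ K : M.elems, ∀ᵐ x ∂(volume : Measure (E d)).restrict (cell K), ∀ i,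
    z.1 x i = peval x (z.2 K i : MvPolynomial (Fin d) ℂ)}
  zero_mem' := by
    intro K
    filter_upwards [M.ae_cell_of_dom (Lp.coeFn_zero (V d) 2 _) K.2] with x hx
    intro i
    simpa [peval] using congrArg (fun y : V d => y i) hx
  add_mem' := by
    intro z z' h h' K
    filter_upwards [M.ae_cell_of_dom (Lp.coeFn_add z.1 z'.1) K.2, h K, h' K] with x hx h1 h2 i
    simpa [peval_add, h1, h2] using congrArg (fun y : V d => y i) hx
  smul_mem' := by
    intro c z h K
    filter_upwards [M.ae_cell_of_dom (Lp.coeFn_smul c z.1) K.2, h K] with x hx h1 i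
    simpa [peval_smul, h1] using congrArg (fun y : V d => y i) hx

/-- `P_p(T_h)` as a subspace. -/
def polySub (M : Mesh d) (p : ℕ) : Submodule ℂ M.H1 := (M.polyGraph p).map (LinearMap.fst ℂ _ _)

/-- `P_p(T_h)^d` as a subspace. -/
def polyVSub (M : Mesh d) (p : ℕ) : Submodule ℂ M.L2V := (M.polyVGraph p).map (LinearMap.fst ℂ _ _)

theorem mem_polySub {v : M.H1} : v ∈ M.polySub p ↔ v ∈ M.Poly p := by
  constructor
  · rintro ⟨z, hz, rfl⟩ K hK
    exact ⟨z.2 ⟨K, hK⟩, (MvPolynomial.mem_restrictTotalDegree _ _ _).1 (z.2 ⟨K, hK⟩).2, hz ⟨K, hK⟩⟩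
  · intro h
    choose P hP hv using h
    exact ⟨(v, fun K => ⟨P K K.2, (MvPolynomial.mem_restrictTotalDegree _ _ _).2 (hP K K.2)⟩),
      fun K => hv K K.2, rfl⟩

theorem isPolyField_iff {w : M.L2V} {W : Finset (E d) → Fin d → MvPolynomial (Fin d) ℂ} :
    M.IsPolyField p w W ↔ ∃ U : M.elems → Fin d → MvPolynomial.restrictTotalDegree (Fin d) ℂ p,
      (w, U) ∈ M.polyVGraph p ∧ ∀ K : M.elems, ∀ i, W K i = U K i := by
  constructor
  · intro h
    exact ⟨fun K i => ⟨W K i, (MvPolynomial.mem_restrictTotalDegree _ _ _).2 ((h K K.2).1 i)⟩,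
      fun K => (h K K.2).2, fun K i => rfl⟩
  · rintro ⟨U, hU, hW⟩ K hK
    refine ⟨fun i => ?_, ?_⟩
    · rw [hW ⟨K, hK⟩ i]
      exact (MvPolynomial.mem_restrictTotalDegree _ _ _).1 (U ⟨K, hK⟩ i).2
    · filter_upwards [hU ⟨K, hK⟩] with x hx i
      rw [hx, hW ⟨K, hK⟩ i]

theorem mem_polyVSub {w : M.L2V} : w ∈ M.polyVSub p ↔ w ∈ M.PolyV p := by
  constructor
  · rintro ⟨z, hz, rfl⟩
    refine ⟨fun K i => M.extPoly (fun K => (z.2 K i : MvPolynomial (Fin d) ℂ)) K,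
      isPolyField_iff.2 ⟨z.2, hz, fun K i => extPoly_of_mem _ K.2⟩⟩
  · rintro ⟨W, hW⟩
    obtain ⟨U, hU, -⟩ := isPolyField_iff.1 hW
    exact ⟨(w, U), hU, rfl⟩

/-- The polynomials determine the function almost everywhere, so the graph injects into a
finite-dimensional space of polynomial families. -/
theorem finiteDimensional_polyGraph : FiniteDimensional ℂ (M.polyGraph p) := by
  refine FiniteDimensional.of_injective ((LinearMap.snd ℂ _ _).comp (M.polyGraph p).subtype)
    fun z z' h => ?_
  have h2 : z.1.2 = z'.1.2 := h
  refine Subtype.ext (Prod.ext (Subtype.ext (M.eq_of_forall_cell fun K hK => ?_)) h2)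
  filter_upwards [z.2 ⟨K, hK⟩, z'.2 ⟨K, hK⟩] with x h3 h4
  rw [h3, h4, h2]

theorem finiteDimensional_polyVGraph : FiniteDimensional ℂ (M.polyVGraph p) := by
  refine FiniteDimensional.of_injective ((LinearMap.snd ℂ _ _).comp (M.polyVGraph p).subtype)
    fun z z' h => ?_
  have h2 : z.1.2 = z'.1.2 := h
  refine Subtype.ext (Prod.ext (M.eq_of_forall_cell fun K hK => ?_) h2)
  filter_upwards [z.2 ⟨K, hK⟩, z'.2 ⟨K, hK⟩] with x h3 h4
  ext i
  rw [h3, h4, h2]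

instance finiteDimensional_polySub : FiniteDimensional ℂ (M.polySub p) := by
  have := finiteDimensional_polyGraph (M := M) (p := p)
  exact Module.Finite.map _ _

instance finiteDimensional_polyVSub : FiniteDimensional ℂ (M.polyVSub p) := by
  have := finiteDimensional_polyVGraph (M := M) (p := p)
  exact Module.Finite.map _ _

/-- Agreement almost everywhere on the open cell extends by continuity to the closed simplex, hence
to its faces. Face integrals of a field therefore do not depend on the polynomials used to represent
it. -/
theorem IsPolyField.eqOn {w : M.L2V} {W U : Finset (E d) → Fin d → MvPolynomial (Fin d) ℂ}
    (hW : M.IsPolyField p w W) (hU : M.IsPolyField p w U) {K : Finset (E d)} (hK : K ∈ M.elems)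
    (i : Fin d) {x : E d} (hx : x ∈ hull K) : peval x (W K i) = peval x (U K i) := by
  refine eqOn_hull_of_ae (M.isSimplex hK) (contDiff_peval (n := 0) _).continuous
    (contDiff_peval (n := 0) _).continuous ?_ x hx
  filter_upwards [(hW K hK).2, (hU K hK).2] with x h1 h2
  rw [← h1 i, ← h2 i]

end Mesh

namespace Setting

variable {d : ℕ} {S : Setting d} {p : ℕ} {F : Finset (E d)}

/-! ## Faces on the boundary -/

theorem owner_mem (hF : F ∈ S.faces) : S.owner F ∈ S.elemsAt F := by
  obtain ⟨K, hK⟩ := S.elemsAt_nonempty hF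
  exact Mesh.mem_elemsAt.2 (Classical.epsilon_spec (p := fun K => K ∈ S.elems ∧ F ⊆ K)
    ⟨K, Mesh.mem_elemsAt.1 hK⟩)

theorem elemsAt_eq_singleton (hF : F ∈ S.FD ∨ F ∈ S.FN ∨ F ∈ S.FR) :
    S.elemsAt F = {S.owner F} := by
  obtain ⟨hF, hc⟩ := (S.mem_bdry F).1 hF
  obtain ⟨K, hK⟩ := Finset.card_eq_one.1 hc
  have := owner_mem hF
  rw [hK] at this
  rw [hK, Finset.mem_singleton.1 this]

theorem faces_of_FR (hF : F ∈ S.FR) : F ∈ S.faces := ((S.mem_bdry F).1 (Or.inr (Or.inr hF))).1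

theorem faces_of_FD (hF : F ∈ S.FD) : F ∈ S.faces := ((S.mem_bdry F).1 (Or.inl hF)).1

theorem trace_add (hd : d ≠ 0) (hF : F ∈ S.faces) {K : Finset (E d)} (hK : K ∈ S.elemsAt F)
    (v w : S.H1) : S.trace K F (v + w) = S.trace K F v + S.trace K F w := by
  obtain ⟨a, ha, rfl⟩ := Mesh.exists_eq_opp hF hK
  exact Mesh.trace_add hd (Mesh.mem_elemsAt.1 hK).1 ha v w

theorem trace_smul (hd : d ≠ 0) (hF : F ∈ S.faces) {K : Finset (E d)} (hK : K ∈ S.elemsAt F)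
    (c : ℂ) (v : S.H1) : S.trace K F (c • v) = c • S.trace K F v := by
  obtain ⟨a, ha, rfl⟩ := Mesh.exists_eq_opp hF hK
  exact Mesh.trace_smul hd (Mesh.mem_elemsAt.1 hK).1 ha c v

theorem bdryTrace_add (hd : d ≠ 0) (hF : F ∈ S.faces) (v w : S.H1) :
    S.bdryTrace (v + w) F = S.bdryTrace v F + S.bdryTrace w F := trace_add hd hF (owner_mem hF) v w

theorem bdryTrace_smul (hd : d ≠ 0) (hF : F ∈ S.faces) (c : ℂ) (v : S.H1) :
    S.bdryTrace (c • v) F = c • S.bdryTrace v F := trace_smul hd hF (owner_mem hF) c v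

theorem jump_add (hd : d ≠ 0) (hF : F ∈ S.faces) (v w : S.H1) :
    S.jump (v + w) F = S.jump v F + S.jump w F := by
  unfold jump
  split_ifs
  · rw [add_zero]
  · rw [← Finset.sum_add_distrib]
    refine Finset.sum_congr rfl fun K hK => ?_
    rw [trace_add hd hF hK, smul_add]

theorem jump_smul (hd : d ≠ 0) (hF : F ∈ S.faces) (c : ℂ) (v : S.H1) :
    S.jump (c • v) F = c • S.jump v F := by
  unfold jump
  split_ifs
  · rw [smul_zero]
  · rw [Finset.smul_sum]
    refine Finset.sum_congr rfl fun K hK => ?_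
    rw [trace_smul hd hF hK, smul_comm]

theorem elemsAt_eq_pair (hd : d ≠ 0) (hF : F ∈ S.faces) (hFD : F ∉ S.FD) (hFN : F ∉ S.FN)
    (hFR : F ∉ S.FR) : ∃ K L, K ≠ L ∧ S.elemsAt F = {K, L} := by
  rw [← Finset.card_eq_two]
  have h1 := Mesh.card_elemsAt_le hd hF
  have h2 := (S.elemsAt_nonempty hF).card_pos
  have h3 : (S.elemsAt F).card ≠ 1 := fun h => by
    rcases (S.mem_bdry F).2 ⟨hF, h⟩ with h | h | h
    exacts [hFD h, hFN h, hFR h]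
  omega

theorem isOutwardNormal_outNormal (hd : d ≠ 0) (hF : F ∈ S.faces) {K : Finset (E d)}
    (hK : K ∈ S.elemsAt F) {n : E d} : IsOutwardNormal K F n ↔ n = outNormal K F := by
  obtain ⟨a, ha, rfl⟩ := Mesh.exists_eq_opp hF hK
  have hK' := (Mesh.mem_elemsAt.1 hK).1
  rw [Mesh.outNormal_opp hd hK' ha]
  exact (S.isSimplex hK').isOutwardNormal_iff hd ha n

theorem norm_outNormal (hd : d ≠ 0) (hF : F ∈ S.faces) {K : Finset (E d)}
    (hK : K ∈ S.elemsAt F) : ‖outNormal K F‖ = 1 :=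
  ((isOutwardNormal_outNormal hd hF hK).2 rfl).1

theorem outNormal_neg (hd : d ≠ 0) (hF : F ∈ S.faces) {K L : Finset (E d)}
    (hK : K ∈ S.elemsAt F) (hL : L ∈ S.elemsAt F) (hne : K ≠ L) :
    outNormal L F = -outNormal K F := by
  obtain ⟨a, ha, hFa⟩ := Mesh.exists_eq_opp hF hK
  obtain ⟨b, hb, hFb⟩ := Mesh.exists_eq_opp hF hL
  have hK' := (Mesh.mem_elemsAt.1 hK).1
  have hL' := (Mesh.mem_elemsAt.1 hL).1
  have h1 := Mesh.outNormal_opp hd hK' ha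
  have h2 := Mesh.outNormal_opp hd hL' hb
  rw [← hFa] at h1
  rw [← hFb] at h2
  rw [h1, h2]
  exact Mesh.normalAt_eq_neg hd hK' hL' hne ha hb (hFa.symm.trans hFb)

/-- The fixed normal is the outward normal of one of the adjacent elements, and the other one has
the opposite normal; the scalar product is ±1. -/
theorem outNormal_eq_smul_nF (hd : d ≠ 0) (hF : F ∈ S.faces) {K : Finset (E d)}
    (hK : K ∈ S.elemsAt F) :
    outNormal K F = (inner ℝ (outNormal K F) (S.nF F) : ℝ) • S.nF F := by
  obtain ⟨L, hL, hn⟩ := S.nF_spec F hF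
  rw [(isOutwardNormal_outNormal hd hF hL).1 hn]
  by_cases hne : L = K
  · subst hne
    rw [real_inner_self_eq_norm_sq, norm_outNormal hd hF hL, one_pow, one_smul]
  · rw [outNormal_neg hd hF hL hK hne, inner_neg_left, real_inner_self_eq_norm_sq,
      norm_outNormal hd hF hL, one_pow, neg_one_smul]

/-- On an interior face the two traces agree and the normals cancel; on a Dirichlet face the trace
is zero; elsewhere the jump is zero by definition. -/
theorem jump_eq_zero (hd : d ≠ 0) {v : S.H1} (hv : v ∈ S.H1D) (hF : F ∈ S.faces) :
    S.jump v F = 0 := by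
  obtain ⟨⟨g, hg⟩, hvD⟩ := hv
  unfold jump
  split_ifs with h
  · rfl
  · push Not at h
    by_cases hFD : F ∈ S.FD
    · rw [elemsAt_eq_singleton (Or.inl hFD), Finset.sum_singleton]
      rw [show S.trace (S.owner F) F v = 0 from hvD F hFD, smul_zero]
    · obtain ⟨K, L, hne, hKL⟩ := elemsAt_eq_pair hd hF hFD h.1 h.2
      have hK : K ∈ S.elemsAt F := by rw [hKL]; simp
      have hL : L ∈ S.elemsAt F := by rw [hKL]; simp
      rw [hKL, Finset.sum_pair hne, Mesh.trace_eq_of_weakGrad hd hg hF hK hL hne,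
        outNormal_neg hd hF hK hL hne, inner_neg_left, ← add_smul, Complex.ofReal_neg,
        add_neg_cancel, zero_smul]

/-! ## The space with zero trace on the Dirichlet boundary -/

/-- `H¹_{Γ_D}(Ω)` as a subspace. -/
def H1Dsub (S : Setting d) (hd : d ≠ 0) : Submodule ℂ S.H1 where
  carrier := S.H1D
  zero_mem' := by
    obtain ⟨G, -, hG⟩ := S.exists_weakGradGraph S.isOpen_dom.measurableSet subset_rfl
    refine ⟨⟨0, (hG _ _).1 G.zero_mem⟩, fun F hF => ?_⟩
    simpa using bdryTrace_smul hd (faces_of_FD hF) 0 (0 : S.H1)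
  add_mem' := by
    rintro v w ⟨⟨g, hg⟩, hv⟩ ⟨⟨k, hk⟩, hw⟩
    obtain ⟨G, -, hG⟩ := S.exists_weakGradGraph S.isOpen_dom.measurableSet subset_rfl
    refine ⟨⟨g + k, (hG _ _).1 (G.add_mem ((hG _ _).2 hg) ((hG _ _).2 hk))⟩, fun F hF => ?_⟩
    rw [bdryTrace_add hd (faces_of_FD hF), hv F hF, hw F hF, add_zero]
  smul_mem' := by
    rintro c v ⟨⟨g, hg⟩, hv⟩
    obtain ⟨G, -, hG⟩ := S.exists_weakGradGraph S.isOpen_dom.measurableSet subset_rfl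
    refine ⟨⟨c • g, (hG _ _).1 (G.smul_mem c ((hG _ _).2 hg))⟩, fun F hF => ?_⟩
    rw [bdryTrace_smul hd (faces_of_FD hF), hv F hF, smul_zero]

theorem isWeakGrad_of_mem {v : S.H1} (hv : v ∈ S.H1D) :
    IsWeakGrad S.dom (v : S.L2) (S.grad v) := by
  obtain ⟨⟨g, hg⟩, -⟩ := hv
  rwa [Mesh.grad_eq v fun K hK => hg.mono (S.cell_subset_dom hK)]

/-! ## The lifting -/

theorem continuous_avgNormal (W : Finset (E d) → Fin d → MvPolynomial (Fin d) ℂ) :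
    Continuous (S.avgNormal W F) :=
  continuous_const.mul (continuous_finsetSum _ fun K _ => continuous_finsetSum _ fun i _ =>
    (contDiff_peval (n := 0) (W K i)).continuous.mul continuous_const)

theorem integrable_jump_avg (hd : d ≠ 0) (hF : F ∈ S.faces) (f : Lp ℂ 2 (faceMeasure F))
    (W : Finset (E d) → Fin d → MvPolynomial (Fin d) ℂ) :
    Integrable (fun x => f x * conj (S.avgNormal W F x)) (faceMeasure F) :=
  (Lp.memLp f).integrable_mul (Mesh.memLp_faceMeasure hd hF
    (Complex.continuous_conj.comp (continuous_avgNormal W)))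

theorem avgNormal_congr {W U : Finset (E d) → Fin d → MvPolynomial (Fin d) ℂ}
    (h : ∀ K ∈ S.elems, ∀ i, ∀ x ∈ hull K, peval x (W K i) = peval x (U K i)) {x : E d}
    (hx : x ∈ hull F) : S.avgNormal W F x = S.avgNormal U F x := by
  unfold avgNormal
  congr 1
  refine Finset.sum_congr rfl fun K hK => Finset.sum_congr rfl fun i _ => ?_
  obtain ⟨hK, hFK⟩ := Mesh.mem_elemsAt.1 hK
  rw [h K hK i x (convexHull_mono (by exact_mod_cast hFK) hx)]

/-- The right-hand side of the definition of the lifting. -/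
def liftRHS (S : Setting d) (v : S.H1) (W : Finset (E d) → Fin d → MvPolynomial (Fin d) ℂ) : ℂ :=
  ∑ F ∈ S.faces, ∫ x, S.jump v F x * conj (S.avgNormal W F x) ∂(faceMeasure F)

theorem liftRHS_congr (v : S.H1) {W U : Finset (E d) → Fin d → MvPolynomial (Fin d) ℂ}
    (h : ∀ K ∈ S.elems, ∀ i, ∀ x ∈ hull K, peval x (W K i) = peval x (U K i)) :
    S.liftRHS v W = S.liftRHS v U := by
  refine Finset.sum_congr rfl fun F _ => integral_congr_ae ?_
  filter_upwards [faceMeasure_ae_mem F] with x hx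
  rw [avgNormal_congr h hx]

theorem liftRHS_add_right (hd : d ≠ 0) (v : S.H1)
    (W U : Finset (E d) → Fin d → MvPolynomial (Fin d) ℂ) :
    S.liftRHS v (W + U) = S.liftRHS v W + S.liftRHS v U := by
  unfold liftRHS
  rw [← Finset.sum_add_distrib]
  refine Finset.sum_congr rfl fun F hF => ?_
  rw [← integral_add (integrable_jump_avg hd hF _ _) (integrable_jump_avg hd hF _ _)]
  congr 1; ext x
  rw [← mul_add, ← map_add]
  congr 2
  simp only [avgNormal, Pi.add_apply, peval_add, add_mul, Finset.sum_add_distrib, mul_add]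

theorem liftRHS_smul_right (v : S.H1) (c : ℂ) (W : Finset (E d) → Fin d → MvPolynomial (Fin d) ℂ) :
    S.liftRHS v (c • W) = conj c * S.liftRHS v W := by
  unfold liftRHS
  rw [Finset.mul_sum]
  refine Finset.sum_congr rfl fun F hF => ?_
  rw [← integral_const_mul]
  congr 1; ext x
  have : S.avgNormal (c • W) F x = c * S.avgNormal W F x := by
    simp only [avgNormal, Pi.smul_apply, peval_smul, mul_assoc, ← Finset.mul_sum]
    ring
  rw [this, map_mul]
  ring

theorem liftRHS_add_left (hd : d ≠ 0) (v w : S.H1)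
    (W : Finset (E d) → Fin d → MvPolynomial (Fin d) ℂ) :
    S.liftRHS (v + w) W = S.liftRHS v W + S.liftRHS w W := by
  unfold liftRHS
  rw [← Finset.sum_add_distrib]
  refine Finset.sum_congr rfl fun F hF => ?_
  rw [← integral_add (integrable_jump_avg hd hF _ _) (integrable_jump_avg hd hF _ _),
    jump_add hd hF]
  refine integral_congr_ae ?_
  filter_upwards [Lp.coeFn_add (S.jump v F) (S.jump w F)] with x hx
  rw [hx, Pi.add_apply, add_mul]

theorem liftRHS_smul_left (hd : d ≠ 0) (c : ℂ) (v : S.H1)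
    (W : Finset (E d) → Fin d → MvPolynomial (Fin d) ℂ) :
    S.liftRHS (c • v) W = c * S.liftRHS v W := by
  unfold liftRHS
  rw [Finset.mul_sum]
  refine Finset.sum_congr rfl fun F hF => ?_
  rw [← integral_const_mul, jump_smul hd hF]
  refine integral_congr_ae ?_
  filter_upwards [Lp.coeFn_smul c (S.jump v F)] with x hx
  rw [hx, Pi.smul_apply, smul_eq_mul, mul_assoc]

/-- Riesz representation in the finite-dimensional polynomial space. The right-hand side is given in
terms of representing polynomials, so the functional lives on the graph and descends to fields by
`liftRHS_congr`. -/
theorem exists_isLift (hd : d ≠ 0) (p : ℕ) (v : S.H1) : ∃ l, S.IsLift p v l := by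
  let ext : (S.elems → Fin d → MvPolynomial.restrictTotalDegree (Fin d) ℂ p) →
      Finset (E d) → Fin d → MvPolynomial (Fin d) ℂ :=
    fun U K i => S.extPoly (fun K => (U K i : MvPolynomial (Fin d) ℂ)) K
  have hext : ∀ U (K : S.elems) i, ext U K i = U K i := fun U K i => Mesh.extPoly_of_mem _ K.2
  let R : (S.elems → Fin d → MvPolynomial.restrictTotalDegree (Fin d) ℂ p) →ₗ[ℂ] ℂ :=
    -- The right-hand side is antilinear in the test field; the conjugate makes it linear.
    { toFun := fun U => conj (S.liftRHS v (ext U))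
      map_add' := fun U U' => by
        rw [← map_add (starRingEnd ℂ), ← liftRHS_add_right hd]
        refine congrArg _ (liftRHS_congr v fun K hK i x _ => ?_)
        rw [Pi.add_apply, Pi.add_apply, hext _ ⟨K, hK⟩, hext _ ⟨K, hK⟩, hext _ ⟨K, hK⟩]
        rfl
      map_smul' := fun c U => by
        have h : S.liftRHS v (ext (c • U)) = S.liftRHS v (c • ext U) := by
          refine liftRHS_congr v fun K hK i x _ => ?_
          rw [Pi.smul_apply, Pi.smul_apply, hext _ ⟨K, hK⟩, hext _ ⟨K, hK⟩]
          rfl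
        rw [h, liftRHS_smul_right, map_mul (starRingEnd ℂ), Complex.conj_conj]
        rfl }
  have := Mesh.finiteDimensional_polyVGraph (M := S.toMesh) (p := p)
  have hR : ∀ w U W, (w, U) ∈ S.polyVGraph p → S.IsPolyField p w W →
      S.liftRHS v (ext U) = S.liftRHS v W := fun w U W hU hW =>
    liftRHS_congr v fun K hK i x hx =>
      (Mesh.isPolyField_iff.2 ⟨U, hU, hext U⟩ : S.IsPolyField p w (ext U)).eqOn hW hK i hx
  obtain ⟨l, hl, hlR⟩ := exists_inner_eq_of_graph (S.polyVGraph p) R fun U hU => by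
    have h0 : S.IsPolyField p (0 : S.L2V) 0 :=
      Mesh.isPolyField_iff.2 ⟨0, Submodule.zero_mem _, fun K i => rfl⟩
    change conj (S.liftRHS v (ext U)) = 0
    rw [hR 0 U 0 hU h0, show (0 : Finset (E d) → Fin d → MvPolynomial (Fin d) ℂ) =
      (0 : ℂ) • 0 by rw [smul_zero], liftRHS_smul_right, map_zero, zero_mul, map_zero]
  refine ⟨l, Mesh.mem_polyVSub.1 hl, fun w W hW => ?_⟩
  obtain ⟨U, hU, -⟩ := Mesh.isPolyField_iff.1 hW
  rw [← inner_conj_symm, hlR w U hU]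
  change conj (conj (S.liftRHS v (ext U))) = _
  rw [Complex.conj_conj, hR w U W hU hW]
  rfl

theorem IsLift.unique {v : S.H1} {l l' : S.L2V} (h : S.IsLift p v l) (h' : S.IsLift p v l') :
    l = l' := by
  have hm : l - l' ∈ S.polyVSub p :=
    Submodule.sub_mem _ (Mesh.mem_polyVSub.2 h.1) (Mesh.mem_polyVSub.2 h'.1)
  obtain ⟨W, hW⟩ := Mesh.mem_polyVSub.1 hm
  have : inner ℂ (l - l') (l - l') = (0 : ℂ) := by
    conv_lhs => rw [inner_sub_right]
    rw [h.2 _ W hW, h'.2 _ W hW, sub_self]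
  exact sub_eq_zero.1 (inner_self_eq_zero.1 this)

theorem isLift_lift (hd : d ≠ 0) (p : ℕ) (v : S.H1) : S.IsLift p v (S.lift p v) :=
  Classical.epsilon_spec (exists_isLift hd p v)

theorem lift_add (hd : d ≠ 0) (v w : S.H1) : S.lift p (v + w) = S.lift p v + S.lift p w := by
  have h1 := isLift_lift hd p v
  have h2 := isLift_lift hd p w
  refine (isLift_lift hd p (v + w)).unique ⟨Mesh.mem_polyVSub.1 (Submodule.add_mem _
    (Mesh.mem_polyVSub.2 h1.1) (Mesh.mem_polyVSub.2 h2.1)), fun z W hW => ?_⟩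
  rw [inner_add_right, h1.2 z W hW, h2.2 z W hW]
  exact (liftRHS_add_left hd v w W).symm

theorem lift_smul (hd : d ≠ 0) (c : ℂ) (v : S.H1) : S.lift p (c • v) = c • S.lift p v := by
  have h1 := isLift_lift hd p v
  refine (isLift_lift hd p (c • v)).unique ⟨Mesh.mem_polyVSub.1 (Submodule.smul_mem _ c
    (Mesh.mem_polyVSub.2 h1.1)), fun z W hW => ?_⟩
  rw [inner_smul_right, h1.2 z W hW]
  exact (liftRHS_smul_left hd c v W).symm

theorem lift_eq_zero (hd : d ≠ 0) {v : S.H1} (hv : v ∈ S.H1D) : S.lift p v = 0 := by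
  refine (isLift_lift hd p v).unique ⟨Mesh.mem_polyVSub.1 (Submodule.zero_mem _), fun z W _ => ?_⟩
  rw [inner_zero_right]
  refine (Finset.sum_eq_zero fun F hF => integral_eq_zero_of_ae ?_).symm
  rw [jump_eq_zero hd hv hF]
  filter_upwards [Lp.coeFn_zero ℂ 2 (faceMeasure F)] with x hx
  rw [hx, Pi.zero_apply, zero_mul]

theorem dgrad_add (hd : d ≠ 0) (v w : S.H1) : S.dgrad p (v + w) = S.dgrad p v + S.dgrad p w := by
  rw [dgrad, Mesh.grad_add, lift_add hd]
  simp only [dgrad]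
  abel

theorem dgrad_smul (hd : d ≠ 0) (c : ℂ) (v : S.H1) : S.dgrad p (c • v) = c • S.dgrad p v := by
  rw [dgrad, Mesh.grad_smul, lift_smul hd, dgrad, smul_sub]

/-- Conforming functions have no jumps, so their lifting vanishes. This is what makes the broken
form and norm restrict to the continuous ones. -/
theorem dgrad_eq_grad (hd : d ≠ 0) {v : S.H1} (hv : v ∈ S.H1D) : S.dgrad p v = S.grad v := by
  rw [dgrad, lift_eq_zero hd hv, sub_zero]

end Setting

/-! ### Weak divergence of piecewise polynomial fields -/

theorem inner_euclidean {d : ℕ} (x y : V d) : inner ℂ x y = ∑ i, y i * conj (x i) := by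
  rw [PiLp.inner_apply]
  rfl

namespace Mesh

variable {d : ℕ} {M : Mesh d}

theorem weakDiv_unique {w : M.L2V} {q q' : M.L2} (h : IsWeakDiv M.dom w q)
    (h' : IsWeakDiv M.dom w q') : q = q' := by
  have hi : ∀ (q : M.L2) {φ : E d → ℝ}, IsTest M.dom φ →
      Integrable (fun x => q x * (φ x : ℂ)) (volume.restrict M.dom) := fun q φ hφ =>
    M.integrable_mul_aux le_rfl q (fun y => y) continuous_id (fun _ => le_rfl) hφ.1.continuous hφ.2.1
  have := ae_eq_zero_of_test M.isOpen_dom (f := fun x => q x - q' x)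
    (((Lp.memLp q).integrable one_le_two).sub ((Lp.memLp q').integrable one_le_two)) fun φ hφ => by
      simp_rw [sub_mul]
      rw [integral_sub (hi q hφ) (hi q' hφ), sub_eq_zero]
      exact neg_injective ((h φ hφ).symm.trans (h' φ hφ))
  refine Lp.ext ?_
  filter_upwards [this] with x hx using sub_eq_zero.1 hx

/-- Test functions supported in one cell see only the smooth field there, for which weak and
classical divergence agree. -/
theorem weakDiv_ae_eq {w : M.L2V} {q : M.L2} (h : IsWeakDiv M.dom w q) {K : Finset (E d)}
    (hK : K ∈ M.elems) {W : Fin d → E d → ℂ} (hW : ∀ i, ContDiff ℝ 1 (W i))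
    (hw : ∀ᵐ x ∂(volume : Measure (E d)).restrict (cell K), ∀ i, w x i = W i x) :
    ∀ᵐ x ∂(volume : Measure (E d)).restrict (cell K), q x = ∑ i, pderiv i (W i) x := by
  have hcell := M.cell_subset_dom hK
  have hdiv : Continuous fun x => ∑ i, pderiv i (W i) x :=
    continuous_finsetSum _ fun i _ => continuous_pderiv (hW i) i
  have hq := (M.memLp_cell q hK).integrable one_le_two
  have hdm : MemLp (fun x => ∑ i, pderiv i (W i) x) 2 (volume.restrict (cell K)) :=
    IPDG.memLp_cell hdiv
  have := ae_eq_zero_of_test (isOpen_cell K) (f := fun x => q x - ∑ i, pderiv i (W i) x)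
    (hq.sub (hdm.integrable one_le_two)) fun φ hφ => by
      have hφ1 : ContDiff ℝ 1 φ := hφ.1.of_le (by simp)
      have h1 := h φ (hφ.mono hcell)
      have hz : ∀ x ∉ cell K, (∑ i, w x i * ((pderiv i φ x : ℝ) : ℂ)) = 0 := by
        intro x hx
        have : fderiv ℝ φ x = 0 := by
          by_contra hne
          exact hx (hφ.2.2 (support_fderiv_subset ℝ (Function.mem_support.2 hne)))
        simp [pderiv, this]
      rw [setIntegral_eq_integral_of_forall_compl_eq_zero fun x hx => hz x fun hx' => hx (hcell hx'),
        ← setIntegral_eq_integral_of_forall_compl_eq_zero hz, ← hφ.setIntegral_eq hcell] at h1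
      have hwi : ∀ i, Integrable (fun x => W i x * ((pderiv i φ x : ℝ) : ℂ))
          (volume.restrict (cell K)) := fun i =>
        MemLp.integrable_mul (p := 2) (q := 2) (IPDG.memLp_cell (hW i).continuous)
          (IPDG.memLp_cell (Complex.continuous_ofReal.comp (pderiv_continuous hφ i)))
      have hφm : MemLp (fun x => (φ x : ℂ)) 2 (volume.restrict (cell K)) :=
        memLp_test hφ1.continuous hφ.2.1 _
      have hdi : ∀ i, Integrable (fun x => pderiv i (W i) x * (φ x : ℂ))
          (volume.restrict (cell K)) := fun i =>
        MemLp.integrable_mul (p := 2) (q := 2) (IPDG.memLp_cell (continuous_pderiv (hW i) i)) hφm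
      have h2 : ∫ x in cell K, ∑ i, w x i * ((pderiv i φ x : ℝ) : ℂ) =
          -∫ x in cell K, (∑ i, pderiv i (W i) x) * (φ x : ℂ) := by
        rw [integral_congr_ae (g := fun x => ∑ i, W i x * ((pderiv i φ x : ℝ) : ℂ)) (by
          filter_upwards [hw] with x hx
          exact Finset.sum_congr rfl fun i _ => by rw [hx i])]
        simp_rw [Finset.sum_mul]
        rw [integral_finsetSum _ fun i _ => hwi i, integral_finsetSum _ fun i _ => hdi i,
          ← Finset.sum_neg_distrib]
        exact Finset.sum_congr rfl fun i _ => integral_mul_pderiv_test hφ (hW i) i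
      simp_rw [sub_mul]
      exact (integral_sub ((M.memLp_cell q hK).integrable_mul hφm) (hdm.integrable_mul hφm)).trans
        (sub_eq_zero.2 (neg_injective (h1.symm.trans h2)))
  filter_upwards [this] with x hx using sub_eq_zero.1 hx

/-- Integration by parts against a piecewise polynomial field. -/
theorem inner_grad_add_inner_div (hd : d ≠ 0) {p : ℕ} (v : M.H1) {w : M.L2V} {q : M.L2}
    {W : Finset (E d) → Fin d → MvPolynomial (Fin d) ℂ} (hW : M.IsPolyField p w W)
    (hq : IsWeakDiv M.dom w q) :
    inner ℂ w (M.grad v) + inner ℂ q (v : M.L2) =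
      ∑ F ∈ M.faces, ∑ K ∈ M.elemsAt F, ∫ y, M.trace K F v y *
        conj (∑ i, peval y (W K i) * ((outNormal K F i : ℝ) : ℂ)) ∂faceMeasure F := by
  rw [← green_field hd v (W := fun K i x => peval x (W K i)) fun K _ i => contDiff_peval _,
    M.inner_eq_sum, M.inner_eq_sum, ← Finset.sum_add_distrib]
  refine Finset.sum_congr rfl fun K hK => ?_
  rw [← integral_add]
  · refine integral_congr_ae ?_
    filter_upwards [(hW K hK).2, weakDiv_ae_eq hq hK (fun i => contDiff_peval (W K i)) (hW K hK).2]
      with x h1 h2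
    rw [inner_euclidean, ← h2]
    simp_rw [h1]
    rfl
  · exact (L2.integrable_inner w (M.grad v)).mono_measure (M.restrict_cell_le hK)
  · exact (L2.integrable_inner q (v : M.L2)).mono_measure (M.restrict_cell_le hK)

end Mesh

/-! ### Normal traces and normal continuity of BDM fields -/

namespace Setting

variable {d : ℕ} {S : Setting d} {p : ℕ} {F : Finset (E d)}

theorem wdiv_eq {w : S.L2V} {q : S.L2} (h : IsWeakDiv S.dom w q) : S.wdiv w = q :=
  Mesh.weakDiv_unique (Classical.epsilon_spec (p := fun q : S.L2 => IsWeakDiv S.dom w q) ⟨q, h⟩) h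

theorem isWeakDiv_wdiv {w : S.L2V} (hw : w ∈ S.XN) : IsWeakDiv S.dom w (S.wdiv w) := by
  obtain ⟨q, g, hq, -⟩ := hw
  rwa [wdiv_eq hq]

theorem isNormalTrace_ntrace {w : S.L2V} (hw : w ∈ S.XN) :
    S.IsNormalTrace w (S.wdiv w) (S.ntrace w) := by
  obtain ⟨q, g, hq, hg⟩ := hw
  refine Classical.epsilon_spec (p := fun g => S.IsNormalTrace w (S.wdiv w) g) ⟨g, ?_⟩
  rwa [wdiv_eq hq]

/-- Smooth functions supported away from all faces but `F ⊄ Γ_D` belong to `H¹_{Γ_D}(Ω)`. -/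
theorem exists_mem_H1D_of_test (hd : d ≠ 0) (hFD : F ∉ S.FD) {φ : E d → ℝ}
    (hφ : IsTest (Set.univ ∩ S.offFaces F) φ) :
    ∃ v ∈ S.H1D, ∀ F' ∈ S.faces, ∀ K ∈ S.elemsAt F',
      S.trace K F' v =ᵐ[faceMeasure F'] fun x => (φ x : ℂ) := by
  obtain ⟨v, -, -, hv, ht⟩ := Mesh.exists_H1_of_smooth (M := S.toMesh) hd (contDiff_ofReal hφ.1)
    (hφ.2.1.comp_left (g := fun t : ℝ => (t : ℂ)) (by simp))
  have ht' : ∀ F' ∈ S.faces, ∀ K ∈ S.elemsAt F',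
      S.trace K F' v =ᵐ[faceMeasure F'] fun x => (φ x : ℂ) := by
    intro F' hF' K hK
    obtain ⟨a, ha, rfl⟩ := Mesh.exists_eq_opp hF' hK
    exact ht K (Mesh.mem_elemsAt.1 hK).1 a ha
  refine ⟨v, ⟨⟨_, hv⟩, fun F' hF' => Lp.ext ?_⟩, ht'⟩
  have hF := faces_of_FD hF'
  filter_upwards [ht' F' hF _ (owner_mem hF), Lp.coeFn_zero ℂ 2 (faceMeasure F'),
    Mesh.test_eq_zero_on_face hF (fun h : F' = F => hFD (h ▸ hF')) hφ] with x h1 h2 h3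
  rw [h2, Mesh.bdryTrace, h1, h3]
  simp

open Classical in
theorem robinForm_test {v : S.H1} {φ : E d → ℝ} (hφ : IsTest (Set.univ ∩ S.offFaces F) φ)
    (ht : ∀ F' ∈ S.faces, ∀ K ∈ S.elemsAt F',
      S.trace K F' v =ᵐ[faceMeasure F'] fun x => (φ x : ℂ)) (g : FaceData d) :
    S.robinForm (fun _ => 1) (S.bdryTrace v) g =
      if F ∈ S.FR then ∫ x, (φ x : ℂ) * conj (g F x) ∂faceMeasure F else 0 := by
  have h0 : ∀ F' ∈ S.FR, ∫ x, S.bdryTrace v F' x * conj (g F' x) ∂faceMeasure F' =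
      ∫ x, (φ x : ℂ) * conj (g F' x) ∂faceMeasure F' := by
    intro F' hF'
    refine integral_congr_ae ?_
    filter_upwards [ht F' (faces_of_FR hF') _ (owner_mem (faces_of_FR hF'))] with x hx
    rw [Mesh.bdryTrace, hx]
  have h1 : ∀ F' ∈ S.FR, F' ≠ F → ∫ x, (φ x : ℂ) * conj (g F' x) ∂faceMeasure F' = 0 := by
    intro F' hF' hne
    refine integral_eq_zero_of_ae ?_
    filter_upwards [Mesh.test_eq_zero_on_face (faces_of_FR hF') hne hφ] with x hx
    simp [hx]
  unfold robinForm
  split_ifs with h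
  · rw [Finset.sum_eq_single_of_mem F h, h0 F h]
    · simp
    · intro F' hF' hne
      rw [h0 F' hF', h1 F' hF' hne, mul_zero]
  · refine Finset.sum_eq_zero fun F' hF' => ?_
    rw [h0 F' hF', h1 F' hF' fun he => h (he ▸ hF'), mul_zero]

/-- Test functions near a single Robin face are conforming since the Dirichlet faces are among the
avoided ones. Nothing constrains the data off the Robin faces, so equality holds only on them. -/
theorem IsNormalTrace.unique (hd : d ≠ 0) {w : S.L2V} {q : S.L2} {g g' : FaceData d}
    (h : S.IsNormalTrace w q g) (h' : S.IsNormalTrace w q g') (hF : F ∈ S.FR) : g F = g' F := by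
  have hFD : F ∉ S.FD := fun hD => Finset.disjoint_left.1 S.disj_DR hD hF
  have hf := faces_of_FR hF
  have hm : ∀ g : FaceData d, MemLp (fun x => conj (g F x)) 2 (faceMeasure F) := fun g =>
    (Lp.memLp (g F)).star
  have := Mesh.face_ae_eq_zero hd hf isOpen_univ (ae_of_all _ fun _ => Set.mem_univ _)
    (f := fun x => conj (g F x) - conj (g' F x)) ((hm g).sub (hm g')) fun φ hφ => by
      obtain ⟨v, hv, ht⟩ := exists_mem_H1D_of_test hd hFD hφ
      have e := (h v hv).symm.trans (h' v hv)
      rw [robinForm_test hφ ht, robinForm_test hφ ht, if_pos hF, if_pos hF] at e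
      have hφm : MemLp (fun x => (φ x : ℂ)) 2 (faceMeasure F) :=
        Mesh.memLp_faceMeasure hd hf (Complex.continuous_ofReal.comp hφ.1.continuous)
      simp_rw [mul_comm _ (φ _ : ℂ), mul_sub]
      exact (integral_sub (hφm.integrable_mul (hm g)) (hφm.integrable_mul (hm g'))).trans
        (sub_eq_zero.2 e)
  refine Lp.ext ?_
  filter_upwards [this] with x hx
  exact (starRingEnd ℂ).injective (sub_eq_zero.1 hx)

theorem ntrace_eq (hd : d ≠ 0) {w : S.L2V} {q : S.L2} {g : FaceData d} (hq : IsWeakDiv S.dom w q)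
    (hg : S.IsNormalTrace w q g) (hF : F ∈ S.FR) : S.ntrace w F = g F := by
  have h := isNormalTrace_ntrace ⟨q, g, hq, hg⟩
  rw [wdiv_eq hq] at h
  exact h.unique hd hg hF

theorem robinForm_eq_inner (c : Finset (E d) → ℝ) (φ v : FaceData d) :
    S.robinForm c φ v = ∑ F ∈ S.FR, (c F : ℂ) * inner ℂ (v F) (φ F) := by
  refine Finset.sum_congr rfl fun F _ => ?_
  rw [L2.inner_def]
  rfl

/-- The space `X_{Γ_N}(div, Ω)` as a subspace. -/
def XNsub (S : Setting d) : Submodule ℂ S.L2V where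
  carrier := S.XN
  zero_mem' := by
    obtain ⟨G, hG⟩ := S.exists_weakDivGraph
    refine ⟨0, 0, (hG _ _).1 G.zero_mem, fun v _ => ?_⟩
    simp [robinForm_eq_inner]
  add_mem' := by
    rintro w w' ⟨q, g, hq, hg⟩ ⟨q', g', hq', hg'⟩
    obtain ⟨G, hG⟩ := S.exists_weakDivGraph
    refine ⟨q + q', g + g', (hG _ _).1 (G.add_mem ((hG _ _).2 hq) ((hG _ _).2 hq')), fun v hv => ?_⟩
    have h1 := hg v hv
    have h2 := hg' v hv
    simp only [robinForm_eq_inner] at h1 h2 ⊢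
    simp only [Pi.add_apply, inner_add_left, mul_add, Finset.sum_add_distrib]
    rw [← h1, ← h2]
    ring
  smul_mem' := by
    rintro c w ⟨q, g, hq, hg⟩
    obtain ⟨G, hG⟩ := S.exists_weakDivGraph
    refine ⟨c • q, c • g, (hG _ _).1 (G.smul_mem c ((hG _ _).2 hq)), fun v hv => ?_⟩
    have h1 := hg v hv
    simp only [robinForm_eq_inner] at h1 ⊢
    simp only [Pi.smul_apply, inner_smul_left, mul_left_comm _ (conj c)]
    rw [← Finset.mul_sum, ← h1]
    ring

theorem wdiv_add {w w' : S.L2V} (hw : w ∈ S.XN) (hw' : w' ∈ S.XN) :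
    S.wdiv (w + w') = S.wdiv w + S.wdiv w' := by
  obtain ⟨G, hG⟩ := S.exists_weakDivGraph
  exact wdiv_eq ((hG _ _).1 (G.add_mem ((hG _ _).2 (isWeakDiv_wdiv hw))
    ((hG _ _).2 (isWeakDiv_wdiv hw'))))

theorem wdiv_smul (c : ℂ) {w : S.L2V} (hw : w ∈ S.XN) : S.wdiv (c • w) = c • S.wdiv w := by
  obtain ⟨G, hG⟩ := S.exists_weakDivGraph
  exact wdiv_eq ((hG _ _).1 (G.smul_mem c ((hG _ _).2 (isWeakDiv_wdiv hw))))

theorem ntrace_add (hd : d ≠ 0) {w w' : S.L2V} (hw : w ∈ S.XN) (hw' : w' ∈ S.XN)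
    (hF : F ∈ S.FR) : S.ntrace (w + w') F = S.ntrace w F + S.ntrace w' F := by
  refine ntrace_eq hd (g := S.ntrace w + S.ntrace w')
    (isWeakDiv_wdiv (S.XNsub.add_mem hw hw')) (fun v hv => ?_) hF
  have h1 := isNormalTrace_ntrace hw v hv
  have h2 := isNormalTrace_ntrace hw' v hv
  rw [wdiv_add hw hw']
  simp only [robinForm_eq_inner] at h1 h2 ⊢
  simp only [Pi.add_apply, inner_add_left, mul_add, Finset.sum_add_distrib]
  rw [← h1, ← h2]
  ring

theorem ntrace_smul (hd : d ≠ 0) (c : ℂ) {w : S.L2V} (hw : w ∈ S.XN) (hF : F ∈ S.FR) :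
    S.ntrace (c • w) F = c • S.ntrace w F := by
  refine ntrace_eq hd (g := c • S.ntrace w)
    (isWeakDiv_wdiv (S.XNsub.smul_mem c hw)) (fun v hv => ?_) hF
  have h1 := isNormalTrace_ntrace hw v hv
  rw [wdiv_smul c hw]
  simp only [robinForm_eq_inner] at h1 ⊢
  simp only [Pi.smul_apply, inner_smul_left, mul_left_comm _ (conj c)]
  rw [← Finset.mul_sum, ← h1]
  ring

open Classical in
/-- The normal components of a field in the BDM space are continuous through interior faces, vanish
on `Γ_N` and are the normal trace on `Γ_R`. -/
theorem sum_normal_component (hd : d ≠ 0) {w : S.L2V} (hw : w ∈ S.XN)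
    {W : Finset (E d) → Fin d → MvPolynomial (Fin d) ℂ} (hW : S.IsPolyField p w W)
    (hF : F ∈ S.faces) (hFD : F ∉ S.FD) :
    ∀ᵐ x ∂faceMeasure F, ∑ K ∈ S.elemsAt F, ∑ i, peval x (W K i) * ((outNormal K F i : ℝ) : ℂ) =
      if F ∈ S.FR then S.ntrace w F x else 0 := by
  have hcont : Continuous fun x =>
      conj (∑ K ∈ S.elemsAt F, ∑ i, peval x (W K i) * ((outNormal K F i : ℝ) : ℂ)) :=
    Complex.continuous_conj.comp (continuous_finsetSum _ fun K _ => continuous_finsetSum _ fun i _ =>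
      (contDiff_peval (n := 0) (W K i)).continuous.mul continuous_const)
  have hm := Mesh.memLp_faceMeasure hd hF hcont
  have hg : MemLp (fun x => if F ∈ S.FR then conj (S.ntrace w F x) else 0) 2 (faceMeasure F) := by
    split_ifs
    · exact (Lp.memLp _).star
    · exact MemLp.zero'
  -- Localized test functions reduce the definition of the normal trace, after integration by parts
  -- on the elements, to an identity on `F` alone.
  have := Mesh.face_ae_eq_zero hd hF isOpen_univ (ae_of_all _ fun _ => Set.mem_univ _)
    (hm.sub hg) fun φ hφ => by
      obtain ⟨v, hv, ht⟩ := exists_mem_H1D_of_test hd hFD hφ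
      have hφm : MemLp (fun x => (φ x : ℂ)) 2 (faceMeasure F) :=
        Mesh.memLp_faceMeasure hd hF (Complex.continuous_ofReal.comp hφ.1.continuous)
      have e := isNormalTrace_ntrace hw v hv
      rw [Mesh.inner_grad_add_inner_div hd v hW (isWeakDiv_wdiv hw), robinForm_test hφ ht,
        Finset.sum_eq_single_of_mem F hF] at e
      · have hl : ∑ K ∈ S.elemsAt F, ∫ y, S.trace K F v y *
            conj (∑ i, peval y (W K i) * ((outNormal K F i : ℝ) : ℂ)) ∂faceMeasure F =
            ∫ y, (φ y : ℂ) * conj (∑ K ∈ S.elemsAt F, ∑ i, peval y (W K i) *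
              ((outNormal K F i : ℝ) : ℂ)) ∂faceMeasure F := by
          rw [← integral_finsetSum]
          · refine integral_congr_ae ?_
            have hall : ∀ᵐ x ∂faceMeasure F, ∀ K ∈ S.elemsAt F, S.trace K F v x = (φ x : ℂ) := by
              rw [Finset.eventually_all]
              exact fun K hK => ht F hF K hK
            filter_upwards [hall] with x hx
            rw [map_sum, Finset.mul_sum]
            exact Finset.sum_congr rfl fun K hK => by rw [hx K hK]
          · intro K hK
            exact (Lp.memLp _).integrable_mul (Mesh.memLp_faceMeasure hd hF
              (Complex.continuous_conj.comp (continuous_finsetSum _ fun i _ =>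
                (contDiff_peval (n := 0) (W K i)).continuous.mul continuous_const)))
        rw [hl] at e
        simp only [Pi.sub_apply, sub_mul]
        refine (integral_sub (hm.integrable_mul hφm) (hg.integrable_mul hφm)).trans
          (sub_eq_zero.2 ?_)
        simp only [Pi.mul_apply]
        simp_rw [mul_comm _ (φ _ : ℂ)]
        rw [e]
        split_ifs <;> simp
      · intro F' hF' hne
        refine Finset.sum_eq_zero fun K hK => integral_eq_zero_of_ae ?_
        filter_upwards [ht F' hF' K hK, Mesh.test_eq_zero_on_face hF' hne hφ] with x h1 h2
        simp [h1, h2]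
  filter_upwards [this] with x hx
  have := sub_eq_zero.1 hx
  apply (starRingEnd ℂ).injective
  refine this.trans ?_
  split_ifs <;> simp

/-- Normal components are continuous through interior faces, so their average equals each of them,
up to the orientation. On a Dirichlet face only one element is present and the average is the value
itself. -/
theorem inner_nF_mul_avgNormal (hd : d ≠ 0) {w : S.L2V} (hw : w ∈ S.XN)
    {W : Finset (E d) → Fin d → MvPolynomial (Fin d) ℂ} (hW : S.IsPolyField p w W)
    (hF : F ∈ S.faces) (hFN : F ∉ S.FN) (hFR : F ∉ S.FR) :
    ∀ᵐ x ∂faceMeasure F, ∀ K ∈ S.elemsAt F,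
      ((inner ℝ (outNormal K F) (S.nF F) : ℝ) : ℂ) * S.avgNormal W F x =
        ∑ i, peval x (W K i) * ((outNormal K F i : ℝ) : ℂ) := by
  have hn : ∀ K ∈ S.elemsAt F, ∀ (L : Finset (E d)) (x : E d),
      ((inner ℝ (outNormal K F) (S.nF F) : ℝ) : ℂ) *
        ∑ i, peval x (W L i) * ((S.nF F i : ℝ) : ℂ) =
        ∑ i, peval x (W L i) * ((outNormal K F i : ℝ) : ℂ) := by
    intro K hK L x
    rw [Finset.mul_sum]
    refine Finset.sum_congr rfl fun i _ => ?_
    conv_rhs => rw [outNormal_eq_smul_nF hd hF hK]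
    rw [PiLp.smul_apply, smul_eq_mul]
    push_cast
    ring
  by_cases hFD : F ∈ S.FD
  · refine ae_of_all _ fun x K hK => ?_
    have hs := elemsAt_eq_singleton (Or.inl hFD)
    rw [hs] at hK
    rw [avgNormal, hs, Finset.sum_singleton, Finset.mem_singleton.1 hK, Finset.card_singleton,
      Nat.cast_one, div_one, one_mul, hn _ (owner_mem hF)]
  · obtain ⟨K, L, hne, hKL⟩ := elemsAt_eq_pair hd hF hFD hFN hFR
    have hK : K ∈ S.elemsAt F := by rw [hKL]; simp
    have hL : L ∈ S.elemsAt F := by rw [hKL]; simp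
    filter_upwards [sum_normal_component hd hw hW hF hFD] with x hx N hN
    rw [if_neg hFR, hKL, Finset.sum_pair hne, outNormal_neg hd hF hK hL hne] at hx
    simp only [PiLp.neg_apply, Complex.ofReal_neg, mul_neg, Finset.sum_neg_distrib] at hx
    have hx' := add_neg_eq_zero.1 hx
    rw [avgNormal, hKL, Finset.sum_pair hne, Finset.card_pair hne, mul_left_comm, mul_add,
      hn N hN, hn N hN]
    rw [hKL, Finset.mem_insert, Finset.mem_singleton] at hN
    rcases hN with rfl | rfl
    · rw [hx']
      push_cast
      ring
    · rw [outNormal_neg hd hF hK hL hne]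
      simp only [PiLp.neg_apply, Complex.ofReal_neg, mul_neg, Finset.sum_neg_distrib]
      rw [hx']
      push_cast
      ring

/-! ### The discrete integration by parts formula -/

/-- The defect in the discrete integration by parts formula. -/
def ibp (S : Setting d) (p : ℕ) (w : S.L2V) (v : S.H1) : ℂ :=
  inner ℂ w (S.dgrad p v) + inner ℂ (S.wdiv w) (v : S.L2)
    - S.robinForm (fun _ => 1) (S.bdryTrace v) (S.ntrace w)

/-- For conforming `v` the discrete gradient is the gradient, and the formula is the defining
property of the normal trace. -/
theorem ibp_eq_zero_of_mem_H1D (hd : d ≠ 0) {w : S.L2V} (hw : w ∈ S.XN) {v : S.H1}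
    (hv : v ∈ S.H1D) : S.ibp p w v = 0 := by
  rw [ibp, dgrad_eq_grad hd hv, isNormalTrace_ntrace hw v hv, sub_self]

/-- After integration by parts on each element everything is a sum over faces, which cancels face by
face: the normal trace balances Robin faces, the normal component is zero on Neumann faces, and the
lifting balances all others. Testing the lifting with `w` is allowed because `w` is a piecewise
polynomial. -/
theorem ibp_eq_zero_of_mem_BDM (hd : d ≠ 0) {w : S.L2V} (hw : w ∈ S.BDM p) (v : S.H1) :
    S.ibp p w v = 0 := by
  classical
  obtain ⟨⟨W, hW⟩, hw⟩ := hw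
  rw [ibp, dgrad, inner_sub_right, sub_add_eq_add_sub,
    Mesh.inner_grad_add_inner_div hd v hW (isWeakDiv_wdiv hw), (isLift_lift hd p v).2 w W hW,
    ← Finset.sum_sub_distrib, sub_eq_zero]
  have hsum : S.robinForm (fun _ => 1) (S.bdryTrace v) (S.ntrace w) = ∑ F ∈ S.faces,
      if F ∈ S.FR then ∫ x, S.bdryTrace v F x * conj (S.ntrace w F x) ∂faceMeasure F else 0 := by
    rw [Finset.sum_ite_mem, Finset.inter_eq_right.2 fun F hF => faces_of_FR hF]
    simp [robinForm]
  rw [hsum]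
  refine Finset.sum_congr rfl fun F hF => ?_
  -- On Neumann and Robin faces the jump is zero by convention, so the lifting contributes nothing.
  by_cases h : F ∈ S.FN ∨ F ∈ S.FR
  · have hjump : S.jump v F = 0 := if_pos h
    have hFD : F ∉ S.FD := fun hD => by
      rcases h with h | h
      · exact Finset.disjoint_left.1 S.disj_DN hD h
      · exact Finset.disjoint_left.1 S.disj_DR hD h
    have h0 : ∫ x, S.jump v F x * conj (S.avgNormal W F x) ∂faceMeasure F = 0 := by
      rw [hjump]
      refine integral_eq_zero_of_ae ?_
      filter_upwards [Lp.coeFn_zero ℂ 2 (faceMeasure F)] with x hx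
      rw [hx, Pi.zero_apply, zero_mul]
    have hn := sum_normal_component hd hw hW hF hFD
    have hs := elemsAt_eq_singleton (S := S) (F := F) (Or.inr h)
    rw [hs] at hn
    simp only [Finset.sum_singleton] at hn
    rw [h0, sub_zero, hs, Finset.sum_singleton]
    by_cases hFR : F ∈ S.FR
    · simp only [if_pos hFR] at hn ⊢
      refine integral_congr_ae ?_
      filter_upwards [hn] with x hx
      rw [hx]
      rfl
    · simp only [if_neg hFR] at hn ⊢
      refine integral_eq_zero_of_ae ?_
      filter_upwards [hn] with x hx
      rw [hx]
      simp
  -- On interior and Dirichlet faces, signed traces times the average normal component reproduce the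
  -- element boundary terms.
  · push Not at h
    rw [if_neg h.2, sub_eq_zero, ← integral_finsetSum]
    · have hj : S.jump v F =ᵐ[faceMeasure F] fun x => ∑ K ∈ S.elemsAt F,
          ((inner ℝ (outNormal K F) (S.nF F) : ℝ) : ℂ) * S.trace K F v x := by
        rw [show S.jump v F = _ from if_neg (not_or.2 h)]
        refine (Lp.coeFn_finsetSum _ _).trans ?_
        have hall : ∀ᵐ x ∂faceMeasure F, ∀ K ∈ S.elemsAt F,
            (((inner ℝ (outNormal K F) (S.nF F) : ℝ) : ℂ) • S.trace K F v :
              Lp ℂ 2 (faceMeasure F)) x =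
            ((inner ℝ (outNormal K F) (S.nF F) : ℝ) : ℂ) * S.trace K F v x := by
          rw [Finset.eventually_all]
          exact fun K _ => Lp.coeFn_smul _ _
        filter_upwards [hall] with x hx
        rw [Finset.sum_apply]
        exact Finset.sum_congr rfl hx
      refine integral_congr_ae ?_
      filter_upwards [hj, inner_nF_mul_avgNormal hd hw hW hF h.1 h.2] with x h1 h2
      rw [h1, Finset.sum_mul]
      refine Finset.sum_congr rfl fun K hK => ?_
      rw [← h2 K hK, map_mul, Complex.conj_ofReal]
      ring
    · intro K hK
      exact (Lp.memLp _).integrable_mul (Mesh.memLp_faceMeasure hd hF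
        (Complex.continuous_conj.comp (continuous_finsetSum _ fun i _ =>
          (contDiff_peval (n := 0) (W K i)).continuous.mul continuous_const)))

end Setting

/-! ### Matrix square roots for the weighted norms -/

open scoped MatrixOrder in
/-- The positive square root of a positive definite matrix. -/
theorem exists_matrix_sqrt {d : ℕ} {A : Matrix (Fin d) (Fin d) ℝ} (hA : A.IsSymm)
    (hpos : ∀ ξ : Fin d → ℝ, ξ ≠ 0 → 0 < ξ ⬝ᵥ A.mulVec ξ) :
    ∃ B : Matrix (Fin d) (Fin d) ℝ, B.IsSymm ∧ B * B = A ∧ IsUnit B.det := by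
  have hP : A.PosDef := Matrix.posDef_iff_dotProduct_mulVec.2
    ⟨by rw [Matrix.IsHermitian, Matrix.conjTranspose_eq_transpose_of_trivial]; exact hA,
      fun x hx => by rw [star_trivial]; exact hpos x hx⟩
  have hn : 0 ≤ A := hP.posSemidef.nonneg
  have hB := CFC.sqrt_mul_sqrt_self A hn
  have hs : (CFC.sqrt A).PosSemidef := Matrix.nonneg_iff_posSemidef.1 (CFC.sqrt_nonneg A)
  refine ⟨CFC.sqrt A, ?_, hB, ?_⟩
  · have := hs.1
    rwa [Matrix.IsHermitian, Matrix.conjTranspose_eq_transpose_of_trivial] at this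
  · have h1 := (Matrix.isUnit_iff_isUnit_det _).1 hP.isUnit
    rw [← hB, Matrix.det_mul] at h1
    exact isUnit_of_mul_isUnit_left h1

namespace Mesh

variable {d : ℕ} (M : Mesh d) {H : Type*} [NormedAddCommGroup H] [InnerProductSpace ℂ H]

/-! ## Multiplication by piecewise constant operators -/

/-- The function that sends `x ∈ K` to `T_K f(x)`. -/
def opMulFun (T : Finset (E d) → H →L[ℂ] H)
    (f : Lp H 2 ((volume : Measure (E d)).restrict M.dom)) (x : E d) : H :=
  ∑ K ∈ M.elems, (cell K).indicator (fun y => T K (f y)) x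

theorem memLp_opMulFun (T : Finset (E d) → H →L[ℂ] H)
    (f : Lp H 2 ((volume : Measure (E d)).restrict M.dom)) :
    MemLp (M.opMulFun T f) 2 ((volume : Measure (E d)).restrict M.dom) := by
  unfold opMulFun
  refine memLp_finsetSum _ fun K _ => MemLp.indicator (isOpen_cell K).measurableSet ?_
  exact ContinuousLinearMap.comp_memLp' _ (Lp.memLp f)

theorem sum_indicator_eq {G : Type*} [AddCommMonoid G] (f : Finset (E d) → E d → G)
    {K : Finset (E d)} (hK : K ∈ M.elems) {x : E d} (hx : x ∈ cell K) :
    ∑ L ∈ M.elems, (cell L).indicator (f L) x = f K x := by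
  rw [Finset.sum_eq_single_of_mem K hK, Set.indicator_of_mem hx]
  intro L hL hne
  exact Set.indicator_of_notMem (fun h => Set.disjoint_left.1 (M.disjoint_cell hL hK hne) h hx) _

theorem toLp_opMulFun_ae (T : Finset (E d) → H →L[ℂ] H)
    (f : Lp H 2 ((volume : Measure (E d)).restrict M.dom)) {K : Finset (E d)} (hK : K ∈ M.elems) :
    ∀ᵐ x ∂(volume : Measure (E d)).restrict (cell K),
      (M.memLp_opMulFun T f).toLp _ x = T K (f x) := by
  filter_upwards [M.ae_cell_of_dom (M.memLp_opMulFun T f).coeFn_toLp hK,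
    ae_restrict_mem (isOpen_cell K).measurableSet] with x h1 h2
  rw [h1]
  exact M.sum_indicator_eq (fun K y => T K (f y)) hK h2

/-- Multiplication by a piecewise constant operator. -/
def opMul (T : Finset (E d) → H →L[ℂ] H) :
    Lp H 2 ((volume : Measure (E d)).restrict M.dom) →L[ℂ]
      Lp H 2 ((volume : Measure (E d)).restrict M.dom) :=
  LinearMap.mkContinuous
    { toFun := fun f => (M.memLp_opMulFun T f).toLp
      map_add' := fun f g => M.eq_of_forall_cell fun K hK => by
        filter_upwards [M.toLp_opMulFun_ae T (f + g) hK, M.toLp_opMulFun_ae T f hK,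
          M.toLp_opMulFun_ae T g hK, M.ae_cell_of_dom (Lp.coeFn_add f g) hK,
          M.ae_cell_of_dom (Lp.coeFn_add ((M.memLp_opMulFun T f).toLp)
            ((M.memLp_opMulFun T g).toLp)) hK] with x h1 h2 h3 h4 h5
        rw [h1, h4, h5, Pi.add_apply, Pi.add_apply, map_add, h2, h3]
      map_smul' := fun c f => M.eq_of_forall_cell fun K hK => by
        filter_upwards [M.toLp_opMulFun_ae T (c • f) hK, M.toLp_opMulFun_ae T f hK,
          M.ae_cell_of_dom (Lp.coeFn_smul c f) hK,
          M.ae_cell_of_dom (Lp.coeFn_smul c ((M.memLp_opMulFun T f).toLp)) hK] with x h1 h2 h4 h5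
        rw [RingHom.id_apply, h1, h4, h5, Pi.smul_apply, Pi.smul_apply, map_smul, h2] }
    (∑ K ∈ M.elems, ‖T K‖) fun f => by
      refine Lp.norm_le_mul_norm_of_ae_le_mul (M.ae_dom_iff.2 fun K hK => ?_)
      filter_upwards [M.toLp_opMulFun_ae T f hK] with x hx
      change ‖(M.memLp_opMulFun T f).toLp _ x‖ ≤ _
      rw [hx]
      refine ((T K).le_opNorm _).trans ?_
      gcongr
      exact Finset.single_le_sum (f := fun K => ‖T K‖) (fun _ _ => norm_nonneg _) hK

theorem opMul_ae (T : Finset (E d) → H →L[ℂ] H)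
    (f : Lp H 2 ((volume : Measure (E d)).restrict M.dom)) {K : Finset (E d)} (hK : K ∈ M.elems) :
    ∀ᵐ x ∂(volume : Measure (E d)).restrict (cell K), M.opMul T f x = T K (f x) :=
  M.toLp_opMulFun_ae T f hK

theorem opMul_congr {T T' : Finset (E d) → H →L[ℂ] H} (h : ∀ K ∈ M.elems, T K = T' K) :
    M.opMul T = M.opMul T' := by
  ext1 f
  refine M.eq_of_forall_cell fun K hK => ?_
  filter_upwards [M.opMul_ae T f hK, M.opMul_ae T' f hK] with x h1 h2
  rw [h1, h2, h K hK]

theorem opMul_opMul (T T' : Finset (E d) → H →L[ℂ] H)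
    (f : Lp H 2 ((volume : Measure (E d)).restrict M.dom)) :
    M.opMul T (M.opMul T' f) = M.opMul (T * T') f := by
  refine M.eq_of_forall_cell fun K hK => ?_
  filter_upwards [M.opMul_ae T (M.opMul T' f) hK, M.opMul_ae T' f hK, M.opMul_ae (T * T') f hK]
    with x h1 h2 h3
  rw [h1, h2, h3]
  rfl

theorem opMul_one (f : Lp H 2 ((volume : Measure (E d)).restrict M.dom)) :
    M.opMul (1 : Finset (E d) → H →L[ℂ] H) f = f := by
  refine M.eq_of_forall_cell fun K hK => ?_
  filter_upwards [M.opMul_ae 1 f hK] with x h1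
  rw [h1]
  rfl

theorem inner_opMul [CompleteSpace H] {T : Finset (E d) → H →L[ℂ] H}
    (hT : ∀ K ∈ M.elems, IsSelfAdjoint (T K))
    (f g : Lp H 2 ((volume : Measure (E d)).restrict M.dom)) :
    inner ℂ (M.opMul T f) g = inner ℂ f (M.opMul T g) := by
  rw [M.inner_eq_sum, M.inner_eq_sum]
  refine Finset.sum_congr rfl fun K hK => integral_congr_ae ?_
  filter_upwards [M.opMul_ae T f hK, M.opMul_ae T g hK] with x h1 h2
  rw [h1, h2, ← ContinuousLinearMap.adjoint_inner_right, ← ContinuousLinearMap.star_eq_adjoint,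
    (hT K hK).star_eq]

/-- Multiplication by a piecewise constant real weight. -/
def wt (c : Finset (E d) → ℝ) : M.L2 →L[ℂ] M.L2 :=
  M.opMul fun K => (c K : ℂ) • (1 : ℂ →L[ℂ] ℂ)

theorem wt_congr {c c' : Finset (E d) → ℝ} (h : ∀ K ∈ M.elems, c K = c' K) : M.wt c = M.wt c' :=
  M.opMul_congr fun K hK => by rw [h K hK]

theorem wt_wt (c c' : Finset (E d) → ℝ) (f : M.L2) :
    M.wt c (M.wt c' f) = M.wt (fun K => c K * c' K) f := by
  rw [wt, wt, opMul_opMul, wt]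
  congr 2
  ext K
  simp [mul_comm]

theorem wt_eq_self {c : Finset (E d) → ℝ} (h : ∀ K ∈ M.elems, c K = 1) (f : M.L2) :
    M.wt c f = f := by
  conv_rhs => rw [← M.opMul_one f]
  rw [wt, M.opMul_congr (T' := 1) fun K hK => by rw [h K hK]; simp]

theorem inner_wt (c : Finset (E d) → ℝ) (f g : M.L2) :
    inner ℂ (M.wt c f) g = inner ℂ f (M.wt c g) := by
  refine M.inner_opMul (fun K _ => ?_) f g
  rw [isSelfAdjoint_iff, star_smul, star_one, RCLike.star_def, Complex.conj_ofReal]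

theorem massForm_eq_inner (c : Finset (E d) → ℝ) (φ v : M.L2) :
    M.massForm c φ v = inner ℂ v (M.wt c φ) := by
  rw [massForm, M.inner_eq_sum]
  refine Finset.sum_congr rfl fun K hK => ?_
  rw [← integral_const_mul]
  refine integral_congr_ae ?_
  filter_upwards [M.opMul_ae (fun K => (c K : ℂ) • (1 : ℂ →L[ℂ] ℂ)) φ hK] with x hx
  rw [wt, hx, RCLike.inner_apply]
  simp [mul_assoc]

theorem massForm_eq_inner_inner {c r : Finset (E d) → ℝ} (h : ∀ K ∈ M.elems, r K * r K = c K)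
    (φ v : M.L2) : M.massForm c φ v = inner ℂ (M.wt r v) (M.wt r φ) := by
  rw [massForm_eq_inner, inner_wt, wt_wt, M.wt_congr h]

theorem massForm_re_mono {c c' : Finset (E d) → ℝ} (h : ∀ K ∈ M.elems, c K ≤ c' K) (v : M.L2) :
    (M.massForm c v v).re ≤ (M.massForm c' v v).re := by
  rw [massForm, massForm, Complex.re_sum, Complex.re_sum]
  refine Finset.sum_le_sum fun K hK => ?_
  rw [Complex.re_ofReal_mul, Complex.re_ofReal_mul]
  refine mul_le_mul_of_nonneg_right (h K hK) ?_
  simp_rw [Complex.mul_conj]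
  rw [integral_complex_ofReal, Complex.ofReal_re]
  exact integral_nonneg fun x => Complex.normSq_nonneg _

/-- Multiplication by a piecewise constant real matrix. -/
def mat (B : Finset (E d) → Matrix (Fin d) (Fin d) ℝ) : M.L2V →L[ℂ] M.L2V :=
  M.opMul fun K => Matrix.toEuclideanCLM (𝕜 := ℂ) ((B K).map (fun t : ℝ => (t : ℂ)))

theorem mulMat_eq (B : Finset (E d) → Matrix (Fin d) (Fin d) ℝ) (σ : M.L2V) :
    M.mulMat B σ = M.mat B σ := by
  refine M.eq_of_forall_cell fun K hK => ?_
  filter_upwards [M.ae_cell_of_dom (M.mulMatFun_memLp B σ).coeFn_toLp hK,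
    ae_restrict_mem (isOpen_cell K).measurableSet, M.opMul_ae
    (fun K => Matrix.toEuclideanCLM (𝕜 := ℂ) ((B K).map (fun t : ℝ => (t : ℂ)))) σ hK] with x h1 h2 h3
  rw [mat, h3, mulMat, h1]
  exact M.sum_indicator_eq (fun K y => Matrix.toEuclideanCLM (𝕜 := ℂ)
    ((B K).map (fun t : ℝ => (t : ℂ))) (σ y)) hK h2

theorem mat_congr {B C : Finset (E d) → Matrix (Fin d) (Fin d) ℝ}
    (h : ∀ K ∈ M.elems, B K = C K) : M.mat B = M.mat C :=
  M.opMul_congr fun K hK => by rw [h K hK]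

theorem mat_mat (B C : Finset (E d) → Matrix (Fin d) (Fin d) ℝ) (σ : M.L2V) :
    M.mat B (M.mat C σ) = M.mat (fun K => B K * C K) σ := by
  rw [mat, mat, opMul_opMul, mat]
  congr 2
  ext1 K
  rw [Pi.mul_apply, ← map_mul]
  congr 1
  exact (Matrix.map_mul (f := Complex.ofRealHom)).symm

theorem mat_eq_self {B : Finset (E d) → Matrix (Fin d) (Fin d) ℝ}
    (h : ∀ K ∈ M.elems, B K = 1) (σ : M.L2V) : M.mat B σ = σ := by
  conv_rhs => rw [← M.opMul_one σ]
  rw [mat, M.opMul_congr (T' := 1) fun K hK => ?_]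
  rw [h K hK, Matrix.map_one _ Complex.ofReal_zero Complex.ofReal_one, map_one]
  rfl

theorem inner_mat {B : Finset (E d) → Matrix (Fin d) (Fin d) ℝ}
    (h : ∀ K ∈ M.elems, (B K).IsSymm) (σ τ : M.L2V) :
    inner ℂ (M.mat B σ) τ = inner ℂ σ (M.mat B τ) := by
  refine M.inner_opMul (fun K hK => ?_) σ τ
  rw [isSelfAdjoint_iff, ← map_star, Matrix.star_eq_conjTranspose]
  congr 1
  ext i j
  simp [Matrix.conjTranspose_apply, (h K hK).apply i j]

end Mesh

namespace Setting

variable {d : ℕ} (S : Setting d)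

/-- The positive square root of `A`. -/
def sqrtA (K : Finset (E d)) : Matrix (Fin d) (Fin d) ℝ :=
  Classical.epsilon fun B => B.IsSymm ∧ B * B = S.A K ∧ IsUnit B.det

variable {S}

theorem sqrtA_spec {K : Finset (E d)} (hK : K ∈ S.elems) :
    (S.sqrtA K).IsSymm ∧ S.sqrtA K * S.sqrtA K = S.A K ∧ IsUnit (S.sqrtA K).det :=
  Classical.epsilon_spec (exists_matrix_sqrt (S.A_symm K hK) (S.A_pos K hK))

theorem sqrtA_inv_symm {K : Finset (E d)} (hK : K ∈ S.elems) : (S.sqrtA K)⁻¹.IsSymm := by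
  rw [Matrix.IsSymm, Matrix.transpose_nonsing_inv, (sqrtA_spec hK).1.eq]

theorem stiffForm_eq (σ τ : S.L2V) :
    S.stiffForm σ τ = inner ℂ (S.mat S.sqrtA τ) (S.mat S.sqrtA σ) := by
  rw [stiffForm, Mesh.mulMat_eq, S.inner_mat fun K hK => (sqrtA_spec hK).1, Mesh.mat_mat,
    S.mat_congr fun K hK => (sqrtA_spec hK).2.1]

theorem inner_mulMat_inv (w : S.L2V) : inner ℂ w (S.mulMat (fun K => (S.A K)⁻¹) w) =
    (inner ℂ (S.mat (fun K => (S.sqrtA K)⁻¹) w) (S.mat (fun K => (S.sqrtA K)⁻¹) w) : ℂ) := by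
  rw [Mesh.mulMat_eq, S.inner_mat fun K hK => sqrtA_inv_symm hK, Mesh.mat_mat]
  rw [S.mat_congr fun K hK => ?_]
  rw [← (sqrtA_spec hK).2.1, Matrix.mul_inv_rev]

/-- The symmetric weights cancel, so the unweighted product pairs the norms weighted by the inverse
of `A` and by `A`. -/
theorem inner_mat_inv_mat (w τ : S.L2V) :
    inner ℂ (S.mat (fun K => (S.sqrtA K)⁻¹) w) (S.mat S.sqrtA τ) = (inner ℂ w τ : ℂ) := by
  rw [S.inner_mat fun K hK => sqrtA_inv_symm hK, Mesh.mat_mat,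
    S.mat_eq_self fun K hK => Matrix.nonsing_inv_mul _ (sqrtA_spec hK).2.2]

theorem alpha_pos (hd : d ≠ 0) {K : Finset (E d)} (hK : K ∈ S.elems) : 0 < S.alpha K := by
  have : Nonempty (Fin d) := ⟨⟨0, Nat.pos_of_ne_zero hd⟩⟩
  have hne : (Metric.sphere (0 : E d) 1).Nonempty := NormedSpace.sphere_nonempty.2 zero_le_one
  have hc : Continuous fun ξ : E d => ξ.ofLp ⬝ᵥ (S.A K).mulVec ξ.ofLp := by
    simp only [dotProduct, Matrix.mulVec]
    fun_prop
  obtain ⟨ξ, hξ, hmin⟩ := (isCompact_sphere (0 : E d) 1).exists_isMinOn hne hc.continuousOn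
  have hξ0 : ξ.ofLp ≠ 0 := fun h => by
    have : ξ = 0 := by ext i; exact congrFun h i
    rw [this] at hξ
    simp at hξ
  have := hne.to_subtype
  exact (S.A_pos K hK _ hξ0).trans_le (le_ciInf fun η => hmin η.2)

theorem diam_pos_of_two {K : Finset (E d)} {a b : E d} (ha : a ∈ K) (hb : b ∈ K) (hab : a ≠ b) :
    0 < S.diam K :=
  (dist_pos.2 hab).trans_le (Metric.dist_le_diam_of_mem (isCompact_hull K).isBounded
    (subset_convexHull ℝ _ ha) (subset_convexHull ℝ _ hb))

theorem diam_pos (hd : d ≠ 0) {K : Finset (E d)} (hK : K ∈ S.elems) : 0 < S.diam K := by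
  obtain ⟨a, ha, b, hb, hab⟩ := Finset.one_lt_card.1 (show 1 < K.card by rw [S.card_eq K hK]; omega)
  exact diam_pos_of_two ha hb hab

/-- A face has `d` vertices, hence two distinct ones only from dimension 2 on; in dimension 1 the
face weights would degenerate. -/
theorem diam_pos_face (hd : 2 ≤ d) {F : Finset (E d)} (hF : F ∈ S.faces) : 0 < S.diam F := by
  obtain ⟨a, ha, b, hb, hab⟩ := Finset.one_lt_card.1
    (show 1 < F.card by rw [Mesh.card_face hF]; omega)
  exact diam_pos_of_two ha hb hab

theorem alphaF_pos (hd : d ≠ 0) {F : Finset (E d)} (hF : F ∈ S.faces) : 0 < S.alphaF F :=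
  alpha_pos hd (Mesh.mem_elemsAt.1 (owner_mem hF)).1

end Setting

theorem Mesh.massForm_mul {d : ℕ} (M : Mesh d) (a : ℝ) (c : Finset (E d) → ℝ) (φ v : M.L2) :
    M.massForm (fun K => a * c K) φ v = a * M.massForm c φ v := by
  rw [massForm, massForm, Finset.mul_sum]
  exact Finset.sum_congr rfl fun K _ => by push_cast; ring

namespace Setting

variable {d : ℕ} (S : Setting d) {p : ℕ}

/-! ## The norms as Hilbert space norms -/

/-- A Hilbert space that contains `L²(Ω) × L²(Ω)^d × L²(Γ_R)`. -/
abbrev EH : Type := WithLp 2 (S.L2 × WithLp 2 (S.L2V ×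
  PiLp 2 fun F : S.FR => Lp ℂ 2 (faceMeasure (F : Finset (E d)))))

/-- Assembling an element of the Hilbert space from its three components. -/
def mkEH (v : S.L2) (σ : S.L2V) (g : FaceData d) : S.EH :=
  WithLp.toLp 2 (v, WithLp.toLp 2 (σ, WithLp.toLp 2 fun F => g F))

variable {S}

theorem inner_mkEH (v v' : S.L2) (σ σ' : S.L2V) (g g' : FaceData d) :
    inner ℂ (S.mkEH v σ g) (S.mkEH v' σ' g') =
      (inner ℂ v v' + (inner ℂ σ σ' + ∑ F ∈ S.FR, inner ℂ (g F) (g' F)) : ℂ) := by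
  rw [WithLp.prod_inner_apply, WithLp.prod_inner_apply, PiLp.inner_apply,
    ← Finset.sum_coe_sort S.FR]
  rfl

theorem mkEH_add (v v' : S.L2) (σ σ' : S.L2V) (g g' : FaceData d) :
    S.mkEH (v + v') (σ + σ') (g + g') = S.mkEH v σ g + S.mkEH v' σ' g' := rfl

theorem mkEH_smul (c : ℂ) (v : S.L2) (σ : S.L2V) (g : FaceData d) :
    S.mkEH (c • v) (c • σ) (c • g) = c • S.mkEH v σ g := rfl

theorem mkEH_congr {v : S.L2} {σ : S.L2V} {g g' : FaceData d} (h : ∀ F ∈ S.FR, g F = g' F) :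
    S.mkEH v σ g = S.mkEH v σ g' := by
  unfold mkEH
  congr
  ext1 F
  exact h F F.2

theorem robinForm_mul (a : ℝ) (c : Finset (E d) → ℝ) (φ v : FaceData d) :
    S.robinForm (fun F => a * c F) φ v = a * S.robinForm c φ v := by
  rw [robinForm, robinForm, Finset.mul_sum]
  exact Finset.sum_congr rfl fun K _ => by push_cast; ring

theorem robinForm_congr {c c' : Finset (E d) → ℝ} (h : ∀ F ∈ S.FR, c F = c' F) (φ v : FaceData d) :
    S.robinForm c φ v = S.robinForm c' φ v :=
  Finset.sum_congr rfl fun F hF => by rw [h F hF]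

theorem robinForm_re_mono {c c' : Finset (E d) → ℝ} (h : ∀ F ∈ S.FR, c F ≤ c' F) (v : FaceData d) :
    (S.robinForm c v v).re ≤ (S.robinForm c' v v).re := by
  rw [robinForm_eq_inner, robinForm_eq_inner, Complex.re_sum, Complex.re_sum]
  refine Finset.sum_le_sum fun F hF => ?_
  rw [Complex.re_ofReal_mul, Complex.re_ofReal_mul]
  exact mul_le_mul_of_nonneg_right (h F hF) (inner_self_nonneg (𝕜 := ℂ))

variable (S) in
/-- The map from `H¹(T_h)` to the Hilbert space, for weights `r` on elements and `t` on faces. -/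
def emb (hd : d ≠ 0) (p : ℕ) (r t : Finset (E d) → ℝ) : S.H1 →ₗ[ℂ] S.EH where
  toFun v := S.mkEH (S.wt r (v : S.L2)) (S.mat S.sqrtA (S.dgrad p v))
    fun F => (t F : ℂ) • S.bdryTrace v F
  map_add' v w := by
    rw [← mkEH_add, Submodule.coe_add, map_add, dgrad_add hd, map_add]
    refine mkEH_congr fun F hF => ?_
    rw [bdryTrace_add hd (faces_of_FR hF), smul_add]
    rfl
  map_smul' c v := by
    rw [RingHom.id_apply, ← mkEH_smul, Submodule.coe_smul, map_smul, dgrad_smul hd, map_smul]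
    refine mkEH_congr fun F hF => ?_
    rw [bdryTrace_smul hd (faces_of_FR hF), smul_comm]
    rfl

theorem emb_apply (hd : d ≠ 0) (r t : Finset (E d) → ℝ) (v : S.H1) :
    S.emb hd p r t v = S.mkEH (S.wt r (v : S.L2)) (S.mat S.sqrtA (S.dgrad p v))
      fun F => (t F : ℂ) • S.bdryTrace v F := rfl

theorem sum_inner_smul (t t' : Finset (E d) → ℝ) (φ v : FaceData d) :
    ∑ F ∈ S.FR, inner ℂ ((t F : ℂ) • v F) ((t' F : ℂ) • φ F) =
      S.robinForm (fun F => t F * t' F) φ v := by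
  rw [robinForm_eq_inner]
  refine Finset.sum_congr rfl fun F _ => ?_
  rw [inner_smul_left, inner_smul_right, Complex.conj_ofReal]
  push_cast
  ring

theorem inner_emb (hd : d ≠ 0) (r t r' t' : Finset (E d) → ℝ) (v φ : S.H1) :
    inner ℂ (S.emb hd p r t v) (S.emb hd p r' t' φ) =
      S.massForm (fun K => r K * r' K) φ v + (S.stiffForm (S.dgrad p φ) (S.dgrad p v) +
        S.robinForm (fun F => t F * t' F) (S.bdryTrace φ) (S.bdryTrace v)) := by
  rw [emb_apply, emb_apply, inner_mkEH, sum_inner_smul, S.inner_wt, S.wt_wt,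
    ← S.massForm_eq_inner, stiffForm_eq]

theorem norm_emb_sq (hd : d ≠ 0) {r t c e : Finset (E d) → ℝ} (hr : ∀ K ∈ S.elems, r K * r K = c K)
    (ht : ∀ F ∈ S.FR, t F * t F = e F) (v : S.H1) :
    ‖S.emb hd p r t v‖ ^ 2 = (S.massForm c v v).re + ((S.stiffForm (S.dgrad p v) (S.dgrad p v)).re +
        (S.robinForm e (S.bdryTrace v) (S.bdryTrace v)).re) := by
  rw [norm_sq_eq_re_inner (𝕜 := ℂ), inner_emb, robinForm_congr ht, S.massForm_eq_inner,
    S.wt_congr hr, ← S.massForm_eq_inner]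
  simp

variable (S) in
/-- The weight of the energy norm on elements. -/
def wtE (K : Finset (E d)) : ℝ := √(S.omega ^ 2 * S.mu K)

variable (S) in
/-- The weight of the energy norm on faces. -/
def wtEF (F : Finset (E d)) : ℝ := √(S.omega * S.gam F)

variable (S) in
/-- The weight of the norm `‖·‖_{†,1}` on elements. -/
def wtD (K : Finset (E d)) : ℝ :=
  √(max 1 (S.omega ^ 2 * S.diam K ^ 2 / S.theta K ^ 2) * (S.alpha K / S.diam K ^ 2))

variable (S) in
/-- The weight of the norm `‖·‖_{†,1}` on faces. -/
def wtDF (F : Finset (E d)) : ℝ :=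
  √(max 1 (S.omega * S.diam F / S.thetaF F) * (S.alphaF F / S.diam F))

theorem wtE_sq {K : Finset (E d)} (hK : K ∈ S.elems) :
    S.wtE K * S.wtE K = S.omega ^ 2 * S.mu K :=
  Real.mul_self_sqrt (mul_nonneg (sq_nonneg _) (S.mu_pos K hK).le)

theorem wtEF_sq {F : Finset (E d)} (hF : F ∈ S.FR) :
    S.wtEF F * S.wtEF F = S.omega * S.gam F :=
  Real.mul_self_sqrt (mul_nonneg S.omega_pos.le (S.gam_pos F hF).le)

theorem wtD_sq (hd : d ≠ 0) {K : Finset (E d)} (hK : K ∈ S.elems) :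
    S.wtD K * S.wtD K =
      max 1 (S.omega ^ 2 * S.diam K ^ 2 / S.theta K ^ 2) * (S.alpha K / S.diam K ^ 2) :=
  Real.mul_self_sqrt (mul_nonneg (zero_le_one.trans (le_max_left _ _))
    (div_nonneg (alpha_pos hd hK).le (sq_nonneg _)))

theorem wtDF_sq (hd : d ≠ 0) {F : Finset (E d)} (hF : F ∈ S.FR) :
    S.wtDF F * S.wtDF F =
      max 1 (S.omega * S.diam F / S.thetaF F) * (S.alphaF F / S.diam F) :=
  Real.mul_self_sqrt (mul_nonneg (zero_le_one.trans (le_max_left _ _))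
    (div_nonneg (alphaF_pos hd (faces_of_FR hF)).le Metric.diam_nonneg))

theorem brokenNorm_eq (hd : d ≠ 0) (v : S.H1) :
    S.brokenNorm p v = ‖S.emb hd p S.wtE S.wtEF v‖ := by
  rw [brokenNorm, ← Real.sqrt_sq (norm_nonneg _),
    norm_emb_sq hd (fun K hK => wtE_sq hK) fun F hF => wtEF_sq hF, Mesh.massForm_mul, robinForm_mul,
    Complex.re_ofReal_mul, Complex.re_ofReal_mul]
  congr 1
  ring

theorem brokenNorm_sq (hd : d ≠ 0) (v : S.H1) :
    S.brokenNorm p v ^ 2 = S.omega ^ 2 * (S.massForm S.mu v v).re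
      + S.omega * (S.robinForm S.gam (S.bdryTrace v) (S.bdryTrace v)).re
      + (S.stiffForm (S.dgrad p v) (S.dgrad p v)).re := by
  rw [brokenNorm_eq hd, norm_emb_sq hd (fun K hK => wtE_sq hK) fun F hF => wtEF_sq hF,
    Mesh.massForm_mul, robinForm_mul, Complex.re_ofReal_mul, Complex.re_ofReal_mul]
  ring

theorem energyNorm_eq (hd : d ≠ 0) {v : S.H1} (hv : v ∈ S.H1D) :
    S.energyNorm v = S.brokenNorm p v := by
  rw [energyNorm, brokenNorm, dgrad_eq_grad hd hv]

theorem dagNorm_eq (hd : d ≠ 0) (v : S.H1) :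
    S.dagNorm p v = ‖S.emb hd p S.wtD S.wtDF v‖ := by
  rw [dagNorm, ← Real.sqrt_sq (norm_nonneg _),
    norm_emb_sq hd (fun K hK => wtD_sq hd hK) fun F hF => wtDF_sq hd hF, add_assoc]

theorem norm_emb_mono (hd : d ≠ 0) {r t r' t' : Finset (E d) → ℝ}
    (hr : ∀ K ∈ S.elems, r K * r K ≤ r' K * r' K) (ht : ∀ F ∈ S.FR, t F * t F ≤ t' F * t' F)
    (v : S.H1) : ‖S.emb hd p r t v‖ ≤ ‖S.emb hd p r' t' v‖ := by
  refine (sq_le_sq₀ (norm_nonneg _) (norm_nonneg _)).1 ?_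
  rw [norm_emb_sq hd (fun _ _ => rfl) fun _ _ => rfl, norm_emb_sq hd (fun _ _ => rfl) fun _ _ => rfl]
  exact add_le_add (S.massForm_re_mono hr _) (add_le_add_right (robinForm_re_mono ht _) _)

/-- The second entries of the two maxima reproduce the energy weights exactly: the element one gives
`ω² μ`, the face one `ω γ`. -/
theorem brokenNorm_le_dagNorm (hd : 2 ≤ d) (v : S.H1) : S.brokenNorm p v ≤ S.dagNorm p v := by
  have hd0 : d ≠ 0 := by omega
  rw [brokenNorm_eq hd0, dagNorm_eq hd0]
  refine norm_emb_mono hd0 (fun K hK => ?_) (fun F hF => ?_) v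
  · rw [wtE_sq hK, wtD_sq hd0 hK]
    have ha := alpha_pos hd0 hK
    have hh := diam_pos hd0 hK
    have hm := S.mu_pos K hK
    calc S.omega ^ 2 * S.mu K
        = S.omega ^ 2 * S.diam K ^ 2 / S.theta K ^ 2 * (S.alpha K / S.diam K ^ 2) := by
          rw [theta, Real.sq_sqrt (div_pos ha hm).le]
          field_simp
      _ ≤ _ := by gcongr; exact le_max_right _ _
  · rw [wtEF_sq hF, wtDF_sq hd0 hF]
    have ha := alphaF_pos hd0 (faces_of_FR hF)
    have hh := diam_pos_face hd (faces_of_FR hF)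
    have hm := S.gam_pos F hF
    calc S.omega * S.gam F
        = S.omega * S.diam F / S.thetaF F * (S.alphaF F / S.diam F) := by
          rw [thetaF]
          field_simp
      _ ≤ _ := by gcongr; exact le_max_right _ _

variable (S) in
/-- The weight of the norm `‖·‖_{†,div}` on elements. -/
def wtV (K : Finset (E d)) : ℝ := √(S.diam K ^ 2 / S.alpha K)

variable (S) in
/-- The weight of the norm `‖·‖_{†,div}` on faces. -/
def wtVF (F : Finset (E d)) : ℝ := √(S.diam F / S.alphaF F)

theorem wtV_pos (hd : d ≠ 0) {K : Finset (E d)} (hK : K ∈ S.elems) : 0 < S.wtV K :=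
  Real.sqrt_pos.2 (div_pos (pow_pos (diam_pos hd hK) 2) (alpha_pos hd hK))

theorem wtVF_pos (hd : 2 ≤ d) {F : Finset (E d)} (hF : F ∈ S.FR) : 0 < S.wtVF F :=
  Real.sqrt_pos.2 (div_pos (diam_pos_face hd (faces_of_FR hF))
    (alphaF_pos (by omega) (faces_of_FR hF)))

variable (S) in
/-- The map from `X_{Γ_N}(div, Ω)` to the Hilbert space. -/
def embV (hd : d ≠ 0) : S.XNsub →ₗ[ℂ] S.EH where
  toFun w := S.mkEH (S.wt S.wtV (S.wdiv w)) (S.mat (fun K => (S.sqrtA K)⁻¹) w)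
    -- The minus sign leaves the norm unchanged and matches the sign of the boundary term in `ibp`.
    fun F => ((-S.wtVF F : ℝ) : ℂ) • S.ntrace w F
  map_add' w w' := by
    rw [← mkEH_add, Submodule.coe_add, map_add, wdiv_add w.2 w'.2, map_add]
    refine mkEH_congr fun F hF => ?_
    rw [ntrace_add hd w.2 w'.2 hF, smul_add]
    rfl
  map_smul' c w := by
    rw [RingHom.id_apply, ← mkEH_smul, Submodule.coe_smul, map_smul, wdiv_smul c w.2, map_smul]
    refine mkEH_congr fun F hF => ?_
    rw [ntrace_smul hd c w.2 hF, smul_comm]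
    rfl

theorem embV_apply (hd : d ≠ 0) (w : S.XNsub) :
    S.embV hd w = S.mkEH (S.wt S.wtV (S.wdiv w)) (S.mat (fun K => (S.sqrtA K)⁻¹) w)
      fun F => ((-S.wtVF F : ℝ) : ℂ) • S.ntrace w F := rfl

theorem divNorm_eq (hd : d ≠ 0) (w : S.XNsub) : S.divNorm w = ‖S.embV hd w‖ := by
  rw [divNorm, ← Real.sqrt_sq (norm_nonneg (S.embV hd w)), norm_sq_eq_re_inner (𝕜 := ℂ),
    embV_apply, inner_mkEH, sum_inner_smul, inner_mulMat_inv]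
  have h1 : S.massForm (fun K => S.diam K ^ 2 / S.alpha K) (S.wdiv w) (S.wdiv w) =
      inner ℂ (S.wt S.wtV (S.wdiv w)) (S.wt S.wtV (S.wdiv w)) :=
    S.massForm_eq_inner_inner (fun K hK => Real.mul_self_sqrt
      (div_nonneg (sq_nonneg _) (alpha_pos hd hK).le)) _ _
  have h2 : S.robinForm (fun F => S.diam F / S.alphaF F) (S.ntrace w) (S.ntrace w) =
      S.robinForm (fun F => -S.wtVF F * -S.wtVF F) (S.ntrace w) (S.ntrace w) :=
    robinForm_congr (fun F hF => by
      rw [neg_mul_neg]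
      exact (Real.mul_self_sqrt (div_nonneg Metric.diam_nonneg
        (alphaF_pos hd (faces_of_FR hF)).le)).symm) _ _
  rw [h1, h2]
  congr 1
  simp only [RCLike.re_to_complex, Complex.add_re]
  ring

/-- Duality between the norms `‖·‖_{†,div}` and `‖·‖_{†,1}`. -/
theorem norm_ibp_le (hd : 2 ≤ d) {w : S.L2V} (hw : w ∈ S.XN) (v : S.H1) :
    ‖S.ibp p w v‖ ≤ S.divNorm w * S.dagNorm p v := by
  have hd0 : d ≠ 0 := by omega
  -- With reciprocal weights on the two sides the defect is a single inner product. The reciprocal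
  -- weights correspond to the entry 1 in the maxima, so they are dominated by those of the primal
  -- norm.
  have h1 : S.ibp p w v = inner ℂ (S.embV hd0 ⟨w, hw⟩)
      (S.emb hd0 p (fun K => (S.wtV K)⁻¹) (fun F => (S.wtVF F)⁻¹) v) := by
    rw [embV_apply, emb_apply, inner_mkEH, sum_inner_smul, inner_mat_inv_mat, S.inner_wt, S.wt_wt,
      S.wt_eq_self fun K hK => mul_inv_cancel₀ (wtV_pos hd0 hK).ne', ibp,
      robinForm_congr (c := fun F => -S.wtVF F * (S.wtVF F)⁻¹) (c' := fun F => (-1) * 1)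
        (fun F hF => by rw [neg_mul, mul_inv_cancel₀ (wtVF_pos hd hF).ne', mul_one]), robinForm_mul]
    push_cast
    ring
  rw [h1, show S.divNorm w = ‖S.embV hd0 ⟨w, hw⟩‖ from divNorm_eq hd0 ⟨w, hw⟩, dagNorm_eq hd0]
  refine (norm_inner_le_norm _ _).trans (mul_le_mul_of_nonneg_left ?_ (norm_nonneg _))
  refine norm_emb_mono hd0 (fun K hK => ?_) (fun F hF => ?_) v
  · rw [wtD_sq hd0 hK, ← mul_inv, wtV, Real.mul_self_sqrt
      (div_nonneg (sq_nonneg _) (alpha_pos hd0 hK).le), inv_div]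
    exact le_mul_of_one_le_left (div_nonneg (alpha_pos hd0 hK).le (sq_nonneg _)) (le_max_left _ _)
  · have ha := alphaF_pos hd0 (faces_of_FR hF)
    have hh := diam_pos_face hd (faces_of_FR hF)
    rw [wtDF_sq hd0 hF, ← mul_inv, wtVF, Real.mul_self_sqrt (div_nonneg hh.le ha.le), inv_div]
    exact le_mul_of_one_le_left (div_nonneg ha.le hh.le) (le_max_left _ _)

end Setting

/-! ## Best approximation and inf-sup conditions in Hilbert spaces -/

section Hilbert

variable {X H : Type*} [AddCommGroup X] [Module ℂ X] [NormedAddCommGroup H] [InnerProductSpace ℂ H]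

/-- Orthogonal projection in the Hilbert space onto the image of the subspace; only completeness of
the image matters, and `X` needs no topology. -/
theorem exists_best_approx (T : X →ₗ[ℂ] H) (U : Submodule ℂ X)
    (hU : IsComplete (U.map T : Set H)) (v : X) :
    ∃ s ∈ U, ∀ t ∈ U, ‖T (v - s)‖ ≤ ‖T (v - t)‖ := by
  obtain ⟨w, ⟨s, hs, rfl⟩, hw⟩ := (U.map T).exists_norm_eq_iInf_of_complete_subspace hU (T v)
  refine ⟨s, hs, fun t ht => ?_⟩
  rw [map_sub, map_sub, hw]
  exact ciInf_le (f := fun w : U.map T => ‖T v - w‖)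
    ⟨0, by rintro _ ⟨w, rfl⟩; exact norm_nonneg _⟩ ⟨T t, Submodule.mem_map_of_mem ht⟩

/-- An operator that is bounded below satisfies the dual solvability condition. -/
theorem exists_inner_apply_eq [CompleteSpace H] (B : H →L[ℂ] H) {γ : ℝ}
    (hB : ∀ x, ‖x‖ ≤ γ * ‖B x‖) (y : H) : ∃ z, ∀ x, inner ℂ z (B x) = inner ℂ y x := by
  have hinj : Function.Injective (B : H →ₗ[ℂ] H) := by
    refine (injective_iff_map_eq_zero _).2 fun x hx => ?_
    have h := hB x
    rw [show B x = 0 from hx, norm_zero, mul_zero] at h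
    exact norm_le_zero_iff.1 h
  let e := LinearEquiv.ofInjective (B : H →ₗ[ℂ] H) hinj
  let f : StrongDual ℂ (LinearMap.range (B : H →ₗ[ℂ] H)) :=
    LinearMap.mkContinuous ((innerSL ℂ y : H →ₗ[ℂ] ℂ) ∘ₗ (e.symm : _ →ₗ[ℂ] H)) (‖y‖ * γ) fun w => by
      change ‖inner ℂ y (e.symm w)‖ ≤ _
      have h1 : B (e.symm w) = w := congrArg Subtype.val (e.apply_symm_apply w)
      have h2 := hB (e.symm w)
      rw [h1] at h2
      rw [mul_assoc]
      exact (norm_inner_le_norm _ _).trans (mul_le_mul_of_nonneg_left h2 (norm_nonneg _))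
  -- The lower bound makes `y` composed with the inverse bounded on the range. Hahn–Banach extends
  -- it to the whole space, so the range need not be studied further.
  obtain ⟨g, hg, -⟩ := exists_extension_norm_eq _ f
  refine ⟨(InnerProductSpace.toDual ℂ H).symm g, fun x => ?_⟩
  rw [InnerProductSpace.toDual_symm_apply]
  refine (hg ⟨B x, x, rfl⟩).trans ?_
  change inner ℂ y (e.symm ⟨B x, x, rfl⟩) = _
  congr 1
  exact e.symm_apply_apply x

/-- Compress `R` to the subspace; the inf-sup condition says that the compression is bounded below.
The supremum over the second argument is exactly what solves problems whose unknown is the second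
argument. -/
theorem exists_inner_apply_eq_of_infSup (U : Submodule ℂ H) (hU : IsComplete (U : Set H))
    (R : H →L[ℂ] H) {γ : ℝ} (hγ : 0 ≤ γ)
    (hR : ∀ x ∈ U, ∃ y ∈ U, ‖y‖ ≤ 1 ∧ ‖x‖ ≤ γ * ‖inner ℂ y (R x)‖) (y : H) :
    ∃ z ∈ U, ∀ x ∈ U, inner ℂ z (R x) = inner ℂ y x := by
  have : CompleteSpace U := hU.completeSpace_coe
  let B : U →L[ℂ] U := U.orthogonalProjectionOnto ∘L R ∘L U.subtypeL
  have hB : ∀ z x : U, inner ℂ z (B x) = inner ℂ (z : H) (R x) := fun z x =>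
    Submodule.inner_orthogonalProjectionOnto_eq_of_mem_left z (R x)
  obtain ⟨z, hz⟩ := exists_inner_apply_eq B (fun x => by
    obtain ⟨w, hw, hw1, hle⟩ := hR x x.2
    refine hle.trans (mul_le_mul_of_nonneg_left ?_ hγ)
    rw [← hB ⟨w, hw⟩ x]
    exact (norm_inner_le_norm _ _).trans (mul_le_of_le_one_left (norm_nonneg _) hw1))
    (U.orthogonalProjectionOnto y)
  refine ⟨z, z.2, fun x hx => ?_⟩
  rw [← hB z ⟨x, hx⟩, hz]
  exact Submodule.inner_orthogonalProjectionOnto_eq_of_mem_right ⟨x, hx⟩ y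

end Hilbert

namespace Setting

variable {d : ℕ} {S : Setting d} {p : ℕ}

theorem norm_mkEH_sq (v : S.L2) (σ : S.L2V) (g : FaceData d) :
    ‖S.mkEH v σ g‖ ^ 2 = ‖v‖ ^ 2 + (‖σ‖ ^ 2 + ∑ F ∈ S.FR, ‖g F‖ ^ 2) := by
  rw [norm_sq_eq_re_inner (𝕜 := ℂ), inner_mkEH, map_add, map_add, map_sum,
    norm_sq_eq_re_inner (𝕜 := ℂ), norm_sq_eq_re_inner (𝕜 := ℂ)]
  simp_rw [norm_sq_eq_re_inner (𝕜 := ℂ)]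

theorem norm_mkEH_le (v : S.L2) (σ : S.L2V) (g : FaceData d) :
    ‖S.mkEH v σ g‖ ≤ ‖v‖ + (‖σ‖ + ∑ F ∈ S.FR, ‖g F‖) := by
  have hs : 0 ≤ ∑ F ∈ S.FR, ‖g F‖ := Finset.sum_nonneg fun F _ => norm_nonneg _
  refine (sq_le_sq₀ (norm_nonneg _) (by positivity)).1 ?_
  rw [norm_mkEH_sq]
  have h1 : ∑ F ∈ S.FR, ‖g F‖ ^ 2 ≤ (∑ F ∈ S.FR, ‖g F‖) ^ 2 :=
    Finset.sum_sq_le_sq_sum_of_nonneg fun F _ => norm_nonneg _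
  nlinarith [mul_nonneg (norm_nonneg v) (norm_nonneg σ), mul_nonneg (norm_nonneg v) hs,
    mul_nonneg (norm_nonneg σ) hs]

theorem exists_norm_bdryTrace_le (hd : d ≠ 0) {F : Finset (E d)} (hF : F ∈ S.faces) :
    ∃ C : ℝ, ∀ v : S.H1, ‖S.bdryTrace v F‖ ≤ C * (‖(v : S.L2)‖ + ‖S.grad v‖) := by
  have ho := owner_mem hF
  obtain ⟨a, ha, hFa⟩ := Mesh.exists_eq_opp hF ho
  obtain ⟨C, hC⟩ := Mesh.norm_trace_le (M := S.toMesh) hd (Mesh.mem_elemsAt.1 ho).1 ha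
  refine ⟨C, fun v => ?_⟩
  have := hC v
  rwa [← hFa] at this

theorem tendsto_bdryTrace (hd : d ≠ 0) {F : Finset (E d)} (hF : F ∈ S.faces) {v : ℕ → S.H1}
    {v' : S.H1} (h1 : Tendsto (fun n => (v n : S.L2)) atTop (𝓝 v'))
    (h2 : Tendsto (fun n => S.grad (v n)) atTop (𝓝 (S.grad v'))) :
    Tendsto (fun n => S.bdryTrace (v n) F) atTop (𝓝 (S.bdryTrace v' F)) := by
  obtain ⟨C, hC⟩ := exists_norm_bdryTrace_le hd hF
  rw [tendsto_iff_norm_sub_tendsto_zero] at h1 h2 ⊢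
  have hle : ∀ n, ‖S.bdryTrace (v n) F - S.bdryTrace v' F‖ ≤
      C * (‖(v n : S.L2) - v'‖ + ‖S.grad (v n) - S.grad v'‖) := by
    intro n
    have h := hC (v n + (-1 : ℂ) • v')
    rw [bdryTrace_add hd hF, bdryTrace_smul hd hF, Mesh.grad_add, Mesh.grad_smul, Submodule.coe_add,
      Submodule.coe_smul] at h
    simpa only [neg_one_smul, ← sub_eq_add_neg] using h
  refine squeeze_zero (fun n => norm_nonneg _) hle ?_
  simpa using (h1.add h2).const_mul C

/-- `H¹_{Γ_D}(Ω)` is complete for the weighted norms. -/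
theorem isComplete_emb (hd : d ≠ 0) {r t : Finset (E d) → ℝ} (hr : ∀ K ∈ S.elems, r K ≠ 0) :
    IsComplete ((S.H1Dsub hd).map (S.emb hd p r t) : Set S.EH) := by
  refine IsClosed.isComplete (IsSeqClosed.isClosed fun x x' hx hlim => ?_)
  choose v hv hvx using hx
  -- Inverse weights recover the function and its gradient from the first two components. The limit
  -- pair lies in the closed graph of the weak gradient, and continuity of traces handles the
  -- boundary, whatever the face weights `t` are.
  have hfst : Continuous fun x : S.EH => S.wt (fun K => (r K)⁻¹) x.fst :=
    (ContinuousLinearMap.continuous _).comp (WithLp.prod_continuous_ofLp 2 _ _).fst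
  have hsnd : Continuous fun x : S.EH => S.mat (fun K => (S.sqrtA K)⁻¹) x.snd.fst :=
    (ContinuousLinearMap.continuous _).comp ((WithLp.prod_continuous_ofLp 2 _ _).fst.comp
      (WithLp.prod_continuous_ofLp 2 _ _).snd)
  have hvL : ∀ n, (v n : S.L2) = S.wt (fun K => (r K)⁻¹) (x n).fst := fun n => by
    rw [← hvx n, emb_apply]
    exact ((S.wt_wt (fun K => (r K)⁻¹) r (v n)).trans
      (S.wt_eq_self (fun K hK => inv_mul_cancel₀ (hr K hK)) _)).symm
  have hvg : ∀ n, S.grad (v n) = S.mat (fun K => (S.sqrtA K)⁻¹) (x n).snd.fst := fun n => by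
    rw [← hvx n, emb_apply, dgrad_eq_grad hd (hv n)]
    exact ((S.mat_mat (fun K => (S.sqrtA K)⁻¹) S.sqrtA (S.grad (v n))).trans
      (S.mat_eq_self (fun K hK => Matrix.nonsing_inv_mul _ (sqrtA_spec hK).2.2) _)).symm
  have h1 := (hfst.tendsto x').comp hlim
  have h2 := (hsnd.tendsto x').comp hlim
  set vL := S.wt (fun K => (r K)⁻¹) x'.fst
  set g := S.mat (fun K => (S.sqrtA K)⁻¹) x'.snd.fst
  obtain ⟨G, hGc, hG⟩ := S.exists_weakGradGraph S.isOpen_dom.measurableSet subset_rfl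
  have hmem : (vL, g) ∈ G := by
    refine hGc.mem_of_tendsto (h1.prodMk_nhds h2) (Eventually.of_forall fun n => ?_)
    change (S.wt _ (x n).fst, S.mat _ (x n).snd.fst) ∈ G
    rw [← hvL n, ← hvg n]
    exact (hG _ _).2 (isWeakGrad_of_mem (hv n))
  have hw := (hG _ _).1 hmem
  have hwc : ∀ K ∈ S.elems, IsWeakGrad (cell K) vL g := fun K hK => hw.mono (S.cell_subset_dom hK)
  let v' : S.H1 := ⟨vL, g, hwc⟩
  have hg' : S.grad v' = g := Mesh.grad_eq v' hwc
  have t1 : Tendsto (fun n => (v n : S.L2)) atTop (𝓝 v') := h1.congr fun n => (hvL n).symm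
  have t2 : Tendsto (fun n => S.grad (v n)) atTop (𝓝 (S.grad v')) := by
    rw [hg']
    exact h2.congr fun n => (hvg n).symm
  have hv' : v' ∈ S.H1D := by
    refine ⟨⟨g, hw⟩, fun F hF => ?_⟩
    refine tendsto_nhds_unique (tendsto_bdryTrace hd (faces_of_FD hF) t1 t2) ?_
    exact tendsto_const_nhds.congr fun n => ((hv n).2 F hF).symm
  refine SetLike.mem_coe.2 (Submodule.mem_map.2 ⟨v', hv', ?_⟩)
  refine tendsto_nhds_unique ?_ hlim
  rw [tendsto_iff_norm_sub_tendsto_zero]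
  have hlim0 : Tendsto (fun n => ‖S.wt r (v n : S.L2) - S.wt r v'‖ +
      (‖S.mat S.sqrtA (S.grad (v n)) - S.mat S.sqrtA (S.grad v')‖ +
        ∑ F ∈ S.FR, ‖(t F : ℂ) • S.bdryTrace (v n) F - (t F : ℂ) • S.bdryTrace v' F‖))
      atTop (𝓝 0) := by
    have e1 := tendsto_iff_norm_sub_tendsto_zero.1 (((S.wt r).continuous.tendsto _).comp t1)
    have e2 := tendsto_iff_norm_sub_tendsto_zero.1 (((S.mat S.sqrtA).continuous.tendsto _).comp t2)
    have e3 := tendsto_finsetSum S.FR fun F hF => tendsto_iff_norm_sub_tendsto_zero.1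
      ((tendsto_bdryTrace hd (faces_of_FR hF) t1 t2).const_smul (t F : ℂ))
    simpa using e1.add (e2.add e3)
  refine squeeze_zero (fun n => norm_nonneg _) (fun n => ?_) hlim0
  rw [← hvx n, emb_apply, emb_apply, dgrad_eq_grad hd (hv n), dgrad_eq_grad hd hv']
  exact norm_mkEH_le (S := S) (S.wt r (v n : S.L2) - S.wt r v')
    (S.mat S.sqrtA (S.grad (v n)) - S.mat S.sqrtA (S.grad v'))
    (fun F => (t F : ℂ) • S.bdryTrace (v n) F - (t F : ℂ) • S.bdryTrace v' F)

/-! ## The projections -/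

theorem wtD_pos (hd : d ≠ 0) {K : Finset (E d)} (hK : K ∈ S.elems) : 0 < S.wtD K :=
  Real.sqrt_pos.2 (mul_pos (zero_lt_one.trans_le (le_max_left _ _))
    (div_pos (alpha_pos hd hK) (pow_pos (diam_pos hd hK) 2)))

/-- The projection is a choice among minimizers, so a minimizer has to exist; this is where
completeness of the conforming space is used. -/
theorem projG_mem (hd : d ≠ 0) (v : S.H1) : S.projG p v ∈ S.H1D := by
  refine (Classical.epsilon_spec (p := fun s => s ∈ S.H1D ∧
    ∀ t ∈ S.H1D, S.dagNorm p (v - s) ≤ S.dagNorm p (v - t)) ?_).1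
  simp_rw [dagNorm_eq hd]
  exact exists_best_approx _ (S.H1Dsub hd)
    (isComplete_emb hd fun K hK => (wtD_pos hd hK).ne') v

theorem projhG_mem (hd : d ≠ 0) (v : S.H1) : S.projhG p v ∈ S.Lagrange p := by
  refine (Classical.epsilon_spec (p := fun s => s ∈ S.Lagrange p ∧
    ∀ t ∈ S.Lagrange p, S.dagNorm p (v - s) ≤ S.dagNorm p (v - t)) ?_).1
  simp_rw [dagNorm_eq hd]
  have h : ∀ s, s ∈ S.polySub p ⊓ S.H1Dsub hd ↔ s ∈ S.Lagrange p := fun s => by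
    rw [Submodule.mem_inf, Mesh.mem_polySub]
    rfl
  simp_rw [← h]
  refine exists_best_approx _ (S.polySub p ⊓ S.H1Dsub hd) ?_ v
  have : FiniteDimensional ℂ ((S.polySub p ⊓ S.H1Dsub hd : Submodule ℂ S.H1)) :=
    Submodule.finiteDimensional_inf_left _ _
  exact Submodule.complete_of_finiteDimensional _

/-- The divergence norm is a Hilbert norm only on the fields with a normal trace, so the
approximation problem is posed inside that space, on a finite-dimensional subspace. -/
theorem projhD_mem (hd : d ≠ 0) {w : S.L2V} (hw : w ∈ S.XN) : S.projhD p w ∈ S.BDM p := by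
  refine (Classical.epsilon_spec (p := fun s => s ∈ S.BDM p ∧
    ∀ t ∈ S.BDM p, S.divNorm (w - s) ≤ S.divNorm (w - t)) ?_).1
  let U : Submodule ℂ S.XNsub := (S.polyVSub p).comap S.XNsub.subtype
  have hfin : FiniteDimensional ℂ U := by
    refine FiniteDimensional.of_injective (V₂ := S.polyVSub p)
      ((S.XNsub.subtype ∘ₗ U.subtype).codRestrict _ fun x => x.2) fun x y h => ?_
    exact Subtype.ext (Subtype.ext (congrArg (fun z : S.polyVSub p => (z : S.L2V)) h))
  obtain ⟨s, hs, hmin⟩ := exists_best_approx (S.embV hd) U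
    (Submodule.complete_of_finiteDimensional _) ⟨w, hw⟩
  refine ⟨s, ⟨Mesh.mem_polyVSub.1 hs, s.2⟩, fun t ht => ?_⟩
  have := hmin ⟨t, ht.2⟩ (Mesh.mem_polyVSub.2 ht.1)
  rwa [← divNorm_eq, ← divNorm_eq] at this

/-! ## The Helmholtz forms -/

variable (S) in
/-- The isometry that turns the energy inner product into the Helmholtz form. -/
def rot : S.EH →L[ℂ] S.EH :=
  LinearMap.mkContinuous
    -- The factors -1, 1 and `-i` on the volume, gradient and Robin components are the coefficients
    -- of the Helmholtz form relative to the energy product.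
    { toFun := fun x => S.mkEH (-x.fst) x.snd.fst
        fun F => open Classical in if h : F ∈ S.FR then -Complex.I • x.snd.snd ⟨F, h⟩ else 0
      map_add' := fun x y => by
        rw [← mkEH_add, WithLp.add_fst, neg_add, WithLp.add_snd, WithLp.add_fst]
        refine mkEH_congr fun F hF => ?_
        rw [Pi.add_apply, dif_pos hF, dif_pos hF, dif_pos hF, WithLp.add_snd, PiLp.add_apply,
          smul_add]
      map_smul' := fun c x => by
        rw [RingHom.id_apply, ← mkEH_smul, WithLp.smul_fst, ← smul_neg, WithLp.smul_snd,
          WithLp.smul_fst]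
        refine mkEH_congr fun F hF => ?_
        rw [Pi.smul_apply, dif_pos hF, dif_pos hF, WithLp.smul_snd, PiLp.smul_apply, smul_comm] }
    1 fun x => by
      rw [one_mul]
      refine (sq_le_sq₀ (norm_nonneg _) (norm_nonneg _)).1 ?_
      change ‖S.mkEH _ _ _‖ ^ 2 ≤ _
      rw [norm_mkEH_sq, WithLp.prod_norm_sq_eq_of_L2, WithLp.prod_norm_sq_eq_of_L2,
        PiLp.norm_sq_eq_of_L2, norm_neg, ← Finset.sum_coe_sort S.FR]
      refine le_of_eq ?_
      congr 2
      refine Finset.sum_congr rfl fun F _ => ?_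
      rw [dif_pos F.2, norm_smul, norm_neg, Complex.norm_I, one_mul]

theorem norm_rot_le (x : S.EH) : ‖S.rot x‖ ≤ ‖x‖ :=
  (S.rot.le_of_opNorm_le (LinearMap.mkContinuous_norm_le _ zero_le_one _) x).trans_eq (one_mul _)

theorem rot_mkEH (v : S.L2) (σ : S.L2V) (g : FaceData d) :
    S.rot (S.mkEH v σ g) = S.mkEH (-v) σ (-Complex.I • g) := by
  classical
  change S.mkEH (-v) σ (fun F => if h : F ∈ S.FR then -Complex.I • g F else 0) = _
  refine mkEH_congr fun F hF => ?_
  rw [dif_pos hF]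
  rfl

variable (S) in
/-- The Helmholtz form without stabilization. -/
def bz (p : ℕ) (φ v : S.H1) : ℂ :=
  -(S.omega : ℂ) ^ 2 * S.massForm S.mu φ v
    - Complex.I * (S.omega : ℂ) * S.robinForm S.gam (S.bdryTrace φ) (S.bdryTrace v)
    + S.stiffForm (S.dgrad p φ) (S.dgrad p v)

theorem bz_eq_inner (hd : d ≠ 0) (φ v : S.H1) :
    S.bz p φ v = inner ℂ (S.emb hd p S.wtE S.wtEF v) (S.rot (S.emb hd p S.wtE S.wtEF φ)) := by
  have hm : S.massForm (fun K => S.omega ^ 2 * S.mu K) φ v =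
      inner ℂ (S.wt S.wtE v) (S.wt S.wtE φ) := S.massForm_eq_inner_inner (fun K hK => wtE_sq hK) _ _
  rw [emb_apply, emb_apply, rot_mkEH, inner_mkEH, inner_neg_right, ← hm, Mesh.massForm_mul,
    ← stiffForm_eq]
  simp only [Pi.smul_apply, inner_smul_right]
  rw [← Finset.mul_sum]
  simp_rw [← inner_smul_right]
  rw [sum_inner_smul, robinForm_congr fun F hF => wtEF_sq hF, robinForm_mul, bz]
  push_cast
  ring

/-- The Helmholtz form is the energy product up to `rot`, which does not increase norms; hence
continuity with constant 1. -/
theorem norm_bz_le (hd : d ≠ 0) (φ v : S.H1) :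
    ‖S.bz p φ v‖ ≤ S.brokenNorm p φ * S.brokenNorm p v := by
  rw [bz_eq_inner hd, brokenNorm_eq hd, brokenNorm_eq hd, mul_comm]
  exact (norm_inner_le_norm _ _).trans
    (mul_le_mul_of_nonneg_left (norm_rot_le _) (norm_nonneg _))

theorem bh_eq (s : S.SesqForm) (φ v : S.H1) : S.bh p s φ v = S.bz p φ v + s φ v := by
  rw [bh, ah, bz]
  ring

theorem b_eq (hd : d ≠ 0) {φ v : S.H1} (hφ : φ ∈ S.H1D) (hv : v ∈ S.H1D) :
    S.b φ v = S.bz p φ v := by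
  rw [b, bz, dgrad_eq_grad hd hφ, dgrad_eq_grad hd hv]

theorem bz_add_left (hd : d ≠ 0) (φ φ' v : S.H1) :
    S.bz p (φ + φ') v = S.bz p φ v + S.bz p φ' v := by
  simp only [bz_eq_inner hd, map_add, inner_add_right]

theorem bz_smul_left (hd : d ≠ 0) (c : ℂ) (φ v : S.H1) : S.bz p (c • φ) v = c * S.bz p φ v := by
  simp only [bz_eq_inner hd, map_smul, inner_smul_right]

theorem bz_add_right (hd : d ≠ 0) (φ v v' : S.H1) :
    S.bz p φ (v + v') = S.bz p φ v + S.bz p φ v' := by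
  simp only [bz_eq_inner hd, map_add, inner_add_left]

theorem bz_smul_right (hd : d ≠ 0) (c : ℂ) (φ v : S.H1) :
    S.bz p φ (c • v) = conj c * S.bz p φ v := by
  simp only [bz_eq_inner hd, map_smul, inner_smul_left]

/-! ## Solvability of the dual problems -/

theorem wtE_pos {K : Finset (E d)} (hK : K ∈ S.elems) : 0 < S.wtE K :=
  Real.sqrt_pos.2 (mul_pos (pow_pos S.omega_pos 2) (S.mu_pos K hK))

theorem wtEF_pos {F : Finset (E d)} (hF : F ∈ S.FR) : 0 < S.wtEF F :=
  Real.sqrt_pos.2 (mul_pos S.omega_pos (S.gam_pos F hF))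

/-- The given inf-sup condition, rescaled from unit vectors, is transported to the image of the
conforming space in `EH`. There `exists_inner_apply_eq_of_infSup` solves for the second argument of
the form. -/
theorem exists_dual (hd : d ≠ 0) (hwp : S.WellPosed) (y : S.EH) :
    ∃ ξ ∈ S.H1D, ∀ w ∈ S.H1D, S.b w ξ = inner ℂ y (S.emb hd p S.wtE S.wtEF w) := by
  obtain ⟨γ, hγ, h⟩ := hwp
  have hR : ∀ x ∈ (S.H1Dsub hd).map (S.emb hd p S.wtE S.wtEF),
      ∃ y ∈ (S.H1Dsub hd).map (S.emb hd p S.wtE S.wtEF),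
        ‖y‖ ≤ 1 ∧ ‖x‖ ≤ γ * ‖inner ℂ y (S.rot x)‖ := by
    intro x hx
    obtain ⟨φ, hφ, rfl⟩ := Submodule.mem_map.1 hx
    set N := ‖S.emb hd p S.wtE S.wtEF φ‖
    by_cases hN : N = 0
    · exact ⟨0, Submodule.zero_mem _, by simp, by rw [hN]; positivity⟩
    have hN' : 0 < N := lt_of_le_of_ne (norm_nonneg _) (Ne.symm hN)
    have hφ' : (N⁻¹ : ℂ) • φ ∈ S.H1D := (S.H1Dsub hd).smul_mem _ hφ
    obtain ⟨v, hv, hv1, hle⟩ := h _ hφ' (by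
      rw [energyNorm_eq (p := p) hd hφ', brokenNorm_eq hd, map_smul, norm_smul, norm_inv,
        Complex.norm_real, Real.norm_of_nonneg hN'.le]
      exact inv_mul_cancel₀ hN)
    rw [energyNorm_eq (p := p) hd hv, brokenNorm_eq hd] at hv1
    refine ⟨_, Submodule.mem_map_of_mem hv, hv1.le, ?_⟩
    rw [b_eq (p := p) hd hφ' hv, bz_smul_left hd, bz_eq_inner hd] at hle
    have h2 := hle.trans (Complex.re_le_norm _)
    rw [norm_mul, norm_inv, Complex.norm_real, Real.norm_of_nonneg hN'.le, inv_mul_eq_div,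
      div_le_div_iff₀ hγ hN', one_mul] at h2
    rwa [mul_comm]
  obtain ⟨z, hz, hzy⟩ := exists_inner_apply_eq_of_infSup
    ((S.H1Dsub hd).map (S.emb hd p S.wtE S.wtEF))
    (isComplete_emb hd fun K hK => (wtE_pos hK).ne') S.rot hγ.le hR y
  obtain ⟨ξ, hξ, rfl⟩ := Submodule.mem_map.1 hz
  refine ⟨ξ, hξ, fun w hw => ?_⟩
  rw [b_eq (p := p) hd hw hξ, bz_eq_inner hd, hzy _ (Submodule.mem_map_of_mem hw)]

/-- The suprema in the approximation factors range only over data that have a dual solution;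
existence makes them control every datum. -/
theorem exists_isDualVol (hd : d ≠ 0) (hwp : S.WellPosed) (ψ : S.L2) :
    ∃ ξ, S.IsDualVol ψ ξ := by
  -- The weight divides by `wtE` what the embedding of `w` multiplies by. The degree is immaterial
  -- for conforming functions.
  obtain ⟨ξ, hξ, h⟩ := exists_dual (p := 0) hd hwp
    (S.mkEH (S.wt (fun K => S.omega * S.mu K / S.wtE K) ψ) 0 0)
  refine ⟨ξ, hξ, fun w hw => ?_⟩
  rw [h w hw, emb_apply, inner_mkEH, inner_zero_left, S.inner_wt, S.wt_wt,
    S.wt_congr fun K hK => div_mul_cancel₀ (S.omega * S.mu K) (wtE_pos hK).ne',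
    ← S.massForm_eq_inner, S.massForm_mul]
  simp

theorem exists_isDualBdry (hd : d ≠ 0) (hwp : S.WellPosed) (Ψ : FaceData d) :
    ∃ ξ, S.IsDualBdry Ψ ξ := by
  obtain ⟨ξ, hξ, h⟩ := exists_dual (p := 0) hd hwp
    (S.mkEH 0 0 fun F => ((√S.omega * S.gam F / S.wtEF F : ℝ) : ℂ) • Ψ F)
  refine ⟨ξ, hξ, fun w hw => ?_⟩
  rw [h w hw, emb_apply, inner_mkEH, inner_zero_left, inner_zero_left, sum_inner_smul,
    robinForm_congr fun F hF => div_mul_cancel₀ (√S.omega * S.gam F) (wtEF_pos hF).ne',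
    robinForm_mul, zero_add, zero_add]

end Setting

namespace Setting

variable {d : ℕ} {S : Setting d} {p : ℕ}

/-! ## Fluxes -/

/-- Boundary faces miss the open domain up to null sets, so functions with compact support in the
domain have zero boundary traces. They are conforming test functions without Robin term, and the
identity reduces to the definition of the weak divergence. -/
theorem IsNormalTrace.isWeakDiv (hd : d ≠ 0) {w : S.L2V} {q : S.L2} {g : FaceData d}
    (h : S.IsNormalTrace w q g) : IsWeakDiv S.dom w q := by
  intro φ hφ
  have hφ1 : ContDiff ℝ 1 φ := hφ.1.of_le (by simp)
  obtain ⟨v, hvφ, hgφ, hv, ht⟩ := Mesh.exists_H1_of_smooth (M := S.toMesh) hd (contDiff_ofReal hφ.1)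
    (hφ.2.1.comp_left (g := fun t : ℝ => (t : ℂ)) (by simp))
  have hbdry : ∀ F, (F ∈ S.FD ∨ F ∈ S.FN ∨ F ∈ S.FR) → S.bdryTrace v F = 0 := by
    intro F hF
    have hF' := ((S.mem_bdry F).1 hF).1
    have hs := elemsAt_eq_singleton hF
    have ho := owner_mem hF'
    obtain ⟨a, ha, hFa⟩ := Mesh.exists_eq_opp hF' ho
    have hK := (Mesh.mem_elemsAt.1 ho).1
    have hnot : ∀ᵐ x ∂faceMeasure F, x ∉ S.dom := by
      have := S.faceMeasure_ae_notMem_dom hd hK ha (by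
        rw [← hFa, hs]; exact fun L hL => Finset.mem_singleton.1 hL)
      rwa [← hFa] at this
    have htF : S.trace (S.owner F) F v =ᵐ[faceMeasure F] fun x => (φ x : ℂ) := by
      have := ht _ hK a ha
      rwa [← hFa] at this
    refine Lp.ext ?_
    filter_upwards [hnot, htF, Lp.coeFn_zero ℂ 2 (faceMeasure F)] with x h1 h2 h3
    rw [h3, Mesh.bdryTrace, h2, image_eq_zero_of_notMem_tsupport fun hx => h1 (hφ.2.2 hx)]
    simp
  have key := h v ⟨⟨_, hv⟩, fun F hF => hbdry F (Or.inl hF)⟩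
  have hrob : S.robinForm (fun _ => 1) (S.bdryTrace v) g = 0 := by
    rw [robinForm_eq_inner]
    exact Finset.sum_eq_zero fun F hF => by
      rw [hbdry F (Or.inr (Or.inr hF)), inner_zero_right, mul_zero]
  rw [hrob, L2.inner_def, L2.inner_def, add_eq_zero_iff_eq_neg] at key
  have h1 : ∫ x in S.dom, ∑ i, w x i * ((pderiv i φ x : ℝ) : ℂ) =
      conj (∫ x in S.dom, inner ℂ (w x) (S.grad v x)) := by
    rw [← integral_conj]
    refine integral_congr_ae ?_
    filter_upwards [hgφ] with x hx
    rw [hx, inner_euclidean, map_sum]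
    refine Finset.sum_congr rfl fun i _ => ?_
    rw [map_mul, Complex.conj_conj, mul_comm]
    congr 1
    rw [show cgrad (fun y => (φ y : ℂ)) x i = _ from pderiv_ofReal hφ1 i x, Complex.conj_ofReal]
  have h2 : ∫ x in S.dom, q x * (φ x : ℂ) =
      conj (∫ x in S.dom, inner ℂ (q x) ((v : S.L2) x)) := by
    rw [← integral_conj]
    refine integral_congr_ae ?_
    filter_upwards [hvφ] with x hx
    rw [hx, RCLike.inner_apply, map_mul, Complex.conj_conj, Complex.conj_ofReal, mul_comm]
  rw [h1, h2, key, map_neg]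

theorem IsNormalTrace.mem_XN (hd : d ≠ 0) {w : S.L2V} {q : S.L2} {g : FaceData d}
    (h : S.IsNormalTrace w q g) : w ∈ S.XN := ⟨q, g, h.isWeakDiv hd, h⟩

theorem ibp_eq (hd : d ≠ 0) {w : S.L2V} {q : S.L2} {g : FaceData d}
    (h : S.IsNormalTrace w q g) (v : S.H1) :
    S.ibp p w v = inner ℂ w (S.dgrad p v) + inner ℂ q (v : S.L2)
      - S.robinForm (fun _ => 1) (S.bdryTrace v) g := by
  rw [ibp, wdiv_eq (h.isWeakDiv hd), robinForm_eq_inner, robinForm_eq_inner]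
  congr 1
  exact Finset.sum_congr rfl fun F hF => by rw [ntrace_eq hd (h.isWeakDiv hd) h hF]

theorem ibp_sub_left (hd : d ≠ 0) {w w' : S.L2V} (hw : w ∈ S.XN) (hw' : w' ∈ S.XN) (v : S.H1) :
    S.ibp p (w - w') v = S.ibp p w v - S.ibp p w' v := by
  have h : w - w' = w + (-1 : ℂ) • w' := by rw [neg_one_smul, sub_eq_add_neg]
  have hw'' : (-1 : ℂ) • w' ∈ S.XN := S.XNsub.smul_mem _ hw'
  have hr : S.robinForm (fun _ => 1) (S.bdryTrace v) (S.ntrace (w - w')) =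
      S.robinForm (fun _ => 1) (S.bdryTrace v) (S.ntrace w) -
        S.robinForm (fun _ => 1) (S.bdryTrace v) (S.ntrace w') := by
    simp only [robinForm_eq_inner]
    rw [← Finset.sum_sub_distrib]
    refine Finset.sum_congr rfl fun F hF => ?_
    rw [h, ntrace_add hd hw hw'' hF, ntrace_smul hd _ hw' hF, neg_one_smul, ← sub_eq_add_neg,
      inner_sub_left]
    ring
  rw [ibp, hr, inner_sub_left, h, wdiv_add hw hw'', wdiv_smul _ hw', neg_one_smul,
    ← sub_eq_add_neg, inner_sub_left, ibp, ibp]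
  ring

theorem ibp_sub_right (hd : d ≠ 0) (w : S.L2V) (v v' : S.H1) :
    S.ibp p w (v - v') = S.ibp p w v - S.ibp p w v' := by
  have h : v - v' = v + (-1 : ℂ) • v' := by rw [neg_one_smul, sub_eq_add_neg]
  have hr : S.robinForm (fun _ => 1) (S.bdryTrace (v - v')) (S.ntrace w) =
      S.robinForm (fun _ => 1) (S.bdryTrace v) (S.ntrace w) -
        S.robinForm (fun _ => 1) (S.bdryTrace v') (S.ntrace w) := by
    simp only [robinForm_eq_inner]
    rw [← Finset.sum_sub_distrib]
    refine Finset.sum_congr rfl fun F hF => ?_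
    rw [h, bdryTrace_add hd (faces_of_FR hF), bdryTrace_smul hd (faces_of_FR hF), neg_one_smul,
      ← sub_eq_add_neg, inner_sub_right]
    ring
  rw [ibp, hr, h, dgrad_add hd, dgrad_smul hd, neg_one_smul, ← sub_eq_add_neg, inner_sub_right,
    Submodule.coe_add, Submodule.coe_smul, neg_one_smul, ← sub_eq_add_neg, inner_sub_right, ibp, ibp]
  ring

/-- For `w ∈ X_{Γ_N}`, only the distances to the conforming spaces matter in `ibp`. -/
theorem norm_ibp_le_dist (hd : 2 ≤ d) {w σ : S.L2V} (hw : w ∈ S.XN) (hσ : σ ∈ S.BDM p)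
    (v : S.H1) {c : S.H1} (hc : c ∈ S.H1D) :
    ‖S.ibp p w v‖ ≤ S.divNorm (w - σ) * S.dagNorm p (v - c) := by
  have hd0 : d ≠ 0 := by omega
  have hws : w - σ ∈ S.XN := S.XNsub.sub_mem hw hσ.2
  have h : S.ibp p w v = S.ibp p (w - σ) (v - c) := by
    rw [ibp_sub_right hd0, ibp_eq_zero_of_mem_H1D hd0 hws hc, sub_zero, ibp_sub_left hd0 hw hσ.2,
      ibp_eq_zero_of_mem_BDM hd0 hσ, sub_zero]
  rw [h]
  exact norm_ibp_le hd hws _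

theorem stiffForm_eq_inner_flux (σ : S.L2V) (ξ : S.H1) :
    S.stiffForm σ (S.grad ξ) = inner ℂ (S.flux ξ) σ := by
  rw [stiffForm, flux, Mesh.mulMat_eq, Mesh.mulMat_eq, S.inner_mat S.A_symm]

theorem stiffForm_conj (σ τ : S.L2V) : conj (S.stiffForm σ τ) = S.stiffForm τ σ := by
  rw [stiffForm_eq, stiffForm_eq, inner_conj_symm]

theorem robinForm_conj (c : Finset (E d) → ℝ) (φ v : FaceData d) :
    conj (S.robinForm c φ v) = S.robinForm c v φ := by
  rw [robinForm_eq_inner, robinForm_eq_inner, map_sum]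
  exact Finset.sum_congr rfl fun F _ => by rw [map_mul, Complex.conj_ofReal, inner_conj_symm]

theorem robinForm_one_smul (a : ℂ) (c : Finset (E d) → ℝ) (φ v : FaceData d) :
    S.robinForm (fun _ => 1) φ (fun F => (a * c F) • v F) = conj a * S.robinForm c φ v := by
  rw [robinForm_eq_inner, robinForm_eq_inner, Finset.mul_sum]
  refine Finset.sum_congr rfl fun F _ => ?_
  rw [inner_smul_left, map_mul, Complex.conj_ofReal]
  push_cast
  ring

theorem robinForm_add_right (c : Finset (E d) → ℝ) (φ v w : FaceData d) :
    S.robinForm c φ (v + w) = S.robinForm c φ v + S.robinForm c φ w := by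
  simp only [robinForm_eq_inner]
  rw [← Finset.sum_add_distrib]
  exact Finset.sum_congr rfl fun F _ => by rw [Pi.add_apply, inner_add_left, mul_add]

/-- The flux of the solution satisfies the Helmholtz equation in mixed form. -/
theorem exists_ibp_solution (hd : d ≠ 0) {f : S.L2} {u : S.H1} (hu : S.IsSolution f u) :
    S.flux u ∈ S.XN ∧ ∀ (p : ℕ) (v : S.H1),
      S.ibp p (S.flux u) v = conj (S.bz p u v - inner ℂ (v : S.L2) f) := by
  -- The equation forces the divergence `-ω² μ u - f` and the normal trace `iωγ u`. With these the
  -- defect is, for every broken `v`, the conjugate residual of the form; for conforming `v` the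
  -- residual is zero, which proves that they are the divergence and the normal trace.
  have hid : ∀ (p : ℕ) (v : S.H1), inner ℂ (S.flux u) (S.dgrad p v) +
      inner ℂ (-((S.omega : ℂ) ^ 2) • S.wt S.mu (u : S.L2) - f) (v : S.L2) -
      S.robinForm (fun _ => 1) (S.bdryTrace v)
        (fun F => ((Complex.I * S.omega) * S.gam F) • S.bdryTrace u F) =
      conj (S.bz p u v - inner ℂ (v : S.L2) f) := by
    intro p v
    rw [robinForm_one_smul, ← stiffForm_eq_inner_flux, inner_sub_left, inner_smul_left,
      bz, dgrad_eq_grad hd hu.1]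
    simp only [map_sub, map_add, map_mul, map_neg, map_pow, Complex.conj_ofReal, Complex.conj_I,
      stiffForm_conj, robinForm_conj, inner_conj_symm, S.massForm_eq_inner]
    ring
  have hN : S.IsNormalTrace (S.flux u) (-((S.omega : ℂ) ^ 2) • S.wt S.mu (u : S.L2) - f)
      (fun F => ((Complex.I * S.omega) * S.gam F) • S.bdryTrace u F) := by
    intro v hv
    have h := hid 0 v
    rw [← b_eq hd hu.1 hv, hu.2 v hv, sub_self, map_zero, sub_eq_zero, dgrad_eq_grad hd hv] at h
    exact h
  exact ⟨hN.mem_XN hd, fun p v => (ibp_eq hd hN v).trans (hid p v)⟩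

/-- The flux of a dual solution satisfies the dual equation in mixed form. -/
theorem exists_ibp_dual (hd : d ≠ 0) {ψ : S.L2} {Ψ : FaceData d} {ξ : S.H1} (hξ : ξ ∈ S.H1D)
    (h : ∀ w ∈ S.H1D, S.b w ξ = (S.omega : ℂ) * S.massForm S.mu w ψ +
      ((√S.omega : ℝ) : ℂ) * S.robinForm S.gam (S.bdryTrace w) Ψ) :
    S.flux ξ ∈ S.XN ∧ ∀ (p : ℕ) (e : S.H1), S.ibp p (S.flux ξ) e = S.bz p e ξ -
      ((S.omega : ℂ) * S.massForm S.mu e ψ +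
        ((√S.omega : ℝ) : ℂ) * S.robinForm S.gam (S.bdryTrace e) Ψ) := by
  -- Divergence and normal trace are read off from the dual equation. Compared with the primal
  -- problem the impedance term changes sign, as the unknown stands in the antilinear slot.
  let q : S.L2 := -((S.omega : ℂ) ^ 2) • S.wt S.mu (ξ : S.L2) - (S.omega : ℂ) • S.wt S.mu ψ
  let g : FaceData d := (fun F => ((-(Complex.I * S.omega)) * S.gam F) • S.bdryTrace ξ F) +
    fun F => ((√S.omega : ℝ) * S.gam F : ℂ) • Ψ F
  have hid : ∀ (p : ℕ) (e : S.H1), inner ℂ (S.flux ξ) (S.dgrad p e) + inner ℂ q (e : S.L2) -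
      S.robinForm (fun _ => 1) (S.bdryTrace e) g = S.bz p e ξ -
      ((S.omega : ℂ) * S.massForm S.mu e ψ +
        ((√S.omega : ℝ) : ℂ) * S.robinForm S.gam (S.bdryTrace e) Ψ) := by
    intro p e
    simp only [q, g]
    rw [robinForm_add_right, robinForm_one_smul, robinForm_one_smul, ← stiffForm_eq_inner_flux,
      inner_sub_left, inner_smul_left, inner_smul_left, S.inner_wt, S.inner_wt, bz,
      dgrad_eq_grad hd hξ]
    simp only [map_mul, map_neg, map_pow, Complex.conj_ofReal, Complex.conj_I, S.massForm_eq_inner]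
    ring
  have hN : S.IsNormalTrace (S.flux ξ) q g := by
    intro w hw
    have h' := hid 0 w
    rw [← b_eq hd hw hξ, h w hw, sub_self, sub_eq_zero, dgrad_eq_grad hd hw] at h'
    exact h'
  exact ⟨hN.mem_XN hd, fun p e => (ibp_eq hd hN e).trans (hid p e)⟩

/-! ## The duality argument -/

section Estimates

variable {s : S.SesqForm} {f : S.L2} {u uh : S.H1}

theorem bh_sub_left (hd : d ≠ 0) (φ φ' v : S.H1) :
    S.bh p s (φ - φ') v = S.bh p s φ v - S.bh p s φ' v := by
  have h : φ - φ' = φ + (-1 : ℂ) • φ' := by rw [neg_one_smul, sub_eq_add_neg]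
  rw [bh_eq, bh_eq, bh_eq, map_sub, LinearMap.sub_apply, h, bz_add_left hd, bz_smul_left hd]
  ring

theorem bh_sub_right (hd : d ≠ 0) (φ v v' : S.H1) :
    S.bh p s φ (v - v') = S.bh p s φ v - S.bh p s φ v' := by
  have h : v - v' = v + (-1 : ℂ) • v' := by rw [neg_one_smul, sub_eq_add_neg]
  rw [bh_eq, bh_eq, bh_eq, map_sub, h, bz_add_right hd, bz_smul_right hd]
  simp only [map_neg, map_one]
  ring

theorem bh_eq_bz_left (hs : S.IsStabilization s) {φ : S.H1} (hφ : φ ∈ S.H1D) (v : S.H1) :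
    S.bh p s φ v = S.bz p φ v := by rw [bh_eq, hs φ v (Or.inl hφ), add_zero]

theorem bh_eq_bz_right (hs : S.IsStabilization s) (φ : S.H1) {v : S.H1} (hv : v ∈ S.H1D) :
    S.bh p s φ v = S.bz p φ v := by rw [bh_eq, hs φ v (Or.inr hv), add_zero]

/-- Galerkin orthogonality on the Lagrange space. -/
theorem galerkin (hd : d ≠ 0) (hs : S.IsStabilization s) (hu : S.IsSolution f u)
    (huh : S.IsDiscreteSolution p s f uh) {v : S.H1} (hv : v ∈ S.Lagrange p) :
    S.bh p s (u - uh) v = 0 := by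
  rw [bh_sub_left hd, huh.2 v hv.1, bh_eq_bz_left hs hu.1, ← b_eq hd hu.1 hv.2, hu.2 v hv.2, sub_self]

/-- The dual equation in mixed form writes the datum tested with the error as a value of the form
minus a defect. Galerkin orthogonality subtracts the Lagrange projection from `ξ` in the form, and
the defect is a product of two distances. Both data are kept so that one proof serves volume and
boundary. -/
theorem dual_estimate (hd : 2 ≤ d) (hs : S.IsStabilization s) (hu : S.IsSolution f u)
    (huh : S.IsDiscreteSolution p s f uh) {ψ : S.L2} {Ψ : FaceData d} {ξ : S.H1} (hξ : ξ ∈ S.H1D)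
    (h : ∀ w ∈ S.H1D, S.b w ξ = (S.omega : ℂ) * S.massForm S.mu w ψ +
      ((√S.omega : ℝ) : ℂ) * S.robinForm S.gam (S.bdryTrace w) Ψ) :
    ‖(S.omega : ℂ) * S.massForm S.mu (u - uh : S.H1) ψ +
      ((√S.omega : ℝ) : ℂ) * S.robinForm S.gam (S.bdryTrace (u - uh)) Ψ‖ ≤
      S.brokenNorm p (u - uh) * S.errG p ξ + S.dagNorm p (uh - S.projG p uh) * S.errD p ξ := by
  have hd0 : d ≠ 0 := by omega
  obtain ⟨hX, hibp⟩ := exists_ibp_dual hd0 hξ h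
  have hπ := projhG_mem (p := p) hd0 ξ
  have hξπ : ξ - S.projhG p ξ ∈ S.H1D := (S.H1Dsub hd0).sub_mem hξ hπ.2
  have h1 : S.bz p (u - uh) ξ = S.bz p (u - uh) (ξ - S.projhG p ξ) := by
    rw [← bh_eq_bz_right hs _ hξ, ← bh_eq_bz_right hs _ hξπ, bh_sub_right hd0,
      galerkin hd0 hs hu huh hπ, sub_zero]
  -- The exact solution is conforming and drops out: only the discrete one creates a defect.
  have h2 : S.ibp p (S.flux ξ) (u - uh) = -S.ibp p (S.flux ξ) uh := by
    rw [ibp_sub_right hd0, ibp_eq_zero_of_mem_H1D hd0 hX hu.1, zero_sub]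
  have h3 : (S.omega : ℂ) * S.massForm S.mu (u - uh : S.H1) ψ +
      ((√S.omega : ℝ) : ℂ) * S.robinForm S.gam (S.bdryTrace (u - uh)) Ψ =
      S.bz p (u - uh) (ξ - S.projhG p ξ) + S.ibp p (S.flux ξ) uh := by
    have := hibp p (u - uh)
    rw [h2, h1] at this
    rw [← sub_eq_iff_eq_add.2 (sub_eq_iff_eq_add'.1 this.symm), sub_neg_eq_add]
  rw [h3]
  refine (norm_add_le _ _).trans (add_le_add ?_ ?_)
  · refine (norm_bz_le hd0 _ _).trans (mul_le_mul_of_nonneg_left ?_ (Real.sqrt_nonneg _))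
    exact brokenNorm_le_dagNorm hd _
  · rw [mul_comm]
    exact norm_ibp_le_dist hd hX (projhD_mem hd0 hX) uh (projG_mem hd0 uh)

end Estimates

end Setting

/-! ## Scalar inequalities -/

/-- Finiteness of the factor forces both suprema to be finite, so that estimates can continue with
real numbers. -/
theorem approxFactor_toReal {a b : ℝ≥0∞}
    (h : (4 * a ^ 2 + 2 * b ^ 2) ^ (1 / 2 : ℝ) ≠ ⊤) :
    a ≠ ⊤ ∧ b ≠ ⊤ ∧ ((4 * a ^ 2 + 2 * b ^ 2) ^ (1 / 2 : ℝ)).toReal ^ 2 =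
      4 * a.toReal ^ 2 + 2 * b.toReal ^ 2 := by
  have h' : 4 * a ^ 2 + 2 * b ^ 2 ≠ ⊤ := fun h0 => h (by
    rw [h0]
    exact ENNReal.top_rpow_of_pos (by norm_num))
  have ha : a ≠ ⊤ := by
    rintro rfl
    exact h' (by simp)
  have hb : b ≠ ⊤ := by
    rintro rfl
    exact h' (by simp)
  refine ⟨ha, hb, ?_⟩
  rw [← ENNReal.toReal_rpow, ← Real.sqrt_eq_rpow, Real.sq_sqrt ENNReal.toReal_nonneg,
    ENNReal.toReal_add (ENNReal.mul_ne_top (by simp) (ENNReal.pow_ne_top ha))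
      (ENNReal.mul_ne_top (by simp) (ENNReal.pow_ne_top hb)), ENNReal.toReal_mul,
    ENNReal.toReal_mul, ENNReal.toReal_pow, ENNReal.toReal_pow]
  simp

theorem sq_toReal_lt_one {a : ℝ≥0∞} (h : a < 1) : a.toReal ^ 2 < 1 := by
  have := (ENNReal.toReal_lt_toReal h.ne_top ENNReal.one_ne_top).2 h
  rw [ENNReal.toReal_one] at this
  exact pow_lt_one₀ ENNReal.toReal_nonneg this two_ne_zero

theorem ne_top_of_sqrt_two_mul_le {a : ℝ≥0∞} {ρ : ℝ}
    (h : ENNReal.ofReal (√2) * a ≤ ENNReal.ofReal ρ) : a ≠ ⊤ := by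
  rintro rfl
  rw [ENNReal.mul_top (by simp)] at h
  exact ENNReal.ofReal_ne_top (top_le_iff.1 h)

theorem two_mul_sq_le_of_sqrt_two_mul_le {a : ℝ≥0∞} {ρ : ℝ} (hρ : 0 < ρ)
    (h : ENNReal.ofReal (√2) * a ≤ ENNReal.ofReal ρ) : 2 * a.toReal ^ 2 ≤ ρ ^ 2 := by
  have h1 := ENNReal.toReal_mono ENNReal.ofReal_ne_top h
  rw [ENNReal.toReal_mul, ENNReal.toReal_ofReal (Real.sqrt_nonneg 2),
    ENNReal.toReal_ofReal hρ.le] at h1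
  have h2 := pow_le_pow_left₀ (mul_nonneg (Real.sqrt_nonneg 2) ENNReal.toReal_nonneg) h1 2
  rwa [mul_pow, Real.sq_sqrt zero_le_two] at h2

theorem two_mul_sq_lt_of_sqrt_two_mul_lt {a : ℝ≥0∞} {ρ : ℝ} (hρ : 0 < ρ)
    (h : ENNReal.ofReal (√2) * a < ENNReal.ofReal ρ) : 2 * a.toReal ^ 2 < ρ ^ 2 := by
  have h1 := (ENNReal.toReal_lt_toReal h.ne_top ENNReal.ofReal_ne_top).2 h
  rw [ENNReal.toReal_mul, ENNReal.toReal_ofReal (Real.sqrt_nonneg 2),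
    ENNReal.toReal_ofReal hρ.le] at h1
  have h2 := pow_lt_pow_left₀ h1 (mul_nonneg (Real.sqrt_nonneg 2) ENNReal.toReal_nonneg)
    two_ne_zero
  rwa [mul_pow, Real.sq_sqrt zero_le_two] at h2

section Young

variable {δ ρ g X Y a b : ℝ}

/-- Young's inequality absorbs half of `δ X²` and the amount `ρ²/2` of `Y²`. What remains in front
of `Y²` is `ρ²/2 - g`, nonnegative by `hg`, and is dropped. -/
theorem error_le_of_quadratic (hδ : 0 < δ) (hδ1 : δ ≤ 1) (hρ : 0 < ρ) (hg : 2 * g ≤ ρ ^ 2)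
    (h : δ * X ^ 2 + (ρ ^ 2 - g) * Y ^ 2 ≤ X * a + Y * b) :
    X ≤ 1 / δ * √(a ^ 2 + 1 / ρ ^ 2 * b ^ 2) := by
  have hρ2 : 0 < ρ ^ 2 := pow_pos hρ 2
  have e1 : X * a ≤ δ / 2 * X ^ 2 + a ^ 2 / (2 * δ) := by
    have : 0 ≤ (δ * X - a) ^ 2 / (2 * δ) := by positivity
    have e : (δ * X - a) ^ 2 / (2 * δ) = δ / 2 * X ^ 2 + a ^ 2 / (2 * δ) - X * a := by
      field_simp
      ring
    linarith
  have e2 : Y * b ≤ ρ ^ 2 / 2 * Y ^ 2 + b ^ 2 / (2 * ρ ^ 2) := by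
    have : 0 ≤ (ρ ^ 2 * Y - b) ^ 2 / (2 * ρ ^ 2) := by positivity
    have e : (ρ ^ 2 * Y - b) ^ 2 / (2 * ρ ^ 2) =
        ρ ^ 2 / 2 * Y ^ 2 + b ^ 2 / (2 * ρ ^ 2) - Y * b := by
      field_simp
      ring
    linarith
  have e3 : 0 ≤ (ρ ^ 2 - 2 * g) * Y ^ 2 := mul_nonneg (by linarith) (sq_nonneg _)
  have e4 : δ * X ^ 2 ≤ a ^ 2 / δ + b ^ 2 / ρ ^ 2 := by
    have f1 : a ^ 2 / δ = 2 * (a ^ 2 / (2 * δ)) := by field_simp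
    have f2 : b ^ 2 / ρ ^ 2 = 2 * (b ^ 2 / (2 * ρ ^ 2)) := by field_simp
    rw [f1, f2]
    nlinarith
  -- Only the `a` term carries `1/δ` naturally; `δ ≤ 1` allows the same factor on both, for a common
  -- right-hand side.
  have e5 : b ^ 2 / ρ ^ 2 ≤ b ^ 2 / ρ ^ 2 / δ := le_div_self (by positivity) hδ hδ1
  have e6 : (δ * X) ^ 2 ≤ a ^ 2 + 1 / ρ ^ 2 * b ^ 2 := by
    have : δ * (δ * X ^ 2) ≤ δ * (a ^ 2 / δ + b ^ 2 / ρ ^ 2 / δ) :=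
      mul_le_mul_of_nonneg_left (by linarith) hδ.le
    have e : δ * (a ^ 2 / δ + b ^ 2 / ρ ^ 2 / δ) = a ^ 2 + 1 / ρ ^ 2 * b ^ 2 := by field_simp
    nlinarith
  rw [one_div, inv_mul_eq_div, le_div_iff₀ hδ, mul_comm]
  exact Real.le_sqrt_of_sq_le e6

/-- Now all of `δ X²` is given up and the remainder `ρ²/2 - g` is kept, which is positive by the
strict inequality. -/
theorem nonconformity_le_of_quadratic (hδ : 0 < δ) (hδ1 : δ ≤ 1) (hρ : 0 < ρ) (hg : 2 * g < ρ ^ 2)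
    (h : δ * X ^ 2 + (ρ ^ 2 - g) * Y ^ 2 ≤ X * a + Y * b) :
    Y ≤ √(1 / (δ * (ρ ^ 2 - 2 * g))) * √(a ^ 2 + 1 / ρ ^ 2 * b ^ 2) := by
  have hρ2 : 0 < ρ ^ 2 := pow_pos hρ 2
  have hκ : 0 < ρ ^ 2 - 2 * g := by linarith
  have e1 : X * a ≤ δ * X ^ 2 + a ^ 2 / (2 * δ) := by
    have : 0 ≤ (δ * X - a) ^ 2 / (2 * δ) := by positivity
    have e : (δ * X - a) ^ 2 / (2 * δ) = δ / 2 * X ^ 2 + a ^ 2 / (2 * δ) - X * a := by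
      field_simp
      ring
    have : 0 ≤ δ * X ^ 2 := by positivity
    linarith
  have e2 : Y * b ≤ ρ ^ 2 / 2 * Y ^ 2 + b ^ 2 / (2 * ρ ^ 2) := by
    have : 0 ≤ (ρ ^ 2 * Y - b) ^ 2 / (2 * ρ ^ 2) := by positivity
    have e : (ρ ^ 2 * Y - b) ^ 2 / (2 * ρ ^ 2) =
        ρ ^ 2 / 2 * Y ^ 2 + b ^ 2 / (2 * ρ ^ 2) - Y * b := by
      field_simp
      ring
    linarith
  have e4 : (ρ ^ 2 - 2 * g) * Y ^ 2 ≤ a ^ 2 / δ + b ^ 2 / ρ ^ 2 := by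
    have f1 : a ^ 2 / δ = 2 * (a ^ 2 / (2 * δ)) := by field_simp
    have f2 : b ^ 2 / ρ ^ 2 = 2 * (b ^ 2 / (2 * ρ ^ 2)) := by field_simp
    rw [f1, f2]
    nlinarith
  have e5 : b ^ 2 / ρ ^ 2 ≤ b ^ 2 / ρ ^ 2 / δ := le_div_self (by positivity) hδ hδ1
  rw [← Real.sqrt_mul (by positivity)]
  refine Real.le_sqrt_of_sq_le ?_
  rw [one_div, inv_mul_eq_div, le_div_iff₀ (mul_pos hδ hκ)]
  have : δ * ((ρ ^ 2 - 2 * g) * Y ^ 2) ≤ δ * (a ^ 2 / δ + b ^ 2 / ρ ^ 2 / δ) :=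
    mul_le_mul_of_nonneg_left (by linarith) hδ.le
  have e : δ * (a ^ 2 / δ + b ^ 2 / ρ ^ 2 / δ) = a ^ 2 + 1 / ρ ^ 2 * b ^ 2 := by field_simp
  nlinarith

end Young

/-- The factor 2 of this elementary bound is the source of the coefficients 4 and 2 in the
approximation factors. -/
theorem sq_le_of_le_mul_add {t X Y a b : ℝ} (ht : 0 ≤ t) (h : t ≤ X * a + Y * b) :
    t ^ 2 ≤ 2 * (X ^ 2 * a ^ 2 + Y ^ 2 * b ^ 2) := by
  have := pow_le_pow_left₀ ht h 2
  nlinarith [sq_nonneg (X * a - Y * b)]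

namespace Setting

variable {d p : ℕ} {S : Setting d}

/-! ## Bounds by the approximation factors -/

theorem brokenNorm_nonneg (v : S.H1) : 0 ≤ S.brokenNorm p v := Real.sqrt_nonneg _

theorem dagNorm_nonneg (v : S.H1) : 0 ≤ S.dagNorm p v := Real.sqrt_nonneg _

theorem le_toReal_supVol {err : S.H1 → ℝ} (h : S.supVol err ≠ ⊤) {ψ : S.L2} {ξ : S.H1}
    (hψ : √(S.massForm S.mu ψ ψ).re = 1) (hξ : S.IsDualVol ψ ξ) : err ξ ≤ (S.supVol err).toReal :=
  (ENNReal.ofReal_le_iff_le_toReal h).1 (le_iSup₂_of_le ψ ξ (le_iSup₂_of_le hψ hξ le_rfl))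

theorem le_toReal_supBdry {err : S.H1 → ℝ} (h : S.supBdry err ≠ ⊤) {Ψ : FaceData d} {ξ : S.H1}
    (hΨ : √(S.robinForm S.gam Ψ Ψ).re = 1) (hξ : S.IsDualBdry Ψ ξ) :
    err ξ ≤ (S.supBdry err).toReal :=
  (ENNReal.ofReal_le_iff_le_toReal h).1 (le_iSup₂_of_le Ψ ξ (le_iSup₂_of_le hΨ hξ le_rfl))

theorem massForm_smul_right (c : Finset (E d) → ℝ) (a : ℂ) (φ v : S.L2) :
    S.massForm c φ (a • v) = conj a * S.massForm c φ v := by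
  rw [S.massForm_eq_inner, S.massForm_eq_inner, inner_smul_left]

theorem massForm_smul_left (c : Finset (E d) → ℝ) (a : ℂ) (φ v : S.L2) :
    S.massForm c (a • φ) v = a * S.massForm c φ v := by
  rw [S.massForm_eq_inner, S.massForm_eq_inner, map_smul, inner_smul_right]

theorem robinForm_smul_right (c : Finset (E d) → ℝ) (a : ℂ) (φ v : FaceData d) :
    S.robinForm c φ (a • v) = conj a * S.robinForm c φ v := by
  rw [robinForm_eq_inner, robinForm_eq_inner, Finset.mul_sum]
  refine Finset.sum_congr rfl fun F _ => ?_
  rw [Pi.smul_apply, inner_smul_left]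
  ring

theorem robinForm_smul_left (c : Finset (E d) → ℝ) (a : ℂ) (φ v : FaceData d) :
    S.robinForm c (a • φ) v = a * S.robinForm c φ v := by
  rw [robinForm_eq_inner, robinForm_eq_inner, Finset.mul_sum]
  refine Finset.sum_congr rfl fun F _ => ?_
  rw [Pi.smul_apply, inner_smul_right]
  ring

theorem massForm_self_im (c : Finset (E d) → ℝ) (v : S.L2) : (S.massForm c v v).im = 0 := by
  rw [← Complex.conj_eq_iff_im, S.massForm_eq_inner, inner_conj_symm, S.inner_wt]

theorem robinForm_self_im (c : Finset (E d) → ℝ) (v : FaceData d) : (S.robinForm c v v).im = 0 := by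
  rw [← Complex.conj_eq_iff_im, robinForm_conj]

/-- The normalization identity behind duality arguments: for a Hermitian form `B` and `N = √B(e,e)`,
`B(e/N, e/N) = 1` and `B(e, e/N) = N`. -/
theorem normalize_aux {B : ℂ} (hB : B.im = 0) (hpos : 0 < √B.re) :
    √((((√B.re)⁻¹ : ℝ) : ℂ) * (conj (((√B.re)⁻¹ : ℝ) : ℂ) * B)).re = 1 ∧
      conj (((√B.re)⁻¹ : ℝ) : ℂ) * B = ((√B.re : ℝ) : ℂ) := by
  have hB' : B = ((√B.re * √B.re : ℝ) : ℂ) := by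
    rw [Real.mul_self_sqrt (Real.sqrt_pos.1 hpos).le]
    exact Complex.ext rfl hB
  have h2 : conj (((√B.re)⁻¹ : ℝ) : ℂ) * B = ((√B.re : ℝ) : ℂ) := by
    rw [Complex.conj_ofReal]
    have h : (√B.re)⁻¹ * (√B.re * √B.re) = √B.re := inv_mul_cancel_left₀ hpos.ne' _
    calc (((√B.re)⁻¹ : ℝ) : ℂ) * B = (((√B.re)⁻¹ : ℝ) : ℂ) * ((√B.re * √B.re : ℝ) : ℂ) :=
          congrArg _ hB'
      _ = ((√B.re : ℝ) : ℂ) := by rw [← Complex.ofReal_mul, h]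
  refine ⟨?_, h2⟩
  rw [h2, ← Complex.ofReal_mul, Complex.ofReal_re, inv_mul_cancel₀ hpos.ne', Real.sqrt_one]

section Estimates

variable {s : S.SesqForm} {f : S.L2} {u uh : S.H1}

/-- Duality with the normalized error as datum: tested against it, the error gives its own norm. A
vanishing error needs no datum. -/
theorem volume_error_le (hd : 2 ≤ d) (hwp : S.WellPosed) (hs : S.IsStabilization s)
    (hu : S.IsSolution f u) (huh : S.IsDiscreteSolution p s f uh)
    (hG : S.supVol (S.errG p) ≠ ⊤) (hD : S.supVol (S.errD p) ≠ ⊤) :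
    S.omega * √(S.massForm S.mu (u - uh : S.H1) (u - uh : S.H1)).re ≤
      S.brokenNorm p (u - uh) * (S.supVol (S.errG p)).toReal +
        S.dagNorm p (uh - S.projG p uh) * (S.supVol (S.errD p)).toReal := by
  have hd0 : d ≠ 0 := by omega
  set N := √(S.massForm S.mu (u - uh : S.H1) (u - uh : S.H1)).re with hN
  rcases (Real.sqrt_nonneg _ : 0 ≤ N).eq_or_lt with h0 | hpos
  · rw [hN.trans h0.symm, mul_zero]
    exact add_nonneg (mul_nonneg (brokenNorm_nonneg _) ENNReal.toReal_nonneg)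
      (mul_nonneg (dagNorm_nonneg _) ENNReal.toReal_nonneg)
  obtain ⟨hn1, hn2⟩ := normalize_aux (massForm_self_im S.mu _) hpos
  rw [← hN] at hn1 hn2
  set ψ : S.L2 := ((N⁻¹ : ℝ) : ℂ) • ((u - uh : S.H1) : S.L2) with hψ
  have h1 : √(S.massForm S.mu ψ ψ).re = 1 := by
    rw [hψ, massForm_smul_left, massForm_smul_right, hn1]
  obtain ⟨ξ, hξ⟩ := exists_isDualVol hd0 hwp ψ
  have hr0 : ∀ φ : FaceData d, S.robinForm S.gam φ 0 = 0 := fun φ => by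
    rw [← zero_smul ℂ (0 : FaceData d), robinForm_smul_right, map_zero, zero_mul]
  have h := dual_estimate (p := p) hd hs hu huh (ψ := ψ) (Ψ := 0) hξ.1 fun w hw => by
    rw [hξ.2 w hw, hr0, mul_zero, add_zero]
  rw [hr0, mul_zero, add_zero, hψ, massForm_smul_right, hn2, ← Complex.ofReal_mul,
    Complex.norm_real, Real.norm_of_nonneg (mul_nonneg S.omega_pos.le hpos.le)] at h
  exact h.trans (add_le_add
    (mul_le_mul_of_nonneg_left (le_toReal_supVol hG h1 hξ) (brokenNorm_nonneg _))
    (mul_le_mul_of_nonneg_left (le_toReal_supVol hD h1 hξ) (dagNorm_nonneg _)))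

/-- Same argument with the normalized boundary trace of the error as Robin datum. -/
theorem boundary_error_le (hd : 2 ≤ d) (hwp : S.WellPosed) (hs : S.IsStabilization s)
    (hu : S.IsSolution f u) (huh : S.IsDiscreteSolution p s f uh)
    (hG : S.supBdry (S.errG p) ≠ ⊤) (hD : S.supBdry (S.errD p) ≠ ⊤) :
    √S.omega * √(S.robinForm S.gam (S.bdryTrace (u - uh)) (S.bdryTrace (u - uh))).re ≤
      S.brokenNorm p (u - uh) * (S.supBdry (S.errG p)).toReal +
        S.dagNorm p (uh - S.projG p uh) * (S.supBdry (S.errD p)).toReal := by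
  have hd0 : d ≠ 0 := by omega
  set N := √(S.robinForm S.gam (S.bdryTrace (u - uh)) (S.bdryTrace (u - uh))).re with hN
  rcases (Real.sqrt_nonneg _ : 0 ≤ N).eq_or_lt with h0 | hpos
  · rw [hN.trans h0.symm, mul_zero]
    exact add_nonneg (mul_nonneg (brokenNorm_nonneg _) ENNReal.toReal_nonneg)
      (mul_nonneg (dagNorm_nonneg _) ENNReal.toReal_nonneg)
  obtain ⟨hn1, hn2⟩ := normalize_aux (robinForm_self_im S.gam _) hpos
  rw [← hN] at hn1 hn2
  set Ψ : FaceData d := ((N⁻¹ : ℝ) : ℂ) • S.bdryTrace (u - uh) with hΨ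
  have h1 : √(S.robinForm S.gam Ψ Ψ).re = 1 := by
    rw [hΨ, robinForm_smul_left, robinForm_smul_right, hn1]
  obtain ⟨ξ, hξ⟩ := exists_isDualBdry hd0 hwp Ψ
  have hm0 : ∀ φ : S.L2, S.massForm S.mu φ 0 = 0 := fun φ => by
    rw [S.massForm_eq_inner, inner_zero_left]
  have h := dual_estimate (p := p) hd hs hu huh (ψ := 0) (Ψ := Ψ) hξ.1 fun w hw => by
    rw [hξ.2 w hw, hm0, mul_zero, zero_add]
  rw [hm0, mul_zero, zero_add, hΨ, robinForm_smul_right, hn2, ← Complex.ofReal_mul,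
    Complex.norm_real,
    Real.norm_of_nonneg (mul_nonneg (Real.sqrt_nonneg _) hpos.le)] at h
  exact h.trans (add_le_add
    (mul_le_mul_of_nonneg_left (le_toReal_supBdry hG h1 hξ) (brokenNorm_nonneg _))
    (mul_le_mul_of_nonneg_left (le_toReal_supBdry hD h1 hξ) (dagNorm_nonneg _)))

theorem massForm_mu_re_nonneg (v : S.L2) : 0 ≤ (S.massForm S.mu v v).re := by
  rw [S.massForm_eq_inner_inner (r := fun K => √(S.mu K))
    fun K hK => Real.mul_self_sqrt (S.mu_pos K hK).le]
  exact inner_self_nonneg (𝕜 := ℂ)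

theorem robinForm_gam_re_nonneg (v : FaceData d) : 0 ≤ (S.robinForm S.gam v v).re := by
  rw [robinForm_eq_inner, Complex.re_sum]
  refine Finset.sum_nonneg fun F hF => ?_
  rw [Complex.re_ofReal_mul]
  exact mul_nonneg (S.gam_pos F hF).le (inner_self_nonneg (𝕜 := ℂ))

/-- The lower-order terms of the error are controlled by the approximation factors. -/
theorem lower_order_le (hd : 2 ≤ d) (hwp : S.WellPosed) (hs : S.IsStabilization s)
    (hu : S.IsSolution f u) (huh : S.IsDiscreteSolution p s f uh)
    (hG : S.gbaG p ≠ ⊤) (hD : S.gbaD p ≠ ⊤) :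
    2 * S.omega ^ 2 * (S.massForm S.mu (u - uh : S.H1) (u - uh : S.H1)).re +
      S.omega * (S.robinForm S.gam (S.bdryTrace (u - uh)) (S.bdryTrace (u - uh))).re ≤
      (S.gbaG p).toReal ^ 2 * S.brokenNorm p (u - uh) ^ 2 +
        (S.gbaD p).toReal ^ 2 * S.dagNorm p (uh - S.projG p uh) ^ 2 := by
  obtain ⟨g1, g2, hg⟩ := approxFactor_toReal hG
  obtain ⟨k1, k2, hk⟩ := approxFactor_toReal hD
  have h1 := sq_le_of_le_mul_add (mul_nonneg S.omega_pos.le (Real.sqrt_nonneg _))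
    (volume_error_le hd hwp hs hu huh g1 k1)
  have h2 := sq_le_of_le_mul_add (mul_nonneg (Real.sqrt_nonneg _) (Real.sqrt_nonneg _))
    (boundary_error_le hd hwp hs hu huh g2 k2)
  rw [mul_pow, Real.sq_sqrt (massForm_mu_re_nonneg _)] at h1
  rw [mul_pow, Real.sq_sqrt (robinForm_gam_re_nonneg _), Real.sq_sqrt S.omega_pos.le] at h2
  rw [gbaG, gbaD, hg, hk]
  -- Twice the squared volume bound plus the squared boundary bound; each square already carries a
  -- factor 2, whence 4 and 2.
  nlinarith

/-- The Gårding identity for the discrete form. -/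
theorem bh_self_re (hd : d ≠ 0) (s : S.SesqForm) (e : S.H1) :
    (S.bh p s e e).re = S.brokenNorm p e ^ 2 + (s e e).re -
      (2 * S.omega ^ 2 * (S.massForm S.mu e e).re +
        S.omega * (S.robinForm S.gam (S.bdryTrace e) (S.bdryTrace e)).re) := by
  have hr : S.robinForm S.gam (S.bdryTrace e) (S.bdryTrace e) =
      (((S.robinForm S.gam (S.bdryTrace e) (S.bdryTrace e)).re : ℝ) : ℂ) :=
    Complex.ext rfl (robinForm_self_im _ _)
  have h1 : (-(S.omega : ℂ) ^ 2 * S.massForm S.mu e e).re =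
      -(S.omega ^ 2 * (S.massForm S.mu e e).re) := by
    rw [← Complex.ofReal_pow, ← Complex.ofReal_neg, Complex.re_ofReal_mul, neg_mul]
  have h2 : (Complex.I * (S.omega : ℂ) *
      S.robinForm S.gam (S.bdryTrace e) (S.bdryTrace e)).re = 0 := by
    rw [hr, mul_assoc, ← Complex.ofReal_mul, Complex.I_mul_re, Complex.ofReal_im, neg_zero]
  rw [brokenNorm_sq hd, bh_eq, bz, Complex.add_re, Complex.add_re, Complex.sub_re, h1, h2]
  ring

/-- The Gårding identity at the error: stabilization bounds the form from below, duality controls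
the lower-order terms, and consistency bounds the form from above. -/
theorem quadratic_estimate (hd : 2 ≤ d) (hwp : S.WellPosed) (hs : S.IsStabilization s)
    (hu : S.IsSolution f u) (huh : S.IsDiscreteSolution p s f uh) {ρ : ℝ}
    (hstab : ρ ^ 2 * S.dagNorm p (uh - S.projG p uh) ^ 2 ≤ (s uh uh).re)
    (hG : S.gbaG p ≠ ⊤) (hD : S.gbaD p ≠ ⊤) {vh : S.H1} (hvh : vh ∈ S.Lagrange p)
    {σh : S.L2V} (hσh : σh ∈ S.BDM p) :
    (1 - (S.gbaG p).toReal ^ 2) * S.brokenNorm p (u - uh) ^ 2 +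
      (ρ ^ 2 - (S.gbaD p).toReal ^ 2) * S.dagNorm p (uh - S.projG p uh) ^ 2 ≤
      S.brokenNorm p (u - uh) * S.energyNorm (u - vh) +
        S.dagNorm p (uh - S.projG p uh) * S.divNorm (S.flux u - σh) := by
  have hd0 : d ≠ 0 := by omega
  have hse : s (u - uh) (u - uh) = s uh uh := by
    rw [map_sub, hs (u - uh) u (Or.inr hu.1), zero_sub, map_sub, LinearMap.sub_apply,
      hs u uh (Or.inl hu.1), zero_sub, neg_neg]
  have huv : u - vh ∈ S.H1D := (S.H1Dsub hd0).sub_mem hu.1 hvh.2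
  obtain ⟨hX, hibp⟩ := exists_ibp_solution hd0 hu
  -- Orthogonality replaces one copy of `u - uh` by `u - vh` up to testing with `uh`. As `uh` is not
  -- a conforming test function, the latter residual is the defect of the exact flux.
  have hb : S.bh p s (u - uh) (u - uh) =
      S.bz p (u - uh) (u - vh) - conj (S.ibp p (S.flux u) uh) := by
    have h1 : S.bh p s (u - uh) (u - uh) =
        S.bh p s (u - uh) (u - vh) - S.bh p s (u - uh) uh := by
      rw [bh_sub_right hd0, bh_sub_right hd0 _ u vh, galerkin hd0 hs hu huh hvh, sub_zero]
    rw [h1, bh_eq_bz_right hs _ huv, bh_sub_left hd0, huh.2 uh huh.1, bh_eq_bz_left hs hu.1,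
      hibp p uh, Complex.conj_conj]
  have hle : (S.bh p s (u - uh) (u - uh)).re ≤
      S.brokenNorm p (u - uh) * S.energyNorm (u - vh) +
        S.dagNorm p (uh - S.projG p uh) * S.divNorm (S.flux u - σh) := by
    refine (Complex.re_le_norm _).trans ?_
    rw [hb]
    refine (norm_sub_le _ _).trans (add_le_add ?_ ?_)
    · rw [energyNorm_eq (p := p) hd0 huv]
      exact norm_bz_le hd0 _ _
    · rw [RCLike.norm_conj, mul_comm]
      exact norm_ibp_le_dist hd hX hσh uh (projG_mem hd0 uh)
  have h3 := lower_order_le hd hwp hs hu huh hG hD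
  have h4 := bh_self_re (p := p) hd0 s (u - uh)
  rw [hse] at h4
  linarith

theorem zero_mem_Lagrange (hd : d ≠ 0) : (0 : S.H1) ∈ S.Lagrange p :=
  ⟨S.mem_polySub.1 (S.polySub p).zero_mem, (S.H1Dsub hd).zero_mem⟩

theorem zero_mem_BDM : (0 : S.L2V) ∈ S.BDM p :=
  ⟨S.mem_polyVSub.1 (S.polyVSub p).zero_mem, S.XNsub.zero_mem⟩

theorem error_quadratic (hd : 2 ≤ d) (hwp : S.WellPosed) (hs : S.IsStabilization s)
    (hu : S.IsSolution f u) (huh : S.IsDiscreteSolution p s f uh) {ρ : ℝ}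
    (hstab : ρ ^ 2 * S.dagNorm p (uh - S.projG p uh) ^ 2 ≤ (s uh uh).re)
    (hG : S.gbaG p ≠ ⊤) (hD : S.gbaD p ≠ ⊤) :
    (1 - (S.gbaG p).toReal ^ 2) * S.brokenNorm p (u - uh) ^ 2 +
      (ρ ^ 2 - (S.gbaD p).toReal ^ 2) * S.dagNorm p (uh - S.projG p uh) ^ 2 ≤
      S.brokenNorm p (u - uh) * S.bestG p u + S.dagNorm p (uh - S.projG p uh) * S.bestD p u := by
  have : Nonempty (S.Lagrange p) := ⟨⟨0, zero_mem_Lagrange (by omega)⟩⟩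
  have : Nonempty (S.BDM p) := ⟨⟨0, zero_mem_BDM⟩⟩
  -- The left side does not involve the approximants, so the two infima may be taken one after the
  -- other; their nonnegative coefficients pass inside.
  rw [bestG, bestD, Real.mul_iInf_of_nonneg (brokenNorm_nonneg _),
    Real.mul_iInf_of_nonneg (dagNorm_nonneg _)]
  refine sub_le_iff_le_add.1 (le_ciInf fun vh => ?_)
  rw [sub_le_iff_le_add, ← sub_le_iff_le_add']
  refine le_ciInf fun σh => ?_
  rw [sub_le_iff_le_add']
  exact quadratic_estimate hd hwp hs hu huh hstab hG hD vh.2 σh.2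

end Estimates

/-! ## Unique solvability of the discrete problem -/

theorem eq_zero_of_brokenNorm_eq_zero (hd : d ≠ 0) {v : S.H1} (h : S.brokenNorm p v = 0) :
    v = 0 := by
  rw [brokenNorm_eq hd, norm_eq_zero, emb_apply] at h
  have h1 : S.wt S.wtE (v : S.L2) = 0 := by
    -- Pairing with the vector that has only the first component isolates the mass term; its
    -- positive weight is then inverted.
    have := S.inner_mkEH (S.wt S.wtE (v : S.L2)) (S.wt S.wtE (v : S.L2)) 0
      (S.mat S.sqrtA (S.dgrad p v)) 0 (fun F => (S.wtEF F : ℂ) • S.bdryTrace v F)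
    rw [h] at this
    simpa using this.symm
  have h2 : S.wt (fun K => (S.wtE K)⁻¹) (S.wt S.wtE (v : S.L2)) = v := by
    rw [S.wt_wt]
    exact S.wt_eq_self (fun K hK => inv_mul_cancel₀ (wtE_pos hK).ne') _
  rw [h1, map_zero] at h2
  exact Subtype.ext h2.symm

variable {s : S.SesqForm}

/-- With zero data the exact solution is 0, and zero approximants make the right-hand side of the
quadratic estimate vanish. The coefficient of the nonconformity is nonnegative, so the broken norm
is zero. -/
theorem discrete_eq_zero (hd : 2 ≤ d) (hwp : S.WellPosed) (hs : S.IsStabilization s)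
    {uh : S.H1} (huh : S.IsDiscreteSolution p s 0 uh) {ρ : ℝ} (hρ : 0 < ρ)
    (hstab : ρ ^ 2 * S.dagNorm p (uh - S.projG p uh) ^ 2 ≤ (s uh uh).re)
    (hg : S.gbaG p < 1) (hdiv : ENNReal.ofReal (√2) * S.gbaD p ≤ ENNReal.ofReal ρ) : uh = 0 := by
  have hd0 : d ≠ 0 := by omega
  have hu : S.IsSolution 0 0 := by
    refine ⟨(S.H1Dsub hd0).zero_mem, fun v hv => ?_⟩
    rw [b_eq (p := p) hd0 (S.H1Dsub hd0).zero_mem hv, ← zero_smul ℂ (0 : S.H1), bz_smul_left hd0,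
      zero_mul, inner_zero_right]
  have h := quadratic_estimate hd hwp hs hu huh hstab hg.ne_top (ne_top_of_sqrt_two_mul_le hdiv)
    (zero_mem_Lagrange hd0) zero_mem_BDM
  have hf : S.flux 0 = 0 := by
    have : S.grad 0 = 0 := by
      rw [← dgrad_eq_grad (p := p) hd0 (S.H1Dsub hd0).zero_mem, ← zero_smul ℂ (0 : S.H1),
        dgrad_smul hd0, zero_smul]
    rw [flux, this, Mesh.mulMat_eq, map_zero]
  have hdn : S.divNorm 0 = 0 := by
    have := divNorm_eq hd0 (0 : S.XNsub)
    rwa [map_zero, norm_zero] at this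
  have hen : S.energyNorm 0 = 0 := by
    rw [energyNorm_eq (p := p) hd0 (S.H1Dsub hd0).zero_mem, brokenNorm_eq hd0, map_zero, norm_zero]
  rw [hf, sub_zero, sub_zero, hdn, hen, mul_zero, mul_zero, add_zero] at h
  have h2 := two_mul_sq_le_of_sqrt_two_mul_le hρ hdiv
  have hg1 := sq_toReal_lt_one hg
  have h3 : 0 ≤ (ρ ^ 2 - (S.gbaD p).toReal ^ 2) * S.dagNorm p (uh - S.projG p uh) ^ 2 :=
    mul_nonneg (by nlinarith [sq_nonneg (S.gbaD p).toReal]) (sq_nonneg _)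
  have h4 : S.brokenNorm p (0 - uh) ^ 2 = 0 :=
    le_antisymm (nonpos_of_mul_nonpos_right (by linarith) (sub_pos.2 hg1)) (sq_nonneg _)
  have h5 := eq_zero_of_brokenNorm_eq_zero hd0 (pow_eq_zero_iff two_ne_zero |>.1 h4)
  rwa [zero_sub, neg_eq_zero] at h5

theorem IsDiscreteSolution.sub (hd : d ≠ 0) {f f' : S.L2} {uh uh' : S.H1}
    (h : S.IsDiscreteSolution p s f uh) (h' : S.IsDiscreteSolution p s f' uh') :
    S.IsDiscreteSolution p s (f - f') (uh - uh') := by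
  refine ⟨S.mem_polySub.1 ((S.polySub p).sub_mem (S.mem_polySub.2 h.1) (S.mem_polySub.2 h'.1)),
    fun v hv => ?_⟩
  rw [bh_sub_left hd, h.2 v hv, h'.2 v hv, inner_sub_right]

/-- A discrete problem whose homogeneous version has only the trivial solution is solvable. -/
theorem exists_discreteSolution (hd : d ≠ 0)
    (h0 : ∀ uh, S.IsDiscreteSolution p s 0 uh → uh = 0) (f : S.L2) :
    ∃ uh, S.IsDiscreteSolution p s f uh := by
  let b := Module.finBasis ℂ (S.polySub p)
  have hadd : ∀ φ φ' v : S.H1, S.bh p s (φ + φ') v = S.bh p s φ v + S.bh p s φ' v := fun φ φ' v => by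
    rw [bh_eq, bh_eq, bh_eq, bz_add_left hd, map_add, LinearMap.add_apply]
    ring
  have hsmul : ∀ (c : ℂ) (φ v : S.H1), S.bh p s (c • φ) v = c * S.bh p s φ v := fun c φ v => by
    rw [bh_eq, bh_eq, bz_smul_left hd, map_smul, LinearMap.smul_apply, smul_eq_mul, mul_add]
  -- Testing with a basis gives a square system. Testing with the basis suffices because the
  -- equation is antilinear in the test function.
  let T : S.polySub p →ₗ[ℂ] (Fin (Module.finrank ℂ (S.polySub p)) → ℂ) :=
    { toFun := fun v i => S.bh p s v (b i)
      map_add' := fun v w => funext fun i => hadd v w (b i)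
      map_smul' := fun c v => funext fun i => hsmul c v (b i) }
  have hext : ∀ (g : S.L2) (v : S.polySub p), (∀ i, T v i = inner ℂ ((b i : S.H1) : S.L2) g) →
      S.IsDiscreteSolution p s g v := by
    refine fun g v hv => ⟨S.mem_polySub.1 v.2, fun w hw => ?_⟩
    let l : S.polySub p →ₗ⋆[ℂ] ℂ :=
      { toFun := fun w => S.bh p s v w - inner ℂ ((w : S.H1) : S.L2) g
        map_add' := fun w w' => by
          rw [bh_eq, bh_eq, bh_eq, Submodule.coe_add, bz_add_right hd, map_add, Submodule.coe_add,
            inner_add_left]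
          ring
        map_smul' := fun c w => by
          rw [bh_eq, bh_eq, Submodule.coe_smul, bz_smul_right hd, map_smulₛₗ, Submodule.coe_smul,
            inner_smul_left, smul_eq_mul, smul_eq_mul]
          ring }
    have hl : l = 0 := b.ext fun i => sub_eq_zero.2 (hv i)
    have := LinearMap.congr_fun hl ⟨w, S.mem_polySub.2 hw⟩
    exact sub_eq_zero.1 this
  have hinj : Function.Injective T := by
    refine (injective_iff_map_eq_zero T).2 fun v hv => Subtype.ext (h0 v (hext 0 v fun i => ?_))
    rw [hv, inner_zero_right]
    rfl
  have hsurj : Function.Surjective T :=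
    (LinearMap.injective_iff_surjective_of_finrank_eq_finrank (by simp)).1 hinj
  obtain ⟨v, hv⟩ := hsurj fun i => inner ℂ ((b i : S.H1) : S.L2) f
  exact ⟨v, hext f v fun i => congrFun hv i⟩

end Setting

end IPDG

end

/-! ### The a priori estimate -/

theorem theorem4p2 (d : ℕ) (hd : d = 2 ∨ d = 3) (S : IPDG.Setting d) (hwp : S.WellPosed)
    (p : ℕ) (hp : 1 ≤ p) (s : S.SesqForm) (hs : S.IsStabilization s)
    (f : S.L2) (u : S.H1) (hu : S.IsSolution f u)
    (ρ : ℝ) (hρ : 0 < ρ)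
    (hstab : ∀ vh ∈ S.Poly p, ρ ^ 2 * S.dagNorm p (vh - S.projG p vh) ^ 2 ≤ (s vh vh).re)
    (hg : S.gbaG p < 1)
    (hdiv : ENNReal.ofReal (√2) * S.gbaD p ≤ ENNReal.ofReal ρ) :
    (∃! uh : S.H1, S.IsDiscreteSolution p s f uh) ∧
    ∀ uh : S.H1, S.IsDiscreteSolution p s f uh →
      S.brokenNorm p (u - uh) ≤
        1 / (1 - (S.gbaG p).toReal ^ 2) *
          √(S.bestG p u ^ 2 + 1 / ρ ^ 2 * S.bestD p u ^ 2) ∧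
      (ENNReal.ofReal (√2) * S.gbaD p < ENNReal.ofReal ρ →
        S.dagNorm p (uh - S.projG p uh) ≤
          √(1 / ((1 - (S.gbaG p).toReal ^ 2) * (ρ ^ 2 - 2 * (S.gbaD p).toReal ^ 2))) *
            √(S.bestG p u ^ 2 + 1 / ρ ^ 2 * S.bestD p u ^ 2)) := by
  have hd2 : 2 ≤ d := by omega
  have hd0 : d ≠ 0 := by omega
  have h0 : ∀ uh, S.IsDiscreteSolution p s 0 uh → uh = 0 := fun uh huh =>
    IPDG.Setting.discrete_eq_zero hd2 hwp hs huh hρ (hstab uh huh.1) hg hdiv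
  obtain ⟨uh, huh⟩ := IPDG.Setting.exists_discreteSolution hd0 h0 f
  refine ⟨⟨uh, huh, fun w hw => ?_⟩, fun uh huh => ?_⟩
  -- The difference of two solutions solves the problem with datum `f - f`.
  · refine sub_eq_zero.1 (h0 _ ?_)
    rw [← sub_self f]
    exact hw.sub hd0 huh
  have hg1 : (S.gbaG p).toReal ^ 2 < 1 := IPDG.sq_toReal_lt_one hg
  have hδ1 : 1 - (S.gbaG p).toReal ^ 2 ≤ 1 := sub_le_self _ (sq_nonneg _)
  have h := IPDG.Setting.error_quadratic hd2 hwp hs hu huh (hstab uh huh.1) hg.ne_top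
    (IPDG.ne_top_of_sqrt_two_mul_le hdiv)
  exact ⟨IPDG.error_le_of_quadratic (sub_pos.2 hg1) hδ1 hρ
      (IPDG.two_mul_sq_le_of_sqrt_two_mul_le hρ hdiv) h,
    fun hlt => IPDG.nonconformity_le_of_quadratic (sub_pos.2 hg1) hδ1 hρ
      (IPDG.two_mul_sq_lt_of_sqrt_two_mul_lt hρ hlt) h⟩
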